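/- Let $B$ be a compact Hausdorff space and let $\mathcal G\to B$ and $\mathcal H\to B$ be bundles of compact (Hausdorff) groups, i.e. locally trivial with fibre a fixed compact group, the trivializations being group isomorphisms on fibres. Assume that both have representation theoretic finite holonomy: every point of the covering $\widehat{\mathcal G}=\bigsqcup_b\widehat{\mathcal G_b}\to B$ of equivalence classes of irreducible representations of the fibres lies in a compact open subset of $\widehat{\mathcal G}$, and likewise for $\mathcal H$. Write $\mathcal G\times\mathcal H$ for $\mathcal G\times_B\mathcal H$. For a space $Y\to B$ with a continuous fibrewise action of $\mathcal G$ and $Y$ compact Hausdorff, $K^0_{\mathcal G}(Y)$ is the group completion of the monoid (under direct sum) of isomorphism classes of $\mathcal G$-equivariant complex vector bundles on $Y$ (of finite, locally constant rank). For $Y$ locally compact Hausdorff, $K^0_{\mathcal G}(Y):=\ker\big(K^0_{\mathcal G}(Y^+)\to K^0_{\mathcal G}(B)\big)$, where $Y^+=Y\cup B$ is the fibrewise one-point compactification and the map is restriction to the section at infinity; proper equivariant maps $Y'\to Y$ over $B$ extend to $Y'^+\to Y^+$ and induce pull-back homomorphisms. Let $\pi_X:X\to B$ be a $\mathcal G\times\mathcal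 H$-bundle (a locally trivial bundle with $X$ locally compact Hausdorff and a continuous fibrewise action of $\mathcal G\times\mathcal H$) on which $\mathcal H$ acts freely: $hx=x$ with $h\in\mathcal H_b$, $x\in X_b$ implies $h=1$. Let $X/\mathcal H$ be the fibrewise orbit space with the quotient topology and the induced action of $\mathcal G$, and let $\pi:X\to X/\mathcal H$ be the quotient map, which is proper and equivariant along the projection $\mathcal G\times\mathcal H\to\mathcal G$. For a $\mathcal G$-equivariant vector bundle $\tilde\pi_E:E\to X/\mathcal H$ let $\pi^*E=\{(x,\varepsilon)\in X\times E:\pi(x)=\tilde\pi_E(\varepsilon)\}$ with the action $(g,h)(x,\varepsilon)=((g,h)x,g\varepsilon)$. Then: 1. Pull-back along $\pi$ (that is, along $\pi^+:X^+\to (X/\mathcal H)^+$) is an isomorphism $\pi^*:K^0_{\mathcal G}(X/\mathcal H)\to K^0_{\mathcal G\times\mathcal H}(X)$. 2. If $X$ is compact, then for every $\mathcal G\times\mathcal H$-equivariant vector bundle $F\to X$ the orbit space $F/\mathcal H$ is a $\mathcal G$-equivariant vector bundle over $X/\mathcal H$, and $[E]\mapsto[\pi^*E]$ is an isomorphism $K^0_{\mathcal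 G}(X/\mathcal H)\to K^0_{\mathcal G\times\mathcal H}(X)$ of the group completions with inverse $[F]\mapsto[F/\mathcal H]$. 3. These isomorphisms are natural: for bundles of compact groups $\mathcal G',\mathcal H'$ over $B$ with the same kind of data $X'$ (freeness of $X'$ is not needed), morphisms $\alpha:\mathcal G'\to\mathcal G$, $\beta:\mathcal H'\to\mathcal H$ and an $\alpha\times\beta$-equivariant map $f:X'\to X$ over $B$ with induced map $\bar f:X'/\mathcal H'\to X/\mathcal H$, one has $f^*\pi^*=\pi'^*\bar f^*$, on the group completions of equivariant vector bundles, and, if $f$ is proper, on the groups $K^0$ of locally compact spaces. 4. If $W\to B$ is a (locally compact Hausdorff) $\mathcal H$-bundle, let $(g,h)(x,w)=((g,h)x,hw)$ on $X\times_BW$ and $X\times_{\mathcal H}W:=(X\times_BW)/\mathcal H$. Pull-back along the quotient map is an isomorphism $K^0_{\mathcal G}(X\times_{\mathcal H}W)\cong K^0_{\mathcal G\times\mathcal H}(X\times_BW)$ (for locally compact spaces, and, in terms of vector bundles, if $X\times_BW$ is compact). -/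

import Mathlib

open Topology Set

/-! ### Families over a space and their total spaces -/

/-- The total space of a family `E` indexed by `B`. -/
structure Tot {B : Type*} (E : B → Type*) where
  base : B
  pt : E base

/-- The family `b ↦ A b × C b`; its total space is the fibre product of the total spaces. -/
def ProdFam {B : Type*} (A C : B → Type*) : B → Type _ := fun b => A b × C b

/-- The pulled back family `s ↦ E (f s)`. -/
def PullFam {S T : Type*} (f : S → T) (E : T → Type*) : S → Type _ := fun s => E (f s)

/-- The family of one-point sets; its total space is the space itself. -/
def PtFam (T : Type*) : T → Type := fun _ => Unit

instance (T : Type*) (t : T) : AddCommGroup (PtFam T t) := inferInstanceAs (AddCommGroup Unit)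

instance (T : Type*) (t : T) : Module ℂ (PtFam T t) := inferInstanceAs (Module ℂ Unit)

namespace Tot

variable {B : Type*} {A C : B → Type*}

/-- The inclusion of the fibre product in the product. -/
def split (z : Tot (ProdFam A C)) : Tot A × Tot C := (⟨z.base, z.pt.1⟩, ⟨z.base, z.pt.2⟩)

/-- The fibre product has the subspace topology. -/
instance [TopologicalSpace (Tot A)] [TopologicalSpace (Tot C)] :
    TopologicalSpace (Tot (ProdFam A C)) :=
  TopologicalSpace.induced split inferInstance

variable {S T : Type*} {f : S → T} {E : T → Type*}

instance [TopologicalSpace T] : TopologicalSpace (Tot (PtFam T)) :=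
  TopologicalSpace.induced Tot.base inferInstance

theorem isInducing_base [TopologicalSpace T] : IsInducing (base : Tot (PtFam T) → T) := ⟨rfl⟩

/-- The inclusion of a pull-back `f^* E = {(s, e) | f s = p e}` in `S × E`. -/
def pullEmb (z : Tot (PullFam f E)) : S × Tot E := (z.base, ⟨f z.base, z.pt⟩)

/-- The pull-back has the subspace topology. -/
instance [TopologicalSpace S] [TopologicalSpace (Tot E)] :
    TopologicalSpace (Tot (PullFam f E)) :=
  TopologicalSpace.induced pullEmb inferInstance

theorem isInducing_split [TopologicalSpace (Tot A)] [TopologicalSpace (Tot C)] :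
    IsInducing (split : Tot (ProdFam A C) → _) := ⟨rfl⟩

theorem isInducing_pullEmb [TopologicalSpace S] [TopologicalSpace (Tot E)] :
    IsInducing (pullEmb : Tot (PullFam f E) → _) := ⟨rfl⟩

theorem pullEmb_injective : Function.Injective (pullEmb : Tot (PullFam f E) → _) := by
  rintro ⟨s, v⟩ ⟨s', v'⟩ h
  simp only [pullEmb, Prod.mk.injEq] at h
  obtain ⟨rfl, h⟩ := h
  have h' := eq_of_heq (Tot.mk.inj h).2
  exact congrArg (Tot.mk s) h'

theorem split_injective : Function.Injective (split : Tot (ProdFam A C) → _) := by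
  rintro ⟨b, v⟩ ⟨b', v'⟩ h
  obtain ⟨h1, h2⟩ := Prod.mk.inj h
  obtain ⟨rfl, h1⟩ := Tot.mk.inj h1
  exact congrArg (Tot.mk b) (Prod.ext (eq_of_heq h1) (eq_of_heq (Tot.mk.inj h2).2))

theorem pull_ext {z z' : Tot (PullFam f E)} (h : z.base = z'.base)
    (h' : (⟨f z.base, z.pt⟩ : Tot E) = ⟨f z'.base, z'.pt⟩) : z = z' :=
  pullEmb_injective (Prod.ext h h')

theorem continuous_fst_split [TopologicalSpace (Tot A)] [TopologicalSpace (Tot C)] :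
    Continuous fun z : Tot (ProdFam A C) => (⟨z.base, z.pt.1⟩ : Tot A) :=
  continuous_fst.comp isInducing_split.continuous

theorem continuous_snd_split [TopologicalSpace (Tot A)] [TopologicalSpace (Tot C)] :
    Continuous fun z : Tot (ProdFam A C) => (⟨z.base, z.pt.2⟩ : Tot C) :=
  continuous_snd.comp isInducing_split.continuous

theorem continuous_to_split [TopologicalSpace (Tot A)] [TopologicalSpace (Tot C)] {Z : Type*}
    [TopologicalSpace Z] {h : Z → Tot (ProdFam A C)}
    (h1 : Continuous fun z => (⟨(h z).base, (h z).pt.1⟩ : Tot A))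
    (h2 : Continuous fun z => (⟨(h z).base, (h z).pt.2⟩ : Tot C)) : Continuous h :=
  isInducing_split.continuous_iff.2 (h1.prodMk h2)

theorem continuous_pull_base [TopologicalSpace S] [TopologicalSpace (Tot E)] :
    Continuous (Tot.base : Tot (PullFam f E) → S) :=
  continuous_fst.comp isInducing_pullEmb.continuous

theorem continuous_pull_pt [TopologicalSpace S] [TopologicalSpace (Tot E)] :
    Continuous fun z : Tot (PullFam f E) => (⟨f z.base, z.pt⟩ : Tot E) :=
  continuous_snd.comp isInducing_pullEmb.continuous

theorem continuous_to_pull [TopologicalSpace S] [TopologicalSpace (Tot E)] {Z : Type*}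
    [TopologicalSpace Z] {h : Z → Tot (PullFam f E)} (h1 : Continuous fun z => (h z).base)
    (h2 : Continuous fun z => (⟨f (h z).base, (h z).pt⟩ : Tot E)) : Continuous h :=
  isInducing_pullEmb.continuous_iff.2 (h1.prodMk h2)

/-- The map `p⁻¹(U) → U × F` given by a family of maps `φ b : E b → F`, `b ∈ U`. -/
def trivMap {F : Type*} {E : B → Type*} (U : Set B) (φ : ∀ b : U, E b → F) :
    {e : Tot E // e.base ∈ U} → U × F :=
  fun e => (⟨e.1.base, e.2⟩, φ ⟨e.1.base, e.2⟩ e.1.pt)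

theorem isHomeomorph_trivMap_iff {F : Type*} {E : B → Type*} [TopologicalSpace B]
    [TopologicalSpace (Tot E)] [TopologicalSpace F] {U : Set B} {φ : ∀ b : U, E b → F}
    (hφ : ∀ b, Function.Bijective (φ b)) :
    IsHomeomorph (trivMap U φ) ↔
      IsInducing (fun e : {e : Tot E // e.base ∈ U} =>
        ((e.1.base, φ ⟨e.1.base, e.2⟩ e.1.pt) : B × F)) := by
  have hi : IsInducing (Prod.map Subtype.val id : U × F → B × F) :=
    IsInducing.subtypeVal.prodMap IsInducing.id
  have hb : Function.Bijective (trivMap U φ) := by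
    constructor
    · rintro ⟨⟨b, v⟩, hb⟩ ⟨⟨b', v'⟩, hb'⟩ h
      simp only [trivMap, Prod.mk.injEq, Subtype.mk.injEq] at h
      obtain ⟨rfl, h⟩ := h
      have := (hφ _).1 h
      simp only at this
      subst this
      rfl
    · rintro ⟨⟨b, hb⟩, y⟩
      obtain ⟨v, hv⟩ := (hφ ⟨b, hb⟩).2 y
      exact ⟨⟨⟨b, v⟩, hb⟩, by simp [trivMap, hv]⟩
  change _ ↔ IsInducing (Prod.map Subtype.val id ∘ trivMap U φ)
  rw [hi.of_comp_iff, isHomeomorph_iff_isEmbedding_surjective]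
  exact ⟨fun h => h.1.1, fun h => ⟨⟨h, hb.1⟩, hb.2⟩⟩

theorem continuous_trivMap_symm {F : Type*} {E : B → Type*} [TopologicalSpace B]
    [TopologicalSpace (Tot E)] [TopologicalSpace F] {U : Set B} {φ : ∀ b : U, E b ≃ F}
    (h : IsHomeomorph (trivMap U fun b => φ b)) :
    Continuous fun z : U × F => (⟨z.1, (φ z.1).symm z.2⟩ : Tot E) := by
  refine (continuous_subtype_val.comp (h.homeomorph _).symm.continuous).congr fun z => ?_
  have : h.homeomorph _ ⟨⟨z.1, (φ z.1).symm z.2⟩, z.1.2⟩ = z := by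
    change trivMap U (fun b => φ b) _ = z
    simp [trivMap]
  change ((h.homeomorph _).symm z).1 = _
  conv_lhs => rw [← this]
  rw [Homeomorph.symm_apply_apply]

/-- Local trivializations of two families give one of the fibre product. -/
theorem isHomeomorph_trivMap_prod {F F' : Type*} [TopologicalSpace B]
    [TopologicalSpace (Tot A)] [TopologicalSpace (Tot C)] [TopologicalSpace F]
    [TopologicalSpace F'] {U U' : Set B} {φ : ∀ b : U, A b → F} {φ' : ∀ b : U', C b → F'}
    (hφ : ∀ b, Function.Bijective (φ b)) (hφ' : ∀ b, Function.Bijective (φ' b))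
    (h : IsHomeomorph (trivMap U φ)) (h' : IsHomeomorph (trivMap U' φ')) :
    IsHomeomorph (trivMap (E := ProdFam A C) (U ∩ U')
      (fun b v => (φ ⟨b.1, b.2.1⟩ v.1, φ' ⟨b.1, b.2.2⟩ v.2))) := by
  rw [isHomeomorph_trivMap_iff (by
    intro b
    exact (hφ ⟨b.1, b.2.1⟩).prodMap (hφ' ⟨b.1, b.2.2⟩))]
  rw [isHomeomorph_trivMap_iff hφ] at h
  rw [isHomeomorph_trivMap_iff hφ'] at h'
  let d : B × F × F' → (B × F) × (B × F') := fun z => ((z.1, z.2.1), (z.1, z.2.2))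
  have hd : IsInducing d := by
    refine IsInducing.of_comp (g := fun z => (z.1.1, z.1.2, z.2.2)) (by fun_prop) (by fun_prop) ?_
    exact IsInducing.id
  rw [← hd.of_comp_iff]
  let c : {e : Tot (ProdFam A C) // e.base ∈ U ∩ U'} →
      {e : Tot A // e.base ∈ U} × {e : Tot C // e.base ∈ U'} :=
    fun e => (⟨(split e.1).1, e.2.1⟩, ⟨(split e.1).2, e.2.2⟩)
  have hc : IsInducing c := by
    have : IsInducing (Prod.map Subtype.val Subtype.val ∘ c) := by
      exact isInducing_split.comp IsInducing.subtypeVal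
    exact (IsInducing.subtypeVal.prodMap IsInducing.subtypeVal).of_comp_iff.1 this
  exact (h.prodMap h').comp hc

/-- A local trivialization of a family gives one of a pull-back. -/
theorem isHomeomorph_trivMap_pull {F : Type*} [TopologicalSpace S] [TopologicalSpace T]
    [TopologicalSpace (Tot E)] [TopologicalSpace F] (hf : Continuous f) {U : Set T}
    {φ : ∀ t : U, E t → F} (hφ : ∀ t, Function.Bijective (φ t))
    (h : IsHomeomorph (trivMap U φ)) :
    IsHomeomorph (trivMap (E := PullFam f E) (f ⁻¹' U) (fun s v => φ ⟨f s.1, s.2⟩ v)) := by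
  rw [isHomeomorph_trivMap_iff (fun s => hφ ⟨f s.1, s.2⟩)]
  rw [isHomeomorph_trivMap_iff hφ] at h
  let d : S × F → S × (T × F) := fun z => (z.1, (f z.1, z.2))
  have hd : IsInducing d := by
    refine IsInducing.of_comp (g := fun z => (z.1, z.2.2)) (by fun_prop) (by fun_prop) ?_
    exact IsInducing.id
  rw [← hd.of_comp_iff]
  let c : {e : Tot (PullFam f E) // e.base ∈ f ⁻¹' U} → S × {e : Tot E // e.base ∈ U} :=
    fun e => ((pullEmb e.1).1, ⟨(pullEmb e.1).2, e.2⟩)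
  have hc : IsInducing c := by
    have : IsInducing (Prod.map id Subtype.val ∘ c) := by
      exact isInducing_pullEmb.comp IsInducing.subtypeVal
    exact (IsInducing.id.prodMap IsInducing.subtypeVal).of_comp_iff.1 this
  exact (IsInducing.id.prodMap h).comp hc

end Tot

/-! ### Bundles of compact groups -/

universe u v v' v'' v''' w w' w'' w'''

/-- A local trivialization, with fibre the topological group `K`, of a family of groups whose
total space is topologized. -/
structure GroupTriv {B : Type u} [TopologicalSpace B] (G : B → Type v) [∀ b, Group (G b)]
    [TopologicalSpace (Tot G)] (K : Type v) [Group K] [TopologicalSpace K] where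
  U : Set B
  isOpen : IsOpen U
  φ : ∀ b : U, G b ≃* K
  isHomeomorph : IsHomeomorph (Tot.trivMap U fun b => φ b)

/-- A bundle of compact groups over `B`; the typical fibre is the compact group `model`. -/
structure GroupBundle (B : Type u) [TopologicalSpace B] where
  fiber : B → Type v
  [group : ∀ b, Group (fiber b)]
  [top : TopologicalSpace (Tot fiber)]
  continuous_base : Continuous (Tot.base : Tot fiber → B)
  model : Type v
  [modelGroup : Group model]
  [modelTop : TopologicalSpace model]
  [modelTopGroup : IsTopologicalGroup model]
  [modelCompact : CompactSpace model]
  [modelT2 : T2Space model]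
  exists_triv : ∀ b, ∃ t : GroupTriv fiber model, b ∈ t.U

attribute [instance] GroupBundle.group GroupBundle.top GroupBundle.modelGroup
  GroupBundle.modelTop GroupBundle.modelTopGroup GroupBundle.modelCompact GroupBundle.modelT2

instance {B : Type*} (A C : B → Type*) [∀ b, Group (A b)] [∀ b, Group (C b)] (b : B) :
    Group (ProdFam A C b) := inferInstanceAs (Group (A b × C b))

namespace GroupBundle

variable {B : Type u} [TopologicalSpace B]

/-- Morphisms of bundles of groups over `B`. -/
structure Hom (𝒢 : GroupBundle.{u, v} B) (ℋ : GroupBundle.{u, v'} B) where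
  toFun : ∀ b, 𝒢.fiber b →* ℋ.fiber b
  continuous : Continuous fun g : Tot 𝒢.fiber => (⟨g.base, toFun g.base g.pt⟩ : Tot ℋ.fiber)

/-- The identity morphism. -/
def Hom.id (𝒢 : GroupBundle.{u, v} B) : Hom 𝒢 𝒢 := ⟨fun _ => MonoidHom.id _, continuous_id⟩

/-- The fibre product of two bundles of compact groups. -/
def prod (𝒢 : GroupBundle.{u, v} B) (ℋ : GroupBundle.{u, v'} B) :
    GroupBundle.{u, max v v'} B where
  fiber := ProdFam 𝒢.fiber ℋ.fiber
  continuous_base := 𝒢.continuous_base.comp (continuous_fst.comp Tot.isInducing_split.continuous)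
  model := 𝒢.model × ℋ.model
  exists_triv b := by
    obtain ⟨t, ht⟩ := 𝒢.exists_triv b
    obtain ⟨t', ht'⟩ := ℋ.exists_triv b
    exact ⟨⟨t.U ∩ t'.U, t.isOpen.inter t'.isOpen,
      fun b => (t.φ ⟨b.1, b.2.1⟩).prodCongr (t'.φ ⟨b.1, b.2.2⟩),
      Tot.isHomeomorph_trivMap_prod (fun b => (t.φ b).bijective) (fun b => (t'.φ b).bijective)
        t.isHomeomorph t'.isHomeomorph⟩, ht, ht'⟩

/-- The element `(g, h)` of `𝒢 × ℋ`. -/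
def pair {𝒢 : GroupBundle.{u, v} B} {ℋ : GroupBundle.{u, v'} B} {b : B} (g : 𝒢.fiber b)
    (h : ℋ.fiber b) : (𝒢.prod ℋ).fiber b := (g, h)

theorem pair_mul {𝒢 : GroupBundle.{u, v} B} {ℋ : GroupBundle.{u, v'} B} {b : B}
    (g g' : 𝒢.fiber b) (h h' : ℋ.fiber b) : pair g h * pair g' h' = pair (g * g') (h * h') := rfl

/-- The projection `𝒢 × ℋ → 𝒢`. -/
def fst (𝒢 : GroupBundle.{u, v} B) (ℋ : GroupBundle.{u, v'} B) : Hom (𝒢.prod ℋ) 𝒢 :=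
  ⟨fun _ => MonoidHom.fst _ _, continuous_fst.comp Tot.isInducing_split.continuous⟩

/-- The product of two morphisms. -/
def Hom.prodMap {𝒢 𝒢' : GroupBundle.{u, v} B} {ℋ ℋ' : GroupBundle.{u, v'} B}
    (α : Hom 𝒢' 𝒢) (β : Hom ℋ' ℋ) : Hom (𝒢'.prod ℋ') (𝒢.prod ℋ) :=
  ⟨fun b => MonoidHom.prodMap (α.toFun b) (β.toFun b),
    Tot.isInducing_split.continuous_iff.2
      ((α.continuous.prodMap β.continuous).comp Tot.isInducing_split.continuous)⟩

theorem continuous_one (𝒢 : GroupBundle.{u, v} B) :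
    Continuous fun b => (⟨b, 1⟩ : Tot 𝒢.fiber) := by
  rw [continuous_iff_continuousAt]
  intro b
  obtain ⟨t, ht⟩ := 𝒢.exists_triv b
  have h : ContinuousOn (fun b => (⟨b, 1⟩ : Tot 𝒢.fiber)) t.U := by
    rw [continuousOn_iff_continuous_domRestrict]
    refine ((Tot.continuous_trivMap_symm (φ := fun b => (t.φ b).toEquiv) t.isHomeomorph).comp
      (Continuous.prodMk_left (1 : 𝒢.model))).congr fun b => ?_
    exact congrArg (Tot.mk b.1) (map_one (t.φ b).symm)
  exact h.continuousAt (t.isOpen.mem_nhds ht)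

/-- The inclusion `ℋ → 𝒢 × ℋ`, `h ↦ (1, h)`. -/
def inr (𝒢 : GroupBundle.{u, v} B) (ℋ : GroupBundle.{u, v'} B) : Hom ℋ (𝒢.prod ℋ) :=
  ⟨fun _ => MonoidHom.inr _ _, Tot.isInducing_split.continuous_iff.2
    ((𝒢.continuous_one.comp ℋ.continuous_base).prodMk continuous_id)⟩

end GroupBundle

/-! ### The representation covering and finite holonomy -/

/-- Continuous irreducible complex representations (in coordinates). -/
structure IrredRep (K : Type*) [Group K] [TopologicalSpace K] where
  n : ℕ
  ρ : Representation ℂ K (Fin n → ℂ)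
  continuous : ∀ x, Continuous fun k => ρ k x
  irreducible : ρ.IsIrreducible

/-- Equivalence of irreducible representations. -/
instance IrredRep.setoid (K : Type*) [Group K] [TopologicalSpace K] : Setoid (IrredRep K) where
  r σ τ := Nonempty (σ.ρ.Equiv τ.ρ)
  iseqv := ⟨fun σ => ⟨.refl σ.ρ⟩, fun ⟨e⟩ => ⟨e.symm⟩, fun ⟨e⟩ ⟨e'⟩ => ⟨e.trans e'⟩⟩

namespace GroupBundle

variable {B : Type u} [TopologicalSpace B] (𝒢 : GroupBundle.{u, v} B)

/-- Each fibre has the subspace topology. -/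
instance fiberTop (b : B) : TopologicalSpace (𝒢.fiber b) :=
  TopologicalSpace.induced (fun g => (⟨b, g⟩ : Tot 𝒢.fiber)) inferInstance

/-- The set of equivalence classes of irreducible representations of the fibre over `b`. -/
def dual (b : B) : Type v := Quotient (IrredRep.setoid (𝒢.fiber b))

/-- The sheet over `t.U` of the representation covering through an irreducible representation
`σ` of the typical fibre: over `b` it consists of the class of `σ ∘ (t.φ b)`. -/
def sheet (t : GroupTriv 𝒢.fiber 𝒢.model) (σ : IrredRep 𝒢.model) : Set (Tot 𝒢.dual) :=
  {d | ∃ (hb : d.base ∈ t.U) (τ : IrredRep (𝒢.fiber d.base)), d.pt = Quotient.mk _ τ ∧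
    Nonempty (τ.ρ.Equiv (σ.ρ.comp (t.φ ⟨d.base, hb⟩).toMonoidHom))}

/-- The topology of the representation covering: a trivialization of the bundle of groups over
`U` identifies the part over `U` with `U` times the discrete space of classes of irreducible
representations of the typical fibre. -/
instance dualTop : TopologicalSpace (Tot 𝒢.dual) :=
  TopologicalSpace.generateFrom {s | ∃ t σ, s = 𝒢.sheet t σ}

/-- Representation theoretic finite holonomy. -/
def FiniteHolonomy : Prop :=
  ∀ σ : Tot 𝒢.dual, ∃ K : Set (Tot 𝒢.dual), IsCompact K ∧ IsOpen K ∧ σ ∈ K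

end GroupBundle

/-! ### Spaces with an action of a bundle of groups -/

/-- A space over `B` with a continuous fibrewise action of the bundle of groups `𝒢`. -/
structure GSpace {B : Type u} [TopologicalSpace B] (𝒢 : GroupBundle.{u, v} B) where
  fiber : B → Type w
  [act : ∀ b, MulAction (𝒢.fiber b) (fiber b)]
  [top : TopologicalSpace (Tot fiber)]
  continuous_base : Continuous (Tot.base : Tot fiber → B)
  continuous_smul : Continuous fun z : Tot (ProdFam 𝒢.fiber fiber) =>
    (⟨z.base, z.pt.1 • z.pt.2⟩ : Tot fiber)

attribute [instance] GSpace.act GSpace.top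

namespace GSpace

variable {B : Type u} [TopologicalSpace B]

section

variable {𝒢 : GroupBundle.{u, v} B} {𝒢' : GroupBundle.{u, v'} B}

/-- The total space. -/
abbrev Total (X : GSpace.{u, v, w} 𝒢) : Type (max u w) := Tot X.fiber

/-- `X → B` is a locally trivial bundle. -/
def IsLocallyTrivial (X : GSpace.{u, v, w} 𝒢) : Prop :=
  ∀ b₀, ∃ (F : Type w) (_ : TopologicalSpace F) (U : Set B) (φ : ∀ b : U, X.fiber b ≃ F),
    IsOpen U ∧ b₀ ∈ U ∧ IsHomeomorph (Tot.trivMap U fun b => φ b)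

/-- Each group acts freely on the corresponding fibre. -/
def IsFree (X : GSpace.{u, v, w} 𝒢) : Prop :=
  ∀ (b : B) (g : 𝒢.fiber b) (x : X.fiber b), g • x = x → g = 1

/-- `γ`-equivariant maps over `B`, for a morphism `γ : 𝒢 → 𝒢'`. -/
structure Hom (γ : 𝒢.Hom 𝒢') (X : GSpace.{u, v, w} 𝒢) (Y : GSpace.{u, v', w'} 𝒢') where
  toFun : ∀ b, X.fiber b → Y.fiber b
  continuous : Continuous fun x : X.Total => (⟨x.base, toFun x.base x.pt⟩ : Y.Total)
  map_smul : ∀ b (g : 𝒢.fiber b) x, toFun b (g • x) = γ.toFun b g • toFun b x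

/-- The map of total spaces. -/
def Hom.tot {γ : 𝒢.Hom 𝒢'} {X : GSpace.{u, v, w} 𝒢} {Y : GSpace.{u, v', w'} 𝒢'}
    (f : Hom γ X Y) (x : X.Total) : Y.Total := ⟨x.base, f.toFun x.base x.pt⟩

/-- Preimages of compact sets are compact. -/
def Hom.Proper {γ : 𝒢.Hom 𝒢'} {X : GSpace.{u, v, w} 𝒢} {Y : GSpace.{u, v', w'} 𝒢'}
    (f : Hom γ X Y) : Prop := ∀ K, IsCompact K → IsCompact (f.tot ⁻¹' K)

/-- Restriction of the action along a morphism of bundles of groups. -/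
def restrict (γ : 𝒢.Hom 𝒢') (X : GSpace.{u, v', w} 𝒢') : GSpace.{u, v, w} 𝒢 where
  fiber := X.fiber
  act b := MulAction.compHom _ (γ.toFun b)
  top := X.top
  continuous_base := X.continuous_base
  continuous_smul := by
    refine X.continuous_smul.comp (f := fun z : Tot (ProdFam 𝒢.fiber X.fiber) =>
      (⟨z.base, γ.toFun _ z.pt.1, z.pt.2⟩ : Tot (ProdFam 𝒢'.fiber X.fiber))) ?_
    exact Tot.isInducing_split.continuous_iff.2
      ((γ.continuous.prodMap continuous_id).comp Tot.isInducing_split.continuous)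

/-- `B` itself, with the trivial action. -/
def base (𝒢 : GroupBundle.{u, v} B) : GSpace.{u, v, 0} 𝒢 where
  fiber := PtFam B
  act _ := { smul := fun _ x => x, one_smul := fun _ => rfl, mul_smul := fun _ _ _ => rfl }
  continuous_base := Tot.isInducing_base.continuous
  continuous_smul := Tot.isInducing_base.continuous_iff.2
    (𝒢.continuous_base.comp Tot.continuous_fst_split)

/-- The action is continuous in a local trivialization of the bundle of groups. -/
theorem continuous_triv (X : GSpace.{u, v, w} 𝒢) (t : GroupTriv 𝒢.fiber 𝒢.model) :
    Continuous fun z : 𝒢.model × {x : X.Total // x.base ∈ t.U} =>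
      (⟨z.2.1.base, (t.φ ⟨z.2.1.base, z.2.2⟩).symm z.1 • z.2.1.pt⟩ : X.Total) := by
  refine X.continuous_smul.comp (f := fun z : 𝒢.model × {x : X.Total // x.base ∈ t.U} =>
      (⟨z.2.1.base, (t.φ ⟨z.2.1.base, z.2.2⟩).symm z.1, z.2.1.pt⟩ :
        Tot (ProdFam 𝒢.fiber X.fiber))) (Tot.isInducing_split.continuous_iff.2 ?_)
  refine Continuous.prodMk ?_ (continuous_subtype_val.comp continuous_snd)
  exact (Tot.continuous_trivMap_symm (φ := fun b => (t.φ b).toEquiv) t.isHomeomorph).comp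
    ((Continuous.subtype_mk (X.continuous_base.comp (continuous_subtype_val.comp continuous_snd))
      (fun z => z.2.2)).prodMk continuous_fst)

theorem isOpen_base_mem (X : GSpace.{u, v, w} 𝒢) (t : GroupTriv 𝒢.fiber 𝒢.model) :
    IsOpen {x : X.Total | x.base ∈ t.U} := t.isOpen.preimage X.continuous_base

/-- If `S` is open, so is the set of points whose whole orbit lies in `S`. -/
theorem isOpen_orbit_subset (X : GSpace.{u, v, w} 𝒢) {S : Set X.Total} (hS : IsOpen S) :
    IsOpen {x : X.Total | ∀ g : 𝒢.fiber x.base, (⟨x.base, g • x.pt⟩ : X.Total) ∈ S} := by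
  rw [isOpen_iff_mem_nhds]
  intro x₀ hx₀
  obtain ⟨t, ht⟩ := 𝒢.exists_triv x₀.base
  have h : ∀ᶠ x in 𝓝 (⟨x₀, ht⟩ : {x : X.Total // x.base ∈ t.U}), ∀ k ∈ (univ : Set 𝒢.model),
      (⟨x.1.base, (t.φ ⟨x.1.base, x.2⟩).symm k • x.1.pt⟩ : X.Total) ∈ S := by
    refine isCompact_univ.eventually_forall_of_forall_eventually fun k _ => ?_
    exact ((X.continuous_triv t).comp continuous_swap).continuousAt.eventually_mem
      (hS.mem_nhds (hx₀ _))
  rw [nhds_subtype_eq_comap, Filter.eventually_comap] at h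
  filter_upwards [h, (X.isOpen_base_mem t).mem_nhds ht] with x hx hxt g
  have := hx ⟨x, hxt⟩ rfl (t.φ ⟨x.base, hxt⟩ g) (mem_univ _)
  simpa using this

/-- If `S` is open, so is the union of the orbits that meet `S`. -/
theorem isOpen_orbit_meets (X : GSpace.{u, v, w} 𝒢) {S : Set X.Total} (hS : IsOpen S) :
    IsOpen {x : X.Total | ∃ g : 𝒢.fiber x.base, (⟨x.base, g • x.pt⟩ : X.Total) ∈ S} := by
  rw [isOpen_iff_mem_nhds]
  rintro x₀ ⟨g, hg⟩
  obtain ⟨t, ht⟩ := 𝒢.exists_triv x₀.base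
  have h : ∀ᶠ x in 𝓝 (⟨x₀, ht⟩ : {x : X.Total // x.base ∈ t.U}),
      (⟨x.1.base, (t.φ ⟨x.1.base, x.2⟩).symm (t.φ ⟨x₀.base, ht⟩ g) • x.1.pt⟩ : X.Total) ∈ S := by
    refine ((X.continuous_triv t).comp (Continuous.prodMk_right _)).continuousAt.eventually_mem
      (hS.mem_nhds ?_)
    simpa using hg
  rw [nhds_subtype_eq_comap, Filter.eventually_comap] at h
  filter_upwards [h, (X.isOpen_base_mem t).mem_nhds ht] with x hx hxt
  exact ⟨_, hx ⟨x, hxt⟩ rfl⟩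

/-- Over a closed subset of a trivializing set the orbits through a compact set form a compact
set. -/
theorem isCompact_orbits (X : GSpace.{u, v, w} 𝒢) (t : GroupTriv 𝒢.fiber 𝒢.model) {C : Set B}
    (hC : IsClosed C) (hCt : C ⊆ t.U) {K : Set X.Total} (hK : IsCompact K) :
    IsCompact {x : X.Total | x.base ∈ C ∧
      ∃ g : 𝒢.fiber x.base, (⟨x.base, g • x.pt⟩ : X.Total) ∈ K} := by
  have hK' : IsCompact {x : {x : X.Total // x.base ∈ t.U} | x.1 ∈ K ∧ x.1.base ∈ C} := by
    rw [Subtype.isCompact_iff]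
    convert! hK.inter_right (hC.preimage X.continuous_base) using 1
    ext x
    constructor
    · rintro ⟨x, h, rfl⟩
      exact h
    · intro h
      exact ⟨⟨x, hCt h.2⟩, h, rfl⟩
  convert! ((isCompact_univ (X := 𝒢.model)).prod hK').image (X.continuous_triv t) using 1
  ext x
  simp only [mem_ofPred_eq, mem_image, mem_prod, mem_univ, true_and, Prod.exists, Subtype.exists]
  constructor
  · rintro ⟨hx, g, hg⟩
    refine ⟨t.φ ⟨x.base, hCt hx⟩ g⁻¹, ⟨x.base, g • x.pt⟩, hCt hx, ⟨hg, hx⟩, ?_⟩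
    simp
  · rintro ⟨k, y, hy, ⟨hyK, hyC⟩, rfl⟩
    refine ⟨hyC, ((t.φ ⟨y.base, hy⟩).symm k)⁻¹, ?_⟩
    simpa using hyK

end

/-! ### The quotient by the second factor -/

section

variable {𝒢 : GroupBundle.{u, v} B} {ℋ : GroupBundle.{u, v'} B}

/-- A `𝒢 × ℋ`-space regarded as an `ℋ`-space. -/
def resRight (X : GSpace.{u, max v v', w} (𝒢.prod ℋ)) : GSpace.{u, v', w} ℋ :=
  X.restrict (GroupBundle.inr 𝒢 ℋ)

/-- The fibres of `X/ℋ`: the orbit spaces of the groups `ℋ_b` acting on `X_b`. -/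
def QuotFiber (X : GSpace.{u, max v v', w} (𝒢.prod ℋ)) (b : B) : Type w :=
  MulAction.orbitRel.Quotient (ℋ.fiber b) (X.resRight.fiber b)

/-- The class of a point in `X_b / ℋ_b`. -/
def quotMk (X : GSpace.{u, max v v', w} (𝒢.prod ℋ)) (b : B) (x : X.fiber b) : X.QuotFiber b :=
  Quotient.mk (MulAction.orbitRel (ℋ.fiber b) (X.resRight.fiber b)) x

/-- The quotient map of total spaces. -/
def quotProj (X : GSpace.{u, max v v', w} (𝒢.prod ℋ)) (x : X.Total) : Tot X.QuotFiber :=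
  ⟨x.base, X.quotMk x.base x.pt⟩

/-- `X/ℋ` has the quotient topology. -/
instance quotTop (X : GSpace.{u, max v v', w} (𝒢.prod ℋ)) : TopologicalSpace (Tot X.QuotFiber) :=
  TopologicalSpace.coinduced X.quotProj inferInstance

theorem quotMk_eq (X : GSpace.{u, max v v', w} (𝒢.prod ℋ)) {b : B} {x y : X.fiber b} :
    X.quotMk b x = X.quotMk b y ↔
      ∃ h : ℋ.fiber b, GroupBundle.pair (𝒢 := 𝒢) (ℋ := ℋ) 1 h • y = x := by
  exact Quotient.eq (r := MulAction.orbitRel (ℋ.fiber b) (X.resRight.fiber b))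

theorem quotMk_surjective (X : GSpace.{u, max v v', w} (𝒢.prod ℋ)) (b : B) :
    Function.Surjective (X.quotMk b) := Quotient.mk_surjective

theorem quotProj_surjective (X : GSpace.{u, max v v', w} (𝒢.prod ℋ)) :
    Function.Surjective X.quotProj := by
  rintro ⟨b, y⟩
  obtain ⟨x, rfl⟩ := X.quotMk_surjective b y
  exact ⟨⟨b, x⟩, rfl⟩

theorem continuous_quotProj (X : GSpace.{u, max v v', w} (𝒢.prod ℋ)) :
    Continuous X.quotProj := continuous_coinduced_rng

theorem isQuotientMap_quotProj (X : GSpace.{u, max v v', w} (𝒢.prod ℋ)) :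
    IsQuotientMap X.quotProj := ⟨⟨rfl⟩, X.quotProj_surjective⟩

theorem quotProj_eq (X : GSpace.{u, max v v', w} (𝒢.prod ℋ)) {x y : X.Total}
    (h : X.quotProj x = X.quotProj y) :
    ∃ k : ℋ.fiber y.base,
      (⟨y.base, GroupBundle.pair (𝒢 := 𝒢) (ℋ := ℋ) 1 k • y.pt⟩ : X.Total)
        = x := by
  obtain ⟨b, x⟩ := x
  obtain ⟨b', y⟩ := y
  simp only [quotProj, Tot.mk.injEq] at h
  obtain ⟨rfl, h⟩ := h
  obtain ⟨k, rfl⟩ := X.quotMk_eq.1 (eq_of_heq h)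
  exact ⟨k, rfl⟩

theorem quotProj_smul (X : GSpace.{u, max v v', w} (𝒢.prod ℋ)) (x : X.Total)
    (k : ℋ.fiber x.base) :
    X.quotProj ⟨x.base, GroupBundle.pair (𝒢 := 𝒢) (ℋ := ℋ) 1 k • x.pt⟩
      = X.quotProj x := by
  simp only [quotProj, Tot.mk.injEq, heq_eq_eq, true_and]
  exact X.quotMk_eq.2 ⟨k, rfl⟩

theorem isOpenMap_quotProj (X : GSpace.{u, max v v', w} (𝒢.prod ℋ)) : IsOpenMap X.quotProj := by
  intro S hS
  rw [← X.isQuotientMap_quotProj.isOpen_preimage]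
  convert! X.resRight.isOpen_orbit_meets (S := S) hS using 1
  ext x
  constructor
  · rintro ⟨y, hy, hyx⟩
    obtain ⟨k, rfl⟩ := X.quotProj_eq hyx
    exact ⟨k, hy⟩
  · rintro ⟨k, hk⟩
    exact ⟨_, hk, X.quotProj_smul x k⟩

theorem isProperMap_quotProj (X : GSpace.{u, max v v', w} (𝒢.prod ℋ)) :
    IsProperMap X.quotProj := by
  rw [isProperMap_iff_isClosedMap_and_compact_fibers]
  refine ⟨X.continuous_quotProj, fun S hS => ?_, fun y => ?_⟩
  · rw [← isOpen_compl_iff, ← X.isQuotientMap_quotProj.isOpen_preimage]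
    convert! X.resRight.isOpen_orbit_subset (S := Sᶜ) hS.isOpen_compl using 1
    ext x
    constructor
    · intro hx k hk
      exact hx ⟨_, hk, X.quotProj_smul x k⟩
    · rintro hx ⟨y, hy, hyx⟩
      obtain ⟨k, rfl⟩ := X.quotProj_eq hyx
      exact hx k hy
  · obtain ⟨x, rfl⟩ := X.quotProj_surjective y
    obtain ⟨t, ht⟩ := ℋ.exists_triv x.base
    have := (isCompact_univ (X := ℋ.model)).image
      ((X.resRight.continuous_triv t).comp
        (Continuous.prodMk_left (⟨x, ht⟩ : {x : X.resRight.Total // x.base ∈ t.U})))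
    convert! this using 1
    ext y
    constructor
    · intro hy
      obtain ⟨k, rfl⟩ := X.quotProj_eq hy
      refine ⟨t.φ ⟨x.base, ht⟩ k, mem_univ _, ?_⟩
      simp only [Function.comp, MulEquiv.symm_apply_apply]
      rfl
    · rintro ⟨k, _, rfl⟩
      exact X.quotProj_smul x _

/-- `X/ℋ` as a `𝒢`-space, with `g • [x] = [(g, 1) • x]`. -/
def quot (X : GSpace.{u, max v v', w} (𝒢.prod ℋ)) : GSpace.{u, v, w} 𝒢 where
  fiber := X.QuotFiber
  act b :=
    { smul := fun g => Quotient.lift (fun x : X.fiber b => X.quotMk b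
          (GroupBundle.pair (𝒢 := 𝒢) (ℋ := ℋ) g 1 • x)) (by
        intro (x : X.fiber b) (y : X.fiber b) hxy
        obtain ⟨h, hh⟩ := hxy
        have hh : GroupBundle.pair (𝒢 := 𝒢) 1 h • y = x := hh
        subst hh
        refine X.quotMk_eq.2 ⟨h, ?_⟩
        rw [smul_smul, smul_smul, GroupBundle.pair_mul, GroupBundle.pair_mul]
        simp only [one_mul, mul_one])
      one_smul := by
        intro y
        obtain ⟨x, rfl⟩ := X.quotMk_surjective b y
        exact congrArg (X.quotMk b) (one_smul ((𝒢.prod ℋ).fiber b) x)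
      mul_smul := by
        intro g g' y
        obtain ⟨x, rfl⟩ := X.quotMk_surjective b y
        refine congrArg (X.quotMk b) (Eq.trans ?_ (mul_smul
          (GroupBundle.pair (ℋ := ℋ) g 1) (GroupBundle.pair (ℋ := ℋ) g' 1) x))
        rw [GroupBundle.pair_mul, one_mul] }
  top := X.quotTop
  continuous_base := X.isQuotientMap_quotProj.continuous_iff.2 X.continuous_base
  continuous_smul := by
    let q : Tot (ProdFam 𝒢.fiber X.fiber) → Tot (ProdFam 𝒢.fiber X.QuotFiber) :=
      fun z => ⟨z.base, z.pt.1, X.quotMk _ z.pt.2⟩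
    have hqc : Continuous q := Tot.isInducing_split.continuous_iff.2
      ((continuous_id.prodMap X.continuous_quotProj).comp Tot.isInducing_split.continuous)
    have hqs : Function.Surjective q := by
      rintro ⟨b, g, y⟩
      obtain ⟨x, rfl⟩ := X.quotMk_surjective b y
      exact ⟨⟨b, g, x⟩, rfl⟩
    have hqo : IsOpenMap q := by
      intro S hS
      obtain ⟨S', hS', rfl⟩ := Tot.isInducing_split.isOpen_iff.1 hS
      have h1 := (IsOpenMap.id (X := Tot 𝒢.fiber)).prodMap X.isOpenMap_quotProj S' hS'
      refine Tot.isInducing_split.isOpen_iff.2 ⟨_, h1, ?_⟩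
      ext ⟨b, g, y⟩
      constructor
      · rintro ⟨⟨g', x⟩, hgx, he⟩
        obtain ⟨b', x⟩ := x
        simp only [Prod.map, id, Tot.split, quotProj, Prod.mk.injEq, Tot.mk.injEq] at he
        obtain ⟨rfl, rfl, he⟩ := he
        exact ⟨⟨b', g, x⟩, hgx, by rw [← eq_of_heq he]⟩
      · rintro ⟨⟨b', g', x⟩, hz, he⟩
        rw [← he]
        exact ⟨_, hz, rfl⟩
    have hq : IsQuotientMap q := hqo.isQuotientMap hqc hqs
    rw [hq.continuous_iff]
    refine X.continuous_quotProj.comp (X.continuous_smul.comp (f := fun z :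
      Tot (ProdFam 𝒢.fiber X.fiber) => (⟨z.base, (z.pt.1, 1), z.pt.2⟩ :
        Tot (ProdFam (𝒢.prod ℋ).fiber X.fiber))) ?_)
    refine Tot.isInducing_split.continuous_iff.2 (Continuous.prodMk ?_
      (continuous_snd.comp Tot.isInducing_split.continuous))
    have hg : Continuous fun z : Tot (ProdFam 𝒢.fiber X.fiber) =>
      (⟨z.base, z.pt.1⟩ : Tot 𝒢.fiber) := continuous_fst.comp Tot.isInducing_split.continuous
    exact Tot.isInducing_split.continuous_iff.2 (hg.prodMk
      (ℋ.continuous_one.comp (𝒢.continuous_base.comp hg)))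

/-- The quotient map `X → X/ℋ`, equivariant along `𝒢 × ℋ → 𝒢`. -/
def quotMap (X : GSpace.{u, max v v', w} (𝒢.prod ℋ)) :
    Hom (GroupBundle.fst 𝒢 ℋ) X X.quot where
  toFun := X.quotMk
  continuous := X.continuous_quotProj
  map_smul b g x := by
    refine X.quotMk_eq.2 ⟨g.2, ?_⟩
    rw [smul_smul]
    congr 1
    exact Prod.ext (one_mul _) (mul_one _)

theorem quotMap_proper (X : GSpace.{u, max v v', w} (𝒢.prod ℋ)) : X.quotMap.Proper :=
  fun _ hK => X.isProperMap_quotProj.isCompact_preimage hK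

/-- The map `X'/ℋ' → X/ℋ` induced by an equivariant map `X' → X`. -/
def Hom.quot {𝒢' : GroupBundle.{u, v} B} {ℋ' : GroupBundle.{u, v'} B} {α : 𝒢'.Hom 𝒢}
    {β : ℋ'.Hom ℋ} {X' : GSpace.{u, max v v', w} (𝒢'.prod ℋ')}
    {X : GSpace.{u, max v v', w} (𝒢.prod ℋ)} (f : Hom (α.prodMap β) X' X) :
    Hom α X'.quot X.quot where
  toFun b := Quotient.lift (fun x : X'.fiber b => X.quotMk b (f.toFun b x)) (by
    rintro x y ⟨h, rfl⟩
    refine X.quotMk_eq.2 ⟨β.toFun b h, ?_⟩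
    refine Eq.trans ?_ (f.map_smul b (GroupBundle.pair (𝒢 := 𝒢') (ℋ := ℋ') 1 h) y).symm
    congr 1
    exact Prod.ext (map_one (α.toFun b)).symm rfl)
  continuous := X'.isQuotientMap_quotProj.continuous_iff.2
    (X.continuous_quotProj.comp f.continuous)
  map_smul b g y := by
    obtain ⟨x, rfl⟩ := X'.quotMk_surjective b y
    change X.quotMk b (f.toFun b (GroupBundle.pair (𝒢 := 𝒢') (ℋ := ℋ') g 1 • x)) =
      X.quotMk b (GroupBundle.pair (𝒢 := 𝒢) (ℋ := ℋ) (α.toFun b g) 1 • f.toFun b x)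
    rw [f.map_smul]
    congr 2
    exact Prod.ext rfl (map_one (β.toFun b))

theorem Hom.quot_proper {𝒢' : GroupBundle.{u, v} B} {ℋ' : GroupBundle.{u, v'} B} {α : 𝒢'.Hom 𝒢}
    {β : ℋ'.Hom ℋ} {X' : GSpace.{u, max v v', w} (𝒢'.prod ℋ')}
    {X : GSpace.{u, max v v', w} (𝒢.prod ℋ)} {f : Hom (α.prodMap β) X' X} (hf : f.Proper) :
    f.quot.Proper := by
  intro K hK
  have h := (hf _ (X.quotMap_proper K hK)).image X'.continuous_quotProj
  convert! h using 1
  ext y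
  obtain ⟨x, rfl⟩ := X'.quotProj_surjective y
  constructor
  · intro hx
    exact ⟨x, hx, rfl⟩
  · rintro ⟨x', hx', he⟩
    rw [← he]
    exact hx'

/-- The fibre product `P ×_B W` of a `𝒢 × ℋ`-space and an `ℋ`-space, with the action
`(g, h) (p, w) = ((g, h) p, h w)`. -/
def mixedProd (P : GSpace.{u, max v v', w} (𝒢.prod ℋ)) (W : GSpace.{u, v', w'} ℋ) :
    GSpace.{u, max v v', max w w'} (𝒢.prod ℋ) where
  fiber := ProdFam P.fiber W.fiber
  act b :=
    { smul := fun g z => (g • z.1, g.2 • z.2)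
      one_smul := fun z => Prod.ext (one_smul _ _) (one_smul _ _)
      mul_smul := fun g g' z => Prod.ext (mul_smul g g' z.1) (mul_smul g.2 g'.2 z.2) }
  continuous_base := P.continuous_base.comp
    (continuous_fst.comp Tot.isInducing_split.continuous)
  continuous_smul := by
    have h1 : Continuous fun z : Tot (ProdFam (𝒢.prod ℋ).fiber (ProdFam P.fiber W.fiber)) =>
        (⟨z.base, z.pt.1⟩ : Tot (𝒢.prod ℋ).fiber) :=
      continuous_fst.comp Tot.isInducing_split.continuous
    have h2 : Continuous fun z : Tot (ProdFam (𝒢.prod ℋ).fiber (ProdFam P.fiber W.fiber)) =>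
        (⟨z.base, z.pt.2⟩ : Tot (ProdFam P.fiber W.fiber)) :=
      continuous_snd.comp Tot.isInducing_split.continuous
    have h3 : Continuous fun z : Tot (ProdFam (𝒢.prod ℋ).fiber (ProdFam P.fiber W.fiber)) =>
        (⟨z.base, z.pt.1.2⟩ : Tot ℋ.fiber) :=
      continuous_snd.comp (Tot.isInducing_split.continuous.comp h1)
    have h4 := Tot.isInducing_split.continuous.comp h2
    refine Tot.isInducing_split.continuous_iff.2 (Continuous.prodMk ?_ ?_)
    · exact P.continuous_smul.comp (Tot.isInducing_split.continuous_iff.2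
        (h1.prodMk (continuous_fst.comp h4)) :
          Continuous fun z : Tot (ProdFam (𝒢.prod ℋ).fiber (ProdFam P.fiber W.fiber)) =>
            (⟨z.base, z.pt.1, z.pt.2.1⟩ : Tot (ProdFam (𝒢.prod ℋ).fiber P.fiber)))
    · exact W.continuous_smul.comp (Tot.isInducing_split.continuous_iff.2
        (h3.prodMk (continuous_snd.comp h4)) :
          Continuous fun z : Tot (ProdFam (𝒢.prod ℋ).fiber (ProdFam P.fiber W.fiber)) =>
            (⟨z.base, z.pt.1.2, z.pt.2.2⟩ : Tot (ProdFam ℋ.fiber W.fiber)))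

end

/-! ### The fibrewise one-point compactification -/

section

variable {𝒢 : GroupBundle.{u, v} B} {𝒢' : GroupBundle.{u, v'} B}

/-- The topology of `X⁺ = X ∪ B`: a set is open if it meets `X` and `B` in open sets and contains,
with the point at infinity over `b`, the complement of a compact subset of `X` over a
neighbourhood of `b`. -/
instance plusTop (X : GSpace.{u, v, w} 𝒢) : TopologicalSpace (Tot fun b => Option (X.fiber b)) where
  IsOpen S := IsOpen {x : X.Total | (⟨x.base, some x.pt⟩ : Tot fun b => Option (X.fiber b)) ∈ S} ∧
    ∀ b, (⟨b, none⟩ : Tot fun b => Option (X.fiber b)) ∈ S →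
      ∃ (V : Set B) (K : Set X.Total), IsOpen V ∧ b ∈ V ∧ IsCompact K ∧
        (∀ b' ∈ V, (⟨b', none⟩ : Tot fun b => Option (X.fiber b)) ∈ S) ∧
        ∀ x : X.Total, x.base ∈ V → x ∉ K →
          (⟨x.base, some x.pt⟩ : Tot fun b => Option (X.fiber b)) ∈ S
  isOpen_univ := ⟨isOpen_univ, fun _ _ => ⟨univ, ∅, isOpen_univ, trivial, isCompact_empty,
    fun _ _ => trivial, fun _ _ _ => trivial⟩⟩
  isOpen_inter S S' h h' := by
    refine ⟨h.1.inter h'.1, fun b hb => ?_⟩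
    obtain ⟨V, K, hV, hbV, hK, h1, h2⟩ := h.2 b hb.1
    obtain ⟨V', K', hV', hbV', hK', h1', h2'⟩ := h'.2 b hb.2
    exact ⟨V ∩ V', K ∪ K', hV.inter hV', ⟨hbV, hbV'⟩, hK.union hK',
      fun c hc => ⟨h1 c hc.1, h1' c hc.2⟩, fun x hx hxK =>
        ⟨h2 x hx.1 fun h => hxK (.inl h), h2' x hx.2 fun h => hxK (.inr h)⟩⟩
  isOpen_sUnion 𝒮 h := by
    constructor
    · have : {x : X.Total | (⟨x.base, some x.pt⟩ : Tot fun b => Option (X.fiber b)) ∈ ⋃₀ 𝒮} =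
          ⋃ S ∈ 𝒮, {x : X.Total | (⟨x.base, some x.pt⟩ : Tot fun b => Option (X.fiber b)) ∈ S} := by
        ext x
        simp
      rw [this]
      exact isOpen_biUnion fun S hS => (h S hS).1
    · rintro b ⟨S, hS, hb⟩
      obtain ⟨V, K, hV, hbV, hK, h1, h2⟩ := (h S hS).2 b hb
      exact ⟨V, K, hV, hbV, hK, fun c hc => ⟨S, hS, h1 c hc⟩, fun x hx hxK => ⟨S, hS, h2 x hx hxK⟩⟩

theorem isOpen_plus_iff (X : GSpace.{u, v, w} 𝒢) {S : Set (Tot fun b => Option (X.fiber b))} :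
    IsOpen S ↔
      IsOpen {x : X.Total | (⟨x.base, some x.pt⟩ : Tot fun b => Option (X.fiber b)) ∈ S} ∧
      ∀ b, (⟨b, none⟩ : Tot fun b => Option (X.fiber b)) ∈ S →
        ∃ (V : Set B) (K : Set X.Total), IsOpen V ∧ b ∈ V ∧ IsCompact K ∧
          (∀ b' ∈ V, (⟨b', none⟩ : Tot fun b => Option (X.fiber b)) ∈ S) ∧
          ∀ x : X.Total, x.base ∈ V → x ∉ K →
            (⟨x.base, some x.pt⟩ : Tot fun b => Option (X.fiber b)) ∈ S := Iff.rfl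

theorem continuous_plus_base (X : GSpace.{u, v, w} 𝒢) :
    Continuous (Tot.base : (Tot fun b => Option (X.fiber b)) → B) := by
  refine ⟨fun V hV => X.isOpen_plus_iff.2 ⟨hV.preimage X.continuous_base, fun b hb =>
    ⟨V, ∅, hV, hb, isCompact_empty, fun _ h => h, fun _ h _ => h⟩⟩⟩

theorem continuous_some (X : GSpace.{u, v, w} 𝒢) :
    Continuous fun x : X.Total => (⟨x.base, some x.pt⟩ : Tot fun b => Option (X.fiber b)) :=
  ⟨fun _ hS => (X.isOpen_plus_iff.1 hS).1⟩

theorem continuous_none (X : GSpace.{u, v, w} 𝒢) :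
    Continuous fun b : B => (⟨b, none⟩ : Tot fun b => Option (X.fiber b)) := by
  refine ⟨fun S hS => isOpen_iff_mem_nhds.2 fun b hb => ?_⟩
  obtain ⟨V, K, hV, hbV, hK, h1, h2⟩ := (X.isOpen_plus_iff.1 hS).2 b hb
  exact Filter.mem_of_superset (hV.mem_nhds hbV) h1

theorem isOpenMap_some (X : GSpace.{u, v, w} 𝒢) :
    IsOpenMap fun x : X.Total => (⟨x.base, some x.pt⟩ : Tot fun b => Option (X.fiber b)) := by
  intro S hS
  refine X.isOpen_plus_iff.2 ⟨?_, ?_⟩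
  · convert! hS using 1
    ext ⟨b, x⟩
    constructor
    · rintro ⟨⟨b', x'⟩, hx', he⟩
      simp only [Tot.mk.injEq] at he
      obtain ⟨rfl, he⟩ := he
      rwa [← Option.some.inj (eq_of_heq he)]
    · intro h
      exact ⟨_, h, rfl⟩
  · rintro b ⟨x, _, he⟩
    simp only [Tot.mk.injEq] at he
    obtain ⟨rfl, he⟩ := he
    simp at he

/-- If `S ⊆ X⁺` is open, so is the set of points whose whole orbit lies in `S`. -/
theorem isOpen_plus_orbit [RegularSpace B] (X : GSpace.{u, v, w} 𝒢)
    {S : Set (Tot fun b => Option (X.fiber b))} (hS : IsOpen S) :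
    IsOpen {y : Tot fun b => Option (X.fiber b) | ∀ g : 𝒢.fiber y.base,
      (⟨y.base, g • y.pt⟩ : Tot fun b => Option (X.fiber b)) ∈ S} := by
  refine X.isOpen_plus_iff.2 ⟨X.isOpen_orbit_subset hS.1, fun b hb => ?_⟩
  have hb' : (⟨b, none⟩ : Tot fun b => Option (X.fiber b)) ∈ S := hb 1
  obtain ⟨V, K, hV, hbV, hK, h1, h2⟩ := (X.isOpen_plus_iff.1 hS).2 b hb'
  obtain ⟨t, ht⟩ := 𝒢.exists_triv b
  obtain ⟨C, hCb, hC, hCs⟩ := exists_mem_nhds_isClosed_subset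
    ((hV.inter t.isOpen).mem_nhds ⟨hbV, ht⟩)
  refine ⟨interior C, _, isOpen_interior, mem_interior_iff_mem_nhds.2 hCb,
    X.isCompact_orbits t hC (fun c hc => (hCs hc).2) hK,
    fun c hc g => h1 c (hCs (interior_subset hc)).1, fun x hx hxK g => ?_⟩
  refine h2 ⟨x.base, g • x.pt⟩ (hCs (interior_subset hx)).1 fun hg => ?_
  exact hxK ⟨interior_subset hx, g, hg⟩

/-- The fibrewise one-point compactification `X⁺ = X ∪ B`. -/
def plus [CompactSpace B] [T2Space B] (X : GSpace.{u, v, w} 𝒢) : GSpace.{u, v, w} 𝒢 where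
  fiber b := Option (X.fiber b)
  continuous_base := X.continuous_plus_base
  continuous_smul := by
    rw [continuous_iff_continuousAt]
    have hsnd : Continuous fun z : Tot (ProdFam 𝒢.fiber fun b => Option (X.fiber b)) =>
        (⟨z.base, z.pt.2⟩ : Tot fun b => Option (X.fiber b)) :=
      continuous_snd.comp Tot.isInducing_split.continuous
    rintro ⟨b, g, _ | x⟩
    · refine (nhds_basis_opens _).tendsto_right_iff.2 fun S hS => ?_
      have hO := X.isOpen_plus_orbit hS.2
      filter_upwards [hsnd.continuousAt.eventually_mem (hO.mem_nhds (fun _ => hS.1))] with z hz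
      exact hz _
    · let j : Tot (ProdFam 𝒢.fiber X.fiber) → Tot (ProdFam 𝒢.fiber fun b => Option (X.fiber b)) :=
        fun z => ⟨z.base, z.pt.1, some z.pt.2⟩
      have hj : IsOpenMap j := by
        intro S hS
        obtain ⟨S', hS', rfl⟩ := Tot.isInducing_split.isOpen_iff.1 hS
        have h1 := (IsOpenMap.id (X := Tot 𝒢.fiber)).prodMap X.isOpenMap_some S' hS'
        refine Tot.isInducing_split.isOpen_iff.2 ⟨_, h1, ?_⟩
        ext ⟨b, g, y⟩
        constructor
        · rintro ⟨⟨g', x⟩, hgx, he⟩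
          obtain ⟨b', x⟩ := x
          simp only [Prod.map, id, Tot.split, Prod.mk.injEq, Tot.mk.injEq] at he
          obtain ⟨rfl, rfl, he⟩ := he
          exact ⟨⟨b', g, x⟩, hgx, by rw [← eq_of_heq he]⟩
        · rintro ⟨⟨b', g', x⟩, hz, he⟩
          rw [← he]
          exact ⟨_, hz, rfl⟩
      let Q : Tot (ProdFam 𝒢.fiber fun b => Option (X.fiber b)) → Tot fun b => Option (X.fiber b) :=
        fun z => ⟨z.base, z.pt.1 • z.pt.2⟩
      have h : Filter.Tendsto (Q ∘ j) (𝓝 ⟨b, g, x⟩) (𝓝 (Q ⟨b, g, some x⟩)) :=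
        (X.continuous_some.comp X.continuous_smul).continuousAt
          (x := (⟨b, g, x⟩ : Tot (ProdFam 𝒢.fiber X.fiber)))
      exact (Filter.tendsto_map'_iff.2 h).mono_left (hj.nhds_le ⟨b, g, x⟩)

variable [CompactSpace B] [T2Space B]

/-- The section at infinity `B → X⁺`. -/
def infty (X : GSpace.{u, v, w} 𝒢) : Hom (GroupBundle.Hom.id 𝒢) (base 𝒢) X.plus where
  toFun _ _ := none
  continuous := X.continuous_none.comp (base 𝒢).continuous_base
  map_smul _ _ _ := rfl

/-- The extension `X⁺ → Y⁺` of a proper map `X → Y`. -/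
def Hom.plus {γ : 𝒢.Hom 𝒢'} {X : GSpace.{u, v, w} 𝒢} {Y : GSpace.{u, v', w'} 𝒢'}
    (f : Hom γ X Y) (hf : f.Proper) : Hom γ X.plus Y.plus where
  toFun b := Option.map (f.toFun b)
  continuous := by
    refine ⟨fun S hS => X.isOpen_plus_iff.2 ?_⟩
    have h := Y.isOpen_plus_iff.1 hS
    refine ⟨h.1.preimage f.continuous, fun b hb => ?_⟩
    obtain ⟨V, K, hV, hbV, hK, h1, h2⟩ := h.2 b hb
    exact ⟨V, _, hV, hbV, hf K hK, h1, fun x hx hxK => h2 (f.tot x) hx hxK⟩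
  map_smul b g x := by
    cases x with
    | none => rfl
    | some x => exact congrArg some (f.map_smul b g x)

end

end GSpace

/-! ### Equivariant vector bundles -/

/-- A complex vector bundle over `T`, of locally constant finite rank. (Up to isomorphism nothing
is lost by taking the fibres in `Type`.) -/
structure VBundle (T : Type u) [TopologicalSpace T] where
  fiber : T → Type
  [addCommGroup : ∀ t, AddCommGroup (fiber t)]
  [module : ∀ t, Module ℂ (fiber t)]
  [top : TopologicalSpace (Tot fiber)]
  continuous_base : Continuous (Tot.base : Tot fiber → T)
  locTriv : ∀ t₀, ∃ (n : ℕ) (U : Set T) (φ : ∀ t : U, fiber t ≃ₗ[ℂ] (Fin n → ℂ)),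
    IsOpen U ∧ t₀ ∈ U ∧ IsHomeomorph (Tot.trivMap U fun t => φ t)

attribute [instance] VBundle.addCommGroup VBundle.module VBundle.top

instance {T : Type*} (A C : T → Type*) [∀ t, AddCommGroup (A t)] [∀ t, AddCommGroup (C t)]
    (t : T) : AddCommGroup (ProdFam A C t) := inferInstanceAs (AddCommGroup (A t × C t))

instance {T : Type*} (A C : T → Type*) [∀ t, AddCommGroup (A t)] [∀ t, AddCommGroup (C t)]
    [∀ t, Module ℂ (A t)] [∀ t, Module ℂ (C t)] (t : T) : Module ℂ (ProdFam A C t) :=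
  inferInstanceAs (Module ℂ (A t × C t))

instance {S T : Type*} (f : S → T) (E : T → Type*) [∀ t, AddCommGroup (E t)] (s : S) :
    AddCommGroup (PullFam f E s) := inferInstanceAs (AddCommGroup (E (f s)))

instance {S T : Type*} (f : S → T) (E : T → Type*) [∀ t, AddCommGroup (E t)]
    [∀ t, Module ℂ (E t)] (s : S) : Module ℂ (PullFam f E s) :=
  inferInstanceAs (Module ℂ (E (f s)))

namespace VBundle

variable {S : Type w} {T : Type u} [TopologicalSpace S] [TopologicalSpace T]

/-- Equal points have equal fibres. -/
def cast (E : VBundle T) {t t' : T} (h : t = t') : E.fiber t ≃ₗ[ℂ] E.fiber t' := by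
  subst h
  exact LinearEquiv.refl _ _

theorem mk_cast (E : VBundle T) {t t' : T} (h : t = t') (v : E.fiber t) :
    (⟨t', E.cast h v⟩ : Tot E.fiber) = ⟨t, v⟩ := by
  subst h
  rfl

theorem mk_cast_symm (E : VBundle T) {t t' : T} (h : t = t') (v : E.fiber t') :
    (⟨t, (E.cast h).symm v⟩ : Tot E.fiber) = ⟨t', v⟩ := by
  subst h
  rfl

/-- The pull-back of a vector bundle. -/
@[reducible] def pull {f : S → T} (hf : Continuous f) (E : VBundle T) : VBundle S where
  fiber := PullFam f E.fiber
  continuous_base := continuous_fst.comp Tot.isInducing_pullEmb.continuous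
  locTriv s := by
    obtain ⟨n, U, φ, hU, hs, h⟩ := E.locTriv (f s)
    exact ⟨n, f ⁻¹' U, fun s => φ ⟨f s.1, s.2⟩, hU.preimage hf, hs,
      Tot.isHomeomorph_trivMap_pull hf (fun t => (φ t).bijective) h⟩

/-- The direct sum of two vector bundles. -/
@[reducible] def sum (E E' : VBundle T) : VBundle T where
  fiber := ProdFam E.fiber E'.fiber
  continuous_base := E.continuous_base.comp (continuous_fst.comp Tot.isInducing_split.continuous)
  locTriv t := by
    obtain ⟨n, U, φ, hU, ht, h⟩ := E.locTriv t
    obtain ⟨n', U', φ', hU', ht', h'⟩ := E'.locTriv t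
    let e : ((Fin n → ℂ) × (Fin n' → ℂ)) ≃L[ℂ] (Fin (n + n') → ℂ) :=
      ((LinearEquiv.sumArrowLequivProdArrow (Fin n) (Fin n') ℂ ℂ).symm.trans
        (LinearEquiv.funCongrLeft ℂ ℂ finSumFinEquiv.symm)).toContinuousLinearEquiv
    refine ⟨n + n', U ∩ U', fun t => ((φ ⟨t.1, t.2.1⟩).prodCongr (φ' ⟨t.1, t.2.2⟩)).trans
      e.toLinearEquiv, hU.inter hU', ⟨ht, ht'⟩, ?_⟩
    have h1 := Tot.isHomeomorph_trivMap_prod (fun t => (φ t).bijective)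
      (fun t => (φ' t).bijective) h h'
    exact ((Homeomorph.refl _).prodCongr e.toHomeomorph).isHomeomorph.comp h1

/-- The zero bundle. -/
@[reducible] def zero (T : Type u) [TopologicalSpace T] : VBundle T where
  fiber := PtFam T
  continuous_base := Tot.isInducing_base.continuous
  locTriv t := by
    have φ : ∀ t, PtFam T t ≃ₗ[ℂ] (Fin 0 → ℂ) := fun _ => (0 : Unit ≃ₗ[ℂ] (Fin 0 → ℂ))
    refine ⟨0, univ, fun t => φ t, isOpen_univ, trivial, ?_⟩
    rw [Tot.isHomeomorph_trivMap_iff (fun t => (φ t).bijective)]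
    have h : IsInducing (Tot.base : Tot (PtFam T) → T) := Tot.isInducing_base
    refine IsInducing.of_comp (g := Prod.fst) ?_ continuous_fst (h.comp IsInducing.subtypeVal)
    refine (h.continuous.comp continuous_subtype_val).prodMk ?_
    exact continuous_of_const fun _ _ => Subsingleton.elim _ _

end VBundle

namespace GSpace

variable {B : Type u} [TopologicalSpace B] {𝒢 : GroupBundle.{u, v} B}

/-- The projection `𝒢 ×_B Y → Y`. -/
def actSnd (Y : GSpace.{u, v, w} 𝒢) (z : Tot (ProdFam 𝒢.fiber Y.fiber)) : Y.Total :=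
  ⟨z.base, z.pt.2⟩

end GSpace

/-- A `𝒢`-equivariant complex vector bundle over the `𝒢`-space `Y`: the group elements act
linearly between the fibres, covering the action on `Y`, and the total action
`𝒢 ×_B E = {(g, y, e) | e ∈ E_y} → E` is continuous. -/
structure EquivVB {B : Type u} [TopologicalSpace B] {𝒢 : GroupBundle.{u, v} B}
    (Y : GSpace.{u, v, w} 𝒢) extends VBundle Y.Total where
  act : ∀ {b : B} (g : 𝒢.fiber b) (y : Y.fiber b), fiber ⟨b, y⟩ →ₗ[ℂ] fiber ⟨b, g • y⟩
  act_one : ∀ {b : B} (y : Y.fiber b) (e : fiber ⟨b, y⟩),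
    (⟨⟨b, (1 : 𝒢.fiber b) • y⟩, act 1 y e⟩ : Tot fiber) = ⟨⟨b, y⟩, e⟩
  act_mul : ∀ {b : B} (g h : 𝒢.fiber b) (y : Y.fiber b) (e : fiber ⟨b, y⟩),
    (⟨⟨b, (g * h) • y⟩, act (g * h) y e⟩ : Tot fiber) =
      ⟨⟨b, g • h • y⟩, act g (h • y) (act h y e)⟩
  continuous_act : Continuous fun z : Tot (PullFam Y.actSnd fiber) =>
    (⟨⟨z.base.base, z.base.pt.1 • z.base.pt.2⟩, act z.base.pt.1 z.base.pt.2 z.pt⟩ : Tot fiber)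

namespace EquivVB

variable {B : Type u} [TopologicalSpace B]

section

variable {𝒢 : GroupBundle.{u, v} B} {Y : GSpace.{u, v, w} 𝒢}

/-- Isomorphisms of equivariant vector bundles. -/
structure Iso (E E' : EquivVB Y) where
  toEquiv : ∀ y, E.fiber y ≃ₗ[ℂ] E'.fiber y
  continuous : Continuous fun e : Tot E.fiber => (⟨e.base, toEquiv _ e.pt⟩ : Tot E'.fiber)
  continuous_symm : Continuous fun e : Tot E'.fiber =>
    (⟨e.base, (toEquiv _).symm e.pt⟩ : Tot E.fiber)
  equivariant : ∀ {b : B} (g : 𝒢.fiber b) (y : Y.fiber b) (e : E.fiber ⟨b, y⟩),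
    toEquiv _ (E.act g y e) = E'.act g y (toEquiv _ e)

/-- The identity. -/
def Iso.refl (E : EquivVB Y) : Iso E E :=
  ⟨fun _ => LinearEquiv.refl _ _, continuous_id, continuous_id, fun _ _ _ => rfl⟩

/-- The inverse isomorphism. -/
def Iso.symm {E E' : EquivVB Y} (i : Iso E E') : Iso E' E where
  toEquiv y := (i.toEquiv y).symm
  continuous := i.continuous_symm
  continuous_symm := i.continuous
  equivariant g y e := by
    rw [LinearEquiv.symm_apply_eq, i.equivariant, LinearEquiv.apply_symm_apply]

/-- The composition of isomorphisms. -/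
def Iso.trans {E E' E'' : EquivVB Y} (i : Iso E E') (j : Iso E' E'') : Iso E E'' where
  toEquiv y := (i.toEquiv y).trans (j.toEquiv y)
  continuous := j.continuous.comp i.continuous
  continuous_symm := i.continuous_symm.comp j.continuous_symm
  equivariant g y e := by
    simp only [LinearEquiv.trans_apply, i.equivariant, j.equivariant]

/-- The isomorphism relation. -/
instance setoid (Y : GSpace.{u, v, w} 𝒢) : Setoid (EquivVB Y) where
  r E E' := Nonempty (Iso E E')
  iseqv := ⟨fun E => ⟨.refl E⟩, fun ⟨i⟩ => ⟨i.symm⟩, fun ⟨i⟩ ⟨j⟩ => ⟨i.trans j⟩⟩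

/-- The direct sum, with the diagonal action. -/
@[reducible] def sum (E E' : EquivVB Y) : EquivVB Y where
  toVBundle := E.toVBundle.sum E'.toVBundle
  act g y := (E.act g y).prodMap (E'.act g y)
  act_one y e := Tot.split_injective (Prod.ext (E.act_one y e.1) (E'.act_one y e.2))
  act_mul g h y e := Tot.split_injective (Prod.ext (E.act_mul g h y e.1) (E'.act_mul g h y e.2))
  continuous_act := by
    refine Tot.continuous_to_split ?_ ?_
    · exact E.continuous_act.comp (Tot.continuous_to_pull Tot.continuous_pull_base
        (Tot.continuous_fst_split.comp Tot.continuous_pull_pt) :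
          Continuous fun z : Tot (PullFam Y.actSnd (ProdFam E.fiber E'.fiber)) =>
            (⟨z.base, z.pt.1⟩ : Tot (PullFam Y.actSnd E.fiber)))
    · exact E'.continuous_act.comp (Tot.continuous_to_pull Tot.continuous_pull_base
        (Tot.continuous_snd_split.comp Tot.continuous_pull_pt) :
          Continuous fun z : Tot (PullFam Y.actSnd (ProdFam E.fiber E'.fiber)) =>
            (⟨z.base, z.pt.2⟩ : Tot (PullFam Y.actSnd E'.fiber)))

/-- The zero bundle. -/
@[reducible] def zero (Y : GSpace.{u, v, w} 𝒢) : EquivVB Y where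
  toVBundle := VBundle.zero Y.Total
  act _ _ := 0
  act_one {b} y e := congrArg
    (fun y' : Y.fiber b => (⟨⟨b, y'⟩, ()⟩ : Tot (PtFam Y.Total))) (one_smul _ y)
  act_mul {b} g h y e := congrArg
    (fun y' : Y.fiber b => (⟨⟨b, y'⟩, ()⟩ : Tot (PtFam Y.Total))) (mul_smul g h y)
  continuous_act := by
    exact Tot.isInducing_base.continuous_iff.2 (Y.continuous_smul.comp Tot.continuous_pull_base)

theorem act_congr (E : EquivVB Y) {b : B} {g g' : 𝒢.fiber b} (hg : g = g') {y y' : Y.fiber b}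
    {e : E.fiber ⟨b, y⟩} {e' : E.fiber ⟨b, y'⟩}
    (h : (⟨⟨b, y⟩, e⟩ : Tot E.fiber) = ⟨⟨b, y'⟩, e'⟩) :
    (⟨⟨b, g • y⟩, E.act g y e⟩ : Tot E.fiber) = ⟨⟨b, g' • y'⟩, E.act g' y' e'⟩ := by
  subst hg
  obtain ⟨h1, h2⟩ := Tot.mk.inj h
  obtain rfl := eq_of_heq (Tot.mk.inj h1).2
  rw [eq_of_heq h2]

end

section

variable {𝒢 : GroupBundle.{u, v} B} {𝒢' : GroupBundle.{u, v'} B} {γ : 𝒢.Hom 𝒢'}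
  {X : GSpace.{u, v, w} 𝒢} {Y : GSpace.{u, v', w'} 𝒢'}

theorem tot_smul (f : GSpace.Hom γ X Y) {b : B} (g : 𝒢.fiber b) (x : X.fiber b) :
    (⟨b, γ.toFun b g • f.toFun b x⟩ : Y.Total) = f.tot ⟨b, g • x⟩ :=
  congrArg (Tot.mk b) (f.map_smul b g x).symm

/-- The pull-back `f^* E = {(x, e) | f x = p e}`, with the action `g (x, e) = (g x, γ(g) e)`. -/
@[reducible] def pull (f : GSpace.Hom γ X Y) (E : EquivVB Y) : EquivVB X where
  toVBundle := E.toVBundle.pull (f := f.tot) f.continuous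
  act {b} g x := (E.cast (tot_smul f g x)).toLinearMap ∘ₗ E.act (γ.toFun b g) (f.toFun b x)
  act_one {b} x e := Tot.pull_ext (f := f.tot) (E := E.fiber) (congrArg (Tot.mk b) (one_smul _ x))
    ((E.mk_cast (tot_smul f 1 x) _).trans
      ((E.act_congr (map_one (γ.toFun b)) rfl).trans (E.act_one (f.toFun b x) e)))
  act_mul {b} g h x e := Tot.pull_ext (f := f.tot) (E := E.fiber) (congrArg (Tot.mk b) (mul_smul g h x))
    ((E.mk_cast (tot_smul f (g * h) x) _).trans
      ((E.act_congr (map_mul (γ.toFun b) g h) rfl).trans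
        ((E.act_mul (γ.toFun b g) (γ.toFun b h) (f.toFun b x) e).trans
          ((E.act_congr rfl (E.mk_cast (tot_smul f h x) _).symm).trans
            (E.mk_cast (tot_smul f g (h • x)) _).symm))))
  continuous_act := by
    have h3 : Continuous fun z : Tot (ProdFam 𝒢.fiber X.fiber) =>
        (⟨z.base, γ.toFun _ z.pt.1, f.toFun _ z.pt.2⟩ : Tot (ProdFam 𝒢'.fiber Y.fiber)) :=
      Tot.continuous_to_split (γ.continuous.comp Tot.continuous_fst_split)
        (f.continuous.comp Tot.continuous_snd_split)
    refine Tot.continuous_to_pull (f := f.tot) (E := E.fiber)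
      (X.continuous_smul.comp Tot.continuous_pull_base) ?_
    refine (E.continuous_act.comp (Tot.continuous_to_pull (h3.comp Tot.continuous_pull_base)
      ((Tot.continuous_pull_pt (f := f.tot) (E := E.fiber)).comp
        (Tot.continuous_pull_pt (f := X.actSnd) (E := PullFam f.tot E.fiber))) :
        Continuous fun z : Tot (PullFam X.actSnd (PullFam f.tot E.fiber)) =>
          (⟨⟨z.base.base, γ.toFun _ z.base.pt.1, f.toFun _ z.base.pt.2⟩, z.pt⟩ :
            Tot (PullFam Y.actSnd E.fiber)))).congr fun z => ?_
    exact (E.mk_cast (tot_smul f z.base.pt.1 z.base.pt.2) _).symm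

end

/-! ### The monoid of isomorphism classes -/

section

variable {𝒢 : GroupBundle.{u, v} B} {Y : GSpace.{u, v, w} 𝒢}

/-- The sum of two isomorphisms. -/
def Iso.sum {E E' F F' : EquivVB Y} (i : Iso E E') (j : Iso F F') :
    Iso (E.sum F) (E'.sum F') where
  toEquiv y := (i.toEquiv y).prodCongr (j.toEquiv y)
  continuous := Tot.continuous_to_split (i.continuous.comp Tot.continuous_fst_split)
    (j.continuous.comp Tot.continuous_snd_split)
  continuous_symm := Tot.continuous_to_split (i.continuous_symm.comp Tot.continuous_fst_split)
    (j.continuous_symm.comp Tot.continuous_snd_split)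
  equivariant g y e := Prod.ext (i.equivariant g y e.1) (j.equivariant g y e.2)

/-- Commutativity of the direct sum. -/
def sumComm (E F : EquivVB Y) : Iso (E.sum F) (F.sum E) where
  toEquiv y := LinearEquiv.prodComm ℂ (E.fiber y) (F.fiber y)
  continuous := Tot.continuous_to_split Tot.continuous_snd_split Tot.continuous_fst_split
  continuous_symm := Tot.continuous_to_split Tot.continuous_snd_split Tot.continuous_fst_split
  equivariant _ _ _ := rfl

/-- Associativity of the direct sum. -/
def sumAssoc (E F G : EquivVB Y) : Iso ((E.sum F).sum G) (E.sum (F.sum G)) where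
  toEquiv y := LinearEquiv.prodAssoc ℂ (E.fiber y) (F.fiber y) (G.fiber y)
  continuous := Tot.continuous_to_split (A := E.fiber) (C := ProdFam F.fiber G.fiber)
    ((Tot.continuous_fst_split (A := E.fiber) (C := F.fiber)).comp
      (Tot.continuous_fst_split (A := ProdFam E.fiber F.fiber) (C := G.fiber)))
    (Tot.continuous_to_split (A := F.fiber) (C := G.fiber)
      ((Tot.continuous_snd_split (A := E.fiber) (C := F.fiber)).comp
        (Tot.continuous_fst_split (A := ProdFam E.fiber F.fiber) (C := G.fiber)))
      Tot.continuous_snd_split)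
  continuous_symm := Tot.continuous_to_split (A := ProdFam E.fiber F.fiber) (C := G.fiber)
    (Tot.continuous_to_split (A := E.fiber) (C := F.fiber) Tot.continuous_fst_split
      ((Tot.continuous_fst_split (A := F.fiber) (C := G.fiber)).comp
        (Tot.continuous_snd_split (A := E.fiber) (C := ProdFam F.fiber G.fiber))))
    ((Tot.continuous_snd_split (A := F.fiber) (C := G.fiber)).comp
      (Tot.continuous_snd_split (A := E.fiber) (C := ProdFam F.fiber G.fiber)))
  equivariant _ _ _ := rfl

/-- The zero bundle is neutral. -/
def zeroSum (E : EquivVB Y) : Iso ((zero Y).sum E) E where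
  toEquiv _ :=
    { toFun := fun e => e.2
      invFun := fun e => ((), e)
      map_add' := fun _ _ => rfl
      map_smul' := fun _ _ => rfl
      left_inv := fun _ => rfl
      right_inv := fun _ => rfl }
  continuous := Tot.continuous_snd_split
  continuous_symm := Tot.continuous_to_split
    (Tot.isInducing_base.continuous_iff.2 E.continuous_base) continuous_id
  equivariant _ _ _ := rfl

/-- The set of isomorphism classes of equivariant vector bundles over `Y`. -/
def Classes (Y : GSpace.{u, v, w} 𝒢) : Type (max u v w 1) := Quotient (setoid Y)

/-- The isomorphism class of an equivariant vector bundle. -/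
def toClass (E : EquivVB Y) : Classes Y := Quotient.mk (setoid Y) E

/-- Addition is induced by the direct sum. -/
instance : Add (Classes Y) :=
  ⟨Quotient.map₂ sum fun _ _ h _ _ h' => h.elim fun i => h'.elim fun j => ⟨i.sum j⟩⟩

/-- The neutral element is the class of the zero bundle. -/
instance : Zero (Classes Y) := ⟨toClass (zero Y)⟩

instance : AddCommMonoid (Classes Y) where
  add_assoc := by
    rintro ⟨E⟩ ⟨F⟩ ⟨G⟩
    exact Quotient.sound ⟨sumAssoc E F G⟩
  add_comm := by
    rintro ⟨E⟩ ⟨F⟩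
    exact Quotient.sound ⟨sumComm E F⟩
  zero_add := by
    rintro ⟨E⟩
    exact Quotient.sound ⟨zeroSum E⟩
  add_zero := by
    rintro ⟨E⟩
    exact Quotient.sound ⟨(sumComm E (zero Y)).trans (zeroSum E)⟩
  nsmul := nsmulRec

end

section

variable {𝒢 : GroupBundle.{u, v} B} {𝒢' : GroupBundle.{u, v'} B} {γ : 𝒢.Hom 𝒢'}
  {X : GSpace.{u, v, w} 𝒢} {Y : GSpace.{u, v', w'} 𝒢'}

theorem mk_pull_act (f : GSpace.Hom γ X Y) (E : EquivVB Y) {b : B} (g : 𝒢.fiber b)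
    (x : X.fiber b) (e : E.fiber (f.tot ⟨b, x⟩)) :
    (⟨f.tot ⟨b, g • x⟩, (E.pull f).act g x e⟩ : Tot E.fiber) =
      ⟨⟨b, γ.toFun b g • f.toFun b x⟩, E.act (γ.toFun b g) (f.toFun b x) e⟩ :=
  E.mk_cast (tot_smul f g x) _

theorem Iso.map_cast {E E' : EquivVB Y} (i : Iso E E') {y y' : Y.Total} (h : y = y')
    (e : E.fiber y) : i.toEquiv y' (E.cast h e) = E'.cast h (i.toEquiv y e) := by
  subst h
  rfl

theorem cast_sum {E E' : EquivVB Y} {y y' : Y.Total} (h : y = y') (e : E.fiber y × E'.fiber y) :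
    (E.sum E').cast h e = (E.cast h e.1, E'.cast h e.2) := by
  subst h
  rfl

/-- Isomorphic bundles have isomorphic pull-backs. -/
def Iso.pull (f : GSpace.Hom γ X Y) {E E' : EquivVB Y} (i : Iso E E') :
    Iso (E.pull f) (E'.pull f) where
  toEquiv x := i.toEquiv (f.tot x)
  continuous := Tot.continuous_to_pull (f := f.tot) (E := E'.fiber)
    (Tot.continuous_pull_base (f := f.tot) (E := E.fiber))
    (i.continuous.comp (Tot.continuous_pull_pt (f := f.tot) (E := E.fiber)))
  continuous_symm := Tot.continuous_to_pull (f := f.tot) (E := E.fiber)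
    (Tot.continuous_pull_base (f := f.tot) (E := E'.fiber))
    (i.continuous_symm.comp (Tot.continuous_pull_pt (f := f.tot) (E := E'.fiber)))
  equivariant g x e := (i.map_cast (tot_smul f g x) _).trans
    (congrArg (E'.cast (tot_smul f g x)) (i.equivariant _ _ e))

/-- Pull-backs commute with direct sums. -/
def pullSum (f : GSpace.Hom γ X Y) (E E' : EquivVB Y) :
    Iso ((E.sum E').pull f) ((E.pull f).sum (E'.pull f)) where
  toEquiv x := LinearEquiv.refl ℂ (E.fiber (f.tot x) × E'.fiber (f.tot x))
  continuous := Tot.continuous_to_split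
    (Tot.continuous_to_pull (f := f.tot) (E := E.fiber)
      (Tot.continuous_pull_base (f := f.tot) (E := ProdFam E.fiber E'.fiber))
      ((Tot.continuous_fst_split (A := E.fiber) (C := E'.fiber)).comp
        (Tot.continuous_pull_pt (f := f.tot) (E := ProdFam E.fiber E'.fiber))))
    (Tot.continuous_to_pull (f := f.tot) (E := E'.fiber)
      (Tot.continuous_pull_base (f := f.tot) (E := ProdFam E.fiber E'.fiber))
      ((Tot.continuous_snd_split (A := E.fiber) (C := E'.fiber)).comp
        (Tot.continuous_pull_pt (f := f.tot) (E := ProdFam E.fiber E'.fiber))))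
  continuous_symm := Tot.continuous_to_pull (f := f.tot) (E := ProdFam E.fiber E'.fiber)
    ((Tot.continuous_pull_base (f := f.tot) (E := E.fiber)).comp
      (Tot.continuous_fst_split (A := PullFam f.tot E.fiber) (C := PullFam f.tot E'.fiber)))
    (Tot.continuous_to_split
      ((Tot.continuous_pull_pt (f := f.tot) (E := E.fiber)).comp
        (Tot.continuous_fst_split (A := PullFam f.tot E.fiber) (C := PullFam f.tot E'.fiber)))
      ((Tot.continuous_pull_pt (f := f.tot) (E := E'.fiber)).comp
        (Tot.continuous_snd_split (A := PullFam f.tot E.fiber) (C := PullFam f.tot E'.fiber))))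
  equivariant g x _ := cast_sum (tot_smul f g x) _

/-- The pull-back of the zero bundle is the zero bundle. -/
def pullZero (f : GSpace.Hom γ X Y) : Iso ((zero Y).pull f) (zero X) where
  toEquiv _ := LinearEquiv.refl ℂ Unit
  continuous := Tot.isInducing_base.continuous_iff.2
    (Tot.continuous_pull_base (f := f.tot) (E := PtFam Y.Total))
  continuous_symm := Tot.continuous_to_pull (f := f.tot) (E := PtFam Y.Total)
    Tot.isInducing_base.continuous
    (Tot.isInducing_base.continuous_iff.2 (Continuous.comp (g := f.tot) f.continuous
      Tot.isInducing_base.continuous))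
  equivariant _ _ _ := rfl

end

section

variable {𝒢₁ : GroupBundle.{u, v} B} {𝒢₂ : GroupBundle.{u, v'} B} {𝒢₃ : GroupBundle.{u, v''} B}
  {𝒢₄ : GroupBundle.{u, v'''} B} {γ : 𝒢₁.Hom 𝒢₂} {δ : 𝒢₂.Hom 𝒢₄} {γ' : 𝒢₁.Hom 𝒢₃}
  {δ' : 𝒢₃.Hom 𝒢₄} {X : GSpace.{u, v, w} 𝒢₁} {Y : GSpace.{u, v', w'} 𝒢₂}
  {Y' : GSpace.{u, v'', w''} 𝒢₃} {Z : GSpace.{u, v''', w'''} 𝒢₄}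

/-- Pull-backs along the two sides of a commutative square agree. -/
def pullSquare (f : GSpace.Hom γ X Y) (g : GSpace.Hom δ Y Z) (f' : GSpace.Hom γ' X Y')
    (g' : GSpace.Hom δ' Y' Z)
    (hγ : ∀ b k, δ.toFun b (γ.toFun b k) = δ'.toFun b (γ'.toFun b k))
    (hf : ∀ x, g.tot (f.tot x) = g'.tot (f'.tot x)) (E : EquivVB Z) :
    Iso ((E.pull g).pull f) ((E.pull g').pull f') where
  toEquiv x := E.cast (hf x)
  continuous := by
    refine Tot.continuous_to_pull (f := f'.tot) (E := PullFam g'.tot E.fiber)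
      (Tot.continuous_pull_base (f := f.tot) (E := PullFam g.tot E.fiber))
      (Tot.continuous_to_pull (f := g'.tot) (E := E.fiber)
        (Continuous.comp (g := f'.tot) f'.continuous
          (Tot.continuous_pull_base (f := f.tot) (E := PullFam g.tot E.fiber))) ?_)
    refine ((Tot.continuous_pull_pt (f := g.tot) (E := E.fiber)).comp
      (Tot.continuous_pull_pt (f := f.tot) (E := PullFam g.tot E.fiber)) : Continuous
      fun e : Tot (PullFam f.tot (PullFam g.tot E.fiber)) =>
        (⟨g.tot (f.tot e.base), e.pt⟩ : Tot E.fiber)).congr fun e => ?_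
    exact (E.mk_cast (hf e.base) _).symm
  continuous_symm := by
    refine Tot.continuous_to_pull (f := f.tot) (E := PullFam g.tot E.fiber)
      (Tot.continuous_pull_base (f := f'.tot) (E := PullFam g'.tot E.fiber))
      (Tot.continuous_to_pull (f := g.tot) (E := E.fiber)
        (Continuous.comp (g := f.tot) f.continuous
          (Tot.continuous_pull_base (f := f'.tot) (E := PullFam g'.tot E.fiber))) ?_)
    refine ((Tot.continuous_pull_pt (f := g'.tot) (E := E.fiber)).comp
      (Tot.continuous_pull_pt (f := f'.tot) (E := PullFam g'.tot E.fiber)) : Continuous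
      fun e : Tot (PullFam f'.tot (PullFam g'.tot E.fiber)) =>
        (⟨g'.tot (f'.tot e.base), e.pt⟩ : Tot E.fiber)).congr fun e => ?_
    exact (E.mk_cast_symm (hf e.base) _).symm
  equivariant {b} k x e := by
    have h1 : (⟨g.tot (f.tot ⟨b, k • x⟩), ((E.pull g).pull f).act k x e⟩ : Tot E.fiber) =
        ⟨_, E.act (δ.toFun b (γ.toFun b k)) (g.toFun b (f.toFun b x)) e⟩ := by
      refine Eq.trans ?_ (mk_pull_act g E (γ.toFun b k) (f.toFun b x) e)
      exact congrArg (fun z : Tot (PullFam g.tot E.fiber) => (⟨g.tot z.base, z.pt⟩ : Tot E.fiber))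
        (mk_pull_act f (E.pull g) k x e)
    have h2 : (⟨g'.tot (f'.tot ⟨b, k • x⟩),
        ((E.pull g').pull f').act k x (E.cast (hf ⟨b, x⟩) e)⟩ : Tot E.fiber) =
        ⟨_, E.act (δ'.toFun b (γ'.toFun b k)) (g'.toFun b (f'.toFun b x))
          (E.cast (hf ⟨b, x⟩) e)⟩ := by
      refine Eq.trans ?_ (mk_pull_act g' E (γ'.toFun b k) (f'.toFun b x) _)
      exact congrArg (fun z : Tot (PullFam g'.tot E.fiber) => (⟨g'.tot z.base, z.pt⟩ : Tot E.fiber))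
        (mk_pull_act f' (E.pull g') k x _)
    have h3 := E.act_congr (hγ b k) (E.mk_cast (hf ⟨b, x⟩) e).symm
    have h4 := (E.mk_cast (hf ⟨b, k • x⟩) (((E.pull g).pull f).act k x e)).trans
      (h1.trans (h3.trans h2.symm))
    exact eq_of_heq (Tot.mk.inj h4).2

end

end EquivVB

/-! ### The `K`-groups -/

section

variable {B : Type u} [TopologicalSpace B] {𝒢 : GroupBundle.{u, v} B} {𝒢' : GroupBundle.{u, v'} B}
  {γ : 𝒢.Hom 𝒢'} {X : GSpace.{u, v, w} 𝒢} {Y : GSpace.{u, v', w'} 𝒢'}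

/-- The pull-back homomorphism on isomorphism classes of equivariant vector bundles. -/
def EquivVB.Classes.map (f : GSpace.Hom γ X Y) : EquivVB.Classes Y →+ EquivVB.Classes X where
  toFun := Quotient.map (EquivVB.pull f) fun _ _ h => h.elim fun i => ⟨i.pull f⟩
  map_zero' := Quotient.sound ⟨EquivVB.pullZero f⟩
  map_add' := by
    rintro ⟨E⟩ ⟨F⟩
    exact Quotient.sound ⟨EquivVB.pullSum f E F⟩

/-- The group completion of the monoid of isomorphism classes of `𝒢`-equivariant vector bundles
on `Y`. For `Y` compact this is the equivariant `K`-group `K⁰_𝒢(Y)`. -/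
abbrev KVect (Y : GSpace.{u, v, w} 𝒢) : Type (max u v w 1) :=
  Algebra.GrothendieckAddGroup (EquivVB.Classes Y)

/-- The class `[E]` of an equivariant vector bundle. -/
noncomputable def KVect.mk (E : EquivVB Y) : KVect Y :=
  Algebra.GrothendieckAddGroup.of E.toClass

/-- The pull-back homomorphism `[E] ↦ [f^* E]`. -/
noncomputable def KVect.map (f : GSpace.Hom γ X Y) : KVect Y →+ KVect X :=
  Algebra.GrothendieckAddGroup.lift
    (Algebra.GrothendieckAddGroup.of.comp (EquivVB.Classes.map f))

theorem KVect.map_mk (f : GSpace.Hom γ X Y) (E : EquivVB Y) :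
    KVect.map f (KVect.mk E) = KVect.mk (E.pull f) :=
  DFunLike.congr_fun (Algebra.GrothendieckAddGroup.lift.symm_apply_apply
    (Algebra.GrothendieckAddGroup.of.comp (EquivVB.Classes.map f))) E.toClass

theorem KVect.hom_ext {A : Type*} [AddCommGroup A] {φ ψ : KVect Y →+ A}
    (h : ∀ E, φ (KVect.mk E) = ψ (KVect.mk E)) : φ = ψ := by
  apply Algebra.GrothendieckAddGroup.lift.symm.injective
  ext ⟨E⟩
  exact h E

end

section

variable {B : Type u} [TopologicalSpace B]
  {𝒢₁ : GroupBundle.{u, v} B} {𝒢₂ : GroupBundle.{u, v'} B} {𝒢₃ : GroupBundle.{u, v''} B}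
  {𝒢₄ : GroupBundle.{u, v'''} B} {γ : 𝒢₁.Hom 𝒢₂} {δ : 𝒢₂.Hom 𝒢₄} {γ' : 𝒢₁.Hom 𝒢₃}
  {δ' : 𝒢₃.Hom 𝒢₄} {X : GSpace.{u, v, w} 𝒢₁} {Y : GSpace.{u, v', w'} 𝒢₂}
  {Y' : GSpace.{u, v'', w''} 𝒢₃} {Z : GSpace.{u, v''', w'''} 𝒢₄}

theorem KVect.map_square (f : GSpace.Hom γ X Y) (g : GSpace.Hom δ Y Z) (f' : GSpace.Hom γ' X Y')
    (g' : GSpace.Hom δ' Y' Z)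
    (hγ : ∀ b k, δ.toFun b (γ.toFun b k) = δ'.toFun b (γ'.toFun b k))
    (hf : ∀ x, g.tot (f.tot x) = g'.tot (f'.tot x)) (a : KVect Z) :
    KVect.map f (KVect.map g a) = KVect.map f' (KVect.map g' a) := by
  refine DFunLike.congr_fun (f := (KVect.map f).comp (KVect.map g))
    (g := (KVect.map f').comp (KVect.map g')) (KVect.hom_ext fun E => ?_) a
  simp only [AddMonoidHom.comp_apply, KVect.map_mk]
  exact congrArg Algebra.GrothendieckAddGroup.of
    (Quotient.sound ⟨EquivVB.pullSquare f g f' g' hγ hf E⟩)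

end

section

variable {B : Type u} [TopologicalSpace B] [CompactSpace B] [T2Space B]
  {𝒢 : GroupBundle.{u, v} B} {𝒢' : GroupBundle.{u, v'} B}
  {γ : 𝒢.Hom 𝒢'} {X : GSpace.{u, v, w} 𝒢} {Y : GSpace.{u, v', w'} 𝒢'}

/-- The equivariant `K`-group of a locally compact space `Y` over the compact space `B`:
`K⁰_𝒢(Y) = ker (K⁰_𝒢(Y⁺) → K⁰_𝒢(B))`, the map being the restriction to the section at infinity. -/
noncomputable def K0 (Y : GSpace.{u, v, w} 𝒢) : AddSubgroup (KVect Y.plus) :=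
  (KVect.map Y.infty).ker

/-- The identity of `B` is equivariant along every morphism. -/
def GSpace.baseMap (γ : 𝒢.Hom 𝒢') : GSpace.Hom γ (GSpace.base 𝒢) (GSpace.base 𝒢') where
  toFun _ x := x
  continuous := continuous_id
  map_smul _ _ _ := rfl

/-- The homomorphism `K⁰_𝒢'(Y) → K⁰_𝒢(X)` given by pull-back along the extension `X⁺ → Y⁺` of a
proper map `X → Y`. -/
noncomputable def K0.map (f : GSpace.Hom γ X Y) (hf : f.Proper) : K0 Y →+ K0 X :=
  ((KVect.map (f.plus hf)).comp (K0 Y).subtype).codRestrict (K0 X) fun a => by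
    have h := KVect.map_square X.infty (f.plus hf) (GSpace.baseMap γ) Y.infty
      (fun _ _ => rfl) (fun _ => rfl) (a : KVect Y.plus)
    have ha : KVect.map Y.infty (a : KVect Y.plus) = 0 := a.2
    rw [ha, map_zero] at h
    exact h

end

/-! ### The orbit bundle -/

/-- The data `(E, q)` identify the vector bundle `E` over `X/ℋ` with the orbit space `F/ℋ`:
the map `q : F → E` is equivariant along `𝒢 × ℋ → 𝒢`, covers `X → X/ℋ`, is a linear isomorphism
on each fibre, identifies exactly the points of each `ℋ`-orbit and is a topological quotient
map. -/
structure OrbitBundle {B : Type u} [TopologicalSpace B] {𝒢 : GroupBundle.{u, v} B}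
    {ℋ : GroupBundle.{u, v'} B} {X : GSpace.{u, max v v', w} (𝒢.prod ℋ)} (F : EquivVB X)
    (E : EquivVB X.quot) where
  q : ∀ x : X.Total, F.fiber x ≃ₗ[ℂ] E.fiber (X.quotMap.tot x)
  equivariant : ∀ {b : B} (g : 𝒢.fiber b) (h : ℋ.fiber b) (x : X.fiber b) (e : F.fiber ⟨b, x⟩),
    (⟨_, q _ (F.act (GroupBundle.pair g h) x e)⟩ : Tot E.fiber) =
      ⟨_, E.act g (X.quotMk b x) (q _ e)⟩
  orbits : ∀ {b : B} (x x' : X.fiber b) (e : F.fiber ⟨b, x⟩) (e' : F.fiber ⟨b, x'⟩),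
    (⟨_, q _ e⟩ : Tot E.fiber) = ⟨_, q _ e'⟩ ↔ ∃ h : ℋ.fiber b,
      (⟨⟨b, GroupBundle.pair (𝒢 := 𝒢) 1 h • x⟩, F.act (GroupBundle.pair 1 h) x e⟩ : Tot F.fiber) =
        ⟨⟨b, x'⟩, e'⟩
  isQuotientMap : IsQuotientMap fun e : Tot F.fiber => (⟨_, q _ e.pt⟩ : Tot E.fiber)

/-!
Equivariant vector bundles over a free quotient.

Let `ℋ` act freely on `X`. The theorem rests on one fact, `EquivVB.exists_split_over`: over a closed
set of points with trivial `ℋ`-stabilizer in a compact `𝒢 × ℋ`-space each equivariant vector bundle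
`R` is a direct summand of the pull-back of a `𝒢`-equivariant bundle `W` over `B`. To prove it, let
`e` be a vector of `R` over a point `z` with trivial stabilizer. A coordinate functional, multiplied
by a bump function concentrated near `z` and averaged over `ℋ`, is an `ℋ`-invariant family `λ` of
functionals that does not vanish on `e` (`EquivVB.exists_invFunctional_ne_zero`). The functions
`g ↦ λ (g e)` on the fibres of `𝒢` are then smoothed by convolution with matrix coefficients, which
by the Peter–Weyl theorem (`eq_zero_of_forall_irredRep`) do not all
kill them. Finite holonomy of `𝒢` enters here: the matrix coefficients of the representations in a
compact open subset of the representation covering form locally constant finite dimensional spaces of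
functions, stable under translations, hence a `𝒢`-equivariant vector bundle over `B`. Finitely many
such morphisms are combined to an embedding, and averaging yields a splitting.

Bundles of the form `f^* W`, for `f` the quotient map `X → X/ℋ` or its extension
`X⁺ → (X/ℋ)⁺`, have the property that morphisms between them descend (`EquivVB.Mor.descend`), since
`f` is an open quotient map whose fibres are the `ℋ`-orbits. In particular idempotents descend, and so
do direct summands (`EquivVB.exists_descend`). For compact `X` this shows that pull-back is bijective
on isomorphism classes of bundles, and that the inverse is the orbit bundle.

For locally compact `X` the points at infinity of `X⁺` are not free, and only the formal differences
`[E] - [F]` of bundles that are isomorphic at infinity descend. For surjectivity, the isomorphism at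
infinity is extended to a morphism `φ : E → F` with an inverse up to a cut-off function, and
`EquivVB.exists_clutch` replaces `E` and `F` by bundles that are direct summands of pull-backs from
`B`, using that `E` and `F` are such summands away from infinity. For injectivity, a stable isomorphism
between the pull-backs of `E` and `F` is made to agree with the given isomorphism near infinity; the
obstruction, an automorphism over the section at infinity, is removed by adding its inverse and
applying the Whitehead lemma (`EquivVB.exists_whitehead`, `EquivVB.exists_iso_extending`). The
additional summand is then absorbed in a bundle pulled back from `B` (`EquivVB.absorbIso`).

Naturality holds because pull-backs along the two sides of a commutative square agree, and
`X ×_B W` is a space with free `ℋ`-action to which the previous results apply.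
-/

set_option linter.unusedSectionVars false

/-! ### Continuity in local coordinates of a vector bundle -/

namespace VBundle

variable {T : Type u} [TopologicalSpace T]

/-- A local trivialization of a vector bundle. -/
structure Chart (E : VBundle T) where
  n : ℕ
  U : Set T
  φ : ∀ t : U, E.fiber t ≃ₗ[ℂ] (Fin n → ℂ)
  isOpen : IsOpen U
  isHomeomorph : IsHomeomorph (Tot.trivMap U fun t => φ t)

theorem exists_chart (E : VBundle T) (t : T) : ∃ c : E.Chart, t ∈ c.U := by
  obtain ⟨n, U, φ, hU, ht, h⟩ := E.locTriv t
  exact ⟨⟨n, U, φ, hU, h⟩, ht⟩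

namespace Chart

variable {E : VBundle T} (c : E.Chart)

open Classical in
/-- The coordinates in a chart, extended by zero. -/
noncomputable def co (t : T) : E.fiber t →ₗ[ℂ] (Fin c.n → ℂ) :=
  if h : t ∈ c.U then (c.φ ⟨t, h⟩).toLinearMap else 0

open Classical in
/-- The vector with given coordinates in a chart, extended by zero. -/
noncomputable def sec (t : T) : (Fin c.n → ℂ) →ₗ[ℂ] E.fiber t :=
  if h : t ∈ c.U then (c.φ ⟨t, h⟩).symm.toLinearMap else 0

theorem co_of_mem {t : T} (h : t ∈ c.U) (v : E.fiber t) : c.co t v = c.φ ⟨t, h⟩ v := by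
  simp [co, h]

theorem sec_of_mem {t : T} (h : t ∈ c.U) (x : Fin c.n → ℂ) :
    c.sec t x = (c.φ ⟨t, h⟩).symm x := by
  simp [sec, h]

theorem co_sec {t : T} (h : t ∈ c.U) (x : Fin c.n → ℂ) : c.co t (c.sec t x) = x := by
  rw [c.co_of_mem h, c.sec_of_mem h, LinearEquiv.apply_symm_apply]

theorem sec_co {t : T} (h : t ∈ c.U) (v : E.fiber t) : c.sec t (c.co t v) = v := by
  rw [c.co_of_mem h, c.sec_of_mem h, LinearEquiv.symm_apply_apply]

theorem isOpen_mem : IsOpen {e : Tot E.fiber | e.base ∈ c.U} :=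
  c.isOpen.preimage E.continuous_base

theorem nhds_eq {e : Tot E.fiber} (he : e.base ∈ c.U) :
    𝓝 e = Filter.comap (fun e => (e.base, c.co e.base e.pt)) (𝓝 (e.base, c.co e.base e.pt)) := by
  have h := (Tot.isHomeomorph_trivMap_iff (fun t => (c.φ t).bijective)).1 c.isHomeomorph
  have hfun : (fun e : {e : Tot E.fiber // e.base ∈ c.U} =>
      ((e.1.base, c.φ ⟨e.1.base, e.2⟩ e.1.pt) : T × (Fin c.n → ℂ))) =
      (fun e => (e.base, c.co e.base e.pt)) ∘ Subtype.val := by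
    funext e
    simp only [Function.comp, c.co_of_mem e.2]
  rw [hfun] at h
  have h1 := h.nhds_eq_comap ⟨e, he⟩
  rw [nhds_subtype_eq_comap, ← Filter.comap_comap] at h1
  have hS : {e : Tot E.fiber | e.base ∈ c.U} ∈ 𝓝 e := c.isOpen_mem.mem_nhds he
  have hS' : {e : Tot E.fiber | e.base ∈ c.U} ∈
      Filter.comap (fun e => (e.base, c.co e.base e.pt)) (𝓝 (e.base, c.co e.base e.pt)) :=
    ⟨Prod.fst ⁻¹' c.U, (c.isOpen.preimage continuous_fst).mem_nhds he, fun _ h => h⟩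
  have h2 := congrArg (Filter.map Subtype.val) h1
  rw [Filter.map_comap, Filter.map_comap, Subtype.range_coe_subtype] at h2
  rw [inf_eq_left.2 (Filter.le_principal_iff.2 hS)] at h2
  exact h2.trans (inf_eq_left.2 (Filter.le_principal_iff.2 hS'))

theorem continuousAt_iff {Z : Type*} [TopologicalSpace Z] {h : Z → Tot E.fiber} {z : Z}
    (hz : (h z).base ∈ c.U) :
    ContinuousAt h z ↔ ContinuousAt (fun z => (h z).base) z ∧
      ContinuousAt (fun z => c.co (h z).base (h z).pt) z := by
  rw [ContinuousAt, c.nhds_eq hz, Filter.tendsto_comap_iff, nhds_prod_eq, Filter.tendsto_prod_iff']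
  rfl

theorem continuousAt_co {e : Tot E.fiber} (he : e.base ∈ c.U) :
    ContinuousAt (fun e : Tot E.fiber => c.co e.base e.pt) e :=
  ((c.continuousAt_iff (h := id) he).1 continuousAt_id).2

theorem continuousAt_sec {t : T} (ht : t ∈ c.U) (x : Fin c.n → ℂ) :
    ContinuousAt (fun t => (⟨t, c.sec t x⟩ : Tot E.fiber)) t := by
  refine (c.continuousAt_iff ht).2 ⟨continuousAt_id, ?_⟩
  refine ContinuousAt.congr (f := fun _ => x) continuousAt_const ?_
  filter_upwards [c.isOpen.mem_nhds ht] with t' ht'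
  exact (c.co_sec ht' x).symm

theorem eq_sum_sec {t : T} (h : t ∈ c.U) (v : E.fiber t) :
    v = ∑ i, c.co t v i • c.sec t (Pi.single i 1) := by
  conv_lhs => rw [← c.sec_co h v, pi_eq_sum_univ' (c.co t v)]
  rw [map_sum]
  exact Finset.sum_congr rfl fun i _ => by rw [map_smul]

end Chart

section sections

variable {E : VBundle T} {Z : Type*} [TopologicalSpace Z] {f : Z → T} {z : Z}

theorem continuousAt_base {s : ∀ z, E.fiber (f z)}
    (h : ContinuousAt (fun z => (⟨f z, s z⟩ : Tot E.fiber)) z) : ContinuousAt f z :=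
  E.continuous_base.continuousAt.comp h

theorem continuousAt_zero (E : VBundle T) (hf : ContinuousAt f z) :
    ContinuousAt (fun z => (⟨f z, 0⟩ : Tot E.fiber)) z := by
  obtain ⟨c, hc⟩ := E.exists_chart (f z)
  refine (c.continuousAt_iff hc).2 ⟨hf, ?_⟩
  simp only [map_zero]
  exact continuousAt_const

theorem continuousAt_add {s s' : ∀ z, E.fiber (f z)}
    (h : ContinuousAt (fun z => (⟨f z, s z⟩ : Tot E.fiber)) z)
    (h' : ContinuousAt (fun z => (⟨f z, s' z⟩ : Tot E.fiber)) z) :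
    ContinuousAt (fun z => (⟨f z, s z + s' z⟩ : Tot E.fiber)) z := by
  obtain ⟨c, hc⟩ := E.exists_chart (f z)
  refine (c.continuousAt_iff hc).2 ⟨continuousAt_base h, ?_⟩
  simp only [map_add]
  exact ((c.continuousAt_iff hc).1 h).2.add ((c.continuousAt_iff hc).1 h').2

theorem continuousAt_smul {s : ∀ z, E.fiber (f z)} {a : Z → ℂ} (ha : ContinuousAt a z)
    (h : ContinuousAt (fun z => (⟨f z, s z⟩ : Tot E.fiber)) z) :
    ContinuousAt (fun z => (⟨f z, a z • s z⟩ : Tot E.fiber)) z := by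
  obtain ⟨c, hc⟩ := E.exists_chart (f z)
  refine (c.continuousAt_iff hc).2 ⟨continuousAt_base h, ?_⟩
  simp only [map_smul]
  exact ha.smul ((c.continuousAt_iff hc).1 h).2

theorem continuousAt_sum {ι : Type*} (S : Finset ι) (hf : ContinuousAt f z)
    {s : ι → ∀ z, E.fiber (f z)}
    (h : ∀ i ∈ S, ContinuousAt (fun z => (⟨f z, s i z⟩ : Tot E.fiber)) z) :
    ContinuousAt (fun z => (⟨f z, ∑ i ∈ S, s i z⟩ : Tot E.fiber)) z := by
  classical
  induction S using Finset.induction_on with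
  | empty => simpa using continuousAt_zero E hf
  | insert i S hi ih =>
    simp only [Finset.sum_insert hi]
    exact continuousAt_add (h i (Finset.mem_insert_self _ _))
      (ih fun j hj => h j (Finset.mem_insert_of_mem hj))

end sections

/-! ### Families of linear maps between the fibres -/

section families

variable {A C D : VBundle T}

/-- The map of total spaces given by a family of linear maps of the fibres. -/
def totMap (L : ∀ t, A.fiber t →ₗ[ℂ] C.fiber t) (e : Tot A.fiber) : Tot C.fiber :=
  ⟨e.base, L e.base e.pt⟩

/-- The family of linear maps is continuous on the fibre over `t`. -/
def ContAt (L : ∀ t, A.fiber t →ₗ[ℂ] C.fiber t) (t : T) : Prop :=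
  ∀ e : Tot A.fiber, e.base = t → ContinuousAt (totMap L) e

theorem continuous_totMap_iff {L : ∀ t, A.fiber t →ₗ[ℂ] C.fiber t} :
    Continuous (totMap L) ↔ ∀ t, ContAt L t :=
  ⟨fun h _ _ _ => h.continuousAt, fun h => continuous_iff_continuousAt.2 fun e => h _ e rfl⟩

theorem ContAt.apply {L : ∀ t, A.fiber t →ₗ[ℂ] C.fiber t} {Z : Type*} [TopologicalSpace Z]
    {f : Z → T} {z : Z} {s : ∀ z, A.fiber (f z)} (hL : ContAt L (f z))
    (h : ContinuousAt (fun z => (⟨f z, s z⟩ : Tot A.fiber)) z) :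
    ContinuousAt (fun z => (⟨f z, L (f z) (s z)⟩ : Tot C.fiber)) z :=
  ContinuousAt.comp (g := totMap L) (hL _ rfl) h

/-- Continuity can be checked on the sections of a local frame. -/
theorem contAt_iff_chart {L : ∀ t, A.fiber t →ₗ[ℂ] C.fiber t} (a : A.Chart) {t : T} (ht : t ∈ a.U) :
    ContAt L t ↔ ∀ x, ContinuousAt (fun t => (⟨t, L t (a.sec t x)⟩ : Tot C.fiber)) t := by
  refine ⟨fun h x => h.apply (f := id) (a.continuousAt_sec ht x), fun h => ?_⟩
  rintro e rfl
  have hb : ContinuousAt (fun e : Tot A.fiber => e.base) e := A.continuous_base.continuousAt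
  have h1 : ContinuousAt (fun e : Tot A.fiber => (⟨e.base, ∑ i, a.co e.base e.pt i •
      L e.base (a.sec e.base (Pi.single i 1))⟩ : Tot C.fiber)) e := by
    refine continuousAt_sum _ hb fun i _ => continuousAt_smul ?_ ?_
    · exact (continuous_apply i).continuousAt.comp (a.continuousAt_co ht)
    · exact ContinuousAt.comp (f := Tot.base)
        (g := fun t => (⟨t, L t (a.sec t (Pi.single i 1))⟩ : Tot C.fiber)) (h _) hb
  refine h1.congr ?_
  filter_upwards [a.isOpen_mem.mem_nhds ht] with e' he'
  change Tot.mk e'.base _ = Tot.mk e'.base _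
  conv_rhs => rw [a.eq_sum_sec he' e'.pt]
  simp only [map_sum, map_smul]

theorem ContAt.congr {L L' : ∀ t, A.fiber t →ₗ[ℂ] C.fiber t} {t : T} (h : ContAt L t)
    (hL : ∀ᶠ s in 𝓝 t, L s = L' s) : ContAt L' t := by
  rintro e rfl
  refine (h e rfl).congr ?_
  filter_upwards [A.continuous_base.continuousAt.eventually hL] with e' he'
  change Tot.mk _ _ = Tot.mk _ _
  rw [he']

theorem ContAt.comp {L : ∀ t, A.fiber t →ₗ[ℂ] C.fiber t} {L' : ∀ t, C.fiber t →ₗ[ℂ] D.fiber t}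
    {t : T} (h' : ContAt L' t) (h : ContAt L t) : ContAt (fun t => L' t ∘ₗ L t) t := by
  rintro e rfl
  exact ContinuousAt.comp (g := totMap L') (h' _ rfl) (h e rfl)

theorem ContAt.add {L L' : ∀ t, A.fiber t →ₗ[ℂ] C.fiber t} {t : T} (h : ContAt L t)
    (h' : ContAt L' t) : ContAt (fun t => L t + L' t) t := by
  rintro e rfl
  exact continuousAt_add (f := fun e : Tot A.fiber => e.base) (h e rfl) (h' e rfl)

theorem ContAt.smul {L : ∀ t, A.fiber t →ₗ[ℂ] C.fiber t} {t : T} {a : T → ℂ}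
    (ha : ContinuousAt a t) (h : ContAt L t) : ContAt (fun t => a t • L t) t := by
  rintro e rfl
  exact continuousAt_smul (f := fun e : Tot A.fiber => e.base)
    (ContinuousAt.comp (f := Tot.base) (g := a) ha A.continuous_base.continuousAt) (h e rfl)

theorem contAt_zero {t : T} : ContAt (fun t => (0 : A.fiber t →ₗ[ℂ] C.fiber t)) t := by
  rintro e rfl
  exact continuousAt_zero C A.continuous_base.continuousAt

theorem contAt_id {t : T} : ContAt (fun t => (LinearMap.id : A.fiber t →ₗ[ℂ] A.fiber t)) t :=
  fun _ _ => continuousAt_id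

/-- Multiplication by a function that vanishes near the points of discontinuity. -/
theorem contAt_smul_of_tsupport {L : ∀ t, A.fiber t →ₗ[ℂ] C.fiber t} {a : T → ℂ}
    (ha : Continuous a) (h : ∀ t ∈ tsupport a, ContAt L t) (t : T) :
    ContAt (fun t => a t • L t) t := by
  by_cases ht : t ∈ tsupport a
  · exact (h t ht).smul ha.continuousAt
  · refine contAt_zero.congr ?_
    filter_upwards [(isClosed_tsupport a).isOpen_compl.mem_nhds ht] with s hs
    rw [image_eq_zero_of_notMem_tsupport hs, zero_smul]

/-- A family of linear maps in charts. -/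
noncomputable def mat (L : ∀ t, A.fiber t →ₗ[ℂ] C.fiber t) (a : A.Chart) (c : C.Chart) (t : T) :
    (Fin a.n → ℂ) →L[ℂ] (Fin c.n → ℂ) :=
  LinearMap.toContinuousLinearMap (c.co t ∘ₗ L t ∘ₗ a.sec t)

theorem contAt_iff_mat {L : ∀ t, A.fiber t →ₗ[ℂ] C.fiber t} (a : A.Chart) (c : C.Chart) {t : T}
    (ha : t ∈ a.U) (hc : t ∈ c.U) : ContAt L t ↔ ContinuousAt (mat L a c) t := by
  rw [contAt_iff_chart a ha]
  have h1 : ∀ x, ContinuousAt (fun t => (⟨t, L t (a.sec t x)⟩ : Tot C.fiber)) t ↔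
      ContinuousAt (fun t => mat L a c t x) t := fun x =>
    (c.continuousAt_iff (h := fun t => (⟨t, L t (a.sec t x)⟩ : Tot C.fiber)) hc).trans
      (and_iff_right continuousAt_id)
  simp only [h1]
  refine ⟨fun h => ?_, fun h x => h.clm_apply continuousAt_const⟩
  have hsum : ∀ t, mat L a c t = ∑ i, (ContinuousLinearMap.proj (R := ℂ)
      (φ := fun _ : Fin a.n => ℂ) i).smulRight (mat L a c t (Pi.single i 1)) := by
    intro t
    refine ContinuousLinearMap.ext fun x => ?_
    conv_lhs => rw [pi_eq_sum_univ' x, map_sum]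
    simp only [map_smul, sum_apply, ContinuousLinearMap.smulRight_apply,
      ContinuousLinearMap.proj_apply]
  rw [show mat L a c = _ from funext hsum]
  refine tendsto_finsetSum _ fun i _ => ?_
  exact ((ContinuousLinearMap.smulRightL ℂ (Fin a.n → ℂ) (Fin c.n → ℂ)
    (ContinuousLinearMap.proj i)).continuous.continuousAt.comp (h (Pi.single i 1)) :)

theorem mat_bijective_iff {L : ∀ t, A.fiber t →ₗ[ℂ] C.fiber t} (a : A.Chart) (c : C.Chart) {t : T}
    (ha : t ∈ a.U) (hc : t ∈ c.U) :
    Function.Bijective (mat L a c t) ↔ Function.Bijective (L t) := by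
  have h : ⇑(mat L a c t) = c.φ ⟨t, hc⟩ ∘ L t ∘ (a.φ ⟨t, ha⟩).symm := by
    ext x
    simp [mat, c.co_of_mem hc, a.sec_of_mem ha]
  rw [h, EquivLike.comp_bijective, EquivLike.bijective_comp]

theorem exists_clequiv {n m : ℕ} {f : (Fin n → ℂ) →L[ℂ] (Fin m → ℂ)} (hf : Function.Bijective f) :
    ∃ e : (Fin n → ℂ) ≃L[ℂ] (Fin m → ℂ), (e : (Fin n → ℂ) →L[ℂ] (Fin m → ℂ)) = f :=
  ⟨(LinearEquiv.ofBijective f.toLinearMap hf).toContinuousLinearEquiv, by ext; rfl⟩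

/-- Invertibility is an open condition. -/
theorem ContAt.eventually_bijective {L : ∀ t, A.fiber t →ₗ[ℂ] C.fiber t} {t : T}
    (hL : ContAt L t) (h : Function.Bijective (L t)) : ∀ᶠ s in 𝓝 t, Function.Bijective (L s) := by
  obtain ⟨a, ha⟩ := A.exists_chart t
  obtain ⟨c, hc⟩ := C.exists_chart t
  have h1 := (contAt_iff_mat a c ha hc).1 hL
  obtain ⟨e, he⟩ := exists_clequiv ((mat_bijective_iff a c ha hc).2 h)
  have h2 := h1.eventually_mem (he ▸ e.nhds)
  filter_upwards [h2, a.isOpen.mem_nhds ha, c.isOpen.mem_nhds hc] with s hs has hcs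
  obtain ⟨e', he'⟩ := hs
  rw [← mat_bijective_iff a c has hcs, ← he']
  exact e'.bijective

/-- The inverse of a continuous family is continuous. -/
theorem ContAt.inverse {L : ∀ t, A.fiber t →ₗ[ℂ] C.fiber t} {L' : ∀ t, C.fiber t →ₗ[ℂ] A.fiber t}
    {t : T} (hL : ContAt L t) (h : ∀ᶠ s in 𝓝 t, L' s ∘ₗ L s = LinearMap.id)
    (h' : ∀ᶠ s in 𝓝 t, L s ∘ₗ L' s = LinearMap.id) : ContAt L' t := by
  obtain ⟨a, ha⟩ := A.exists_chart t
  obtain ⟨c, hc⟩ := C.exists_chart t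
  rw [contAt_iff_mat a c ha hc] at hL
  rw [contAt_iff_mat c a hc ha]
  have key : ∀ᶠ s in 𝓝 t, ∃ e : (Fin a.n → ℂ) ≃L[ℂ] (Fin c.n → ℂ),
      (e : (Fin a.n → ℂ) →L[ℂ] (Fin c.n → ℂ)) = mat L a c s ∧
      (e.symm : (Fin c.n → ℂ) →L[ℂ] (Fin a.n → ℂ)) = mat L' c a s := by
    filter_upwards [h, h', a.isOpen.mem_nhds ha, c.isOpen.mem_nhds hc] with s hs hs' has hcs
    have h1 : ∀ v, L' s (L s v) = v := fun v => LinearMap.congr_fun hs v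
    have h2 : ∀ v, L s (L' s v) = v := fun v => LinearMap.congr_fun hs' v
    refine ⟨ContinuousLinearEquiv.equivOfInverse (mat L a c s) (mat L' c a s) ?_ ?_, ?_, ?_⟩
    · intro x
      simp [mat, c.sec_co hcs, h1, a.co_sec has]
    · intro x
      simp [mat, a.sec_co has, h2, c.co_sec hcs]
    · ext; rfl
    · ext; rfl
  obtain ⟨e, he, -⟩ := key.self_of_nhds
  have h3 : ContinuousAt (fun s => (mat L a c s).inverse) t := by
    refine ContinuousAt.comp (g := ContinuousLinearMap.inverse) ?_ hL
    rw [← he]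
    exact (contDiffAt_map_inverse (𝕜 := ℂ) (n := 0) e).continuousAt
  refine h3.congr ?_
  filter_upwards [key] with s ⟨e', he1, he2⟩
  rw [← he1, ← he2, ContinuousLinearMap.inverse_equiv]

/-- A fibrewise injective family has a continuous left inverse near a given point. -/
theorem ContAt.exists_leftInverse {L : ∀ t, A.fiber t →ₗ[ℂ] C.fiber t} {t : T}
    (hL : ∀ᶠ s in 𝓝 t, ContAt L s) (h : Function.Injective (L t)) :
    ∃ R : ∀ t, C.fiber t →ₗ[ℂ] A.fiber t,
      ∀ᶠ s in 𝓝 t, ContAt R s ∧ R s ∘ₗ L s = LinearMap.id := by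
  obtain ⟨a, ha⟩ := A.exists_chart t
  obtain ⟨c, hc⟩ := C.exists_chart t
  obtain ⟨r, hr⟩ := (L t).exists_leftInverse_of_injective (LinearMap.ker_eq_bot.2 h)
  let ρ : (Fin c.n → ℂ) →ₗ[ℂ] (Fin a.n → ℂ) := a.co t ∘ₗ r ∘ₗ c.sec t
  let R₀ : ∀ t, C.fiber t →ₗ[ℂ] A.fiber t := fun s => a.sec s ∘ₗ ρ ∘ₗ c.co s
  have hR₀ : ∀ s, s ∈ a.U → s ∈ c.U → ContAt R₀ s := by
    intro s has hcs
    rw [contAt_iff_chart c hcs]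
    intro x
    refine ContinuousAt.congr (a.continuousAt_sec has (ρ x)) ?_
    filter_upwards [c.isOpen.mem_nhds hcs] with s' hs'
    simp [R₀, c.co_sec hs']
  let K : ∀ t, A.fiber t →ₗ[ℂ] A.fiber t := fun s => R₀ s ∘ₗ L s
  have hK : ∀ᶠ s in 𝓝 t, ContAt K s := by
    filter_upwards [hL, a.isOpen.mem_nhds ha, c.isOpen.mem_nhds hc] with s hs has hcs
    exact (hR₀ s has hcs).comp hs
  have hKt : K t = LinearMap.id := by
    ext v
    have : r (L t v) = v := LinearMap.congr_fun hr v
    simp [K, R₀, ρ, c.sec_co hc, a.sec_co ha, this]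
  have hb := (hK.self_of_nhds).eventually_bijective (by rw [hKt]; exact Function.bijective_id)
  classical
  let K' : ∀ t, A.fiber t →ₗ[ℂ] A.fiber t := fun s =>
    if hs : Function.Bijective (K s) then (LinearEquiv.ofBijective (K s) hs).symm.toLinearMap else 0
  have hK' : ∀ s, Function.Bijective (K s) → K' s ∘ₗ K s = LinearMap.id ∧
      K s ∘ₗ K' s = LinearMap.id := by
    intro s hs
    constructor
    · ext v
      simp only [K', hs, dif_pos, LinearMap.comp_apply, LinearEquiv.coe_coe, LinearMap.id_apply]
      exact (LinearEquiv.ofBijective (K s) hs).symm_apply_apply v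
    · ext v
      simp only [K', hs, dif_pos, LinearMap.comp_apply, LinearEquiv.coe_coe, LinearMap.id_apply]
      exact (LinearEquiv.ofBijective (K s) hs).apply_symm_apply v
  refine ⟨fun s => K' s ∘ₗ R₀ s, ?_⟩
  filter_upwards [hb.eventually_nhds, hK, a.isOpen.mem_nhds ha, c.isOpen.mem_nhds hc]
    with s hs hKs has hcs
  refine ⟨ContAt.comp (hKs.inverse ?_ ?_) (hR₀ s has hcs), ?_⟩
  · filter_upwards [hs] with s' hs' using (hK' s' hs').1
  · filter_upwards [hs] with s' hs' using (hK' s' hs').2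
  · exact (hK' s hs.self_of_nhds).1

end families

end VBundle

/-! ### Invariant integration over a compact group -/

section compactGroup

open MeasureTheory Measure

variable (K : Type*) [Group K] [TopologicalSpace K] [IsTopologicalGroup K] [CompactSpace K]
  [MeasurableSpace K] [BorelSpace K]

/-- The normalized Haar measure of a compact group. -/
noncomputable def normHaar : Measure K := haarMeasure ⊤

instance : IsHaarMeasure (normHaar K) := inferInstanceAs (IsHaarMeasure (haarMeasure ⊤))

instance : IsProbabilityMeasure (normHaar K) := ⟨haarMeasure_self (K₀ := ⊤)⟩

/-- A left invariant probability measure on a compact group is the Haar measure. -/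
theorem eq_normHaar (ν : Measure K) [IsProbabilityMeasure ν] [IsMulLeftInvariant ν] :
    ν = normHaar K := by
  have h := isMulInvariant_eq_smul_of_compactSpace ν (normHaar K)
  have h1 := congrArg (fun m : Measure K => m univ) h
  simp only [measure_univ, Measure.smul_apply, ENNReal.smul_def, smul_eq_mul, mul_one] at h1
  generalize haarScalarFactor ν (normHaar K) = r at h h1
  obtain rfl : r = 1 := by exact_mod_cast h1.symm
  rw [h, one_smul]

instance : IsMulRightInvariant (normHaar K) := by
  refine ⟨fun g => ?_⟩
  have : IsProbabilityMeasure (map (· * g) (normHaar K)) :=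
    Measure.isProbabilityMeasure_map (continuous_mul_const g).measurable.aemeasurable
  have : IsMulLeftInvariant (map (· * g) (normHaar K)) := by
    refine ⟨fun k => ?_⟩
    rw [map_map (continuous_const_mul k).measurable (continuous_mul_const g).measurable]
    have h : (k * ·) ∘ (· * g) = (· * g) ∘ (k * ·) := by
      ext x
      simp [mul_assoc]
    rw [h, ← map_map (continuous_mul_const g).measurable (continuous_const_mul k).measurable,
      map_mul_left_eq_self]
  exact eq_normHaar K _

instance : IsInvInvariant (normHaar K) := by
  refine ⟨?_⟩
  have : IsProbabilityMeasure (normHaar K).inv :=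
    Measure.isProbabilityMeasure_map continuous_inv.measurable.aemeasurable
  exact eq_normHaar K _

variable {K} {K' : Type*} [Group K'] [TopologicalSpace K'] [IsTopologicalGroup K']
  [CompactSpace K'] [MeasurableSpace K'] [BorelSpace K']

theorem integral_normHaar_equiv (e : K' ≃ₜ* K) (f : K → ℂ) :
    ∫ k, f (e k) ∂normHaar K' = ∫ k, f k ∂normHaar K := by
  have h : map e (normHaar K') = normHaar K := by
    have : IsProbabilityMeasure (map e (normHaar K')) :=
      Measure.isProbabilityMeasure_map e.continuous.measurable.aemeasurable
    exact eq_normHaar K _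
  rw [← h]
  exact (MeasureTheory.integral_map_equiv e.toHomeomorph.toMeasurableEquiv f).symm

theorem integrable_of_continuous {f : K → ℂ} (hf : Continuous f) (μ : Measure K)
    [IsFiniteMeasure μ] : Integrable f μ :=
  (BoundedContinuousFunction.mkOfCompact ⟨f, hf⟩).integrable μ

/-- The integral of a jointly continuous function over a compact group is continuous. -/
theorem continuous_integral_compact {Z : Type*} [TopologicalSpace Z] {F : Z → K → ℂ}
    (hF : Continuous fun z : Z × K => F z.1 z.2) (μ : Measure K) [IsFiniteMeasure μ] :
    Continuous fun z => ∫ k, F z k ∂μ := by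
  let c : C(Z, C(K, ℂ)) := ContinuousMap.curry ⟨_, hF⟩
  let I : C(K, ℂ) → ℂ := fun f => ∫ k, f k ∂μ
  have hI : Continuous I := by
    refine LipschitzWith.continuous (K := (μ.real univ).toNNReal) ?_
    refine LipschitzWith.of_dist_le_mul fun f g => ?_
    rw [dist_eq_norm, dist_eq_norm, Real.coe_toNNReal _ measureReal_nonneg,
      ← integral_sub (integrable_of_continuous f.continuous μ)
        (integrable_of_continuous g.continuous μ), mul_comm]
    exact norm_integral_le_of_norm_le_const (Filter.Eventually.of_forall fun k =>
      (f - g).norm_coe_le_norm k)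
  exact hI.comp c.continuous

/-! ### Integration of functions with values in a finite dimensional space -/

variable {V V' : Type*} [AddCommGroup V] [Module ℂ V] [Module.Finite ℂ V]
  [AddCommGroup V'] [Module ℂ V'] [Module.Finite ℂ V']

/-- A function with values in a finite dimensional space is continuous in coordinates. -/
def FinCont (v : K → V) : Prop := ∀ ℓ : Module.Dual ℂ V, Continuous fun k => ℓ (v k)

variable (K) in
/-- The integral of a function with values in a finite dimensional space. It is defined with
a basis and characterized by `dual_vint`. -/
noncomputable def vint (v : K → V) : V :=
  (Module.finBasis ℂ V).equivFun.symm fun i =>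
    ∫ k, (Module.finBasis ℂ V).coord i (v k) ∂normHaar K

theorem dual_vint {v : K → V} (hv : FinCont v) (ℓ : Module.Dual ℂ V) :
    ℓ (vint K v) = ∫ k, ℓ (v k) ∂normHaar K := by
  set b := Module.finBasis ℂ V
  have h : ∀ x, ℓ x = ∑ i, b.coord i x * ℓ (b i) := by
    intro x
    conv_lhs => rw [← b.sum_repr x, _root_.map_sum]
    simp
  rw [h]
  simp only [h (v _)]
  rw [integral_finsetSum _ fun i _ =>
    (integrable_of_continuous (hv (b.coord i)) _).mul_const _]
  refine Finset.sum_congr rfl fun i _ => ?_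
  rw [integral_mul_const]
  congr 1
  rw [vint, Module.Basis.coord_apply, Module.Basis.equivFun_symm_apply, b.repr_sum_self]

theorem dual_ext {x y : V} (h : ∀ ℓ : Module.Dual ℂ V, ℓ x = ℓ y) : x = y :=
  (Module.forall_dual_apply_eq_zero_iff ℂ (x - y)).1 (fun ℓ => by rw [map_sub, h, sub_self]) |>
    sub_eq_zero.1

theorem FinCont.map {v : K → V} (hv : FinCont v) (L : V →ₗ[ℂ] V') : FinCont fun k => L (v k) :=
  fun ℓ => hv (ℓ ∘ₗ L)

theorem map_vint {v : K → V} (hv : FinCont v) (L : V →ₗ[ℂ] V') :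
    L (vint K v) = vint K fun k => L (v k) :=
  dual_ext fun ℓ => by
    rw [dual_vint (hv.map L)]
    exact dual_vint hv (ℓ ∘ₗ L)

theorem vint_const (x : V) : vint K (fun _ => x) = x :=
  dual_ext fun ℓ => by simp [dual_vint (fun ℓ => continuous_const)]

theorem FinCont.comp {v : K → V} (hv : FinCont v) {f : K' → K} (hf : Continuous f) :
    FinCont fun k => v (f k) := fun ℓ => (hv ℓ).comp hf

theorem vint_mul_right {v : K → V} (hv : FinCont v) (g : K) :
    vint K (fun k => v (k * g)) = vint K v :=
  dual_ext fun ℓ => by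
    rw [dual_vint hv, dual_vint (hv.comp (continuous_mul_const g))]
    exact integral_mul_right_eq_self (fun k => ℓ (v k)) g

theorem vint_smul_const {a : K → ℂ} (ha : Continuous a) (x : V) :
    vint K (fun k => a k • x) = (∫ k, a k ∂normHaar K) • x :=
  dual_ext fun ℓ => by
    rw [dual_vint fun ℓ => by
      simpa only [map_smul] using! ha.smul continuous_const]
    simp [integral_mul_const]

theorem vint_add {v v' : K → V} (hv : FinCont v) (hv' : FinCont v') :
    vint K (fun k => v k + v' k) = vint K v + vint K v' :=
  dual_ext fun ℓ => by
    rw [_root_.map_add, dual_vint hv, dual_vint hv', dual_vint fun ℓ => by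
      simpa only [_root_.map_add] using! (hv ℓ).add (hv' ℓ)]
    simp only [_root_.map_add]
    exact integral_add (integrable_of_continuous (hv ℓ) _) (integrable_of_continuous (hv' ℓ) _)

end compactGroup

/-! ### Integration along the fibres of a bundle of compact groups -/

namespace GroupTriv

variable {B : Type u} [TopologicalSpace B] {𝒢 : GroupBundle.{u, v} B}

theorem isInducing_φ (t : GroupTriv 𝒢.fiber 𝒢.model) (b : t.U) : IsInducing (t.φ b) := by
  have h := (Tot.isHomeomorph_trivMap_iff (fun b => (t.φ b).bijective)).1 t.isHomeomorph
  let c : 𝒢.fiber b.1 → {e : Tot 𝒢.fiber // e.base ∈ t.U} := fun g => ⟨⟨b, g⟩, b.2⟩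
  have hc : IsInducing c := by
    have h1 : IsInducing (Subtype.val ∘ c) := ⟨rfl⟩
    exact (IsInducing.subtypeVal.of_comp_iff).1 h1
  have h2 := h.comp hc
  have h3 : IsInducing (Prod.mk b.1 : 𝒢.model → B × 𝒢.model) :=
    IsInducing.of_comp (g := Prod.snd) (by fun_prop) (by fun_prop) IsInducing.id
  exact (h3.of_comp_iff (f := t.φ b)).1 h2

/-- A trivialization of a bundle of groups over a fibre. -/
def fiberEquiv (t : GroupTriv 𝒢.fiber 𝒢.model) (b : t.U) : 𝒢.fiber b.1 ≃ₜ* 𝒢.model where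
  toMulEquiv := t.φ b
  continuous_toFun := (t.isInducing_φ b).continuous
  continuous_invFun := by
    rw [(t.isInducing_φ b).continuous_iff]
    exact continuous_id.congr fun x => ((t.φ b).apply_symm_apply x).symm

end GroupTriv

namespace GroupBundle

variable {B : Type u} [TopologicalSpace B] (𝒢 : GroupBundle.{u, v} B)

theorem fiberTop_eq {𝒢 : GroupBundle.{u, v} B} (t : GroupTriv 𝒢.fiber 𝒢.model) {b : B}
    (hb : b ∈ t.U) : 𝒢.fiberTop b = TopologicalSpace.induced (t.φ ⟨b, hb⟩) inferInstance :=
  (t.isInducing_φ ⟨b, hb⟩).eq_induced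

instance (b : B) : IsTopologicalGroup (𝒢.fiber b) := by
  obtain ⟨t, ht⟩ := 𝒢.exists_triv b
  rw [fiberTop_eq t ht]
  exact topologicalGroup_induced (t.φ ⟨b, ht⟩)

instance (b : B) : CompactSpace (𝒢.fiber b) := by
  obtain ⟨t, ht⟩ := 𝒢.exists_triv b
  exact (t.fiberEquiv ⟨b, ht⟩).toHomeomorph.symm.compactSpace

instance (b : B) : T2Space (𝒢.fiber b) := by
  obtain ⟨t, ht⟩ := 𝒢.exists_triv b
  exact (t.fiberEquiv ⟨b, ht⟩).toHomeomorph.symm.t2Space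

instance (b : B) : MeasurableSpace (𝒢.fiber b) := borel _

instance (b : B) : BorelSpace (𝒢.fiber b) := ⟨rfl⟩

instance : MeasurableSpace 𝒢.model := borel _

instance : BorelSpace 𝒢.model := ⟨rfl⟩

variable {𝒢} {Z : Type*} [TopologicalSpace Z] {β : Z → B}

theorem isInducing_fiber_mk (z : Z) :
    IsInducing fun g : 𝒢.fiber (β z) => (⟨z, g⟩ : Tot (PullFam β 𝒢.fiber)) := by
  refine Tot.isInducing_pullEmb.of_comp_iff.1 ?_
  have h : IsInducing fun g : 𝒢.fiber (β z) => (⟨β z, g⟩ : Tot 𝒢.fiber) := ⟨rfl⟩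
  exact ((IsInducing.of_comp (g := Prod.snd) (by fun_prop) (by fun_prop) IsInducing.id :
    IsInducing (Prod.mk z : Tot 𝒢.fiber → Z × Tot 𝒢.fiber)).comp h)

theorem continuous_fiber_mk (z : Z) :
    Continuous fun g : 𝒢.fiber (β z) => (⟨z, g⟩ : Tot (PullFam β 𝒢.fiber)) :=
  (isInducing_fiber_mk z).continuous

/-- The integral over the fibres of a bundle of groups depends continuously on parameters. -/
theorem continuousAt_fiberIntegral (hβ : Continuous β) {F : ∀ z, 𝒢.fiber (β z) → ℂ} {O : Set Z}
    (hO : IsOpen O) (hF : ∀ x : Tot (PullFam β 𝒢.fiber), x.base ∈ O →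
      ContinuousAt (fun x : Tot (PullFam β 𝒢.fiber) => F x.base x.pt) x) {z : Z} (hz : z ∈ O) :
    ContinuousAt (fun z => ∫ g, F z g ∂normHaar (𝒢.fiber (β z))) z := by
  obtain ⟨t, ht⟩ := 𝒢.exists_triv (β z)
  let O' : Set Z := O ∩ β ⁻¹' t.U
  have hO' : IsOpen O' := hO.inter (t.isOpen.preimage hβ)
  refine (hO'.isOpenEmbedding_subtypeVal.continuousAt_iff (x := ⟨z, hz, ht⟩)).1 ?_
  have hU : Continuous fun y : O' × 𝒢.model => (⟨β y.1.1, y.1.2.2⟩ : t.U) :=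
    Continuous.subtype_mk (hβ.comp (continuous_subtype_val.comp continuous_fst)) _
  have hm : Continuous fun y : O' × 𝒢.model => (⟨y.1.1, (t.φ ⟨β y.1.1, y.1.2.2⟩).symm y.2⟩ :
      Tot (PullFam β 𝒢.fiber)) := by
    refine Tot.continuous_to_pull (f := β) (by fun_prop) ?_
    exact (Tot.continuous_trivMap_symm (φ := fun b => (t.φ b).toEquiv) t.isHomeomorph).comp
      (hU.prodMk continuous_snd)
  have h1 : Continuous fun y : O' × 𝒢.model =>
      F y.1.1 ((t.φ ⟨β y.1.1, y.1.2.2⟩).symm y.2) := by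
    rw [continuous_iff_continuousAt]
    intro y
    exact ContinuousAt.comp (g := fun x : Tot (PullFam β 𝒢.fiber) => F x.base x.pt)
      (hF _ y.1.2.1) hm.continuousAt
  refine (continuous_integral_compact (F := fun (y : O') k =>
    F y.1 ((t.φ ⟨β y.1, y.2.2⟩).symm k)) h1 (normHaar 𝒢.model)).continuousAt.congr
    (Filter.Eventually.of_forall fun y => ?_)
  exact integral_normHaar_equiv (t.fiberEquiv ⟨β y.1, y.2.2⟩).symm (F y.1)

theorem continuous_fiberIntegral (hβ : Continuous β) {F : ∀ z, 𝒢.fiber (β z) → ℂ}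
    (hF : Continuous fun x : Tot (PullFam β 𝒢.fiber) => F x.base x.pt) :
    Continuous fun z => ∫ g, F z g ∂normHaar (𝒢.fiber (β z)) :=
  continuous_iff_continuousAt.2 fun z =>
    continuousAt_fiberIntegral hβ isOpen_univ (fun _ _ => hF.continuousAt) (mem_univ z)

end GroupBundle

namespace VBundle

variable {B : Type u} [TopologicalSpace B] {𝒢 : GroupBundle.{u, v} B} {T : Type w}
  [TopologicalSpace T] {E : VBundle T} {Z : Type*} [TopologicalSpace Z] {β : Z → B} {f : Z → T}

instance (E : VBundle T) (t : T) : Module.Finite ℂ (E.fiber t) := by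
  obtain ⟨c, hc⟩ := E.exists_chart t
  exact Module.Finite.equiv (c.φ ⟨t, hc⟩).symm

/-- A continuous function to the total space with values in one fibre is continuous in
coordinates. -/
theorem finCont_of_continuous {K : Type*} [Group K] [TopologicalSpace K] {t : T}
    {v : K → E.fiber t} (hv : Continuous fun k => (⟨t, v k⟩ : Tot E.fiber)) : FinCont v := by
  intro ℓ
  obtain ⟨c, hc⟩ := E.exists_chart t
  have h : Continuous fun k => c.co t (v k) := continuous_iff_continuousAt.2 fun k =>
    ((c.continuousAt_iff (h := fun k => (⟨t, v k⟩ : Tot E.fiber)) hc).1 hv.continuousAt).2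
  refine ((ℓ ∘ₗ c.sec t).continuous_of_finiteDimensional.comp h).congr fun k => ?_
  simp [c.sec_co hc]

theorem finCont_fiber {v : ∀ z, 𝒢.fiber (β z) → E.fiber (f z)}
    (hv : Continuous fun x : Tot (PullFam β 𝒢.fiber) =>
      (⟨f x.base, v x.base x.pt⟩ : Tot E.fiber)) (z : Z) : FinCont (v z) :=
  finCont_of_continuous (hv.comp (GroupBundle.continuous_fiber_mk z))

/-- The integral over the fibres of a bundle of groups of a function with values in a vector
bundle depends continuously on parameters. -/
theorem continuous_fiberVint (hβ : Continuous β) (hf : Continuous f)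
    {v : ∀ z, 𝒢.fiber (β z) → E.fiber (f z)}
    (hv : Continuous fun x : Tot (PullFam β 𝒢.fiber) =>
      (⟨f x.base, v x.base x.pt⟩ : Tot E.fiber)) :
    Continuous fun z => (⟨f z, vint (𝒢.fiber (β z)) (v z)⟩ : Tot E.fiber) := by
  rw [continuous_iff_continuousAt]
  intro z
  obtain ⟨c, hc⟩ := E.exists_chart (f z)
  refine (c.continuousAt_iff hc).2 ⟨hf.continuousAt, continuousAt_pi.2 fun i => ?_⟩
  have h1 : ∀ z, c.co (f z) (vint (𝒢.fiber (β z)) (v z)) i =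
      ∫ g, c.co (f z) (v z g) i ∂normHaar (𝒢.fiber (β z)) := fun z =>
    dual_vint (finCont_fiber hv z) (LinearMap.proj i ∘ₗ c.co (f z))
  simp only [h1]
  refine GroupBundle.continuousAt_fiberIntegral hβ (c.isOpen.preimage hf) (fun x hx => ?_) hc
  exact (continuous_apply i).continuousAt.comp
    (ContinuousAt.comp (g := fun e : Tot E.fiber => c.co e.base e.pt)
      (f := fun x : Tot (PullFam β 𝒢.fiber) => (⟨f x.base, v x.base x.pt⟩ : Tot E.fiber))
      (c.continuousAt_co (e := ⟨f x.base, v x.base x.pt⟩) hx) hv.continuousAt)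

end VBundle

/-! ### Morphisms of equivariant vector bundles -/

/-- The point of the fibre underlying a point of a pulled back family. -/
abbrev Tot.val {S T : Type*} {f : S → T} {E : T → Type*} (z : Tot (PullFam f E)) : E (f z.base) :=
  z.pt

theorem Tot.isHomeomorph_trivMap_of_continuous {B : Type*} {F : Type*} {E : B → Type*}
    [TopologicalSpace B] [TopologicalSpace (Tot E)] [TopologicalSpace F] {U : Set B}
    {φ : ∀ b : U, E b ≃ F} (h0 : Continuous (Tot.base : Tot E → B))
    (h1 : Continuous fun e : {e : Tot E // e.base ∈ U} => φ ⟨e.1.base, e.2⟩ e.1.pt)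
    (h2 : Continuous fun z : U × F => (⟨z.1, (φ z.1).symm z.2⟩ : Tot E)) :
    IsHomeomorph (Tot.trivMap U fun b => φ b) := by
  let e : {e : Tot E // e.base ∈ U} ≃ₜ U × F :=
    { toFun := Tot.trivMap U fun b => φ b
      invFun := fun z => ⟨⟨z.1, (φ z.1).symm z.2⟩, z.1.2⟩
      left_inv := fun e => Subtype.ext (congrArg (Tot.mk e.1.base)
        ((φ ⟨e.1.base, e.2⟩).symm_apply_apply e.1.pt))
      right_inv := fun z => by simp [Tot.trivMap]
      continuous_toFun := by
        exact (Continuous.subtype_mk (h0.comp continuous_subtype_val) _).prodMk h1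
      continuous_invFun := h2.subtype_mk _ }
  exact e.isHomeomorph

namespace GroupBundle

variable {B : Type u} [TopologicalSpace B] (𝒢 : GroupBundle.{u, v} B)

theorem continuous_inv_tot : Continuous fun g : Tot 𝒢.fiber => (⟨g.base, g.pt⁻¹⟩ : Tot 𝒢.fiber) := by
  rw [continuous_iff_continuousAt]
  intro g
  obtain ⟨t, ht⟩ := 𝒢.exists_triv g.base
  have hO : IsOpen {g : Tot 𝒢.fiber | g.base ∈ t.U} := t.isOpen.preimage 𝒢.continuous_base
  refine (hO.isOpenEmbedding_subtypeVal.continuousAt_iff (x := ⟨g, ht⟩)).1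
    (Continuous.continuousAt ?_)
  have h1 := t.isHomeomorph.continuous
  refine ((Tot.continuous_trivMap_symm (φ := fun b => (t.φ b).toEquiv) t.isHomeomorph).comp
    ((continuous_fst.comp h1).prodMk (continuous_inv.comp (continuous_snd.comp h1)))).congr
    fun g => ?_
  change Tot.mk g.1.base ((t.φ ⟨g.1.base, g.2⟩).symm ((t.φ ⟨g.1.base, g.2⟩) g.1.pt)⁻¹) = _
  rw [map_inv, MulEquiv.symm_apply_apply]
  rfl

theorem continuous_mul_tot : Continuous fun z : Tot (ProdFam 𝒢.fiber 𝒢.fiber) =>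
    (⟨z.base, z.pt.1 * z.pt.2⟩ : Tot 𝒢.fiber) := by
  have hb : Continuous fun z : Tot (ProdFam 𝒢.fiber 𝒢.fiber) => z.base :=
    𝒢.continuous_base.comp Tot.continuous_fst_split
  rw [continuous_iff_continuousAt]
  intro z
  obtain ⟨t, ht⟩ := 𝒢.exists_triv z.base
  have hO : IsOpen {g : Tot (ProdFam 𝒢.fiber 𝒢.fiber) | g.base ∈ t.U} := t.isOpen.preimage hb
  refine (hO.isOpenEmbedding_subtypeVal.continuousAt_iff (x := ⟨z, ht⟩)).1
    (Continuous.continuousAt ?_)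
  have h1 := t.isHomeomorph.continuous
  have hf : Continuous fun z : {g : Tot (ProdFam 𝒢.fiber 𝒢.fiber) | g.base ∈ t.U} =>
      (⟨⟨z.1.base, z.1.pt.1⟩, z.2⟩ : {e : Tot 𝒢.fiber // e.base ∈ t.U}) :=
    (Tot.continuous_fst_split.comp continuous_subtype_val).subtype_mk _
  have hs : Continuous fun z : {g : Tot (ProdFam 𝒢.fiber 𝒢.fiber) | g.base ∈ t.U} =>
      (⟨⟨z.1.base, z.1.pt.2⟩, z.2⟩ : {e : Tot 𝒢.fiber // e.base ∈ t.U}) :=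
    (Tot.continuous_snd_split.comp continuous_subtype_val).subtype_mk _
  refine ((Tot.continuous_trivMap_symm (φ := fun b => (t.φ b).toEquiv) t.isHomeomorph).comp
    ((continuous_fst.comp (h1.comp hf)).prodMk ((continuous_snd.comp (h1.comp hf)).mul
      (continuous_snd.comp (h1.comp hs))))).congr fun g => ?_
  change Tot.mk g.1.base ((t.φ ⟨g.1.base, g.2⟩).symm ((t.φ ⟨g.1.base, g.2⟩) g.1.pt.1 *
    (t.φ ⟨g.1.base, g.2⟩) g.1.pt.2)) = _
  rw [map_mul, MulEquiv.symm_apply_apply, MulEquiv.symm_apply_apply]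
  rfl

end GroupBundle

namespace GSpace

variable {B : Type u} [TopologicalSpace B] {𝒢 : GroupBundle.{u, v} B}

theorem continuous_smul_tot (Y : GSpace.{u, v, w} 𝒢) {Z : Type*} [TopologicalSpace Z] {β : Z → B}
    {g : ∀ z, 𝒢.fiber (β z)} {y : ∀ z, Y.fiber (β z)}
    (hg : Continuous fun z => (⟨β z, g z⟩ : Tot 𝒢.fiber))
    (hy : Continuous fun z => (⟨β z, y z⟩ : Y.Total)) :
    Continuous fun z => (⟨β z, g z • y z⟩ : Y.Total) :=
  Y.continuous_smul.comp (f := fun z => (⟨β z, g z, y z⟩ : Tot (ProdFam 𝒢.fiber Y.fiber)))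
    (Tot.continuous_to_split hg hy)

/-- Continuous real functions on a `𝒢`-space that are constant on the orbits. -/
structure InvFun (Y : GSpace.{u, v, w} 𝒢) where
  toFun : Y.Total → ℝ
  continuous : Continuous toFun
  smul : ∀ {b : B} (g : 𝒢.fiber b) (y : Y.fiber b), toFun ⟨b, g • y⟩ = toFun ⟨b, y⟩

instance (Y : GSpace.{u, v, w} 𝒢) : CoeFun Y.InvFun fun _ => Y.Total → ℝ := ⟨InvFun.toFun⟩

/-- The composition of an invariant function with a real function. -/
def InvFun.comp {Y : GSpace.{u, v, w} 𝒢} (a : Y.InvFun) (f : ℝ → ℝ) (hf : Continuous f) :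
    Y.InvFun where
  toFun y := f (a y)
  continuous := hf.comp a.continuous
  smul g y := congrArg f (a.smul g y)

/-- A set that is a union of orbits. -/
def IsInvariant (Y : GSpace.{u, v, w} 𝒢) (S : Set Y.Total) : Prop :=
  ∀ ⦃b : B⦄ (g : 𝒢.fiber b) (y : Y.fiber b), (⟨b, y⟩ : Y.Total) ∈ S → (⟨b, g • y⟩ : Y.Total) ∈ S

open MeasureTheory in
/-- The average of a function over the orbits. -/
noncomputable def avgFun (Y : GSpace.{u, v, w} 𝒢) (a : C(Y.Total, ℝ)) : Y.InvFun where
  toFun y := ∫ g, a ⟨y.base, g • y.pt⟩ ∂normHaar (𝒢.fiber y.base)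
  continuous := by
    have h1 : Continuous fun x : Tot (PullFam (Tot.base : Y.Total → B) 𝒢.fiber) =>
        ((a ⟨x.base.base, x.val • x.base.pt⟩ : ℝ) : ℂ) :=
      Complex.continuous_ofReal.comp (a.continuous.comp (Y.continuous_smul_tot
        (Tot.continuous_pull_pt (f := (Tot.base : Y.Total → B)))
        (Tot.continuous_pull_base (f := (Tot.base : Y.Total → B)))))
    have h := GroupBundle.continuous_fiberIntegral (F := fun (y : Y.Total) g =>
      ((a ⟨y.base, g • y.pt⟩ : ℝ) : ℂ)) Y.continuous_base h1
    refine (Complex.continuous_re.comp h).congr fun y => ?_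
    simp only [Function.comp, integral_complex_ofReal, Complex.ofReal_re]
  smul {b} g y := by
    have h := integral_mul_right_eq_self (μ := normHaar (𝒢.fiber b))
      (fun k => a ⟨b, k • y⟩) g
    simp only [mul_smul] at h
    exact h

theorem isClosed_orbit_meets (Y : GSpace.{u, v, w} 𝒢) {S : Set Y.Total} (hS : IsClosed S) :
    IsClosed {x : Y.Total | ∃ g : 𝒢.fiber x.base, (⟨x.base, g • x.pt⟩ : Y.Total) ∈ S} := by
  rw [← isOpen_compl_iff]
  convert! Y.isOpen_orbit_subset hS.isOpen_compl using 1
  ext x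
  simp

/-- Invariant functions separate a closed invariant set from the complement of a
neighbourhood. -/
theorem exists_invFun (Y : GSpace.{u, v, w} 𝒢) [NormalSpace Y.Total] {C O : Set Y.Total}
    (hC : IsClosed C) (hCi : Y.IsInvariant C) (hO : IsOpen O) (hCO : C ⊆ O) :
    ∃ ρ : Y.InvFun, (∀ y, 0 ≤ ρ y) ∧ (∀ y, ρ y ≤ 1) ∧ (∃ N, IsOpen N ∧ C ⊆ N ∧ ∀ y ∈ N, ρ y = 1) ∧
      tsupport ρ ⊆ O := by
  let O' : Set Y.Total := {x | ∀ g : 𝒢.fiber x.base, (⟨x.base, g • x.pt⟩ : Y.Total) ∈ O}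
  have hO' : IsOpen O' := Y.isOpen_orbit_subset hO
  have hCO' : C ⊆ O' := fun x hx g => hCO (hCi g x.pt hx)
  obtain ⟨N₂, hN₂, hCN₂, hN₂O⟩ := normal_exists_closure_subset hC hO' hCO'
  obtain ⟨N₁, hN₁, hCN₁, hN₁N⟩ := normal_exists_closure_subset hC hN₂ hCN₂
  obtain ⟨θ, hθ0, hθ1, hθ⟩ := exists_continuous_zero_one_of_isClosed (hN₂.isClosed_compl)
    isClosed_closure (Set.disjoint_left.2 fun x hx hx' => hx (hN₁N hx'))
  have hint : ∀ y : Y.Total, Continuous fun g : 𝒢.fiber y.base => θ ⟨y.base, g • y.pt⟩ := by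
    intro y
    refine θ.continuous.comp (Y.continuous_smul_tot ?_ continuous_const)
    exact continuous_induced_dom
  refine ⟨Y.avgFun θ, fun y => ?_, fun y => ?_, ⟨_, Y.isOpen_orbit_subset hN₁,
    fun x hx g => hCN₁ (hCi g x.pt hx), fun y hy => ?_⟩, ?_⟩
  · exact MeasureTheory.integral_nonneg fun g => (hθ _).1
  · have h1 := MeasureTheory.integral_mono (μ := normHaar (𝒢.fiber y.base))
      (f := fun g => θ ⟨y.base, g • y.pt⟩) (g := fun _ => 1)
      ((BoundedContinuousFunction.mkOfCompact ⟨_, hint y⟩).integrable _)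
      (MeasureTheory.integrable_const _) (fun g => (hθ _).2)
    exact h1.trans_eq (by simp)
  · have : ∀ g : 𝒢.fiber y.base, θ ⟨y.base, g • y.pt⟩ = 1 := fun g =>
      hθ1 (subset_closure (hy g))
    simp [avgFun, this]
  · have h1 : tsupport (Y.avgFun θ) ⊆
        {x : Y.Total | ∃ g : 𝒢.fiber x.base, (⟨x.base, g • x.pt⟩ : Y.Total) ∈ closure N₂} := by
      refine closure_minimal (fun x hx => ?_) (Y.isClosed_orbit_meets isClosed_closure)
      by_contra hx'
      refine hx ?_
      have : ∀ g : 𝒢.fiber x.base, θ ⟨x.base, g • x.pt⟩ = 0 := fun g =>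
        hθ0 fun h => hx' ⟨g, subset_closure h⟩
      simp [avgFun, this]
    intro x hx
    obtain ⟨g, hg⟩ := h1 hx
    have := hN₂O hg g⁻¹
    simpa using this

end GSpace

namespace EquivVB

variable {B : Type u} [TopologicalSpace B]

section

variable {𝒢 : GroupBundle.{u, v} B} {Y : GSpace.{u, v, w} 𝒢}

theorem act_bijective (E : EquivVB Y) {b : B} (g : 𝒢.fiber b) (y : Y.fiber b) :
    Function.Bijective (E.act g y) := by
  have key : ∀ e, (⟨⟨b, g⁻¹ • g • y⟩, E.act g⁻¹ (g • y) (E.act g y e)⟩ : Tot E.fiber) =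
      ⟨⟨b, y⟩, e⟩ := fun e =>
    (E.act_mul g⁻¹ g y e).symm.trans ((E.act_congr (inv_mul_cancel g) rfl).trans (E.act_one y e))
  constructor
  · intro e e' h
    have h1 := (key e).symm.trans (h ▸ key e')
    exact eq_of_heq (Tot.mk.inj h1).2
  · intro e'
    have hy : (⟨b, g⁻¹ • g • y⟩ : Y.Total) = ⟨b, y⟩ := congrArg (Tot.mk b) (inv_smul_smul g y)
    refine ⟨E.cast hy (E.act g⁻¹ (g • y) e'), ?_⟩
    have h1 : (⟨⟨b, g • y⟩, E.act g y (E.cast hy (E.act g⁻¹ (g • y) e'))⟩ : Tot E.fiber) =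
        ⟨⟨b, g • y⟩, e'⟩ :=
      (E.act_congr rfl (E.mk_cast hy _)).trans ((E.act_mul g g⁻¹ (g • y) e').symm.trans
        ((E.act_congr (mul_inv_cancel g) rfl).trans (E.act_one (g • y) e')))
    exact eq_of_heq (Tot.mk.inj h1).2

/-- The action of a group element as a linear isomorphism between two fibres. -/
noncomputable def actEquiv (E : EquivVB Y) {b : B} (g : 𝒢.fiber b) (y : Y.fiber b) :
    E.fiber ⟨b, y⟩ ≃ₗ[ℂ] E.fiber ⟨b, g • y⟩ :=
  LinearEquiv.ofBijective (E.act g y) (E.act_bijective g y)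

theorem act_actEquiv_symm (E : EquivVB Y) {b : B} (g : 𝒢.fiber b) (y : Y.fiber b)
    (e : E.fiber ⟨b, g • y⟩) : E.act g y ((E.actEquiv g y).symm e) = e :=
  (E.actEquiv g y).apply_symm_apply e

theorem actEquiv_symm_act (E : EquivVB Y) {b : B} (g : 𝒢.fiber b) (y : Y.fiber b)
    (e : E.fiber ⟨b, y⟩) : (E.actEquiv g y).symm (E.act g y e) = e :=
  (E.actEquiv g y).symm_apply_apply e

theorem mk_actEquiv_symm (E : EquivVB Y) {b : B} (g : 𝒢.fiber b) (y : Y.fiber b)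
    (e : E.fiber ⟨b, g • y⟩) : (⟨⟨b, y⟩, (E.actEquiv g y).symm e⟩ : Tot E.fiber) =
      ⟨⟨b, g⁻¹ • g • y⟩, E.act g⁻¹ (g • y) e⟩ := by
  obtain ⟨e, rfl⟩ := (E.act_bijective g y).2 e
  rw [actEquiv_symm_act]
  exact ((E.act_mul g⁻¹ g y e).symm.trans
    ((E.act_congr (inv_mul_cancel g) rfl).trans (E.act_one y e))).symm

theorem continuous_act_tot (E : EquivVB Y) {Z : Type*} [TopologicalSpace Z] {β : Z → B}
    {g : ∀ z, 𝒢.fiber (β z)} {y : ∀ z, Y.fiber (β z)} {e : ∀ z, E.fiber ⟨β z, y z⟩}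
    (hg : Continuous fun z => (⟨β z, g z⟩ : Tot 𝒢.fiber))
    (he : Continuous fun z => (⟨⟨β z, y z⟩, e z⟩ : Tot E.fiber)) :
    Continuous fun z => (⟨⟨β z, g z • y z⟩, E.act (g z) (y z) (e z)⟩ : Tot E.fiber) :=
  E.continuous_act.comp (f := fun z => (⟨⟨β z, g z, y z⟩, e z⟩ : Tot (PullFam Y.actSnd E.fiber)))
    (Tot.continuous_to_pull (f := Y.actSnd)
      (Tot.continuous_to_split hg (E.continuous_base.comp he)) he)

theorem continuous_actEquiv_symm_tot (E : EquivVB Y) {Z : Type*} [TopologicalSpace Z] {β : Z → B}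
    {g : ∀ z, 𝒢.fiber (β z)} {y : ∀ z, Y.fiber (β z)} {e : ∀ z, E.fiber ⟨β z, g z • y z⟩}
    (hg : Continuous fun z => (⟨β z, g z⟩ : Tot 𝒢.fiber))
    (he : Continuous fun z => (⟨⟨β z, g z • y z⟩, e z⟩ : Tot E.fiber)) :
    Continuous fun z => (⟨⟨β z, y z⟩, (E.actEquiv (g z) (y z)).symm (e z)⟩ : Tot E.fiber) := by
  simp only [mk_actEquiv_symm]
  exact E.continuous_act_tot (𝒢.continuous_inv_tot.comp hg) he

/-- Morphisms of equivariant vector bundles (over the identity). -/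
structure Mor (E E' : EquivVB Y) where
  toFun : ∀ y, E.fiber y →ₗ[ℂ] E'.fiber y
  continuous : Continuous (VBundle.totMap toFun)
  equivariant : ∀ {b : B} (g : 𝒢.fiber b) (y : Y.fiber b) (e : E.fiber ⟨b, y⟩),
    toFun _ (E.act g y e) = E'.act g y (toFun _ e)

instance (E E' : EquivVB Y) : CoeFun (Mor E E') fun _ => ∀ y, E.fiber y →ₗ[ℂ] E'.fiber y :=
  ⟨Mor.toFun⟩

namespace Mor

variable {E E' E'' : EquivVB Y}

theorem contAt (m : Mor E E') (y : Y.Total) : VBundle.ContAt m.toFun y :=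
  VBundle.continuous_totMap_iff.1 m.continuous y

/-- The identity. -/
def id (E : EquivVB Y) : Mor E E := ⟨fun _ => LinearMap.id, continuous_id, fun _ _ _ => rfl⟩

/-- The composition of morphisms. -/
def comp (m' : Mor E' E'') (m : Mor E E') : Mor E E'' where
  toFun y := m' y ∘ₗ m y
  continuous := m'.continuous.comp m.continuous
  equivariant g y e := (congrArg (m' _) (m.equivariant g y e)).trans (m'.equivariant g y _)

/-- The sum of two morphisms. -/
def add (m m' : Mor E E') : Mor E E' where
  toFun y := m y + m' y
  continuous := VBundle.continuous_totMap_iff.2 fun y => (m.contAt y).add (m'.contAt y)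
  equivariant g y e := by
    simp only [LinearMap.add_apply, m.equivariant, m'.equivariant, map_add]

/-- The product of a morphism with an invariant function. -/
def smul (a : Y.InvFun) (m : Mor E E') : Mor E E' where
  toFun y := (a y : ℂ) • m y
  continuous := VBundle.continuous_totMap_iff.2 fun y =>
    VBundle.ContAt.smul (a := fun y => (a y : ℂ))
      (Complex.continuous_ofReal.comp a.continuous).continuousAt (m.contAt y)
  equivariant g y e := by
    simp only [LinearMap.smul_apply, m.equivariant, map_smul, a.smul]

/-- The opposite of a morphism. -/
def neg (m : Mor E E') : Mor E E' := smul ⟨fun _ => -1, continuous_const, fun _ _ => rfl⟩ m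

/-- The first projection of a direct sum. -/
def fst (E E' : EquivVB Y) : Mor (E.sum E') E where
  toFun y := LinearMap.fst ℂ (E.fiber y) (E'.fiber y)
  continuous := Tot.continuous_fst_split
  equivariant _ _ _ := rfl

/-- The second projection of a direct sum. -/
def snd (E E' : EquivVB Y) : Mor (E.sum E') E' where
  toFun y := LinearMap.snd ℂ (E.fiber y) (E'.fiber y)
  continuous := Tot.continuous_snd_split
  equivariant _ _ _ := rfl

/-- The morphism to a direct sum with the given components. -/
def pair (m : Mor E E') (m' : Mor E E'') : Mor E (E'.sum E'') where
  toFun y := LinearMap.prod (m y) (m' y)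
  continuous := Tot.continuous_to_split m.continuous m'.continuous
  equivariant g y e := Prod.ext (m.equivariant g y e) (m'.equivariant g y e)

@[simp] theorem id_apply (y : Y.Total) (e : E.fiber y) : id E y e = e := rfl

@[simp] theorem comp_apply (m' : Mor E' E'') (m : Mor E E') (y : Y.Total) (e : E.fiber y) :
    m'.comp m y e = m' y (m y e) := rfl

@[simp] theorem add_apply (m m' : Mor E E') (y : Y.Total) (e : E.fiber y) :
    m.add m' y e = m y e + m' y e := rfl

@[simp] theorem smul_apply (a : Y.InvFun) (m : Mor E E') (y : Y.Total) (e : E.fiber y) :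
    smul a m y e = (a y : ℂ) • m y e := rfl

@[simp] theorem neg_apply (m : Mor E E') (y : Y.Total) (e : E.fiber y) :
    m.neg y e = - m y e := by
  change (((-1 : ℝ) : ℂ)) • m y e = _
  simp

/-- Mutually inverse morphisms form an isomorphism. -/
def toIso (m : Mor E E') (m' : Mor E' E) (h : ∀ y e, m' y (m y e) = e)
    (h' : ∀ y e, m y (m' y e) = e) : Iso E E' where
  toEquiv y := LinearEquiv.ofLinearMap (m y) (m' y) (LinearMap.ext (h' y)) (LinearMap.ext (h y))
  continuous := m.continuous
  continuous_symm := m'.continuous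
  equivariant g y e := m.equivariant g y e

end Mor

/-- An isomorphism as a morphism. -/
def Iso.toMor {E E' : EquivVB Y} (i : Iso E E') : Mor E E' where
  toFun y := (i.toEquiv y).toLinearMap
  continuous := i.continuous
  equivariant g y e := i.equivariant g y e

@[simp] theorem Iso.symm_toMor_apply {E E' : EquivVB Y} (i : Iso E E') (y : Y.Total)
    (e : E.fiber y) : i.symm.toMor y (i.toMor y e) = e := (i.toEquiv y).symm_apply_apply e

@[simp] theorem Iso.toMor_symm_apply {E E' : EquivVB Y} (i : Iso E E') (y : Y.Total)
    (e : E'.fiber y) : i.toMor y (i.symm.toMor y e) = e := (i.toEquiv y).apply_symm_apply e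

/-- A morphism that is bijective on all fibres is an isomorphism. -/
noncomputable def Mor.isoOfBijective {E E' : EquivVB Y} (m : Mor E E')
    (h : ∀ y, Function.Bijective (m y)) : Iso E E' where
  toEquiv y := LinearEquiv.ofBijective (m y) (h y)
  continuous := m.continuous
  continuous_symm := VBundle.continuous_totMap_iff.2 fun y => (m.contAt y).inverse
    (L' := fun y => (LinearEquiv.ofBijective (m y) (h y)).symm.toLinearMap)
    (Filter.Eventually.of_forall fun y => LinearMap.ext fun e =>
      (LinearEquiv.ofBijective (m y) (h y)).symm_apply_apply e)
    (Filter.Eventually.of_forall fun y => LinearMap.ext fun e =>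
      (LinearEquiv.ofBijective (m y) (h y)).apply_symm_apply e)
  equivariant g y e := m.equivariant g y e

/-! ### Averaging -/

section average

variable {E E' : EquivVB Y} (L : ∀ y, E.fiber y →ₗ[ℂ] E'.fiber y)

/-- The integrand `g ↦ g⁻¹ L (g e)`. -/
noncomputable def conj (e : Tot E.fiber) (g : 𝒢.fiber e.base.base) : E'.fiber e.base :=
  (E'.actEquiv g e.base.pt).symm (L ⟨e.base.base, g • e.base.pt⟩ (E.act g e.base.pt e.pt))

theorem continuous_conj (hL : Continuous (VBundle.totMap L)) :
    Continuous fun x : Tot (PullFam (fun e : Tot E.fiber => e.base.base) 𝒢.fiber) =>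
      (⟨x.base.base, conj L x.base x.pt⟩ : Tot E'.fiber) := by
  have hg : Continuous fun x : Tot (PullFam (fun e : Tot E.fiber => e.base.base) 𝒢.fiber) =>
      (⟨x.base.base.base, x.pt⟩ : Tot 𝒢.fiber) :=
    Tot.continuous_pull_pt (f := fun e : Tot E.fiber => e.base.base)
  have h1 : Continuous fun x : Tot (PullFam (fun e : Tot E.fiber => e.base.base) 𝒢.fiber) =>
      (⟨⟨x.base.base.base, x.val • x.base.base.pt⟩,
        E.act x.val x.base.base.pt x.base.pt⟩ : Tot E.fiber) :=
    E.continuous_act_tot hg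
      (Tot.continuous_pull_base (f := fun e : Tot E.fiber => e.base.base))
  exact E'.continuous_actEquiv_symm_tot
    (β := fun x : Tot (PullFam (fun e : Tot E.fiber => e.base.base) 𝒢.fiber) => x.base.base.base)
    (g := fun x => x.val) (y := fun x => x.base.base.pt)
    (e := fun x => L _ (E.act x.val x.base.base.pt x.base.pt)) hg (hL.comp h1)

theorem finCont_conj (hL : Continuous (VBundle.totMap L)) (e : Tot E.fiber) :
    FinCont (conj L e) :=
  VBundle.finCont_fiber (f := fun e : Tot E.fiber => e.base) (continuous_conj L hL) e

/-- The average of a continuous family of linear maps over the group is a morphism. -/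
noncomputable def average (hL : Continuous (VBundle.totMap L)) : Mor E E' where
  toFun y :=
    { toFun := fun e => vint (𝒢.fiber y.base) (conj L ⟨y, e⟩)
      map_add' := fun e e' => by
        refine Eq.trans ?_ (vint_add (finCont_conj L hL ⟨y, e⟩) (finCont_conj L hL ⟨y, e'⟩))
        exact congrArg (vint _) (funext fun k => by simp only [conj, map_add])
      map_smul' := fun a e => by
        refine Eq.trans ?_ (map_vint (finCont_conj L hL ⟨y, e⟩) (a • LinearMap.id)).symm
        exact congrArg (vint _) (funext fun k => by
          simp only [conj, map_smul, LinearMap.smul_apply, LinearMap.id_apply]) }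
  continuous := VBundle.continuous_fiberVint (f := fun e : Tot E.fiber => e.base)
    (Y.continuous_base.comp E.continuous_base) E.continuous_base (continuous_conj L hL)
  equivariant {b} h y e := by
    change vint (𝒢.fiber b) (conj L ⟨⟨b, h • y⟩, E.act h y e⟩) =
      E'.act h y (vint (𝒢.fiber b) (conj L ⟨⟨b, y⟩, e⟩))
    refine Eq.trans ?_ ((vint_mul_right ((finCont_conj L hL ⟨⟨b, y⟩, e⟩).map (E'.act h y)) h).trans
      (map_vint (finCont_conj L hL ⟨⟨b, y⟩, e⟩) (E'.act h y)).symm)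
    congr 1
    funext g
    refine (LinearEquiv.symm_apply_eq _).2 ?_
    have h1 : (⟨⟨b, g • h • y⟩, L ⟨b, g • h • y⟩ (E.act g (h • y) (E.act h y e))⟩ : Tot E'.fiber) =
        ⟨⟨b, (g * h) • y⟩, L ⟨b, (g * h) • y⟩ (E.act (g * h) y e)⟩ :=
      congrArg (VBundle.totMap L) (E.act_mul g h y e).symm
    have h2 := E'.act_mul g h y (conj L ⟨⟨b, y⟩, e⟩ (g * h))
    rw [conj, act_actEquiv_symm] at h2
    exact eq_of_heq (Tot.mk.inj (h1.trans h2)).2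

theorem average_apply (hL : Continuous (VBundle.totMap L)) {b : B} {y : Y.fiber b}
    {e : E.fiber ⟨b, y⟩} {e' : E'.fiber ⟨b, y⟩} {a : C(Y.Total, ℝ)}
    (h : ∀ g : 𝒢.fiber b, L ⟨b, g • y⟩ (E.act g y e) = (a ⟨b, g • y⟩ : ℂ) • E'.act g y e') :
    average L hL ⟨b, y⟩ e = (Y.avgFun a ⟨b, y⟩ : ℂ) • e' := by
  change vint (𝒢.fiber b) (conj L ⟨⟨b, y⟩, e⟩) = _
  have h1 : conj L ⟨⟨b, y⟩, e⟩ = fun g => (a ⟨b, g • y⟩ : ℂ) • e' := by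
    funext g
    exact (LinearEquiv.symm_apply_eq _).2 ((h g).trans (map_smul (E'.act g y) _ _).symm)
  have h2 : Continuous fun g : 𝒢.fiber b => ((a ⟨b, g • y⟩ : ℝ) : ℂ) := by
    refine Complex.continuous_ofReal.comp (a.continuous.comp
      (Y.continuous_smul_tot ?_ continuous_const))
    exact continuous_induced_dom
  rw [h1, vint_smul_const h2]
  congr 1
  exact integral_complex_ofReal

end average

/-! ### Cutting off the inverse of a morphism -/

/-- A morphism that is invertible on a closed invariant set `C` has, up to an invariant function
that is `1` near `C`, an inverse. -/
theorem Mor.exists_cutoff_inverse [NormalSpace Y.Total] {E E' : EquivVB Y} (m : Mor E E')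
    {C : Set Y.Total} (hC : IsClosed C) (hCi : Y.IsInvariant C)
    (h : ∀ y ∈ C, Function.Bijective (m y)) :
    ∃ (ρ : Y.InvFun) (m' : Mor E' E), (∀ y, 0 ≤ ρ y) ∧ (∀ y, ρ y ≤ 1) ∧
      (∃ N, IsOpen N ∧ C ⊆ N ∧ ∀ y ∈ N, ρ y = 1) ∧
      (∀ y e, m' y (m y e) = (ρ y : ℂ) • e) ∧ ∀ y e, m y (m' y e) = (ρ y : ℂ) • e := by
  classical
  let O : Set Y.Total := {y | Function.Bijective (m y)}
  have hO : IsOpen O := isOpen_iff_mem_nhds.2 fun y hy => (m.contAt y).eventually_bijective hy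
  obtain ⟨ρ, h0, h1, hN, hρ⟩ := Y.exists_invFun hC hCi hO h
  let L : ∀ y, E'.fiber y →ₗ[ℂ] E.fiber y := fun y =>
    if hy : Function.Bijective (m y) then (LinearEquiv.ofBijective (m y) hy).symm.toLinearMap else 0
  have hL : ∀ y ∈ O, ∀ e, L y (m y e) = e := by
    intro y hy e
    simp only [L, dif_pos (show Function.Bijective (m y) from hy)]
    exact (LinearEquiv.ofBijective (m y) hy).symm_apply_apply e
  have hL' : ∀ y ∈ O, ∀ e, m y (L y e) = e := by
    intro y hy e
    simp only [L, dif_pos (show Function.Bijective (m y) from hy)]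
    exact (LinearEquiv.ofBijective (m y) hy).apply_symm_apply e
  have hρ0 : ∀ y, y ∉ O → ρ y = 0 := fun y hy =>
    image_eq_zero_of_notMem_tsupport fun h => hy (hρ h)
  have hsupp : tsupport (fun y => (ρ y : ℂ)) ⊆ O := by
    refine (closure_mono fun y hy => ?_).trans hρ
    intro h
    exact hy (by simp only [h, Complex.ofReal_zero])
  refine ⟨ρ, ⟨fun y => (ρ y : ℂ) • L y, VBundle.continuous_totMap_iff.2
    (VBundle.contAt_smul_of_tsupport (Complex.continuous_ofReal.comp ρ.continuous)
      fun y hy => ?_), fun {b} g y e => ?_⟩, h0, h1, hN, fun y e => ?_, fun y e => ?_⟩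
  · refine (m.contAt y).inverse ?_ ?_
    · filter_upwards [hO.mem_nhds (hsupp hy)] with z hz using LinearMap.ext (hL z hz)
    · filter_upwards [hO.mem_nhds (hsupp hy)] with z hz using LinearMap.ext (hL' z hz)
  · have hgy := ρ.smul g y
    by_cases hy : ρ ⟨b, y⟩ = 0
    · change (ρ ⟨b, g • y⟩ : ℂ) • _ = E.act g y ((ρ ⟨b, y⟩ : ℂ) • _)
      rw [hgy, hy, Complex.ofReal_zero, zero_smul, zero_smul, map_zero]
    · have hy1 : (⟨b, y⟩ : Y.Total) ∈ O := by
        by_contra h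
        exact hy (hρ0 _ h)
      have hy2 : (⟨b, g • y⟩ : Y.Total) ∈ O := by
        by_contra h
        exact hy (hgy ▸ hρ0 _ h)
      simp only [LinearMap.smul_apply, hgy, map_smul]
      congr 1
      obtain ⟨e, rfl⟩ := hy1.2 e
      rw [← m.equivariant, hL _ hy1, hL _ hy2]
  · by_cases hy : y ∈ O
    · exact congrArg _ (hL y hy e)
    · simp [hρ0 y hy]
  · by_cases hy : y ∈ O
    · simp only [LinearMap.smul_apply, map_smul, hL' y hy]
    · simp [hρ0 y hy]

end

end EquivVB

namespace EquivVB

variable {B : Type u} [TopologicalSpace B]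

/-! ### The image of an idempotent -/

section image

variable {𝒢 : GroupBundle.{u, v} B} {Y : GSpace.{u, v, w} 𝒢} {E : EquivVB Y}

namespace Mor

/-- The image of an idempotent morphism is locally trivial: near `y₀` the map
`P y → P y₀` given by a chart of `E` is a linear isomorphism. -/
theorem exists_triv_range (P : Mor E E) (hP : ∀ y e, P y (P y e) = P y e)
    [TopologicalSpace (Tot fun y => LinearMap.range (P y))]
    (hi : IsInducing fun e : Tot fun y => LinearMap.range (P y) => (⟨e.base, e.pt.1⟩ : Tot E.fiber))
    (y₀ : Y.Total) : ∃ (n : ℕ) (U : Set Y.Total)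
      (φ : ∀ y : U, LinearMap.range (P y) ≃ₗ[ℂ] (Fin n → ℂ)),
      IsOpen U ∧ y₀ ∈ U ∧
        IsHomeomorph (Tot.trivMap (E := fun y => LinearMap.range (P y)) U fun y => φ y) := by
  obtain ⟨c, hc⟩ := E.exists_chart y₀
  let ψ := (Module.finBasis ℂ (LinearMap.range (P y₀))).equivFun
  let q : E.fiber y₀ →ₗ[ℂ] LinearMap.range (P y₀) := (P y₀).rangeRestrict
  let A : (Fin _ → ℂ) →ₗ[ℂ] (Fin c.n → ℂ) :=
    c.co y₀ ∘ₗ (LinearMap.range (P y₀)).subtype ∘ₗ ψ.symm.toLinearMap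
  let A' : (Fin c.n → ℂ) →ₗ[ℂ] (Fin _ → ℂ) := ψ.toLinearMap ∘ₗ q ∘ₗ c.sec y₀
  have hAA : ∀ x, A' (A x) = x := by
    intro x
    have h1 : q (ψ.symm x).1 = ψ.symm x := by
      obtain ⟨⟨_, e, rfl⟩, hz⟩ : ∃ z, z = ψ.symm x := ⟨_, rfl⟩
      rw [← hz]
      exact Subtype.ext (hP y₀ e)
    simp only [A, A', LinearMap.comp_apply, c.sec_co hc, LinearEquiv.coe_coe,
      Submodule.subtype_apply, h1, LinearEquiv.apply_symm_apply]
  let i : ∀ y, (Fin _ → ℂ) →ₗ[ℂ] E.fiber y := fun y => P y ∘ₗ c.sec y ∘ₗ A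
  let r : ∀ y, E.fiber y →ₗ[ℂ] (Fin _ → ℂ) := fun y => A' ∘ₗ c.co y
  let J : ∀ y, E.fiber y →ₗ[ℂ] E.fiber y := fun y =>
    P y ∘ₗ (c.sec y ∘ₗ (A ∘ₗ A') ∘ₗ c.co y) ∘ₗ P y
  let K : ∀ y, E.fiber y →ₗ[ℂ] E.fiber y := fun y => J y + (LinearMap.id + (P.neg) y)
  have hJ : ∀ y e, J y e = i y (r y (P y e)) := fun y e => rfl
  have hKc : ∀ y ∈ c.U, VBundle.ContAt K y := by
    intro y hy
    refine VBundle.ContAt.add (VBundle.ContAt.comp (P.contAt y) (VBundle.ContAt.comp ?_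
      (P.contAt y))) (VBundle.contAt_id.add (P.neg.contAt y))
    rw [VBundle.contAt_iff_chart c hy]
    intro x
    refine ContinuousAt.congr (c.continuousAt_sec hy (A (A' x))) ?_
    filter_upwards [c.isOpen.mem_nhds hy] with z hz
    simp only [LinearMap.comp_apply, c.co_sec hz]
  have hK0 : K y₀ = LinearMap.id := by
    ext e
    have h1 : A (A' (c.co y₀ (P y₀ e))) = c.co y₀ (P y₀ e) := by
      have h2 : q (P y₀ e) = ⟨P y₀ e, e, rfl⟩ := Subtype.ext (hP y₀ e)
      simp only [A, A', LinearMap.comp_apply, c.sec_co hc, h2, LinearEquiv.coe_coe,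
        LinearEquiv.symm_apply_apply, Submodule.subtype_apply]
    simp only [K, LinearMap.add_apply, hJ, LinearMap.id_apply, neg_apply, i, r,
      LinearMap.comp_apply, h1, c.sec_co hc, hP]
    abel
  have hKb : ∀ᶠ y in 𝓝 y₀, Function.Bijective (K y) :=
    (hKc y₀ hc).eventually_bijective (by rw [hK0]; exact Function.bijective_id)
  -- the determinant of `r y ∘ i y` is a continuous function with value `1` at `y₀`
  have hD : ∀ᶠ y in 𝓝 y₀, LinearMap.det (r y ∘ₗ i y) ≠ 0 := by
    have h1 : ContinuousAt (fun y => (r y ∘ₗ i y).toContinuousLinearMap) y₀ := by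
      have h2 := (VBundle.contAt_iff_mat c c hc hc).1 (P.contAt y₀)
      have h3 : ∀ y, (r y ∘ₗ i y).toContinuousLinearMap = A'.toContinuousLinearMap ∘L
          (VBundle.mat P.toFun c c y) ∘L A.toContinuousLinearMap := fun y => by
        ext x; rfl
      simp only [h3]
      exact continuousAt_const.clm_comp (h2.clm_comp continuousAt_const)
    have h2 : ContinuousAt (fun y => ((r y ∘ₗ i y).toContinuousLinearMap).det) y₀ :=
      ContinuousLinearMap.continuous_det.continuousAt.comp h1
    refine (h2.eventually_ne (y := 0) ?_)
    have h4 : r y₀ ∘ₗ i y₀ = LinearMap.id := by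
      refine LinearMap.ext fun x => ?_
      have h5 : P y₀ (ψ.symm x).1 = (ψ.symm x).1 := by
        obtain ⟨⟨_, e, rfl⟩, hz⟩ : ∃ z, z = ψ.symm x := ⟨_, rfl⟩
        rw [← hz]
        exact hP y₀ e
      have h6 : c.sec y₀ (A x) = (ψ.symm x).1 := c.sec_co hc _
      change A' (c.co y₀ (P y₀ (c.sec y₀ (A x)))) = x
      rw [h6, h5]
      exact hAA x
    simp [ContinuousLinearMap.det, h4]
  obtain ⟨U, hU, hUo, hyU⟩ := mem_nhds_iff.1 (hKb.and (hD.and (c.isOpen.mem_nhds hc)))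
  have hbij : ∀ y : U, Function.Bijective (r y.1 ∘ₗ (LinearMap.range (P y.1)).subtype) := by
    intro y
    obtain ⟨h1, h2, -⟩ := hU y.2
    constructor
    · rw [injective_iff_map_eq_zero]
      rintro ⟨_, e, rfl⟩ hv
      have h3 : r y.1 (P y.1 e) = 0 := hv
      refine Subtype.ext (h1.1 ?_)
      change K y.1 (P y.1 e) = K y.1 0
      simp only [K, LinearMap.add_apply, hJ, LinearMap.id_apply, neg_apply, hP, h3, map_zero]
      simp
    · intro x
      obtain ⟨z, hz⟩ := (LinearMap.isUnit_iff_isUnit_det (r y.1 ∘ₗ i y.1)).2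
        (isUnit_iff_ne_zero.2 h2) |> (Module.End.isUnit_iff _).1 |>.2 x
      exact ⟨⟨i y.1 z, _, rfl⟩, hz⟩
  let φ : ∀ y : U, LinearMap.range (P y) ≃ₗ[ℂ] (Fin _ → ℂ) := fun y =>
    LinearEquiv.ofBijective _ (hbij y)
  have hbase : Continuous (Tot.base : (Tot fun y => LinearMap.range (P y)) → Y.Total) :=
    Continuous.comp (g := (Tot.base : Tot E.fiber → Y.Total)) E.continuous_base hi.continuous
  refine ⟨_, U, φ, hUo, hyU, Tot.isHomeomorph_trivMap_of_continuous (φ := fun y => (φ y).toEquiv)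
    hbase ?_ ?_⟩
  · rw [continuous_iff_continuousAt]
    intro e
    have h1 := c.continuousAt_co (e := ⟨e.1.base, e.1.pt.1⟩) (hU e.2).2.2
    exact A'.continuous_of_finiteDimensional.continuousAt.comp
      (ContinuousAt.comp (g := fun e : Tot E.fiber => c.co e.base e.pt)
        (f := fun e : {e : Tot (fun y => LinearMap.range (P y)) // e.base ∈ U} =>
          (⟨e.1.base, e.1.pt.1⟩ : Tot E.fiber)) h1
        (hi.continuous.comp continuous_subtype_val).continuousAt)
  · -- the inverse of `φ y` is `(K y)⁻¹ ∘ i y`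
    rw [hi.continuous_iff, continuous_iff_continuousAt]
    intro z
    classical
    let K' : ∀ y, E.fiber y →ₗ[ℂ] E.fiber y := fun y =>
      if hy : Function.Bijective (K y) then (LinearEquiv.ofBijective (K y) hy).symm.toLinearMap
      else 0
    have hK' : ∀ y ∈ U, ∀ e, K' y (K y e) = e := by
      intro y hy e
      simp only [K', dif_pos (hU hy).1]
      exact (LinearEquiv.ofBijective (K y) _).symm_apply_apply e
    have hK'' : ∀ y ∈ U, ∀ e, K y (K' y e) = e := by
      intro y hy e
      simp only [K', dif_pos (hU hy).1]
      exact (LinearEquiv.ofBijective (K y) _).apply_symm_apply e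
    have hK'c : VBundle.ContAt K' z.1.1 := by
      refine (hKc z.1.1 (hU z.1.2).2.2).inverse ?_ ?_
      · filter_upwards [hUo.mem_nhds z.1.2] with y hy using LinearMap.ext (hK' y hy)
      · filter_upwards [hUo.mem_nhds z.1.2] with y hy using LinearMap.ext (hK'' y hy)
    have h1 : ContinuousAt (fun z : U × _ => (⟨z.1.1, c.sec z.1.1 (A z.2)⟩ : Tot E.fiber)) z := by
      refine (c.continuousAt_iff (h := fun z : U × _ => (⟨z.1.1, c.sec z.1.1 (A z.2)⟩ :
        Tot E.fiber)) (hU z.1.2).2.2).2 ⟨by fun_prop, ?_⟩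
      simp only [fun z : U × (Fin _ → ℂ) => c.co_sec (hU z.1.2).2.2 (A z.2)]
      exact (A.continuous_of_finiteDimensional.comp continuous_snd).continuousAt
    have h2 := VBundle.ContAt.apply (f := fun z : U × (Fin _ → ℂ) => z.1.1) hK'c
      (VBundle.ContAt.apply (f := fun z : U × (Fin _ → ℂ) => z.1.1) (P.contAt z.1.1) h1)
    refine h2.congr (Filter.Eventually.of_forall fun z => ?_)
    refine congrArg (Tot.mk z.1.1) ?_
    obtain ⟨⟨v, e, rfl⟩, hv⟩ := (φ z.1).surjective z.2
    have h3 : (φ z.1).toEquiv.symm z.2 = ⟨P z.1 e, e, rfl⟩ := by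
      rw [← hv]
      exact (φ z.1).symm_apply_apply _
    simp only [h3]
    have h4 : i z.1 z.2 = K z.1 (P z.1 e) := by
      simp only [K, LinearMap.add_apply, hJ, LinearMap.id_apply, neg_apply, hP]
      rw [← hv]
      change i z.1 (r z.1 (P z.1 e)) = _
      abel
    refine Eq.trans ?_ (hK' z.1 z.1.2 (P z.1 e))
    exact congrArg (K' z.1) h4

variable (P : Mor E E) (hP : ∀ y e, P y (P y e) = P y e)

/-- The embedding of the total space of the image of a morphism. -/
def rangeEmb (e : Tot fun y => LinearMap.range (P y)) : Tot E.fiber := ⟨e.base, e.pt.1⟩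

instance : TopologicalSpace (Tot fun y => LinearMap.range (P y)) :=
  TopologicalSpace.induced P.rangeEmb inferInstance

theorem isInducing_rangeEmb : IsInducing P.rangeEmb := ⟨rfl⟩

theorem rangeEmb_injective : Function.Injective P.rangeEmb := by
  rintro ⟨y, v⟩ ⟨y', v'⟩ h
  obtain ⟨h1, h2⟩ := Tot.mk.inj h
  simp only at h1
  subst h1
  exact congrArg (Tot.mk y) (Subtype.ext (eq_of_heq h2))

/-- The image of an idempotent morphism, an equivariant vector bundle. -/
@[reducible] def image : EquivVB Y where
  fiber y := LinearMap.range (P y)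
  continuous_base := E.continuous_base.comp P.isInducing_rangeEmb.continuous
  locTriv := P.exists_triv_range hP P.isInducing_rangeEmb
  act {b} g y := (E.act g y).restrict (by
    rintro _ ⟨e, rfl⟩
    exact ⟨E.act g y e, P.equivariant g y e⟩)
  act_one y e := P.rangeEmb_injective (E.act_one y e.1)
  act_mul g h y e := P.rangeEmb_injective (E.act_mul g h y e.1)
  continuous_act := by
    refine P.isInducing_rangeEmb.continuous_iff.2 (E.continuous_act.comp
      (f := fun z : Tot (PullFam Y.actSnd fun y => LinearMap.range (P y)) =>
        (⟨z.base, z.val.1⟩ : Tot (PullFam Y.actSnd E.fiber))) ?_)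
    exact Tot.continuous_to_pull (f := Y.actSnd) Tot.continuous_pull_base
      (P.isInducing_rangeEmb.continuous.comp (Tot.continuous_pull_pt (f := Y.actSnd)))

/-- The inclusion of the image of an idempotent. -/
def incl : Mor (P.image hP) E where
  toFun y := (LinearMap.range (P y)).subtype
  continuous := P.isInducing_rangeEmb.continuous
  equivariant _ _ _ := rfl

/-- The projection to the image of an idempotent. -/
def proj : Mor E (P.image hP) where
  toFun y := (P y).rangeRestrict
  continuous := P.isInducing_rangeEmb.continuous_iff.2 P.continuous
  equivariant g y e := Subtype.ext (P.equivariant g y e)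

@[simp] theorem proj_incl (y : Y.Total) (e : (P.image hP).fiber y) :
    P.proj hP y (P.incl hP y e) = e := by
  obtain ⟨_, e, rfl⟩ := e
  exact Subtype.ext (hP y e)

@[simp] theorem apply_incl (y : Y.Total) (e : (P.image hP).fiber y) :
    P y (P.incl hP y e) = P.incl hP y e := by
  obtain ⟨_, e, rfl⟩ := e
  exact hP y e

end Mor

end image

/-! ### Descent of morphisms -/

section descent

variable {𝒢 : GroupBundle.{u, v} B} {𝒢' : GroupBundle.{u, v'} B} {γ : 𝒢.Hom 𝒢'}
  {X : GSpace.{u, v, w} 𝒢} {Y : GSpace.{u, v', w'} 𝒢'}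

theorem Mor.map_cast {E E' : EquivVB Y} (m : Mor E E') {y y' : Y.Total} (h : y = y')
    (e : E.fiber y) : m y' (E.cast h e) = E'.cast h (m y e) := by
  subst h
  rfl

/-- The pull-back of a morphism. -/
def Mor.pull (f : GSpace.Hom γ X Y) {E E' : EquivVB Y} (m : Mor E E') :
    Mor (E.pull f) (E'.pull f) where
  toFun x := m (f.tot x)
  continuous := Tot.continuous_to_pull (f := f.tot) (E := E'.fiber)
    (Tot.continuous_pull_base (f := f.tot) (E := E.fiber))
    (m.continuous.comp (Tot.continuous_pull_pt (f := f.tot) (E := E.fiber)))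
  equivariant g x e := (m.map_cast (tot_smul f g x) _).trans
    (congrArg (E'.cast (tot_smul f g x)) (m.equivariant _ _ e))

end descent

end EquivVB

/-- The equivariant map `f` is the quotient map by the kernel of the surjection `γ`. -/
structure GSpace.Hom.IsKerQuot {B : Type u} [TopologicalSpace B] {𝒢 : GroupBundle.{u, v} B}
    {𝒢' : GroupBundle.{u, v'} B} {γ : 𝒢.Hom 𝒢'} {X : GSpace.{u, v, w} 𝒢}
    {Y : GSpace.{u, v', w'} 𝒢'} (f : GSpace.Hom γ X Y) : Prop where
  isOpenMap : IsOpenMap f.tot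
  surjective : Function.Surjective f.tot
  gamma_surjective : ∀ b, Function.Surjective (γ.toFun b)
  orbits : ∀ b (x x' : X.fiber b), f.toFun b x = f.toFun b x' →
    ∃ k : 𝒢.fiber b, γ.toFun b k = 1 ∧ k • x = x'

namespace EquivVB

section descent

variable {B : Type u} [TopologicalSpace B] {𝒢 : GroupBundle.{u, v} B} {𝒢' : GroupBundle.{u, v'} B}
  {γ : 𝒢.Hom 𝒢'} {X : GSpace.{u, v, w} 𝒢} {Y : GSpace.{u, v', w'} 𝒢'} {f : GSpace.Hom γ X Y}

theorem isOpenMap_pullTot (hf : IsOpenMap f.tot) (A : EquivVB Y) :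
    IsOpenMap fun z : Tot (A.pull f).fiber => (⟨f.tot z.base, z.pt⟩ : Tot A.fiber) := by
  intro S hS
  obtain ⟨S', hS', rfl⟩ := (Tot.isInducing_pullEmb (f := f.tot) (E := A.fiber)).isOpen_iff.1 hS
  refine isOpen_iff_mem_nhds.2 ?_
  rintro _ ⟨⟨x, a⟩, hz, rfl⟩
  obtain ⟨U, V, hU, hV, hxU, haV, hUV⟩ := isOpen_prod_iff.1 hS' x ⟨f.tot x, a⟩ hz
  have h1 : {e : Tot A.fiber | e.base ∈ f.tot '' U} ∈ 𝓝 (⟨f.tot x, a⟩ : Tot A.fiber) :=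
    ((hf U hU).preimage A.continuous_base).mem_nhds ⟨x, hxU, rfl⟩
  filter_upwards [h1, hV.mem_nhds haV] with e he heV
  obtain ⟨y, e⟩ := e
  obtain ⟨x', hx', hy⟩ := he
  simp only at hy
  subst hy
  exact ⟨⟨x', e⟩, hUV (show (x', _) ∈ U ×ˢ V from ⟨hx', heV⟩), rfl⟩

theorem surjective_pullTot (hf : Function.Surjective f.tot) (A : EquivVB Y) :
    Function.Surjective fun z : Tot (A.pull f).fiber => (⟨f.tot z.base, z.pt⟩ : Tot A.fiber) := by
  rintro ⟨y, a⟩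
  obtain ⟨x, rfl⟩ := hf y
  exact ⟨⟨x, a⟩, rfl⟩

theorem isQuotientMap_pullTot (hf : f.IsKerQuot) (A : EquivVB Y) :
    IsQuotientMap fun z : Tot (A.pull f).fiber => (⟨f.tot z.base, z.pt⟩ : Tot A.fiber) :=
  (isOpenMap_pullTot hf.isOpenMap A).isQuotientMap
    (Tot.continuous_pull_pt (f := f.tot) (E := A.fiber)) (surjective_pullTot hf.surjective A)

variable {A C : EquivVB Y} (m : Mor (A.pull f) (C.pull f))

/-- A morphism of pulled back bundles takes equal values at points with the same image. -/
theorem Mor.mk_apply_eq (hf : f.IsKerQuot) {x x' : X.Total} {a : A.fiber (f.tot x)}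
    {a' : A.fiber (f.tot x')} (h : (⟨f.tot x, a⟩ : Tot A.fiber) = ⟨f.tot x', a'⟩) :
    (⟨f.tot x, m x a⟩ : Tot C.fiber) = ⟨f.tot x', m x' a'⟩ := by
  obtain ⟨b, x⟩ := x
  obtain ⟨b', x'⟩ := x'
  have h0 := (Tot.mk.inj h).1
  obtain ⟨h1, h2⟩ := Tot.mk.inj h0
  simp only at h1
  subst h1
  obtain ⟨k, hk, rfl⟩ := hf.orbits b x x' (eq_of_heq h2)
  have h3 : ∀ (D : EquivVB Y) (d : D.fiber (f.tot ⟨b, x⟩)),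
      (⟨f.tot ⟨b, k • x⟩, (D.pull f).act k x d⟩ : Tot D.fiber) = ⟨f.tot ⟨b, x⟩, d⟩ := fun D d =>
    (mk_pull_act f D k x d).trans ((D.act_congr hk rfl).trans (D.act_one (f.toFun b x) d))
  have h4 : a' = (A.pull f).act k x a :=
    eq_of_heq (Tot.mk.inj (h.symm.trans (h3 A a).symm)).2
  have h5 : m ⟨b, k • x⟩ a' = (C.pull f).act k x (m ⟨b, x⟩ a) :=
    (congrArg (m ⟨b, k • x⟩) h4).trans (m.equivariant k x a)
  exact ((congrArg (Tot.mk (f.tot ⟨b, k • x⟩)) h5).trans (h3 C _)).symm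

/-- The family of linear maps induced by a morphism of pulled back bundles. -/
noncomputable def Mor.descendFun (hf : f.IsKerQuot) (y : Y.Total) : A.fiber y →ₗ[ℂ] C.fiber y :=
  (C.cast (Function.surjInv_eq hf.surjective y)).toLinearMap ∘ₗ
    m (Function.surjInv hf.surjective y) ∘ₗ
      (A.cast (Function.surjInv_eq hf.surjective y)).symm.toLinearMap

theorem Mor.descendFun_apply (hf : f.IsKerQuot) (x : X.Total) (a : A.fiber (f.tot x)) :
    m.descendFun hf (f.tot x) a = m x a := by
  have h := m.mk_apply_eq hf (A.mk_cast_symm (Function.surjInv_eq hf.surjective (f.tot x)) a)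
  exact eq_of_heq (Tot.mk.inj ((C.mk_cast _ _).trans h)).2

/-- Morphisms of pulled back bundles descend to the quotient. -/
noncomputable def Mor.descend (hf : f.IsKerQuot) : Mor A C where
  toFun := m.descendFun hf
  continuous := by
    rw [(isQuotientMap_pullTot hf A).continuous_iff]
    refine ((Tot.continuous_pull_pt (f := f.tot) (E := C.fiber)).comp m.continuous).congr fun z => ?_
    exact congrArg (Tot.mk _) (m.descendFun_apply hf z.base z.pt).symm
  equivariant {b} g y e := by
    obtain ⟨k, rfl⟩ := hf.gamma_surjective b g
    obtain ⟨x, rfl⟩ : ∃ x, f.toFun b x = y := by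
      obtain ⟨⟨b', x⟩, hx⟩ := hf.surjective ⟨b, y⟩
      obtain ⟨h1, h2⟩ := Tot.mk.inj hx
      simp only at h1
      subst h1
      exact ⟨x, eq_of_heq h2⟩
    have h1 := congrArg (VBundle.totMap (m.descendFun hf)) (mk_pull_act f A k x e)
    have h2 : VBundle.totMap (m.descendFun hf)
        ⟨f.tot ⟨b, k • x⟩, (A.pull f).act k x e⟩ =
        ⟨f.tot ⟨b, k • x⟩, (C.pull f).act k x (m ⟨b, x⟩ e)⟩ :=
      congrArg (Tot.mk _) ((m.descendFun_apply hf ⟨b, k • x⟩ _).trans (m.equivariant k x e))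
    have h3 := h1.symm.trans (h2.trans (mk_pull_act f C k x (m ⟨b, x⟩ e)))
    have h4 := eq_of_heq (Tot.mk.inj h3).2
    refine h4.trans (congrArg _ (m.descendFun_apply hf ⟨b, x⟩ e).symm)

theorem Mor.descend_apply (hf : f.IsKerQuot) (x : X.Total) (a : A.fiber (f.tot x)) :
    m.descend hf (f.tot x) a = m x a := m.descendFun_apply hf x a

/-- Bundles on the quotient with isomorphic pull-backs are isomorphic. -/
theorem Iso.descend (hf : f.IsKerQuot) {A C : EquivVB Y} (i : Iso (A.pull f) (C.pull f)) :
    Nonempty (Iso A C) := by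
  refine ⟨(i.toMor.descend hf).toIso (i.symm.toMor.descend hf) ?_ ?_⟩
  · intro y e
    obtain ⟨x, rfl⟩ := hf.surjective y
    rw [Mor.descend_apply, Mor.descend_apply]
    exact i.symm_toMor_apply x e
  · intro y e
    obtain ⟨x, rfl⟩ := hf.surjective y
    rw [Mor.descend_apply, Mor.descend_apply]
    exact i.toMor_symm_apply x e

end descent

end EquivVB

/-! ### Quotient maps -/

namespace GSpace

variable {B : Type u} [TopologicalSpace B] {𝒢 : GroupBundle.{u, v} B} {ℋ : GroupBundle.{u, v'} B}

theorem quotMap_isKerQuot (X : GSpace.{u, max v v', w} (𝒢.prod ℋ)) : X.quotMap.IsKerQuot where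
  isOpenMap := X.isOpenMap_quotProj
  surjective := X.quotProj_surjective
  gamma_surjective _ g := ⟨(g, 1), rfl⟩
  orbits b x x' h := by
    obtain ⟨k, hk⟩ := X.quotMk_eq.1 h.symm
    exact ⟨_, rfl, hk⟩

variable [CompactSpace B] [T2Space B]

/-- The extension of the quotient map to the one-point compactifications. -/
abbrev quotPlus (X : GSpace.{u, max v v', w} (𝒢.prod ℋ)) :
    Hom (GroupBundle.fst 𝒢 ℋ) X.plus X.quot.plus := X.quotMap.plus X.quotMap_proper

theorem quotPlus_isKerQuot (X : GSpace.{u, max v v', w} (𝒢.prod ℋ)) : X.quotPlus.IsKerQuot where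
  isOpenMap := by
    intro S hS
    have h := X.isOpen_plus_iff.1 hS
    refine X.quot.isOpen_plus_iff.2 ⟨?_, ?_⟩
    · convert! X.isOpenMap_quotProj _ h.1 using 1
      ext ⟨b, y⟩
      constructor
      · rintro ⟨⟨b', x⟩, hx, he⟩
        obtain ⟨h1, h2⟩ := Tot.mk.inj he
        simp only at h1
        subst h1
        cases x with
        | none => exact absurd (eq_of_heq h2) (by simp [quotPlus, Hom.plus])
        | some x =>
          exact ⟨⟨b', x⟩, hx, congrArg (Tot.mk b') (Option.some.inj (eq_of_heq h2))⟩
      · rintro ⟨⟨b', x⟩, hx, he⟩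
        obtain ⟨h1, h2⟩ := Tot.mk.inj he
        simp only at h1
        subst h1
        exact ⟨⟨b', some x⟩, hx, congrArg (Tot.mk b') (congrArg some (eq_of_heq h2))⟩
    · rintro b ⟨⟨b', x⟩, hx, he⟩
      obtain ⟨h1, h2⟩ := Tot.mk.inj he
      simp only at h1
      subst h1
      cases x with
      | some x => exact absurd (eq_of_heq h2) (by simp [quotPlus, Hom.plus])
      | none =>
        obtain ⟨V, K, hV, hbV, hK, h1, h2⟩ := h.2 b' hx
        refine ⟨V, X.quotProj '' K, hV, hbV, hK.image X.continuous_quotProj,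
          fun c hc => ⟨_, h1 c hc, rfl⟩, fun y hy hyK => ?_⟩
        obtain ⟨x, rfl⟩ := X.quotProj_surjective y
        exact ⟨_, h2 x hy fun hxK => hyK ⟨x, hxK, rfl⟩, rfl⟩
  surjective := by
    rintro ⟨b, _ | y⟩
    · exact ⟨⟨b, none⟩, rfl⟩
    · obtain ⟨x, rfl⟩ := X.quotMk_surjective b y
      exact ⟨⟨b, some x⟩, rfl⟩
  gamma_surjective _ g := ⟨(g, 1), rfl⟩
  orbits b x x' h := by
    cases x with
    | none => cases x' with
      | none => exact ⟨1, rfl, rfl⟩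
      | some x' => exact absurd h (by simp [quotPlus, Hom.plus])
    | some x => cases x' with
      | none => exact absurd h (by simp [quotPlus, Hom.plus])
      | some x' =>
        obtain ⟨k, hk⟩ := X.quotMk_eq.1 (Option.some.inj h).symm
        exact ⟨_, rfl, congrArg some hk⟩

end GSpace

/-! ### The topology of the one-point compactification -/

namespace GSpace

section plus

variable {B : Type u} [TopologicalSpace B] [CompactSpace B] [T2Space B] {𝒢 : GroupBundle.{u, v} B}
  (X : GSpace.{u, v, w} 𝒢)

theorem t2Space_plus [T2Space X.Total] [LocallyCompactSpace X.Total] : T2Space X.plus.Total := by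
  have key : ∀ (b : B) (x : X.fiber b), ∃ U V : Set X.plus.Total, IsOpen U ∧ IsOpen V ∧
      (⟨b, some x⟩ : X.plus.Total) ∈ U ∧ (⟨b, none⟩ : X.plus.Total) ∈ V ∧ Disjoint U V := by
    intro b x
    obtain ⟨K, hK, hxK⟩ := exists_compact_mem_nhds (⟨b, x⟩ : X.Total)
    refine ⟨(fun x : X.Total => (⟨x.base, some x.pt⟩ : X.plus.Total)) '' interior K,
      {z | ∀ x, z.pt = some x → (⟨z.base, x⟩ : X.Total) ∉ K}, X.isOpenMap_some _ isOpen_interior,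
      X.isOpen_plus_iff.2 ⟨?_, fun b _ => ⟨univ, K, isOpen_univ, trivial, hK, ?_, ?_⟩⟩,
      ⟨_, mem_interior_iff_mem_nhds.2 hxK, rfl⟩, ?_, ?_⟩
    · convert! hK.isClosed.isOpen_compl using 1
      ext x
      exact ⟨fun h => h x.pt rfl, fun h y hy => Option.some.inj hy ▸ h⟩
    · intro b' _ x hx
      cases hx
    · intro x _ hx y hy
      exact Option.some.inj hy ▸ hx
    · intro x hx
      cases hx
    · rw [Set.disjoint_left]
      rintro _ ⟨x, hx, rfl⟩ h
      exact h x.pt rfl (interior_subset hx)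
  refine ⟨fun p q hpq => ?_⟩
  by_cases hb : p.base = q.base
  · obtain ⟨b, p⟩ := p
    obtain ⟨b', q⟩ := q
    simp only at hb
    subst hb
    cases p with
    | none => cases q with
      | none => exact absurd rfl hpq
      | some y =>
        obtain ⟨U, V, hU, hV, hx, hn, h⟩ := key b y
        exact ⟨V, U, hV, hU, hn, hx, h.symm⟩
    | some x => cases q with
      | none => exact key b x
      | some y =>
        have hxy : (⟨b, x⟩ : X.Total) ≠ ⟨b, y⟩ := by
          intro h
          apply hpq
          rw [eq_of_heq (Tot.mk.inj h).2]
        obtain ⟨U, V, hU, hV, hx, hy, h⟩ := t2_separation hxy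
        refine ⟨_, _, X.isOpenMap_some _ hU, X.isOpenMap_some _ hV, ⟨_, hx, rfl⟩, ⟨_, hy, rfl⟩,
          Set.disjoint_left.2 ?_⟩
        rintro _ ⟨⟨c, x'⟩, hx', rfl⟩ ⟨⟨c', y'⟩, hy', he⟩
        obtain ⟨h1, h2⟩ := Tot.mk.inj he
        simp only at h1
        subst h1
        have h3 : y' = x' := Option.some.inj (eq_of_heq h2)
        subst h3
        exact Set.disjoint_left.1 h hx' hy'
  · exact separated_by_continuous X.plus.continuous_base hb

theorem compactSpace_plus : CompactSpace X.plus.Total := by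
  refine ⟨isCompact_iff_ultrafilter_le_nhds.2 fun F _ => ?_⟩
  obtain ⟨b, -, hb⟩ := isCompact_iff_ultrafilter_le_nhds.1 (isCompact_univ (X := B))
    (F.map (Tot.base : X.plus.Total → B)) (by simp)
  by_cases h : (F : Filter X.plus.Total) ≤ 𝓝 (⟨b, none⟩ : X.plus.Total)
  · exact ⟨_, mem_univ _, h⟩
  · obtain ⟨S, ⟨hbS, hS⟩, hSF⟩ : ∃ S : Set X.plus.Total,
        ((⟨b, none⟩ : X.plus.Total) ∈ S ∧ IsOpen S) ∧ S ∉ F := by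
      by_contra! hc
      exact h (((nhds_basis_opens _).ge_iff).2 fun S hS => hc S hS)
    obtain ⟨V, K, hV, hbV, hK, h1, h2⟩ := (X.isOpen_plus_iff.1 hS).2 b hbS
    have hVF : {z : X.plus.Total | z.base ∈ V} ∈ F := hb (hV.mem_nhds hbV)
    have hSF' : Sᶜ ∈ F := Ultrafilter.compl_mem_iff_notMem.2 hSF
    have hKc : IsCompact ((fun x : X.Total => (⟨x.base, some x.pt⟩ : X.plus.Total)) '' K) :=
      hK.image X.continuous_some
    have hKF : ((fun x : X.Total => (⟨x.base, some x.pt⟩ : X.plus.Total)) '' K) ∈ F := by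
      filter_upwards [hVF, hSF'] with z hz hzS
      obtain ⟨c, z⟩ := z
      cases z with
      | none => exact absurd (h1 c hz) hzS
      | some x =>
        by_cases hx : (⟨c, x⟩ : X.Total) ∈ K
        · exact ⟨_, hx, rfl⟩
        · exact absurd (h2 ⟨c, x⟩ hz hx) hzS
    obtain ⟨z, -, hz⟩ := isCompact_iff_ultrafilter_le_nhds.1 hKc F (Filter.le_principal_iff.2 hKF)
    exact ⟨z, mem_univ _, hz⟩

/-- The points at infinity. -/
def atInfty : Set X.plus.Total := {z | z.pt = none}

theorem isClosed_atInfty : IsClosed X.atInfty := by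
  rw [← isOpen_compl_iff]
  convert! X.isOpenMap_some _ isOpen_univ using 1
  ext ⟨b, z⟩
  constructor
  · intro h
    cases z with
    | none => exact absurd rfl h
    | some x => exact ⟨⟨b, x⟩, trivial, rfl⟩
  · rintro ⟨x, -, hx⟩ h
    rw [← hx] at h
    cases h

theorem isInvariant_atInfty : X.plus.IsInvariant X.atInfty := by
  intro b g y hy
  have hy : y = none := hy
  subst hy
  rfl

end plus

end GSpace

namespace EquivVB

section tietze

variable {B : Type u} [TopologicalSpace B] [CompactSpace B] [T2Space B] {𝒢 : GroupBundle.{u, v} B}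
  {X : GSpace.{u, v, w} 𝒢} {A C : EquivVB X.plus}

/-- A local extension of a morphism on the section at infinity, in charts of the two bundles. -/
noncomputable def extendChart (m : Mor (A.pull X.infty) (C.pull X.infty)) (a : A.Chart)
    (c : C.Chart) (z : X.plus.Total) : A.fiber z →ₗ[ℂ] C.fiber z :=
  c.sec z ∘ₗ (c.co ⟨z.base, none⟩ ∘ₗ m ⟨z.base, ()⟩ ∘ₗ a.sec ⟨z.base, none⟩) ∘ₗ a.co z

theorem contAt_extendChart (m : Mor (A.pull X.infty) (C.pull X.infty)) (a : A.Chart)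
    (c : C.Chart) {z : X.plus.Total} (ha : z ∈ a.U) (hc : z ∈ c.U)
    (ha' : (⟨z.base, none⟩ : X.plus.Total) ∈ a.U) (hc' : (⟨z.base, none⟩ : X.plus.Total) ∈ c.U) :
    VBundle.ContAt (extendChart m a c) z := by
  have hr : Continuous fun z : X.plus.Total => (⟨z.base, none⟩ : X.plus.Total) :=
    X.continuous_none.comp X.plus.continuous_base
  have hβ : Continuous fun z : X.plus.Total => (⟨z.base, ()⟩ : (GSpace.base 𝒢).Total) :=
    Tot.isInducing_base.continuous_iff.2 X.plus.continuous_base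
  rw [VBundle.contAt_iff_chart a ha]
  intro x
  refine (c.continuousAt_iff (h := fun z => (⟨z, extendChart m a c z (a.sec z x)⟩ : Tot C.fiber))
    hc).2 ⟨continuousAt_id, ?_⟩
  have h1 : ContinuousAt (fun z : X.plus.Total =>
      (⟨⟨z.base, ()⟩, a.sec ⟨z.base, none⟩ x⟩ : Tot (A.pull X.infty).fiber)) z := by
    refine (Tot.isInducing_pullEmb (f := X.infty.tot) (E := A.fiber)).continuousAt_iff.2 ?_
    exact hβ.continuousAt.prodMk (ContinuousAt.comp
      (f := fun z : X.plus.Total => (⟨z.base, none⟩ : X.plus.Total))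
      (a.continuousAt_sec ha' x) hr.continuousAt)
  have h2 : ContinuousAt (fun z : X.plus.Total =>
      (⟨⟨z.base, none⟩, m ⟨z.base, ()⟩ (a.sec ⟨z.base, none⟩ x)⟩ : Tot C.fiber)) z :=
    ((Tot.continuous_pull_pt (f := X.infty.tot) (E := C.fiber)).comp
      m.continuous).continuousAt.comp h1
  have h3 := ContinuousAt.comp (g := fun e : Tot C.fiber => c.co e.base e.pt)
    (f := fun z : X.plus.Total =>
      (⟨⟨z.base, none⟩, m ⟨z.base, ()⟩ (a.sec ⟨z.base, none⟩ x)⟩ : Tot C.fiber))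
    (c.continuousAt_co (e := ⟨⟨z.base, none⟩, _⟩) hc') h2
  refine h3.congr ?_
  filter_upwards [a.isOpen.mem_nhds ha, c.isOpen.mem_nhds hc] with y hya hyc
  simp only [extendChart, LinearMap.comp_apply, a.co_sec hya, c.co_sec hyc]
  rfl

/-- A morphism on the section at infinity extends to the one-point compactification. -/
theorem Mor.exists_extend [T2Space X.plus.Total] (m : Mor (A.pull X.infty) (C.pull X.infty)) :
    ∃ M : Mor A C, ∀ (b : B) (e : A.fiber ⟨b, none⟩), M ⟨b, none⟩ e = m ⟨b, ()⟩ e := by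
  have := X.compactSpace_plus
  choose a ha using fun z : X.plus.Total => A.exists_chart z
  choose c hc using fun z : X.plus.Total => C.exists_chart z
  have hr : Continuous fun z : X.plus.Total => (⟨z.base, none⟩ : X.plus.Total) :=
    X.continuous_none.comp X.plus.continuous_base
  let O : X.plus.Total → Set X.plus.Total := fun z =>
    ((a z).U ∩ (c z).U) ∩ (fun z : X.plus.Total => (⟨z.base, none⟩ : X.plus.Total)) ⁻¹'
      ((a z).U ∩ (c z).U)
  have hO : ∀ z, IsOpen (O z) := fun z =>
    ((a z).isOpen.inter (c z).isOpen).inter (((a z).isOpen.inter (c z).isOpen).preimage hr)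
  obtain ⟨t, ht⟩ := X.isClosed_atInfty.isCompact.elim_finite_subcover (fun z : X.atInfty => O z)
    (fun z => hO z) (by
      rintro ⟨b, z⟩ hz
      have hz : z = none := hz
      subst hz
      exact mem_iUnion.2 ⟨⟨⟨b, none⟩, rfl⟩, ⟨ha _, hc _⟩, ⟨ha _, hc _⟩⟩)
  obtain ⟨f, hfs, hf1, -, -⟩ := exists_continuous_sum_one_of_isOpen_isCompact
    (s := fun i => O (t.equivFin.symm i).1.1) (fun i => hO _) X.isClosed_atInfty.isCompact (by
      intro z hz
      obtain ⟨i, hi, hzi⟩ := mem_iUnion₂.1 (ht hz)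
      exact mem_iUnion.2 ⟨t.equivFin ⟨i, hi⟩, by simpa using hzi⟩)
  let L : ∀ z, A.fiber z →ₗ[ℂ] C.fiber z := fun z => ∑ i, (f i z : ℂ) •
    extendChart m (a (t.equivFin.symm i).1.1) (c (t.equivFin.symm i).1.1) z
  have hL : Continuous (VBundle.totMap L) := by
    rw [VBundle.continuous_totMap_iff]
    rintro _ e rfl
    have h1 := VBundle.continuousAt_sum (E := C.toVBundle) (z := e) (f := fun e : Tot A.fiber => e.base)
      Finset.univ A.continuous_base.continuousAt
      (s := fun i e => ((f i e.base : ℂ) • extendChart m (a (t.equivFin.symm i).1.1)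
        (c (t.equivFin.symm i).1.1) e.base) e.pt) (fun i _ => by
        refine VBundle.contAt_smul_of_tsupport (a := fun z => (f i z : ℂ))
          (Complex.continuous_ofReal.comp (f i).continuous) (fun z hz => ?_) e.base e rfl
        have hz' : z ∈ O (t.equivFin.symm i).1.1 := by
          refine hfs i (closure_mono (show Function.support (fun z => (f i z : ℂ)) ⊆
            Function.support (f i) from fun y hy h => hy ?_) hz)
          simp only [h, Complex.ofReal_zero]
        exact contAt_extendChart m _ _ hz'.1.1 hz'.1.2 hz'.2.1 hz'.2.2)
    refine h1.congr (Filter.Eventually.of_forall fun e => ?_)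
    exact congrArg (Tot.mk e.base) (by simp only [L, LinearMap.sum_apply])
  have hLinf : ∀ (b : B) (e : A.fiber ⟨b, none⟩), L ⟨b, none⟩ e = m ⟨b, ()⟩ e := by
    intro b e
    obtain ⟨w, hw⟩ : ∃ w : C.fiber ⟨b, none⟩, w = m ⟨b, ()⟩ e := ⟨_, rfl⟩
    have h1 : ∀ i, ((f i ⟨b, none⟩ : ℂ) • extendChart m (a (t.equivFin.symm i).1.1)
        (c (t.equivFin.symm i).1.1) ⟨b, none⟩) e = (f i ⟨b, none⟩ : ℂ) • w := by
      intro i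
      by_cases hi : f i ⟨b, none⟩ = 0
      · rw [hi, Complex.ofReal_zero, zero_smul, zero_smul, LinearMap.zero_apply]
      · have hz := hfs i (subset_tsupport _ hi)
        rw [LinearMap.smul_apply]
        congr 1
        simp only [extendChart, LinearMap.comp_apply]
        refine ((c _).sec_co hz.1.2 _).trans ?_
        exact (congrArg (m ⟨b, ()⟩) ((a _).sec_co hz.1.1 e)).trans hw.symm
    have h2 := hf1 (show (⟨b, none⟩ : X.plus.Total) ∈ X.atInfty from rfl)
    simp only [Finset.sum_apply, Pi.one_apply] at h2
    refine Eq.trans ?_ hw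
    simp only [L, LinearMap.sum_apply, h1]
    rw [← Finset.sum_smul, ← Complex.ofReal_sum, h2, Complex.ofReal_one, one_smul]
  refine ⟨average L hL, fun b e => ?_⟩
  have h3 := average_apply L hL (y := (none : Option (X.fiber b))) (e := e)
    (e' := (m ⟨b, ()⟩ e : C.fiber ⟨b, none⟩)) (a := 1) (fun g => by
      refine (hLinf b (A.act g none e)).trans ?_
      refine Eq.trans ?_ (one_smul ℂ _).symm
      exact m.equivariant g () e)
  refine h3.trans ?_
  have h4 : X.plus.avgFun 1 ⟨b, none⟩ = 1 := by simp [GSpace.avgFun]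
  rw [h4, Complex.ofReal_one]
  exact one_smul ℂ (m ⟨b, ()⟩ e : C.fiber ⟨b, none⟩)

end tietze

/-! ### Invariant functionals -/

section functionals

variable {B : Type u} [TopologicalSpace B] {𝒢 : GroupBundle.{u, v} B} {Y : GSpace.{u, v, w} 𝒢}

/-- Continuous families of linear functionals on the fibres of an equivariant vector bundle that
are constant along the orbits. -/
structure InvFunctional (F : EquivVB Y) where
  toFun : ∀ y, F.fiber y →ₗ[ℂ] ℂ
  continuous : Continuous fun e : Tot F.fiber => toFun e.base e.pt
  invariant : ∀ {b : B} (g : 𝒢.fiber b) (y : Y.fiber b) (e : F.fiber ⟨b, y⟩),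
    toFun _ (F.act g y e) = toFun _ e

open MeasureTheory in
/-- The average of a continuous family of linear functionals over the group. -/
noncomputable def avgFunctional (F : EquivVB Y) (Λ : ∀ y, F.fiber y →ₗ[ℂ] ℂ)
    (hΛ : Continuous fun e : Tot F.fiber => Λ e.base e.pt) : InvFunctional F :=
  have hc : Continuous fun x : Tot (PullFam (fun e : Tot F.fiber => e.base.base) 𝒢.fiber) =>
      Λ ⟨x.base.base.base, x.val • x.base.base.pt⟩ (F.act x.val x.base.base.pt x.base.pt) :=
    hΛ.comp (F.continuous_act_tot
      (Tot.continuous_pull_pt (f := fun e : Tot F.fiber => e.base.base))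
      (Tot.continuous_pull_base (f := fun e : Tot F.fiber => e.base.base)))
  have hi : ∀ e : Tot F.fiber, Continuous fun g : 𝒢.fiber e.base.base =>
      Λ ⟨e.base.base, g • e.base.pt⟩ (F.act g e.base.pt e.pt) := fun e =>
    hc.comp (GroupBundle.continuous_fiber_mk (β := fun e : Tot F.fiber => e.base.base) e)
  { toFun := fun y =>
      { toFun := fun e => ∫ g, Λ ⟨y.base, g • y.pt⟩ (F.act g y.pt e) ∂normHaar (𝒢.fiber y.base)
        map_add' := fun e e' => by
          simp only [map_add]
          exact integral_add (integrable_of_continuous (hi ⟨y, e⟩) _)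
            (integrable_of_continuous (hi ⟨y, e'⟩) _)
        map_smul' := fun a e => by
          simp only [map_smul]
          exact integral_smul a _ }
    continuous := GroupBundle.continuous_fiberIntegral (β := fun e : Tot F.fiber => e.base.base)
      (F := fun (e : Tot F.fiber) g => Λ ⟨e.base.base, g • e.base.pt⟩ (F.act g e.base.pt e.pt))
      (Y.continuous_base.comp F.continuous_base) hc
    invariant := fun {b} h y e => by
      have h1 := integral_mul_right_eq_self (μ := normHaar (𝒢.fiber b))
        (fun g => Λ ⟨b, g • y⟩ (F.act g y e)) h
      refine Eq.trans ?_ h1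
      refine congrArg (integral (normHaar (𝒢.fiber b))) (funext fun g => ?_)
      exact congrArg (fun e : Tot F.fiber => Λ e.base e.pt) (F.act_mul g h y e).symm }

open MeasureTheory in
/-- At a point with trivial stabilizer the invariant functionals separate the vectors: a
coordinate functional is multiplied by a bump function before it is averaged. -/
theorem exists_invFunctional_ne_zero [T2Space Y.Total] [CompactSpace Y.Total] (F : EquivVB Y)
    {b : B} {y : Y.fiber b} (hy : ∀ g : 𝒢.fiber b, g • y = y → g = 1) {e : F.fiber ⟨b, y⟩}
    (he : e ≠ 0) : ∃ Φ : InvFunctional F, Φ.toFun _ e ≠ 0 := by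
  obtain ⟨c, hc⟩ := F.exists_chart ⟨b, y⟩
  have hx : c.co ⟨b, y⟩ e ≠ 0 := by
    intro h
    apply he
    rw [← c.sec_co hc e, h, map_zero]
  obtain ⟨i, hi⟩ := Function.ne_iff.1 hx
  simp only [Pi.zero_apply] at hi
  set a : ℂ := c.co ⟨b, y⟩ e i with ha
  -- the function `g ↦ Re (a⁻¹ * (g e)_i)` is larger than `1 / 2` near the neutral element
  let s : 𝒢.fiber b → Tot F.fiber := fun g => ⟨⟨b, g • y⟩, F.act g y e⟩
  have hs : Continuous s := by
    refine F.continuous_act_tot (β := fun _ => b) (g := fun g => g) (y := fun _ => y)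
      (e := fun _ => e) ?_ continuous_const
    exact continuous_induced_dom
  have hgy : Continuous fun g : 𝒢.fiber b => (⟨b, g • y⟩ : Y.Total) := F.continuous_base.comp hs
  have hs1 : s 1 = ⟨⟨b, y⟩, e⟩ := F.act_one y e
  have h1y : (⟨b, (1 : 𝒢.fiber b) • y⟩ : Y.Total) = ⟨b, y⟩ := congrArg (Tot.mk b) (one_smul _ y)
  let r : Tot F.fiber → ℝ := fun e => (a⁻¹ * c.co e.base e.pt i).re
  have hr : ∀ z : Tot F.fiber, z.base ∈ c.U → ContinuousAt r z := fun z hz =>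
    Complex.continuous_re.continuousAt.comp (continuousAt_const.mul
      ((continuous_apply i).continuousAt.comp (c.continuousAt_co hz)))
  have hr1 : r ⟨⟨b, y⟩, e⟩ = 1 := by
    change (a⁻¹ * a).re = 1
    rw [inv_mul_cancel₀ hi, Complex.one_re]
  have hr2 : ∀ᶠ g in 𝓝 (1 : 𝒢.fiber b), 1 / 2 < r (s g) ∧ (⟨b, g • y⟩ : Y.Total) ∈ c.U := by
    have h1 : ContinuousAt (fun g => r (s g)) 1 := by
      refine ContinuousAt.comp (g := r) ?_ hs.continuousAt
      rw [hs1]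
      exact hr _ hc
    have h2 : (1 : ℝ) / 2 < r (s 1) := by rw [hs1, hr1]; norm_num
    have h3 : (⟨b, (1 : 𝒢.fiber b) • y⟩ : Y.Total) ∈ c.U := by rw [h1y]; exact hc
    exact (h1.eventually (lt_mem_nhds h2)).and
      (hgy.continuousAt.eventually_mem (c.isOpen.mem_nhds h3))
  obtain ⟨W, hW, hWo, h1W⟩ := mem_nhds_iff.1 hr2
  -- since the stabilizer is trivial, the rest of the orbit stays away from `y`
  have hD : IsClosed ((fun g : 𝒢.fiber b => (⟨b, g • y⟩ : Y.Total)) '' Wᶜ) :=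
    (hWo.isClosed_compl.isCompact.image hgy).isClosed
  have hyD : (⟨b, y⟩ : Y.Total) ∉ (fun g : 𝒢.fiber b => (⟨b, g • y⟩ : Y.Total)) '' Wᶜ := by
    rintro ⟨g, hg, h⟩
    exact hg (hy g (eq_of_heq (Tot.mk.inj h).2) ▸ h1W)
  obtain ⟨N, hN, hyN, hNc⟩ := normal_exists_closure_subset (isClosed_singleton (x := (⟨b, y⟩ : Y.Total)))
    (c.isOpen.inter hD.isOpen_compl) (singleton_subset_iff.2 ⟨hc, hyD⟩)
  obtain ⟨θ, hθ0, hθ1, hθ⟩ := exists_continuous_zero_one_of_isClosed (hN.isClosed_compl)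
    (isClosed_singleton (x := (⟨b, y⟩ : Y.Total)))
    (Set.disjoint_left.2 fun x hx hx' => hx (hyN hx'))
  have hθs : tsupport θ ⊆ c.U := by
    refine (closure_mono fun x hx => ?_).trans (hNc.trans inter_subset_left)
    by_contra h
    exact hx (hθ0 h)
  let Λ : ∀ y, F.fiber y →ₗ[ℂ] ℂ := fun y => (θ y : ℂ) • (LinearMap.proj i ∘ₗ c.co y)
  have hΛ : Continuous fun e : Tot F.fiber => Λ e.base e.pt := by
    rw [continuous_iff_continuousAt]
    intro z
    by_cases hz : z.base ∈ tsupport θ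
    · exact (Complex.continuous_ofReal.comp (θ.continuous.comp F.continuous_base)).continuousAt.smul
        ((continuous_apply i).continuousAt.comp (c.continuousAt_co (hθs hz)))
    · refine ContinuousAt.congr (f := fun _ => 0) continuousAt_const ?_
      filter_upwards [((isClosed_tsupport θ).isOpen_compl.preimage F.continuous_base).mem_nhds hz]
        with z' hz'
      have : θ z'.base = 0 := image_eq_zero_of_notMem_tsupport hz'
      simp [Λ, this]
  refine ⟨avgFunctional F Λ hΛ, fun h0 => ?_⟩
  have h0 : ∫ g, Λ ⟨b, g • y⟩ (F.act g y e) ∂normHaar (𝒢.fiber b) = 0 := h0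
  have hcont : Continuous fun g : 𝒢.fiber b => Λ ⟨b, g • y⟩ (F.act g y e) := hΛ.comp hs
  have h2 : ∫ g, (a⁻¹ * Λ ⟨b, g • y⟩ (F.act g y e)).re ∂normHaar (𝒢.fiber b) = 0 := by
    have h3 := integral_re (𝕜 := ℂ) (integrable_of_continuous
      ((continuous_const (y := a⁻¹)).mul hcont) (normHaar (𝒢.fiber b)))
    refine h3.trans ?_
    have h6 := integral_const_mul (μ := normHaar (𝒢.fiber b)) a⁻¹
      fun g => Λ ⟨b, g • y⟩ (F.act g y e)
    rw [h0, mul_zero] at h6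
    exact congrArg Complex.re h6
  have hval : ∀ g : 𝒢.fiber b, (a⁻¹ * Λ ⟨b, g • y⟩ (F.act g y e)).re =
      θ ⟨b, g • y⟩ * r (s g) := by
    intro g
    simp only [Λ, LinearMap.smul_apply, LinearMap.comp_apply, LinearMap.proj_apply, smul_eq_mul, r,
      s]
    rw [mul_left_comm, Complex.re_ofReal_mul]
  have hθg : Continuous fun g : 𝒢.fiber b => θ ⟨b, g • y⟩ := θ.continuous.comp hgy
  have hle : ∀ g : 𝒢.fiber b, 1 / 2 * θ ⟨b, g • y⟩ ≤ (a⁻¹ * Λ ⟨b, g • y⟩ (F.act g y e)).re := by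
    intro g
    rw [hval]
    by_cases hg : g ∈ W
    · rw [mul_comm]
      exact mul_le_mul_of_nonneg_left (hW hg).1.le (hθ _).1
    · have : θ ⟨b, g • y⟩ = 0 := hθ0 fun hgN => (hNc (subset_closure hgN)).2 ⟨g, hg, rfl⟩
      simp [this]
  have hint : Integrable (fun g : 𝒢.fiber b => θ ⟨b, g • y⟩) (normHaar (𝒢.fiber b)) :=
    (BoundedContinuousFunction.mkOfCompact ⟨_, hθg⟩).integrable _
  have hint2 : Integrable (fun g : 𝒢.fiber b => (a⁻¹ * Λ ⟨b, g • y⟩ (F.act g y e)).re)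
      (normHaar (𝒢.fiber b)) :=
    (BoundedContinuousFunction.mkOfCompact ⟨_, Complex.continuous_re.comp
      ((continuous_const (y := a⁻¹)).mul hcont)⟩).integrable _
  have h4 := integral_mono (hint.const_mul (1 / 2)) hint2 hle
  rw [h2, integral_const_mul] at h4
  have h5 : 0 < ∫ g, θ ⟨b, g • y⟩ ∂normHaar (𝒢.fiber b) := by
    refine (integral_pos_iff_support_of_nonneg (fun g => (hθ _).1) hint).2 ?_
    refine (hθg.isOpen_support).measure_pos _ ⟨1, ?_⟩
    simp only [Function.mem_support]
    rw [h1y, hθ1 rfl]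
    exact one_ne_zero
  linarith

end functionals

end EquivVB

/-! ### The Peter–Weyl theorem -/

section peterWeyl

open MeasureTheory

section kerOp

variable {K : Type*} [TopologicalSpace K] [CompactSpace K] {H : Type*} [NormedAddCommGroup H]
  [InnerProductSpace ℂ H]

/-- The operator `f ↦ (x ↦ ⟪k x, f⟫)` from a Hilbert space to the continuous functions on a
compact space. -/
noncomputable def kerOp (k : C(K, H)) : H →L[ℂ] C(K, ℂ) :=
  LinearMap.mkContinuous
    { toFun := fun f => ⟨fun x => inner ℂ (k x) f, k.continuous.inner continuous_const⟩
      map_add' := fun f g => ContinuousMap.ext fun x => inner_add_right _ _ _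
      map_smul' := fun a f => ContinuousMap.ext fun x => inner_smul_right _ _ _ } ‖k‖ fun f => by
    refine (ContinuousMap.norm_le _ (by positivity)).2 fun x => ?_
    exact (norm_inner_le_norm _ _).trans (mul_le_mul_of_nonneg_right (k.norm_coe_le_norm x)
      (norm_nonneg f))

theorem isCompactOperator_kerOp (k : C(K, H)) : IsCompactOperator (kerOp k) := by
  let e := ContinuousMap.linearIsometryBoundedOfCompact K ℂ ℂ
  have h1 : IsCompactOperator fun f => e (kerOp k f) := by
    refine ⟨closure ((fun f => e (kerOp k f)) '' Metric.ball 0 1),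
      BoundedContinuousFunction.arzela_ascoli (Metric.closedBall (0 : ℂ) ‖k‖)
        (isCompact_closedBall _ _) _ ?_ ?_,
      Filter.mem_of_superset (Metric.ball_mem_nhds 0 one_pos) fun f hf =>
        subset_closure ⟨f, hf, rfl⟩⟩
    · rintro _ x ⟨f, hf, rfl⟩
      rw [mem_closedBall_zero_iff]
      rw [mem_ball_zero_iff] at hf
      refine (norm_inner_le_norm (k x) f).trans ?_
      refine (mul_le_mul (k.norm_coe_le_norm x) hf.le (norm_nonneg f) (norm_nonneg k)).trans ?_
      rw [mul_one]
    · intro x₀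
      rw [Metric.equicontinuousAt_iff_right]
      intro ε hε
      filter_upwards [Metric.continuousAt_iff'.1 k.continuous.continuousAt ε hε] with x hx
      rintro ⟨_, f, hf, rfl⟩
      rw [mem_ball_zero_iff] at hf
      change dist (inner ℂ (k x₀) f) (inner ℂ (k x) f) < ε
      rw [dist_comm, dist_eq_norm, ← inner_sub_left]
      rw [dist_eq_norm] at hx
      refine (norm_inner_le_norm _ f).trans_lt ((mul_le_of_le_one_right (norm_nonneg _)
        hf.le).trans_lt hx)
  have h2 := h1.continuous_comp e.symm.continuous
  have h3 : (e.symm ∘ fun f => e (kerOp k f)) = kerOp k := by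
    funext f
    exact e.symm_apply_apply _
  rwa [h3] at h2

end kerOp

variable (K : Type*) [Group K] [TopologicalSpace K] [IsTopologicalGroup K] [CompactSpace K]
  [T2Space K] [MeasurableSpace K] [BorelSpace K]

instance : (normHaar K).Regular := inferInstanceAs (Measure.haarMeasure ⊤).Regular

variable {K}

/-- A continuous function as an element of `L²`. -/
noncomputable abbrev toL2 : C(K, ℂ) →L[ℂ] Lp ℂ 2 (normHaar K) :=
  ContinuousMap.toLp (E := ℂ) 2 (normHaar K) ℂ

theorem inner_toL2 (c d : C(K, ℂ)) :
    inner ℂ (toL2 c) (toL2 d) = ∫ x, d x * starRingEnd ℂ (c x) ∂normHaar K :=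
  ContinuousMap.inner_toLp (normHaar K) c d

/-- The integral operator with a continuous kernel. -/
noncomputable def intOp (κ : C(K × K, ℂ)) : Lp ℂ 2 (normHaar K) →L[ℂ] C(K, ℂ) :=
  kerOp (ContinuousMap.comp ⟨toL2, toL2.continuous⟩ (ContinuousMap.curry (star κ)))

theorem intOp_toL2 (κ : C(K × K, ℂ)) (c : C(K, ℂ)) (x : K) :
    intOp κ (toL2 c) x = ∫ y, c y * κ (x, y) ∂normHaar K := by
  refine (inner_toL2 _ c).trans ?_
  refine integral_congr_ae (Filter.Eventually.of_forall fun y => ?_)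
  change c y * starRingEnd ℂ (star (κ (x, y))) = _
  simp

/-- The adjoint of an integral operator has the conjugate transposed kernel. -/
theorem inner_intOp (κ κ' : C(K × K, ℂ)) (hκ : ∀ x y, κ' (x, y) = starRingEnd ℂ (κ (y, x)))
    (f g : Lp ℂ 2 (normHaar K)) :
    inner ℂ (toL2 (intOp κ f)) g = inner ℂ f (toL2 (intOp κ' g)) := by
  have hd : DenseRange (toL2 (K := K)) := ContinuousMap.toLp_denseRange ℂ (normHaar K) ℂ (by simp)
  refine hd.induction_on₂ (p := fun f g => inner ℂ (toL2 (intOp κ f)) g =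
    inner ℂ f (toL2 (intOp κ' g))) ?_ (fun c d => ?_) f g
  · exact isClosed_eq
      (((toL2.continuous.comp (intOp κ).continuous).comp continuous_fst).inner continuous_snd)
      (continuous_fst.inner ((toL2.continuous.comp (intOp κ').continuous).comp continuous_snd))
  · rw [inner_toL2, inner_toL2]
    simp only [intOp_toL2, ← integral_conj, ← integral_const_mul, ← integral_mul_const]
    have hc : Continuous fun z : K × K =>
        d z.1 * starRingEnd ℂ (c z.2 * κ (z.1, z.2)) := by
      have := Complex.continuous_conj
      fun_prop
    rw [integral_integral_swap_of_hasCompactSupport (f := fun x y =>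
      d x * starRingEnd ℂ (c y * κ (x, y))) hc (HasCompactSupport.of_compactSpace _)]
    refine integral_congr_ae (Filter.Eventually.of_forall fun y =>
      integral_congr_ae (Filter.Eventually.of_forall fun x => ?_))
    simp only [hκ, map_mul]
    ring

/-- Right translation of functions. -/
noncomputable def rightTranslate (g : K) : C(K, ℂ) →ₗ[ℂ] C(K, ℂ) where
  toFun c := c.comp ⟨fun x => x * g, continuous_mul_const g⟩
  map_add' _ _ := rfl
  map_smul' _ _ := rfl

theorem rightTranslate_apply (g : K) (c : C(K, ℂ)) (x : K) : rightTranslate g c x = c (x * g) := rfl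

theorem continuous_rightTranslate (c : C(K, ℂ)) : Continuous fun g => rightTranslate g c :=
  (ContinuousMap.curry (⟨fun z : K × K => c (z.2 * z.1), by fun_prop⟩ : C(K × K, ℂ))).continuous

/-- A nonzero finite dimensional space of continuous functions that is stable under right
translations contains a nonzero matrix coefficient of an irreducible representation, namely any
nonzero element of a minimal stable subspace. -/
theorem exists_irredRep_of_stable (V : Submodule ℂ C(K, ℂ)) [FiniteDimensional ℂ V] (hV : V ≠ ⊥)
    (hst : ∀ g, ∀ c ∈ V, rightTranslate g c ∈ V) :
    ∃ c ∈ V, c ≠ 0 ∧ ∃ (σ : IrredRep K) (ℓ : Module.Dual ℂ (Fin σ.n → ℂ)) (w : Fin σ.n → ℂ),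
      ∀ x, c x = ℓ (σ.ρ x w) := by
  classical
  have hex : ∃ n, ∃ P : Submodule ℂ C(K, ℂ), P ≤ V ∧ P ≠ ⊥ ∧
      (∀ g, ∀ c ∈ P, rightTranslate g c ∈ P) ∧ Module.finrank ℂ P = n :=
    ⟨_, V, le_rfl, hV, hst, rfl⟩
  obtain ⟨P, hPV, hP, hPst, hPn⟩ := Nat.find_spec hex
  have hmin : ∀ Q : Submodule ℂ C(K, ℂ), Q ≤ P → Q ≠ ⊥ → (∀ g, ∀ c ∈ Q, rightTranslate g c ∈ Q) →
      Q = P := by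
    intro Q hQP hQ hQst
    have : FiniteDimensional ℂ P := Submodule.finiteDimensional_of_le hPV
    exact Submodule.eq_of_le_of_finrank_le hQP
      (hPn.le.trans (Nat.find_min' hex ⟨Q, hQP.trans hPV, hQ, hQst, rfl⟩))
  have : FiniteDimensional ℂ P := Submodule.finiteDimensional_of_le hPV
  let e : P ≃ₗ[ℂ] (Fin _ → ℂ) := (Module.finBasis ℂ P).equivFun
  let ρ₀ : K → P →ₗ[ℂ] P := fun g => (rightTranslate g).restrict (hPst g)
  let ρ : Representation ℂ K (Fin (Module.finrank ℂ P) → ℂ) :=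
    { toFun := fun g => e.toLinearMap ∘ₗ ρ₀ g ∘ₗ e.symm.toLinearMap
      map_one' := by
        refine LinearMap.ext fun v => ?_
        refine (LinearEquiv.eq_symm_apply e).1 (Subtype.ext (ContinuousMap.ext fun x => ?_))
        exact congrArg (e.symm v).1 (mul_one x)
      map_mul' := fun g g' => by
        refine LinearMap.ext fun v => ?_
        refine congrArg e (Subtype.ext (ContinuousMap.ext fun x => ?_))
        refine (congrArg (e.symm v).1 (mul_assoc x g g').symm).trans ?_
        change _ = (e.symm (e (ρ₀ g' (e.symm v)))).1 (x * g)
        rw [LinearEquiv.symm_apply_apply]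
        rfl }
  have hρ : ∀ g v, ρ g v = e (ρ₀ g (e.symm v)) := fun g v => rfl
  have hcont : ∀ v, Continuous fun g => ρ g v := by
    intro v
    refine (e.toLinearMap.continuous_of_finiteDimensional).comp (g := e) ?_
    exact (continuous_rightTranslate (e.symm v).1).subtype_mk _
  have hirr : ρ.IsIrreducible := by
    have hne : Nontrivial (Subrepresentation ρ) := by
      refine ⟨⊥, ⊤, fun h => ?_⟩
      obtain ⟨c, hc, hc0⟩ := (Submodule.ne_bot_iff P).1 hP
      have h1 : e ⟨c, hc⟩ ∈ (⊥ : Subrepresentation ρ) := by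
        rw [h]
        trivial
      have h2 : e ⟨c, hc⟩ = 0 := h1
      rw [LinearEquiv.map_eq_zero_iff] at h2
      exact hc0 (congrArg Subtype.val h2)
    refine ⟨fun S => ?_⟩
    by_cases hS : S.toSubmodule = ⊥
    · exact Or.inl (Subrepresentation.toSubmodule_injective hS)
    · right
      let f : (Fin (Module.finrank ℂ P) → ℂ) →ₗ[ℂ] C(K, ℂ) := P.subtype ∘ₗ e.symm.toLinearMap
      have hf : Function.Injective f := Subtype.val_injective.comp e.symm.injective
      have h1 := hmin (S.toSubmodule.map f) (by
        rintro _ ⟨v, -, rfl⟩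
        exact (e.symm v).2) (fun h => hS (by
          have h0 := LinearMap.le_ker_iff_map.2 h
          rwa [LinearMap.ker_eq_bot.2 hf, le_bot_iff] at h0)) (by
        rintro g _ ⟨v, hv, rfl⟩
        refine ⟨ρ g v, S.apply_mem_toSubmodule g hv, ?_⟩
        change (e.symm (e (ρ₀ g (e.symm v)))).1 = _
        rw [LinearEquiv.symm_apply_apply]
        rfl)
      refine Subrepresentation.toSubmodule_injective (eq_top_iff.2 fun v _ => ?_)
      have h2 : f v ∈ S.toSubmodule.map f := by
        rw [h1]
        exact (e.symm v).2
      obtain ⟨v', hv', h3⟩ := h2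
      exact hf h3 ▸ hv'
  obtain ⟨c, hc, hc0⟩ := (Submodule.ne_bot_iff P).1 hP
  let ev : Module.Dual ℂ C(K, ℂ) :=
    { toFun := fun c => c 1, map_add' := fun _ _ => rfl, map_smul' := fun _ _ => rfl }
  refine ⟨c, hPV hc, hc0, ⟨_, ρ, hcont, hirr⟩, ev ∘ₗ P.subtype ∘ₗ e.symm.toLinearMap,
    e ⟨c, hc⟩, fun x => ?_⟩
  change _ = (e.symm (e (ρ₀ x (e.symm (e ⟨c, hc⟩))))).1 1
  rw [LinearEquiv.symm_apply_apply, LinearEquiv.symm_apply_apply]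
  exact congrArg c (one_mul x).symm

theorem intOp_rightTranslate (κ : C(K × K, ℂ)) (hκ : ∀ x y g, κ (x * g, y * g) = κ (x, y))
    (c : C(K, ℂ)) (g : K) :
    intOp κ (toL2 (rightTranslate g c)) = rightTranslate g (intOp κ (toL2 c)) := by
  refine ContinuousMap.ext fun x => ?_
  rw [rightTranslate_apply, intOp_toL2, intOp_toL2]
  rw [← integral_mul_right_eq_self (μ := normHaar K) (fun y => c y * κ (x * g, y)) g]
  simp only [hκ, rightTranslate_apply]

/-- The matrix coefficients of irreducible representations separate the continuous functions. The
operator `A f (x) = ∫ h (y x⁻¹) f y` kills the matrix coefficients, and the eigenspaces of the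
compact operator `A* A` for nonzero eigenvalues would contain some. -/
theorem eq_zero_of_forall_irredRep (h : C(K, ℂ))
    (hh : ∀ (σ : IrredRep K) (ℓ : Module.Dual ℂ (Fin σ.n → ℂ)) (w : Fin σ.n → ℂ),
      ∫ y, ℓ (σ.ρ y w) * h y ∂normHaar K = 0) : h = 0 := by
  let κ : C(K × K, ℂ) := ⟨fun z => h (z.2 * z.1⁻¹), by fun_prop⟩
  let κ' : C(K × K, ℂ) := ⟨fun z => starRingEnd ℂ (h (z.1 * z.2⁻¹)), by
    have := Complex.continuous_conj
    fun_prop⟩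
  have hinj : Function.Injective (toL2 (K := K)) := ContinuousMap.toLp_injective (normHaar K)
  have hadj := inner_intOp κ κ' fun x y => rfl
  have hadj' := inner_intOp κ' κ fun x y => (Complex.conj_conj _).symm
  let S : Lp ℂ 2 (normHaar K) →L[ℂ] Lp ℂ 2 (normHaar K) :=
    (toL2 ∘L intOp κ' ∘L toL2) ∘L intOp κ
  have hS : ∀ f, S f = toL2 (intOp κ' (toL2 (intOp κ f))) := fun f => rfl
  have hSc : IsCompactOperator S := (isCompactOperator_kerOp _).clm_comp (toL2 ∘L intOp κ' ∘L toL2)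
  have hSs : (S : Lp ℂ 2 (normHaar K) →ₗ[ℂ] Lp ℂ 2 (normHaar K)).IsSymmetric := by
    intro f g
    change inner ℂ (S f) g = inner ℂ f (S g)
    rw [hS, hS, hadj', hadj]
  have hS0 : S = 0 := by
    refine (ContinuousLinearMap.eq_zero_of_forall_hasEigenvalue_eq_zero hSc hSs).1 fun μ hμ => ?_
    by_contra hμ0
    obtain ⟨f, hf⟩ := hμ.exists_hasEigenvector
    have hf1 : S f = μ • f := hf.apply_eq_smul
    have := ContinuousLinearMap.finite_dimensional_eigenspace hSc μ hμ0
    let V : Submodule ℂ C(K, ℂ) :=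
      (Module.End.eigenspace (S : Lp ℂ 2 (normHaar K) →ₗ[ℂ] Lp ℂ 2 (normHaar K)) μ).comap
        (toL2 (K := K)).toLinearMap
    have hVmem : ∀ c, c ∈ V ↔ intOp κ' (toL2 (intOp κ (toL2 c))) = μ • c := by
      intro c
      rw [Submodule.mem_comap, Module.End.mem_eigenspace_iff, ← hinj.eq_iff, map_smul]
      rfl
    have : FiniteDimensional ℂ V := by
      refine Module.Finite.of_injective ((toL2 (K := K)).toLinearMap.restrict (p := V)
        (q := Module.End.eigenspace (S : Lp ℂ 2 (normHaar K) →ₗ[ℂ] Lp ℂ 2 (normHaar K)) μ)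
        fun c hc => hc) ?_
      intro c d hcd
      exact Subtype.ext (hinj (congrArg Subtype.val hcd))
    have hVbot : V ≠ ⊥ := by
      refine (Submodule.ne_bot_iff V).2 ⟨μ⁻¹ • intOp κ' (toL2 (intOp κ f)), ?_, ?_⟩
      · have h1 : toL2 (μ⁻¹ • intOp κ' (toL2 (intOp κ f))) = f := by
          rw [map_smul, ← hS, hf1, inv_smul_smul₀ hμ0]
        rw [hVmem, h1, smul_inv_smul₀ hμ0]
      · intro h0
        have h1 := congrArg (toL2 (K := K)) h0
        rw [map_smul, ← hS, hf1, inv_smul_smul₀ hμ0, map_zero] at h1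
        exact hf.2 h1
    obtain ⟨c, hcV, hc0, σ, ℓ, w, hc⟩ := exists_irredRep_of_stable V hVbot fun g c hc => by
      rw [hVmem] at hc ⊢
      rw [intOp_rightTranslate κ (fun x y g => congrArg h (by group)),
        intOp_rightTranslate κ' (fun x y g => congrArg (fun z => starRingEnd ℂ (h z)) (by group)),
        hc, map_smul]
    have hAc : intOp κ (toL2 c) = 0 := by
      refine ContinuousMap.ext fun x => ?_
      rw [intOp_toL2, ← integral_mul_right_eq_self (μ := normHaar K) (fun y => c y * κ (x, y)) x]
      refine Eq.trans ?_ (hh σ ℓ (σ.ρ x w))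
      refine integral_congr_ae (Filter.Eventually.of_forall fun y => ?_)
      change c (y * x) * h (y * x * x⁻¹) = _
      rw [mul_inv_cancel_right, hc, map_mul]
      rfl
    rw [hVmem, hAc, map_zero, map_zero] at hcV
    exact hc0 ((smul_eq_zero_iff_right hμ0).1 hcV.symm)
  have hA : ∀ f, intOp κ f = 0 := by
    intro f
    have h1 : inner ℂ (toL2 (intOp κ f)) (toL2 (intOp κ f)) = 0 := by
      rw [hadj, ← hS, hS0]
      exact inner_zero_right _
    rw [inner_self_eq_zero] at h1
    exact hinj (h1.trans (map_zero _).symm)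
  have h1 := congrArg (fun c : C(K, ℂ) => c 1) (hA (toL2 (star h)))
  simp only [intOp_toL2] at h1
  have h2 : inner ℂ (toL2 h) (toL2 h) = 0 := by
    rw [inner_toL2]
    refine Eq.trans ?_ h1
    refine integral_congr_ae (Filter.Eventually.of_forall fun y => ?_)
    change h y * starRingEnd ℂ (h y) = starRingEnd ℂ (h y) * h (y * 1⁻¹)
    rw [inv_one, mul_one, mul_comm]
  rw [inner_self_eq_zero] at h2
  exact hinj (h2.trans (map_zero _).symm)

end peterWeyl

/-! ### Vector bundles from transition functions -/

/-- Local trivializations, with continuous transition functions, of a family of vector spaces. -/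
structure VCharts (T : Type u) [TopologicalSpace T] (E : T → Type) [∀ t, AddCommGroup (E t)]
    [∀ t, Module ℂ (E t)] where
  ι : Type w
  n : ι → ℕ
  U : ι → Set T
  isOpen : ∀ i, IsOpen (U i)
  φ : ∀ i (t : U i), E t ≃ₗ[ℂ] (Fin (n i) → ℂ)
  cover : ∀ t, ∃ i, t ∈ U i
  continuous : ∀ i j x, Continuous fun t : ↥(U i ∩ U j) =>
    φ j ⟨t, t.2.2⟩ ((φ i ⟨t, t.2.1⟩).symm x)

namespace VCharts

variable {T : Type u} [TopologicalSpace T] {E : T → Type} [∀ t, AddCommGroup (E t)]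
  [∀ t, Module ℂ (E t)] (c : VCharts.{u, w} T E)

/-- The parametrization of the part of the total space over the domain of a trivialization. -/
noncomputable def param (i : c.ι) (z : c.U i × (Fin (c.n i) → ℂ)) : Tot E := ⟨z.1, (c.φ i z.1).symm z.2⟩

/-- The total space has the finest topology for which all parametrizations are continuous. -/
@[reducible] noncomputable def top : TopologicalSpace (Tot E) :=
  ⨆ i, TopologicalSpace.coinduced (c.param i) inferInstance

theorem isOpen_iff {S : Set (Tot E)} : IsOpen[c.top] S ↔ ∀ i, IsOpen (c.param i ⁻¹' S) :=
  isOpen_iSup_iff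

theorem continuous_base : Continuous[c.top, _] (Tot.base : Tot E → T) :=
  continuous_iSup_dom.2 fun _ => continuous_coinduced_dom.2
    (continuous_subtype_val.comp continuous_fst)

theorem continuous_param (i : c.ι) : Continuous[_, c.top] (c.param i) :=
  continuous_iSup_rng (i := i) continuous_coinduced_rng

theorem continuous_transition (i j : c.ι) :
    Continuous fun z : {z : c.U i × (Fin (c.n i) → ℂ) // z.1.1 ∈ c.U j} =>
      c.φ j ⟨z.1.1.1, z.2⟩ ((c.φ i z.1.1).symm z.1.2) := by
  have h : ∀ z : {z : c.U i × (Fin (c.n i) → ℂ) // z.1.1 ∈ c.U j},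
      c.φ j ⟨z.1.1.1, z.2⟩ ((c.φ i z.1.1).symm z.1.2) =
        ∑ k, z.1.2 k • c.φ j ⟨z.1.1.1, z.2⟩ ((c.φ i z.1.1).symm (Pi.single k 1)) := by
    intro z
    conv_lhs => rw [pi_eq_sum_univ' z.1.2]
    simp only [map_sum, map_smul]
  simp only [h]
  refine continuous_finsetSum _ fun k _ => ?_
  refine ((continuous_apply k).comp (continuous_snd.comp continuous_subtype_val)).smul ?_
  exact (c.continuous i j (Pi.single k 1)).comp (f := fun z : {z : c.U i × (Fin (c.n i) → ℂ) //
    z.1.1 ∈ c.U j} => (⟨z.1.1.1, z.1.1.2, z.2⟩ : ↥(c.U i ∩ c.U j)))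
    ((continuous_subtype_val.comp (continuous_fst.comp continuous_subtype_val)).subtype_mk _)

theorem isHomeomorph_trivMap (j : c.ι) :
    @IsHomeomorph _ _ (@instTopologicalSpaceSubtype _ _ c.top) _
      (Tot.trivMap (c.U j) fun t => c.φ j t) := by
  let := c.top
  refine Tot.isHomeomorph_trivMap_of_continuous (φ := fun t => (c.φ j t).toEquiv)
    c.continuous_base ⟨fun O hO => ?_⟩ (c.continuous_param j)
  have h1 : IsOpen {e : Tot E | ∃ h : e.base ∈ c.U j, c.φ j ⟨e.base, h⟩ e.pt ∈ O} := by
    refine c.isOpen_iff.2 fun i => ?_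
    have hD : IsOpen {z : c.U i × (Fin (c.n i) → ℂ) | z.1.1 ∈ c.U j} :=
      (c.isOpen j).preimage (continuous_subtype_val.comp continuous_fst)
    convert! hD.isOpenMap_subtype_val _ (hO.preimage (c.continuous_transition i j)) using 1
    ext z
    constructor
    · rintro ⟨h, hz⟩
      exact ⟨⟨z, h⟩, hz, rfl⟩
    · rintro ⟨⟨z, h⟩, hz, rfl⟩
      exact ⟨h, hz⟩
  convert! h1.preimage continuous_subtype_val using 1
  ext e
  exact ⟨fun h => ⟨e.2, h⟩, fun ⟨_, h⟩ => h⟩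

/-- The vector bundle given by local trivializations with continuous transition functions. -/
@[reducible] noncomputable def toVBundle : VBundle T where
  fiber := E
  top := c.top
  continuous_base := c.continuous_base
  locTriv t := by
    obtain ⟨i, hi⟩ := c.cover t
    exact ⟨c.n i, c.U i, c.φ i, c.isOpen i, hi, c.isHomeomorph_trivMap i⟩

/-- The trivializations as charts of the vector bundle. -/
noncomputable def toChart (i : c.ι) : c.toVBundle.Chart where
  n := c.n i
  U := c.U i
  φ := c.φ i
  isOpen := c.isOpen i
  isHomeomorph := c.isHomeomorph_trivMap i

end VCharts

/-! ### Bundles of spaces of functions on the fibres of a bundle of groups -/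

theorem span_range_eq_top {F V ι : Type*} [Field F] [AddCommGroup V] [Module F V]
    [FiniteDimensional F V] (ev : ι → Module.Dual F V) (h : ∀ v, (∀ i, ev i v = 0) → v = 0) :
    Submodule.span F (range ev) = ⊤ := by
  have h2 : (Submodule.span F (range ev)).dualCoannihilator = ⊥ := by
    refine (Submodule.eq_bot_iff _).2 fun c hc => h c fun x => ?_
    rw [Submodule.mem_dualCoannihilator] at hc
    exact hc _ (Submodule.subset_span ⟨x, rfl⟩)
  rw [← Subspace.dualCoannihilator_dualAnnihilator_eq (W := Submodule.span F (range ev)), h2,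
    Submodule.dualAnnihilator_bot]

/-- A linear functional on a finite dimensional space of functions is a combination of
evaluations. -/
theorem exists_eq_sum_eval {K : Type*} [TopologicalSpace K] (V : Submodule ℂ C(K, ℂ))
    [FiniteDimensional ℂ V] (ℓ : Module.Dual ℂ V) :
    ∃ a : K →₀ ℂ, ∀ c : V, ℓ c = a.sum fun x r => r * c.1 x := by
  let ev : K → Module.Dual ℂ ↥V := fun x =>
    { toFun := fun c => c.1 x, map_add' := fun _ _ => rfl, map_smul' := fun _ _ => rfl }
  have h1 : Submodule.span ℂ (range ev) = ⊤ := 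
    span_range_eq_top (F := ℂ) (V := ↥V) ev fun c hc => Subtype.ext (ContinuousMap.ext hc)
  have h2 : ℓ ∈ Submodule.span ℂ (range ev) := h1 ▸ Submodule.mem_top
  obtain ⟨a, ha⟩ := Finsupp.mem_span_range_iff_exists_finsupp.1 h2
  refine ⟨a, fun c => ?_⟩
  rw [← ha, Finsupp.sum, LinearMap.sum_apply]
  rfl

/-- A chart of a family of spaces of functions: over `U` the trivialization `t` identifies the
spaces with a fixed finite dimensional space `V` of functions on the typical fibre. -/
structure FunChart {B : Type u} [TopologicalSpace B] {𝒢 : GroupBundle.{u, v} B}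
    (𝒲 : ∀ b, Submodule ℂ (𝒢.fiber b → ℂ)) where
  t : GroupTriv 𝒢.fiber 𝒢.model
  U : Set B
  isOpen : IsOpen U
  subset : U ⊆ t.U
  V : Submodule ℂ C(𝒢.model, ℂ)
  finite : FiniteDimensional ℂ V
  mem_iff : ∀ b (hb : b ∈ U) (f : 𝒢.fiber b → ℂ),
    f ∈ 𝒲 b ↔ ∃ c ∈ V, ∀ x, f x = c (t.φ ⟨b, subset hb⟩ x)

attribute [instance] FunChart.finite

/-- A locally constant family of finite dimensional spaces of functions on the fibres of a bundle
of groups, stable under right translations. -/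
structure FunFam {B : Type u} [TopologicalSpace B] (𝒢 : GroupBundle.{u, v} B) where
  space : ∀ b, Submodule ℂ (𝒢.fiber b → ℂ)
  translate : ∀ {b} (g : 𝒢.fiber b) {f}, f ∈ space b → (fun x => f (x * g)) ∈ space b
  exists_chart : ∀ b, ∃ c : FunChart space, b ∈ c.U

namespace FunChart

variable {B : Type u} [TopologicalSpace B] {𝒢 : GroupBundle.{u, v} B}
  {𝒲 : ∀ b, Submodule ℂ (𝒢.fiber b → ℂ)} (c : FunChart 𝒲)

/-- The identification of the space over `b` with the fixed space of functions. -/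
noncomputable def equiv (b : c.U) : c.V ≃ₗ[ℂ] 𝒲 b :=
  LinearEquiv.ofBijective
    { toFun := fun f => (⟨fun x => f.1 (c.t.φ ⟨b, c.subset b.2⟩ x),
        (c.mem_iff b b.2 _).2 ⟨f.1, f.2, fun _ => rfl⟩⟩ : 𝒲 b)
      map_add' := fun _ _ => rfl
      map_smul' := fun _ _ => rfl } (by
    constructor
    · intro f f' h
      refine Subtype.ext (ContinuousMap.ext fun y => ?_)
      obtain ⟨x, rfl⟩ := (c.t.φ ⟨b, c.subset b.2⟩).surjective y
      exact congrFun (congrArg Subtype.val h) x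
    · rintro ⟨f, hf⟩
      obtain ⟨c', hc', h⟩ := (c.mem_iff b b.2 f).1 hf
      exact ⟨⟨c', hc'⟩, Subtype.ext (funext fun x => (h x).symm)⟩)

theorem equiv_apply (b : c.U) (f : c.V) (x : 𝒢.fiber b.1) :
    (c.equiv b f).1 x = f.1 (c.t.φ ⟨b, c.subset b.2⟩ x) := rfl

theorem equiv_symm_apply (b : c.U) (f : 𝒲 b) (y : 𝒢.model) :
    ((c.equiv b).symm f).1 y = f.1 ((c.t.φ ⟨b, c.subset b.2⟩).symm y) := by
  obtain ⟨f, rfl⟩ := (c.equiv b).surjective f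
  rw [LinearEquiv.symm_apply_apply, equiv_apply, MulEquiv.apply_symm_apply]

end FunChart

namespace FunFam

variable {B : Type u} [TopologicalSpace B] {𝒢 : GroupBundle.{u, v} B} (𝒲 : FunFam 𝒢)

instance (b : B) : FiniteDimensional ℂ (𝒲.space b) := by
  obtain ⟨c, hc⟩ := 𝒲.exists_chart b
  exact Module.Finite.equiv (c.equiv ⟨b, hc⟩)

/-- The fibres of the vector bundle given by a family of spaces of functions: coordinate spaces
with respect to chosen bases, since the fibres of a `VBundle` lie in `Type`. -/
def Fib (t : (GSpace.base 𝒢).Total) : Type := Fin (Module.finrank ℂ (𝒲.space t.base)) → ℂ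

instance (t : (GSpace.base 𝒢).Total) : AddCommGroup (𝒲.Fib t) :=
  inferInstanceAs (AddCommGroup (Fin (Module.finrank ℂ (𝒲.space t.base)) → ℂ))

instance (t : (GSpace.base 𝒢).Total) : Module ℂ (𝒲.Fib t) :=
  inferInstanceAs (Module ℂ (Fin (Module.finrank ℂ (𝒲.space t.base)) → ℂ))

/-- The functions with given coordinates. -/
noncomputable def toSpace (t : (GSpace.base 𝒢).Total) : 𝒲.Fib t ≃ₗ[ℂ] 𝒲.space t.base :=
  (Module.finBasis ℂ (𝒲.space t.base)).equivFun.symm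

/-- Coordinates in a chart. -/
noncomputable def triv (c : FunChart 𝒲.space)
    (t : ((Tot.base : (GSpace.base 𝒢).Total → B) ⁻¹' c.U : Set _)) :
    𝒲.Fib t.1 ≃ₗ[ℂ] (Fin (Module.finrank ℂ c.V) → ℂ) :=
  (𝒲.toSpace t.1).trans ((c.equiv ⟨t.1.base, t.2⟩).symm.trans (Module.finBasis ℂ c.V).equivFun)

/-- The coordinates in a chart of a function are combinations of values. -/
theorem exists_triv_apply (c : FunChart 𝒲.space) (i : Fin (Module.finrank ℂ c.V)) :
    ∃ a : 𝒢.model →₀ ℂ, ∀ (t : (GSpace.base 𝒢).Total) (ht : t.base ∈ c.U) (e : 𝒲.Fib t),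
      𝒲.triv c ⟨t, ht⟩ e i = a.sum fun y r =>
        r * (𝒲.toSpace t e).1 ((c.t.φ ⟨t.base, c.subset ht⟩).symm y) := by
  obtain ⟨a, ha⟩ := exists_eq_sum_eval c.V ((Module.finBasis ℂ c.V).coord i)
  refine ⟨a, fun t ht e => ?_⟩
  have h1 := ha ((c.equiv ⟨t.base, ht⟩).symm (𝒲.toSpace t e))
  simp only [c.equiv_symm_apply ⟨t.base, ht⟩] at h1
  exact h1

/-- The values of a function in terms of the coordinates in a chart. -/
theorem toSpace_eq_sum (c : FunChart 𝒲.space) (t : (GSpace.base 𝒢).Total) (ht : t.base ∈ c.U)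
    (e : 𝒲.Fib t) (x : 𝒢.fiber t.base) :
    (𝒲.toSpace t e).1 x = ∑ i, 𝒲.triv c ⟨t, ht⟩ e i *
      (Module.finBasis ℂ c.V i).1 (c.t.φ ⟨t.base, c.subset ht⟩ x) := by
  have h1 := (Module.finBasis ℂ c.V).sum_equivFun ((c.equiv ⟨t.base, ht⟩).symm (𝒲.toSpace t e))
  have h2 := congrArg (fun f : c.V => f.1 (c.t.φ ⟨t.base, c.subset ht⟩ x)) h1
  simp only [c.equiv_symm_apply ⟨t.base, ht⟩, MulEquiv.symm_apply_apply] at h2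
  rw [← h2]
  simp only [Submodule.coe_sum, Submodule.coe_smul, ContinuousMap.sum_apply,
    ContinuousMap.smul_apply, smul_eq_mul]
  rfl

theorem toSpace_triv_symm (c : FunChart 𝒲.space) (t : (GSpace.base 𝒢).Total) (ht : t.base ∈ c.U)
    (x : Fin (Module.finrank ℂ c.V) → ℂ) (y : 𝒢.fiber t.base) :
    (𝒲.toSpace t ((𝒲.triv c ⟨t, ht⟩).symm x)).1 y = ∑ i, x i *
      (Module.finBasis ℂ c.V i).1 (c.t.φ ⟨t.base, c.subset ht⟩ y) := by
  rw [𝒲.toSpace_eq_sum c t ht, LinearEquiv.apply_symm_apply]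

end FunFam

theorem GroupTriv.continuous_φ {B : Type u} [TopologicalSpace B] {𝒢 : GroupBundle.{u, v} B}
    (t : GroupTriv 𝒢.fiber 𝒢.model) {Z : Type*} [TopologicalSpace Z] {h : Z → Tot 𝒢.fiber}
    (hh : Continuous h) (hU : ∀ z, (h z).base ∈ t.U) :
    Continuous fun z => t.φ ⟨(h z).base, hU z⟩ (h z).pt :=
  continuous_snd.comp (t.isHomeomorph.continuous.comp
    (f := fun z => (⟨h z, hU z⟩ : {e : Tot 𝒢.fiber // e.base ∈ t.U})) (hh.subtype_mk _))

theorem GroupTriv.continuous_φ_symm {B : Type u} [TopologicalSpace B] {𝒢 : GroupBundle.{u, v} B}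
    (t : GroupTriv 𝒢.fiber 𝒢.model) {Z : Type*} [TopologicalSpace Z] {β : Z → B}
    (hβ : Continuous β) (hU : ∀ z, β z ∈ t.U) {k : Z → 𝒢.model} (hk : Continuous k) :
    Continuous fun z => (⟨β z, (t.φ ⟨β z, hU z⟩).symm (k z)⟩ : Tot 𝒢.fiber) :=
  (Tot.continuous_trivMap_symm (φ := fun b => (t.φ b).toEquiv) t.isHomeomorph).comp
    (f := fun z => ((⟨β z, hU z⟩, k z) : t.U × 𝒢.model)) ((hβ.subtype_mk _).prodMk hk)

namespace FunFam

variable {B : Type u} [TopologicalSpace B] {𝒢 : GroupBundle.{u, v} B} (𝒲 : FunFam 𝒢)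

/-- The local trivializations of the vector bundle given by a family of spaces of functions. -/
noncomputable def charts : VCharts (GSpace.base 𝒢).Total 𝒲.Fib where
  ι := FunChart 𝒲.space
  n c := Module.finrank ℂ c.V
  U c := Tot.base ⁻¹' c.U
  isOpen c := c.isOpen.preimage (GSpace.base 𝒢).continuous_base
  φ c t := 𝒲.triv c t
  cover t := 𝒲.exists_chart t.base
  continuous c d x := by
    refine continuous_pi fun i => ?_
    obtain ⟨a, ha⟩ := 𝒲.exists_triv_apply d i
    have h1 : ∀ t : ↥((Tot.base ⁻¹' c.U ∩ Tot.base ⁻¹' d.U : Set (GSpace.base 𝒢).Total)),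
        𝒲.triv d ⟨t, t.2.2⟩ ((𝒲.triv c ⟨t, t.2.1⟩).symm x) i = a.sum fun y r =>
          r * ∑ k, x k * (Module.finBasis ℂ c.V k).1 (c.t.φ ⟨t.1.base, c.subset t.2.1⟩
            ((d.t.φ ⟨t.1.base, d.subset t.2.2⟩).symm y)) := by
      intro t
      rw [ha]
      simp only [𝒲.toSpace_triv_symm c t.1 t.2.1]
    simp only [h1, Finsupp.sum]
    have hb : Continuous fun t : ↥((Tot.base ⁻¹' c.U ∩ Tot.base ⁻¹' d.U :
        Set (GSpace.base 𝒢).Total)) => t.1.base :=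
      (GSpace.base 𝒢).continuous_base.comp continuous_subtype_val
    refine continuous_finsetSum _ fun y _ => continuous_const.mul
      (continuous_finsetSum _ fun k _ => continuous_const.mul ?_)
    exact (Module.finBasis ℂ c.V k).1.continuous.comp
      (c.t.continuous_φ (d.t.continuous_φ_symm hb (fun t => d.subset t.2.2) continuous_const)
        fun t => c.subset t.2.1)

noncomputable instance : TopologicalSpace (Tot 𝒲.Fib) := 𝒲.charts.top

/-- The vector bundle given by a family of spaces of functions. -/
@[reducible] noncomputable def vbundle : VBundle (GSpace.base 𝒢).Total := 𝒲.charts.toVBundle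

/-- A map to the bundle is continuous if the values of the functions depend continuously on the
argument and the parameters. -/
theorem continuous_of_eval {Z : Type*} [TopologicalSpace Z] {h : Z → Tot 𝒲.vbundle.fiber}
    (hb : Continuous fun z => (h z).base.base)
    (hv : Continuous fun p : Tot (PullFam (fun z => (h z).base.base) 𝒢.fiber) =>
      (𝒲.toSpace (h p.base).base (h p.base).pt).1 p.pt) : Continuous h := by
  rw [continuous_iff_continuousAt]
  intro z
  obtain ⟨c, hc⟩ := 𝒲.exists_chart (h z).base.base
  have hO : IsOpen {z | (h z).base.base ∈ c.U} := c.isOpen.preimage hb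
  refine ((𝒲.charts.toChart c).continuousAt_iff hc).2
    ⟨(Tot.isInducing_base.continuous_iff.2 hb).continuousAt, ?_⟩
  refine (hO.isOpenEmbedding_subtypeVal.continuousAt_iff (x := ⟨z, hc⟩)).1
    (Continuous.continuousAt (continuous_pi fun i => ?_))
  obtain ⟨a, ha⟩ := 𝒲.exists_triv_apply c i
  have h1 : ∀ z : {z | (h z).base.base ∈ c.U}, (𝒲.charts.toChart c).co (h z).base (h z).pt i =
      a.sum fun y r => r * (𝒲.toSpace (h z).base (h z).pt).1
        ((c.t.φ ⟨(h z).base.base, c.subset z.2⟩).symm y) := by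
    intro z
    rw [(𝒲.charts.toChart c).co_of_mem (show (h z).base ∈ (𝒲.charts.toChart c).U from z.2)]
    exact ha (h z).base z.2 (h z).pt
  simp only [Function.comp, h1, Finsupp.sum]
  refine continuous_finsetSum _ fun y _ => continuous_const.mul ?_
  refine hv.comp (f := fun z : {z | (h z).base.base ∈ c.U} =>
    (⟨z.1, (c.t.φ ⟨(h z).base.base, c.subset z.2⟩).symm y⟩ :
      Tot (PullFam (fun z => (h z).base.base) 𝒢.fiber))) ?_
  exact Tot.continuous_to_pull (f := fun z => (h z).base.base) continuous_subtype_val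
    (c.t.continuous_φ_symm (hb.comp continuous_subtype_val) (fun z => c.subset z.2)
      continuous_const)

/-- The values of the functions depend continuously on function and argument. -/
theorem continuous_eval {Z : Type*} [TopologicalSpace Z] {h : Z → Tot 𝒲.vbundle.fiber}
    (hh : Continuous h) {x : ∀ z, 𝒢.fiber (h z).base.base}
    (hx : Continuous fun z => (⟨(h z).base.base, x z⟩ : Tot 𝒢.fiber)) :
    Continuous fun z => (𝒲.toSpace (h z).base (h z).pt).1 (x z) := by
  rw [continuous_iff_continuousAt]
  intro z
  obtain ⟨c, hc⟩ := 𝒲.exists_chart (h z).base.base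
  have hb : Continuous fun z => (h z).base.base := 𝒢.continuous_base.comp hx
  have hO : IsOpen {z | (h z).base.base ∈ c.U} := c.isOpen.preimage hb
  refine (hO.isOpenEmbedding_subtypeVal.continuousAt_iff (x := ⟨z, hc⟩)).1
    (Continuous.continuousAt ?_)
  have h1 : ∀ z : {z // (h z).base.base ∈ c.U}, (𝒲.toSpace (h z).base (h z).pt).1 (x z) =
      ∑ i, (𝒲.charts.toChart c).co (h z).base (h z).pt i * (Module.finBasis ℂ c.V i).1
        (c.t.φ ⟨(h z).base.base, c.subset z.2⟩ (x z)) := by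
    intro z
    rw [𝒲.toSpace_eq_sum c (h z).base z.2,
      (𝒲.charts.toChart c).co_of_mem (show (h z).base ∈ (𝒲.charts.toChart c).U from z.2)]
    rfl
  refine Continuous.congr ?_ fun z => (h1 z).symm
  have h2 : Continuous fun z : {z | (h z).base.base ∈ c.U} =>
      c.t.φ ⟨(h z).base.base, c.subset z.2⟩ (x z) :=
    c.t.continuous_φ (hx.comp continuous_subtype_val) fun z => c.subset z.2
  refine continuous_finsetSum _ fun i _ => Continuous.mul ?_
    ((Module.finBasis ℂ c.V i).1.continuous.comp h2)
  refine (continuous_apply i).comp (continuous_iff_continuousAt.2 fun z => ?_)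
  exact (ContinuousAt.comp (g := fun e : Tot 𝒲.vbundle.fiber =>
    (𝒲.charts.toChart c).co e.base e.pt) ((𝒲.charts.toChart c).continuousAt_co z.2)
    (hh.comp continuous_subtype_val).continuousAt)

/-- Right translation of functions in a fibre. -/
noncomputable def translateFun (t : (GSpace.base 𝒢).Total) (g : 𝒢.fiber t.base) :
    𝒲.space t.base →ₗ[ℂ] 𝒲.space t.base where
  toFun f := ⟨fun x => f.1 (x * g), 𝒲.translate g f.2⟩
  map_add' _ _ := rfl
  map_smul' _ _ := rfl

/-- The equivariant vector bundle given by a family of spaces of functions; the action is by right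
translations. -/
@[reducible] noncomputable def bundle : EquivVB (GSpace.base 𝒢) where
  toVBundle := 𝒲.vbundle
  act {b} g y := (𝒲.toSpace ⟨b, y⟩).symm.toLinearMap ∘ₗ 𝒲.translateFun ⟨b, y⟩ g ∘ₗ
    (𝒲.toSpace ⟨b, y⟩).toLinearMap
  act_one {b} y e := by
    refine congrArg (Tot.mk (⟨b, y⟩ : (GSpace.base 𝒢).Total)) ?_
    refine (LinearEquiv.symm_apply_eq _).2 (Subtype.ext (funext fun x => ?_))
    exact congrArg (𝒲.toSpace ⟨b, y⟩ e).1 (mul_one x)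
  act_mul {b} g h y e := by
    refine congrArg (Tot.mk (⟨b, y⟩ : (GSpace.base 𝒢).Total)) ?_
    refine congrArg (𝒲.toSpace ⟨b, y⟩).symm (Subtype.ext (funext fun x => ?_))
    change (𝒲.toSpace ⟨b, y⟩ e).1 (x * (g * h)) = (𝒲.toSpace ⟨b, y⟩ ((𝒲.toSpace ⟨b, y⟩).symm
      (𝒲.translateFun ⟨b, y⟩ h (𝒲.toSpace ⟨b, y⟩ e)))).1 (x * g)
    rw [LinearEquiv.apply_symm_apply, ← mul_assoc]
    rfl
  continuous_act := by
    let Z := Tot (PullFam (GSpace.base 𝒢).actSnd 𝒲.Fib)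
    let β : Z → B := fun z => z.base.base
    have hg : Continuous fun z : Z => (⟨z.base.base, z.base.pt.1⟩ : Tot 𝒢.fiber) :=
      Tot.continuous_fst_split.comp (Tot.continuous_pull_base (f := (GSpace.base 𝒢).actSnd))
    have hβ : Continuous β := 𝒢.continuous_base.comp hg
    refine 𝒲.continuous_of_eval (h := fun z : Z =>
      ⟨⟨z.base.base, z.base.pt.1 • z.base.pt.2⟩, _⟩) hβ ?_
    have h1 : Continuous fun p : Tot (PullFam β 𝒢.fiber) => p.base :=
      Tot.continuous_pull_base (f := β)
    have h2 : Continuous fun p : Tot (PullFam β 𝒢.fiber) =>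
        (⟨β p.base, p.val * p.base.base.pt.1⟩ : Tot 𝒢.fiber) :=
      𝒢.continuous_mul_tot.comp (f := fun p : Tot (PullFam β 𝒢.fiber) =>
        (⟨β p.base, p.val, p.base.base.pt.1⟩ : Tot (ProdFam 𝒢.fiber 𝒢.fiber)))
        (Tot.continuous_to_split (Tot.continuous_pull_pt (f := β)) (hg.comp h1))
    refine (𝒲.continuous_eval (h := fun p : Tot (PullFam β 𝒢.fiber) =>
      (⟨⟨β p.base, p.base.base.pt.2⟩, p.base.val⟩ : Tot 𝒲.vbundle.fiber))
      ((Tot.continuous_pull_pt (f := (GSpace.base 𝒢).actSnd)).comp h1) h2).congr fun p => ?_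
    have h3 := (𝒲.toSpace ⟨β p.base, p.base.base.pt.2⟩).apply_symm_apply
      (𝒲.translateFun ⟨β p.base, p.base.base.pt.2⟩ p.base.base.pt.1
        (𝒲.toSpace ⟨β p.base, p.base.base.pt.2⟩ p.base.val))
    exact (congrArg (fun f => f.1 p.val) h3).symm

end FunFam

namespace FunFam

variable {B : Type u} [TopologicalSpace B] {𝒢 : GroupBundle.{u, v} B} (𝒲 : FunFam 𝒢)

theorem toSpace_act {b : B} (g : 𝒢.fiber b) (y : (GSpace.base 𝒢).fiber b)
    (e : 𝒲.bundle.fiber ⟨b, y⟩) (x : 𝒢.fiber b) :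
    (𝒲.toSpace ⟨b, g • y⟩ (𝒲.bundle.act g y e)).1 x = (𝒲.toSpace ⟨b, y⟩ e).1 (x * g) :=
  congrArg (fun f => f.1 x) ((𝒲.toSpace ⟨b, y⟩).apply_symm_apply
    (𝒲.translateFun ⟨b, y⟩ g (𝒲.toSpace ⟨b, y⟩ e)))

end FunFam

/-! ### The representation covering -/

/-- The restriction of an irreducible representation along an isomorphism. -/
def IrredRep.comp {K K' : Type*} [Group K] [TopologicalSpace K] [Group K'] [TopologicalSpace K']
    (σ : IrredRep K') (e : K ≃* K') (he : Continuous e) : IrredRep K where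
  n := σ.n
  ρ := σ.ρ.comp e.toMonoidHom
  continuous x := (σ.continuous x).comp he
  irreducible := by
    let o : Subrepresentation (σ.ρ.comp e.toMonoidHom) ≃o Subrepresentation σ.ρ :=
      { toFun := fun S => ⟨S.toSubmodule, fun g v hv => by
          have := S.apply_mem_toSubmodule (e.symm g) hv
          change σ.ρ (e (e.symm g)) v ∈ _ at this
          rwa [MulEquiv.apply_symm_apply] at this⟩
        invFun := fun S => ⟨S.toSubmodule, fun g v hv => S.apply_mem_toSubmodule (e g) hv⟩
        left_inv := fun _ => rfl
        right_inv := fun _ => rfl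
        map_rel_iff' := Iff.rfl }
    have := σ.irreducible
    exact o.isSimpleOrder

theorem IrredRep.continuous_apply {K : Type*} [Group K] [TopologicalSpace K] (σ : IrredRep K)
    {Z : Type*} [TopologicalSpace Z] {g : Z → K} (hg : Continuous g) {x : Z → Fin σ.n → ℂ}
    (hx : Continuous x) : Continuous fun z => σ.ρ (g z) (x z) := by
  have h : ∀ z, σ.ρ (g z) (x z) = ∑ k, x z k • σ.ρ (g z) (Pi.single k 1) := by
    intro z
    conv_lhs => rw [pi_eq_sum_univ' (x z)]
    simp only [map_sum, map_smul]
  simp only [h]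
  exact continuous_finsetSum _ fun k _ =>
    ((_root_.continuous_apply k).comp hx).smul ((σ.continuous _).comp hg)

theorem IrredRep.exists_ne_zero {K : Type*} [Group K] [TopologicalSpace K] (σ : IrredRep K) :
    ∃ x : Fin σ.n → ℂ, x ≠ 0 := by
  by_contra! h
  have := σ.irreducible
  obtain ⟨S, S', hS⟩ := (IsSimpleOrder.toNontrivial : Nontrivial (Subrepresentation σ.ρ))
  refine hS (Subrepresentation.toSubmodule_injective (Submodule.ext fun x => ?_))
  rw [h x]
  exact ⟨fun _ => zero_mem _, fun _ => zero_mem _⟩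

namespace GroupBundle

variable {B : Type u} [TopologicalSpace B] {𝒢 : GroupBundle.{u, v} B}

/-- The irreducible representation `σ ∘ t.φ b` of the fibre over `b`. -/
def rep (t : GroupTriv 𝒢.fiber 𝒢.model) (σ : IrredRep 𝒢.model) (b : t.U) :
    IrredRep (𝒢.fiber b.1) := σ.comp (t.φ b) (t.fiberEquiv b).continuous

/-- The point of the representation covering given by an irreducible representation. -/
def dualMk {b : B} (τ : IrredRep (𝒢.fiber b)) : Tot 𝒢.dual := ⟨b, Quotient.mk _ τ⟩

theorem dualMk_mem_sheet {t : GroupTriv 𝒢.fiber 𝒢.model} {σ : IrredRep 𝒢.model} {b : B}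
    {τ : IrredRep (𝒢.fiber b)} :
    dualMk τ ∈ 𝒢.sheet t σ ↔ ∃ hb : b ∈ t.U, Nonempty (τ.ρ.Equiv (rep t σ ⟨b, hb⟩).ρ) := by
  constructor
  · rintro ⟨hb, τ', h1, h2⟩
    obtain ⟨e⟩ : Nonempty (τ.ρ.Equiv τ'.ρ) := Quotient.exact h1
    exact ⟨hb, h2.map e.trans⟩
  · rintro ⟨hb, h⟩
    exact ⟨hb, τ, rfl, h⟩

theorem isOpen_sheet (t : GroupTriv 𝒢.fiber 𝒢.model) (σ : IrredRep 𝒢.model) :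
    IsOpen (𝒢.sheet t σ) := TopologicalSpace.isOpen_generateFrom_of_mem ⟨t, σ, rfl⟩

theorem exists_mem_sheet (t : GroupTriv 𝒢.fiber 𝒢.model) {d : Tot 𝒢.dual} (hd : d.base ∈ t.U) :
    ∃ σ, d ∈ 𝒢.sheet t σ := by
  obtain ⟨b, ⟨τ⟩⟩ := d
  refine ⟨τ.comp (t.φ ⟨b, hd⟩).symm (t.fiberEquiv ⟨b, hd⟩).symm.continuous, ?_⟩
  refine dualMk_mem_sheet.2 ⟨hd, ⟨.mk (LinearEquiv.refl _ _) fun g => LinearMap.ext fun x => ?_⟩⟩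
  change τ.ρ g x = τ.ρ ((t.φ ⟨b, hd⟩).symm (t.φ ⟨b, hd⟩ g)) x
  rw [MulEquiv.symm_apply_apply]

/-- The equivalence of two representations of the typical fibre, transported to the fibres by two
trivializations, is an open condition: the average of an intertwiner of the representations of one
fibre is an intertwiner of the representations of the neighbouring fibres, and it is not zero by
continuity. -/
theorem isOpen_equiv_rep (t t' : GroupTriv 𝒢.fiber 𝒢.model) (σ σ' : IrredRep 𝒢.model) :
    IsOpen {b : B | ∃ (h : b ∈ t.U) (h' : b ∈ t'.U),
      Nonempty ((rep t σ ⟨b, h⟩).ρ.Equiv (rep t' σ' ⟨b, h'⟩).ρ)} := by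
  let O : Set B := t.U ∩ t'.U
  let β : O → B := Subtype.val
  have hβ : Continuous β := continuous_subtype_val
  suffices h : IsOpen {b : O | Nonempty ((rep t σ ⟨b, b.2.1⟩).ρ.Equiv (rep t' σ' ⟨b, b.2.2⟩).ρ)} by
    convert! (t.isOpen.inter t'.isOpen).isOpenMap_subtype_val _ h using 1
    ext b
    exact ⟨fun ⟨h1, h2, h3⟩ => ⟨⟨b, h1, h2⟩, h3, rfl⟩, fun ⟨b', h3, h4⟩ =>
      h4 ▸ ⟨b'.2.1, b'.2.2, h3⟩⟩
  refine isOpen_iff_mem_nhds.2 ?_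
  rintro b₀ ⟨T₀⟩
  let T : (Fin σ.n → ℂ) →ₗ[ℂ] (Fin σ'.n → ℂ) := T₀.toLinearMap
  have hT : ∀ k x, T (σ.ρ (t.φ ⟨b₀, b₀.2.1⟩ k) x) = σ'.ρ (t'.φ ⟨b₀, b₀.2.2⟩ k) (T x) :=
    fun k x => LinearMap.congr_fun (T₀.isIntertwining' k) x
  let F : ∀ b : O, (Fin σ.n → ℂ) → 𝒢.fiber (β b) → Fin σ'.n → ℂ := fun b x k =>
    σ'.ρ (t'.φ ⟨b, b.2.2⟩ k⁻¹) (T (σ.ρ (t.φ ⟨b, b.2.1⟩ k) x))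
  have hF : ∀ x, Continuous fun p : Tot (PullFam β 𝒢.fiber) => F p.base x p.val := by
    intro x
    have hp : Continuous fun p : Tot (PullFam β 𝒢.fiber) => (⟨β p.base, p.val⟩ : Tot 𝒢.fiber) :=
      Tot.continuous_pull_pt (f := β)
    refine σ'.continuous_apply ?_ (T.continuous_of_finiteDimensional.comp
      (σ.continuous_apply ?_ continuous_const))
    · exact t'.continuous_φ (𝒢.continuous_inv_tot.comp hp) fun p => p.base.2.2
    · exact t.continuous_φ hp fun p => p.base.2.1
  have hFc : ∀ b x, FinCont (F b x) := fun b x ℓ =>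
    ℓ.continuous_of_finiteDimensional.comp ((hF x).comp (continuous_fiber_mk (β := β) b))
  let A : ∀ b : O, (Fin σ.n → ℂ) →ₗ[ℂ] (Fin σ'.n → ℂ) := fun b =>
    { toFun := fun x => vint (𝒢.fiber (β b)) (F b x)
      map_add' := fun x y => by
        refine Eq.trans ?_ (vint_add (hFc b x) (hFc b y))
        exact congrArg (vint _) (funext fun k => by simp only [F, map_add])
      map_smul' := fun a x => by
        refine Eq.trans ?_ (map_vint (hFc b x) (a • LinearMap.id)).symm
        exact congrArg (vint _) (funext fun k => by
          simp only [F, map_smul, LinearMap.smul_apply, LinearMap.id_apply]) }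
  have hA : ∀ b : O, ∀ k x, A b (σ.ρ (t.φ ⟨b, b.2.1⟩ k) x) =
      σ'.ρ (t'.φ ⟨b, b.2.2⟩ k) (A b x) := by
    intro b k x
    refine Eq.trans ?_ ((vint_mul_right ((hFc b x).map (σ'.ρ (t'.φ ⟨b, b.2.2⟩ k))) k).trans
      (map_vint (hFc b x) _).symm)
    refine congrArg (vint _) (funext fun h => ?_)
    change σ'.ρ (t'.φ ⟨b, b.2.2⟩ h⁻¹) (T (σ.ρ (t.φ ⟨b, b.2.1⟩ h) (σ.ρ (t.φ ⟨b, b.2.1⟩ k) x))) =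
      σ'.ρ (t'.φ ⟨b, b.2.2⟩ k) (σ'.ρ (t'.φ ⟨b, b.2.2⟩ (h * k)⁻¹)
        (T (σ.ρ (t.φ ⟨b, b.2.1⟩ (h * k)) x)))
    rw [← Module.End.mul_apply, ← map_mul, ← map_mul, ← Module.End.mul_apply (σ'.ρ _), ← map_mul,
      ← map_mul, mul_inv_rev, mul_inv_cancel_left]
  obtain ⟨x, hx⟩ := σ.exists_ne_zero
  have hx' : T x ≠ 0 := fun h => hx ((LinearEquiv.map_eq_zero_iff T₀.toLinearEquiv).1 h)
  obtain ⟨j, hj⟩ := Function.ne_iff.1 hx'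
  have hA0 : A b₀ x = T x := by
    refine Eq.trans (congrArg (vint _) (funext fun k => ?_)) (vint_const (T x))
    change σ'.ρ (t'.φ ⟨b₀, b₀.2.2⟩ k⁻¹) (T (σ.ρ (t.φ ⟨b₀, b₀.2.1⟩ k) x)) = T x
    rw [hT, ← Module.End.mul_apply, ← map_mul, ← map_mul, inv_mul_cancel, map_one, map_one]
    rfl
  have hAc : Continuous fun b => A b x j := by
    refine (continuous_fiberIntegral hβ (F := fun b k => F b x k j)
      ((_root_.continuous_apply j).comp (hF x))).congr fun b => ?_
    exact (dual_vint (hFc b x) (LinearMap.proj j)).symm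
  have hne : A b₀ x j ≠ 0 := by rwa [hA0]
  filter_upwards [hAc.continuousAt.eventually_ne hne] with b hb
  let f : Representation.IntertwiningMap (rep t σ ⟨b, b.2.1⟩).ρ (rep t' σ' ⟨b, b.2.2⟩).ρ :=
    ⟨A b, fun k => LinearMap.ext (hA b k)⟩
  have := (rep t σ ⟨b, b.2.1⟩).irreducible
  have := (rep t' σ' ⟨b, b.2.2⟩).irreducible
  rcases Representation.IsIrreducible.bijective_or_eq_zero f with h | h
  · exact ⟨f.ofBijective h⟩
  · exact absurd (congrArg (fun f => f.toLinearMap x j) h) hb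

theorem continuous_dualMk_rep (t : GroupTriv 𝒢.fiber 𝒢.model) (σ : IrredRep 𝒢.model) :
    Continuous fun b : t.U => dualMk (rep t σ b) := by
  refine continuous_generateFrom_iff.2 ?_
  rintro _ ⟨t', σ', rfl⟩
  convert! (isOpen_equiv_rep t t' σ σ').preimage continuous_subtype_val using 1
  ext b
  exact dualMk_mem_sheet.trans ⟨fun h => ⟨b.2, h⟩, fun ⟨_, h⟩ => h⟩

/-- The restriction of a trivialization to an open set. -/
def _root_.GroupTriv.restrict (t : GroupTriv 𝒢.fiber 𝒢.model) {V : Set B} (hV : IsOpen V) :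
    GroupTriv 𝒢.fiber 𝒢.model where
  U := t.U ∩ V
  isOpen := t.isOpen.inter hV
  φ b := t.φ ⟨b, b.2.1⟩
  isHomeomorph := by
    refine (Tot.isHomeomorph_trivMap_iff (φ := fun b : (t.U ∩ V : Set B) => t.φ ⟨b, b.2.1⟩)
      fun b => (t.φ ⟨b, b.2.1⟩).bijective).2 ?_
    have h := (Tot.isHomeomorph_trivMap_iff fun b => (t.φ b).bijective).1 t.isHomeomorph
    have h1 : IsInducing fun e : {e : Tot 𝒢.fiber // e.base ∈ t.U ∩ V} =>
        (⟨e.1, e.2.1⟩ : {e : Tot 𝒢.fiber // e.base ∈ t.U}) :=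
      IsInducing.subtypeVal.of_comp_iff.1 IsInducing.subtypeVal
    exact h.comp h1

theorem continuous_dual_base : Continuous (Tot.base : Tot 𝒢.dual → B) := by
  refine ⟨fun V hV => isOpen_iff_mem_nhds.2 fun d hd => ?_⟩
  obtain ⟨t, ht⟩ := 𝒢.exists_triv d.base
  obtain ⟨σ, hσ⟩ := exists_mem_sheet (t.restrict hV) (d := d) ⟨ht, hd⟩
  exact Filter.mem_of_superset ((isOpen_sheet _ σ).mem_nhds hσ) fun d' h => h.1.2

/-- Near each point a compact open subset of the representation covering consists of the same
finitely many representations of the typical fibre. -/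
theorem exists_finite_rep [T2Space B] [CompactSpace B] {K : Set (Tot 𝒢.dual)} (hK : IsCompact K)
    (hKo : IsOpen K) (b₁ : B) :
    ∃ (t : GroupTriv 𝒢.fiber 𝒢.model) (N : Set B) (hN : N ⊆ t.U) (s : Set (IrredRep 𝒢.model)),
      IsOpen N ∧ b₁ ∈ N ∧ s.Finite ∧ ∀ (b : B) (hb : b ∈ N) (τ : IrredRep (𝒢.fiber b)),
        dualMk τ ∈ K ↔ ∃ σ ∈ s, Nonempty (τ.ρ.Equiv (rep t σ ⟨b, hN hb⟩).ρ) := by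
  classical
  obtain ⟨t, ht⟩ := 𝒢.exists_triv b₁
  obtain ⟨C, hCb, hC, hCt⟩ := exists_mem_nhds_isClosed_subset (t.isOpen.mem_nhds ht)
  have hKC : IsCompact (K ∩ Tot.base ⁻¹' C) := hK.inter_right (hC.preimage continuous_dual_base)
  obtain ⟨s, hs⟩ := hKC.elim_finite_subcover (fun σ => 𝒢.sheet t σ) (isOpen_sheet t)
    fun d hd => mem_iUnion.2 (exists_mem_sheet t (hCt hd.2))
  let A : IrredRep 𝒢.model → Set B := fun σ => {b | ∃ h : b ∈ t.U, dualMk (rep t σ ⟨b, h⟩) ∈ K}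
  have hA : ∀ σ, IsOpen (A σ) := by
    intro σ
    convert! t.isOpen.isOpenMap_subtype_val _ (hKo.preimage (continuous_dualMk_rep t σ)) using 1
    ext b
    exact ⟨fun ⟨h1, h2⟩ => ⟨⟨b, h1⟩, h2, rfl⟩, fun ⟨b', h3, h4⟩ => h4 ▸ ⟨b'.2, h3⟩⟩
  have hmem : ∀ {σ : IrredRep 𝒢.model} {b : B} {τ : IrredRep (𝒢.fiber b)} (hb : b ∈ t.U),
      Nonempty (τ.ρ.Equiv (rep t σ ⟨b, hb⟩).ρ) → (dualMk τ ∈ K ↔ b ∈ A σ) := by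
    intro σ b τ hb h
    have h1 : dualMk τ = dualMk (rep t σ ⟨b, hb⟩) := congrArg (Tot.mk b) (Quotient.sound h)
    rw [h1]
    exact ⟨fun h => ⟨hb, h⟩, fun ⟨_, h⟩ => h⟩
  -- over `C` the set `A σ` is the image of a part of `K` that is closed, since its complement is
  -- covered by the sheets of the inequivalent representations
  have hAC : ∀ σ, IsClosed (A σ ∩ C) := by
    intro σ
    let O : Set (Tot 𝒢.dual) := ⋃ σ' : {σ' : IrredRep 𝒢.model // ¬ Nonempty (σ'.ρ.Equiv σ.ρ)}, 𝒢.sheet t σ'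
    have hO : IsOpen O := isOpen_iUnion fun σ' => isOpen_sheet t σ'
    have h1 : A σ ∩ C = Tot.base '' ((K ∩ Tot.base ⁻¹' C) \ O) := by
      ext b
      constructor
      · rintro ⟨⟨hb, hbK⟩, hbC⟩
        refine ⟨dualMk (rep t σ ⟨b, hb⟩), ⟨⟨hbK, hbC⟩, fun hO => ?_⟩, rfl⟩
        obtain ⟨⟨σ', hσ'⟩, h⟩ := mem_iUnion.1 hO
        obtain ⟨_, ⟨e⟩⟩ := dualMk_mem_sheet.1 h
        refine hσ' ⟨.mk e.toLinearEquiv.symm fun g => ?_⟩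
        have := e.symm.isIntertwining' ((t.φ ⟨b, hb⟩).symm g)
        change e.symm.toLinearMap ∘ₗ σ'.ρ (t.φ ⟨b, hb⟩ ((t.φ ⟨b, hb⟩).symm g)) =
          σ.ρ (t.φ ⟨b, hb⟩ ((t.φ ⟨b, hb⟩).symm g)) ∘ₗ e.symm.toLinearMap at this
        rwa [MulEquiv.apply_symm_apply] at this
      · rintro ⟨⟨b, ⟨τ⟩⟩, ⟨⟨hK, hbC⟩, hO⟩, rfl⟩
        have hb : b ∈ t.U := hCt hbC
        obtain ⟨σ', hσ'⟩ := exists_mem_sheet t (d := dualMk τ) hb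
        have h2 : Nonempty (σ'.ρ.Equiv σ.ρ) := by
          by_contra h
          exact hO (mem_iUnion.2 ⟨⟨σ', h⟩, hσ'⟩)
        obtain ⟨e⟩ := h2
        obtain ⟨_, ⟨e'⟩⟩ := dualMk_mem_sheet.1 hσ'
        let e'' : (rep t σ' ⟨b, hb⟩).ρ.Equiv (rep t σ ⟨b, hb⟩).ρ :=
          .mk e.toLinearEquiv fun g => e.isIntertwining' (t.φ ⟨b, hb⟩ g)
        exact ⟨(hmem hb ⟨e'.trans e''⟩).1 hK, hbC⟩
    rw [h1]
    exact ((hKC.diff hO).image continuous_dual_base).isClosed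
  let D : IrredRep 𝒢.model → Set B := fun σ => if b₁ ∈ A σ then A σ else (A σ ∩ C)ᶜ
  have hD : ∀ σ, IsOpen (D σ) := by
    intro σ
    by_cases h : b₁ ∈ A σ
    · simpa only [D, if_pos h] using hA σ
    · simpa only [D, if_neg h] using (hAC σ).isOpen_compl
  have hD1 : ∀ σ, b₁ ∈ D σ := by
    intro σ
    by_cases h : b₁ ∈ A σ
    · simpa only [D, if_pos h] using h
    · simp only [D, if_neg h]
      exact fun h' => h h'.1
  refine ⟨t, interior C ∩ ⋂ σ ∈ s, D σ, fun b hb => hCt (interior_subset hb.1),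
    {σ | σ ∈ s ∧ b₁ ∈ A σ}, isOpen_interior.inter (isOpen_biInter_finset fun σ _ => hD σ),
    ⟨mem_interior_iff_mem_nhds.2 hCb, mem_iInter₂.2 fun σ _ => hD1 σ⟩,
    s.finite_toSet.subset fun σ h => h.1, fun b hb τ => ⟨fun h => ?_, ?_⟩⟩
  · have hbC : b ∈ C := interior_subset hb.1
    obtain ⟨σ, hσ, h1⟩ := mem_iUnion₂.1 (hs (⟨h, hbC⟩ : dualMk τ ∈ K ∩ Tot.base ⁻¹' C))
    obtain ⟨hbt, h2⟩ := dualMk_mem_sheet.1 h1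
    refine ⟨σ, ⟨hσ, ?_⟩, h2⟩
    by_contra h3
    have h4 := mem_iInter₂.1 hb.2 σ hσ
    simp only [D, if_neg h3] at h4
    exact h4 ⟨(hmem hbt h2).1 h, hbC⟩
  · rintro ⟨σ, ⟨hσ, h3⟩, h2⟩
    have h4 := mem_iInter₂.1 hb.2 σ hσ
    simp only [D, if_pos h3] at h4
    exact (hmem _ h2).2 h4

/-! ### Matrix coefficients -/

/-- A matrix coefficient of a representation. -/
def coef {K : Type*} [Group K] [TopologicalSpace K] (σ : IrredRep K) (j k : Fin σ.n) : C(K, ℂ) :=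
  ⟨fun x => σ.ρ x (Pi.single k 1) j, (_root_.continuous_apply j).comp (σ.continuous _)⟩

theorem exists_mem_span_coef {K : Type*} [Group K] [TopologicalSpace K] (σ : IrredRep K)
    (ℓ : Module.Dual ℂ (Fin σ.n → ℂ)) (w : Fin σ.n → ℂ) :
    ∃ c ∈ Submodule.span ℂ (range fun p : Fin σ.n × Fin σ.n => coef σ p.1 p.2),
      ∀ x, ℓ (σ.ρ x w) = c x := by
  refine ⟨∑ k, ∑ j, (w k * ℓ (Pi.single j 1)) • coef σ j k,
    Submodule.sum_mem _ fun k _ => Submodule.sum_mem _ fun j _ =>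
      Submodule.smul_mem _ _ (Submodule.subset_span ⟨(j, k), rfl⟩), fun x => ?_⟩
  have h1 : ∀ y : Fin σ.n → ℂ, ℓ y = ∑ j, y j * ℓ (Pi.single j 1) := by
    intro y
    conv_lhs => rw [pi_eq_sum_univ' y]
    simp only [map_sum, map_smul, smul_eq_mul]
  have h2 : σ.ρ x w = ∑ k, w k • σ.ρ x (Pi.single k 1) := by
    conv_lhs => rw [pi_eq_sum_univ' w]
    simp only [map_sum, map_smul]
  rw [h2, map_sum]
  simp only [ContinuousMap.sum_apply, ContinuousMap.smul_apply, smul_eq_mul]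
  refine Finset.sum_congr rfl fun k _ => ?_
  rw [map_smul, h1, smul_eq_mul, Finset.mul_sum]
  refine Finset.sum_congr rfl fun j _ => ?_
  change _ = _ * (σ.ρ x (Pi.single k 1) j)
  ring

/-- The spaces spanned by the matrix coefficients of the representations in a compact open subset
of the representation covering. -/
def coefFam [T2Space B] [CompactSpace B] {K : Set (Tot 𝒢.dual)} (hK : IsCompact K)
    (hKo : IsOpen K) : FunFam 𝒢 where
  space b := Submodule.span ℂ {f | ∃ τ : IrredRep (𝒢.fiber b), dualMk τ ∈ K ∧
    ∃ (ℓ : Module.Dual ℂ (Fin τ.n → ℂ)) (w : Fin τ.n → ℂ), f = fun x => ℓ (τ.ρ x w)}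
  translate {b} g {f} hf := by
    let R : (𝒢.fiber b → ℂ) →ₗ[ℂ] (𝒢.fiber b → ℂ) :=
      { toFun := fun f x => f (x * g), map_add' := fun _ _ => rfl, map_smul' := fun _ _ => rfl }
    refine Submodule.span_le (p := (Submodule.span ℂ _).comap R).2 ?_ hf
    rintro _ ⟨τ, hτ, ℓ, w, rfl⟩
    refine Submodule.subset_span ⟨τ, hτ, ℓ, τ.ρ g w, funext fun x => ?_⟩
    change ℓ (τ.ρ (x * g) w) = _
    rw [map_mul, Module.End.mul_apply]
  exists_chart b₁ := by
    obtain ⟨t, N, hN, s, hNo, hbN, hs, h⟩ := exists_finite_rep hK hKo b₁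
    let S : Set C(𝒢.model, ℂ) := ⋃ σ ∈ s, range fun p : Fin σ.n × Fin σ.n => coef σ p.1 p.2
    have hS : S.Finite := hs.biUnion fun σ _ => finite_range _
    refine ⟨⟨t, N, hNo, hN, Submodule.span ℂ S, FiniteDimensional.span_of_finite ℂ hS,
      fun b hb f => ?_⟩, hbN⟩
    let R : C(𝒢.model, ℂ) →ₗ[ℂ] (𝒢.fiber b → ℂ) :=
      { toFun := fun c x => c (t.φ ⟨b, hN hb⟩ x)
        map_add' := fun _ _ => rfl
        map_smul' := fun _ _ => rfl }
    have h1 : Submodule.span ℂ {f | ∃ τ : IrredRep (𝒢.fiber b), dualMk τ ∈ K ∧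
        ∃ (ℓ : Module.Dual ℂ (Fin τ.n → ℂ)) (w : Fin τ.n → ℂ), f = fun x => ℓ (τ.ρ x w)} =
        (Submodule.span ℂ S).map R := by
      refine le_antisymm (Submodule.span_le.2 ?_) ((Submodule.map_span_le _ _ _).2 ?_)
      · rintro _ ⟨τ, hτ, ℓ, w, rfl⟩
        obtain ⟨σ, hσ, ⟨e⟩⟩ := (h b hb τ).1 hτ
        obtain ⟨c, hc, hcx⟩ := exists_mem_span_coef σ (ℓ ∘ₗ e.toLinearEquiv.symm.toLinearMap)
          (e.toLinearEquiv w)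
        refine ⟨c, Submodule.span_mono (subset_biUnion_of_mem (u := fun σ : IrredRep 𝒢.model =>
          range fun p : Fin σ.n × Fin σ.n => coef σ p.1 p.2) hσ) hc, funext fun x => ?_⟩
        refine (hcx _).symm.trans (congrArg ℓ ?_)
        have h2 : e.toLinearEquiv (τ.ρ x w) = σ.ρ (t.φ ⟨b, hN hb⟩ x) (e.toLinearEquiv w) :=
          LinearMap.congr_fun (e.isIntertwining' x) w
        exact (LinearEquiv.symm_apply_eq _).2 h2.symm
      · intro c hc
        obtain ⟨σ, hσ, ⟨j, k⟩, rfl⟩ := mem_iUnion₂.1 hc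
        exact Submodule.subset_span ⟨rep t σ ⟨b, hN hb⟩, (h b hb _).2 ⟨σ, hσ, ⟨.refl _⟩⟩,
          LinearMap.proj j, Pi.single k 1, rfl⟩
    rw [h1]
    exact ⟨fun ⟨c, hc, hcf⟩ => ⟨c, hc, fun x => congrFun hcf.symm x⟩,
      fun ⟨c, hc, hcf⟩ => ⟨c, hc, funext fun x => (hcf x).symm⟩⟩

/-- With finite holonomy each matrix coefficient of a fibre lies in a locally constant family of
finite dimensional spaces of functions. -/
theorem FiniteHolonomy.exists_funFam [T2Space B] [CompactSpace B] (h : 𝒢.FiniteHolonomy) {b : B}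
    (τ : IrredRep (𝒢.fiber b)) (ℓ : Module.Dual ℂ (Fin τ.n → ℂ)) (w : Fin τ.n → ℂ) :
    ∃ 𝒲 : FunFam 𝒢, (fun x => ℓ (τ.ρ x w)) ∈ 𝒲.space b := by
  obtain ⟨K, hK, hKo, hτ⟩ := h (dualMk τ)
  exact ⟨coefFam hK hKo, Submodule.subset_span ⟨τ, hτ, ℓ, w, rfl⟩⟩

end GroupBundle

/-! ### Mapping equivariant bundles to bundles pulled back from the base -/

open MeasureTheory in
theorem integral_normHaar_of_surjective {K K' : Type*} [Group K] [TopologicalSpace K]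
    [IsTopologicalGroup K] [CompactSpace K] [MeasurableSpace K] [BorelSpace K] [Group K']
    [TopologicalSpace K'] [IsTopologicalGroup K'] [CompactSpace K'] [MeasurableSpace K']
    [BorelSpace K'] (p : K' →* K) (hp : Continuous p) (hs : Function.Surjective p) {f : K → ℂ}
    (hf : Continuous f) : ∫ k, f (p k) ∂normHaar K' = ∫ k, f k ∂normHaar K := by
  have h : Measure.map p (normHaar K') = normHaar K := by
    have : IsProbabilityMeasure (Measure.map p (normHaar K')) :=
      Measure.isProbabilityMeasure_map hp.measurable.aemeasurable
    have := isMulLeftInvariant_map (μ := normHaar K') p.toMulHom hp.measurable hs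
    exact eq_normHaar K _
  rw [← h]
  exact (integral_map hp.measurable.aemeasurable hf.aestronglyMeasurable).symm

theorem exists_bump {T : Type*} [TopologicalSpace T] [NormalSpace T] [T1Space T] {O : Set T}
    (hO : IsOpen O) {t : T} (ht : t ∈ O) :
    ∃ θ : C(T, ℝ), θ t = 1 ∧ (∀ s, 0 ≤ θ s) ∧ tsupport θ ⊆ O := by
  obtain ⟨N, hN, htN, hNO⟩ := normal_exists_closure_subset (isClosed_singleton (x := t)) hO
    (singleton_subset_iff.2 ht)
  obtain ⟨θ, hθ0, hθ1, hθ⟩ := exists_continuous_zero_one_of_isClosed hN.isClosed_compl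
    (isClosed_singleton (x := t)) (Set.disjoint_left.2 fun x hx hx' => hx (htN hx'))
  refine ⟨θ, hθ1 rfl, fun s => (hθ s).1, (closure_mono fun x hx => ?_).trans hNO⟩
  by_contra h
  exact hx (hθ0 h)

theorem tsupport_ofReal {T : Type*} [TopologicalSpace T] (θ : T → ℝ) :
    tsupport (fun t => (θ t : ℂ)) ⊆ tsupport θ :=
  closure_mono fun t ht h => ht (by simp only [h, Complex.ofReal_zero])

/-- Every vector of a vector bundle is the value of a continuous section. -/
theorem VBundle.exists_section {T : Type*} [TopologicalSpace T] [NormalSpace T] [T1Space T]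
    (E : VBundle T) {t : T} (e : E.fiber t) :
    ∃ s : ∀ t, E.fiber t, Continuous (fun t => (⟨t, s t⟩ : Tot E.fiber)) ∧ s t = e := by
  obtain ⟨c, hc⟩ := E.exists_chart t
  obtain ⟨θ, h1, -, hθ⟩ := exists_bump c.isOpen hc
  refine ⟨fun s => (θ s : ℂ) • c.sec s (c.co t e), continuous_iff_continuousAt.2 fun s => ?_, ?_⟩
  · by_cases hs : s ∈ tsupport θ
    · exact VBundle.continuousAt_smul (f := fun s : T => s)
        (Complex.continuous_ofReal.comp θ.continuous).continuousAt (c.continuousAt_sec (hθ hs) _)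
    · refine (VBundle.continuousAt_zero E (f := fun s : T => s) continuousAt_id).congr ?_
      filter_upwards [(isClosed_tsupport θ).isOpen_compl.mem_nhds hs] with s' hs'
      rw [image_eq_zero_of_notMem_tsupport hs', Complex.ofReal_zero, zero_smul]
  · change (θ t : ℂ) • c.sec t (c.co t e) = e
    rw [h1, c.sec_co hc, Complex.ofReal_one, one_smul]

namespace GSpace

variable {B : Type u} [TopologicalSpace B] {𝒢 : GroupBundle.{u, v} B} {𝒢' : GroupBundle.{u, v'} B}

/-- The projection to `B`. -/
def toBase (γ : 𝒢.Hom 𝒢') (Z : GSpace.{u, v, w} 𝒢) : Hom γ Z (base 𝒢') where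
  toFun _ _ := ()
  continuous := Tot.isInducing_base.continuous_iff.2 Z.continuous_base
  map_smul _ _ _ := rfl

theorem isClosedEmbedding_base (𝒢 : GroupBundle.{u, v} B) :
    IsClosedEmbedding (Tot.base : (base 𝒢).Total → B) := by
  refine ⟨⟨Tot.isInducing_base, ?_⟩, ?_⟩
  · rintro ⟨b, _⟩ ⟨_, _⟩ rfl
    rfl
  · convert! isClosed_univ
    exact eq_univ_of_forall fun b => ⟨⟨b, ()⟩, rfl⟩

instance [T2Space B] (𝒢 : GroupBundle.{u, v} B) : T2Space (base 𝒢).Total :=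
  (isClosedEmbedding_base 𝒢).isEmbedding.t2Space

instance [CompactSpace B] (𝒢 : GroupBundle.{u, v} B) : CompactSpace (base 𝒢).Total :=
  (isClosedEmbedding_base 𝒢).compactSpace

end GSpace

namespace EquivVB

variable {B : Type u} [TopologicalSpace B] {𝒢 : GroupBundle.{u, v} B} {ℋ : GroupBundle.{u, v'} B}
  {Z : GSpace.{u, max v v', w} (𝒢.prod ℋ)}

/-- At a point with trivial `ℋ`-stabilizer the `ℋ`-invariant functionals separate the vectors. -/
theorem exists_resRight_invFunctional [T2Space Z.Total] [CompactSpace Z.Total] (R : EquivVB Z)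
    {b : B} {y : Z.fiber b}
    (hy : ∀ h : ℋ.fiber b, GroupBundle.pair (𝒢 := 𝒢) 1 h • y = y → h = 1) {e : R.fiber ⟨b, y⟩}
    (he : e ≠ 0) : ∃ Λ : ∀ z, R.fiber z →ₗ[ℂ] ℂ, Continuous (fun e : Tot R.fiber => Λ e.base e.pt) ∧
      (∀ {b : B} (h : ℋ.fiber b) (y : Z.fiber b) (e : R.fiber ⟨b, y⟩),
        Λ _ (R.act (GroupBundle.pair (𝒢 := 𝒢) 1 h) y e) = Λ _ e) ∧ Λ _ e ≠ 0 := by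
  let f : GSpace.Hom (GroupBundle.inr 𝒢 ℋ) Z.resRight Z := ⟨fun _ x => x, continuous_id,
    fun _ _ _ => rfl⟩
  have : T2Space Z.resRight.Total := ‹T2Space Z.Total›
  have : CompactSpace Z.resRight.Total := ‹CompactSpace Z.Total›
  obtain ⟨Φ, hΦ⟩ := exists_invFunctional_ne_zero (Y := Z.resRight) (R.pull f) (y := y) (e := e)
    hy he
  refine ⟨fun z => Φ.toFun z, ?_, fun {b} h y e => ?_, hΦ⟩
  · exact Φ.continuous.comp (f := fun e : Tot R.fiber => (⟨e.base, e.pt⟩ : Tot (R.pull f).fiber))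
      (Tot.continuous_to_pull (f := f.tot) (E := R.fiber) R.continuous_base continuous_id)
  · have h1 := congrArg (fun e : Tot R.fiber => Φ.toFun e.base e.pt)
      (mk_pull_act f R (b := b) h y e)
    exact h1.symm.trans (Φ.invariant h y e)

/-- At a point with trivial `ℋ`-stabilizer the morphisms to bundles pulled back from bundles of
`𝒢`-representations over `B` separate the vectors. Such morphisms are averages of products of an
`ℋ`-invariant functional and a section of a bundle of functions on the fibres of `𝒢`; if all of them
vanish on `e`, then by the Peter-Weyl theorem the invariant functionals vanish on `e` as well. -/
theorem exists_mor_ne_zero [T2Space B] [CompactSpace B] (h𝒢 : 𝒢.FiniteHolonomy)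
    [T2Space Z.Total] [CompactSpace Z.Total] (R : EquivVB Z) {b : B} {y : Z.fiber b}
    (hy : ∀ h : ℋ.fiber b, GroupBundle.pair (𝒢 := 𝒢) 1 h • y = y → h = 1) {e : R.fiber ⟨b, y⟩}
    (he : e ≠ 0) : ∃ (W : EquivVB (GSpace.base 𝒢))
      (J : Mor R (W.pull (Z.toBase (GroupBundle.fst 𝒢 ℋ)))), J ⟨b, y⟩ e ≠ 0 := by
  obtain ⟨Λ, hΛc, hΛi, hΛe⟩ := exists_resRight_invFunctional R hy he
  by_contra! hall
  let ψ : 𝒢.fiber b → ℂ := fun k => Λ ⟨b, GroupBundle.pair (ℋ := ℋ) k 1 • y⟩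
    (R.act (GroupBundle.pair k 1) y e)
  have hψ : Continuous ψ := by
    refine hΛc.comp (R.continuous_act_tot (β := fun _ : 𝒢.fiber b => b)
      (g := fun k => GroupBundle.pair (ℋ := ℋ) k 1) (y := fun _ => y) (e := fun _ => e) ?_
      continuous_const)
    refine Tot.continuous_to_split (A := 𝒢.fiber) (C := ℋ.fiber) ?_
      ((continuous_const (y := (⟨b, 1⟩ : Tot ℋ.fiber))).congr fun _ => rfl)
    exact continuous_induced_dom
  let φ : C(𝒢.fiber b, ℂ) := ⟨fun k => ψ k⁻¹, hψ.comp continuous_inv⟩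
  have hφ : φ = 0 := by
    refine eq_zero_of_forall_irredRep φ fun τ ℓ w => ?_
    obtain ⟨𝒲, hf⟩ := h𝒢.exists_funFam τ ℓ w
    let t₀ : (GSpace.base 𝒢).Total := ⟨b, ()⟩
    let e₀ : 𝒲.Fib t₀ := (𝒲.toSpace t₀).symm ⟨_, hf⟩
    obtain ⟨s, hs, hs0⟩ := 𝒲.vbundle.exists_section e₀
    let q := Z.toBase (GroupBundle.fst 𝒢 ℋ)
    let L : ∀ z, R.fiber z →ₗ[ℂ] (𝒲.bundle.pull q).fiber z := fun z =>
      (LinearMap.toSpanSingleton ℂ (𝒲.Fib (q.tot z)) (s (q.tot z))) ∘ₗ Λ z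
    have hL : Continuous (VBundle.totMap (A := R.toVBundle)
        (C := (𝒲.bundle.pull q).toVBundle) L) := by
      refine Tot.continuous_to_pull (f := q.tot) (E := 𝒲.Fib) R.continuous_base ?_
      have hq : Continuous fun e : Tot R.fiber => q.tot e.base :=
        Continuous.comp (g := q.tot) q.continuous R.continuous_base
      refine continuous_iff_continuousAt.2 fun e => ?_
      exact VBundle.continuousAt_smul (E := 𝒲.vbundle) (f := fun e : Tot R.fiber => q.tot e.base)
        hΛc.continuousAt (hs.comp hq).continuousAt
    have hJ := hall 𝒲.bundle (average L hL)
    have : ∀ z, Module.Finite ℂ ((𝒲.bundle.pull q).fiber z) := fun z =>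
      inferInstanceAs (Module.Finite ℂ (Fin (Module.finrank ℂ (𝒲.space z.base)) → ℂ))
    let ev : Module.Dual ℂ ((𝒲.bundle.pull q).fiber ⟨b, y⟩) :=
      { toFun := fun v => (𝒲.toSpace t₀ v).1 1
        map_add' := fun v v' => congrArg (fun f => f.1 1) (map_add (𝒲.toSpace t₀) v v')
        map_smul' := fun a v => congrArg (fun f => f.1 1) (map_smul (𝒲.toSpace t₀) a v) }
    have h1 := dual_vint (finCont_conj L hL ⟨⟨b, y⟩, e⟩) ev
    have h2 : ev (vint ((𝒢.prod ℋ).fiber b) (conj L ⟨⟨b, y⟩, e⟩)) = 0 :=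
      (congrArg ev hJ).trans (map_zero ev)
    have h3 : ∀ k : (𝒢.prod ℋ).fiber b, ev (conj L ⟨⟨b, y⟩, e⟩ k) =
        ℓ (τ.ρ ((GroupBundle.fst 𝒢 ℋ).toFun b k)⁻¹ w) * ψ ((GroupBundle.fst 𝒢 ℋ).toFun b k) := by
      intro k
      have h4 : (𝒲.bundle.pull q).act k y (conj L ⟨⟨b, y⟩, e⟩ k) =
          (Λ _ (R.act k y e) • s t₀ : 𝒲.Fib t₀) := act_actEquiv_symm _ k y _
      have h5 := mk_pull_act q 𝒲.bundle k y (conj L ⟨⟨b, y⟩, e⟩ k)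
      rw [h4] at h5
      have h6 : (Λ _ (R.act k y e) • s t₀ : 𝒲.Fib t₀) = 𝒲.bundle.act k.1 ()
        (conj L ⟨⟨b, y⟩, e⟩ k) := eq_of_heq (Tot.mk.inj h5).2
      have h7 := 𝒲.toSpace_act k.1 () (conj L ⟨⟨b, y⟩, e⟩ k) k.1⁻¹
      rw [inv_mul_cancel] at h7
      have h8 : Λ _ (R.act k y e) = ψ k.1 := by
        have hk : k = GroupBundle.pair (𝒢 := 𝒢) 1 k.2 * GroupBundle.pair (ℋ := ℋ) k.1 1 :=
          Prod.ext (one_mul _).symm (mul_one _).symm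
        have h9 := (R.act_congr hk (Eq.refl (⟨⟨b, y⟩, e⟩ : Tot R.fiber))).trans
          (R.act_mul (GroupBundle.pair (𝒢 := 𝒢) 1 k.2) (GroupBundle.pair (ℋ := ℋ) k.1 1) y e)
        exact (congrArg (fun e : Tot R.fiber => Λ e.base e.pt) h9).trans (hΛi _ _ _)
      refine h7.symm.trans ?_
      have h10 : (𝒲.toSpace t₀ (Λ _ (R.act k y e) • s t₀ : 𝒲.Fib t₀)).1 k.1⁻¹ =
          ℓ (τ.ρ (k.1)⁻¹ w) * ψ k.1 := by
        rw [map_smul, hs0, LinearEquiv.apply_symm_apply, h8, mul_comm]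
        rfl
      refine Eq.trans ?_ h10
      exact congrArg (fun v : 𝒲.Fib t₀ => (𝒲.toSpace t₀ v).1 k.1⁻¹) h6.symm
    rw [h2] at h1
    simp only [h3] at h1
    have h4 : Continuous fun g : 𝒢.fiber b => ℓ (τ.ρ g⁻¹ w) * ψ g :=
      (ℓ.continuous_of_finiteDimensional.comp ((τ.continuous w).comp continuous_inv)).mul hψ
    have h5 := integral_normHaar_of_surjective ((GroupBundle.fst 𝒢 ℋ).toFun b) (by
      refine continuous_induced_rng.2 ?_
      exact (GroupBundle.fst 𝒢 ℋ).continuous.comp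
        (continuous_induced_dom (f := fun g => (⟨b, g⟩ : Tot (𝒢.prod ℋ).fiber)))) (fun g => ⟨(g, 1), rfl⟩) h4
    rw [h5] at h1
    rw [h1]
    refine Eq.trans ?_ (MeasureTheory.integral_inv_eq_self
      (fun g => ℓ (τ.ρ g⁻¹ w) * ψ g) (normHaar (𝒢.fiber b)))
    simp only [inv_inv]
    rfl
  refine hΛe ?_
  have h1 : ψ 1⁻¹ = 0 := congrArg (fun f : C(𝒢.fiber b, ℂ) => f 1) hφ
  rw [inv_one] at h1
  exact (congrArg (fun e : Tot R.fiber => Λ e.base e.pt) (R.act_one y e)).symm.trans h1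

end EquivVB

namespace EquivVB

variable {B : Type u} [TopologicalSpace B]

section

variable {𝒢 : GroupBundle.{u, v} B} {Y : GSpace.{u, v, w} 𝒢}

/-- The zero morphism. -/
def Mor.zero (E E' : EquivVB Y) : Mor E E' where
  toFun _ := 0
  continuous := VBundle.continuous_totMap_iff.2 fun _ => VBundle.contAt_zero
  equivariant g y _ := (map_zero (E'.act g y)).symm

/-- The morphism with given components to a bundle identified with a direct sum. -/
def Mor.pairVia {R A A' D : EquivVB Y} (i : Iso D (A.sum A')) (j : Mor R A) (j' : Mor R A') :
    Mor R D := i.symm.toMor.comp (j.pair j')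

/-- The morphism with given components from a bundle identified with a direct sum. -/
def Mor.sumVia {R A A' D : EquivVB Y} (i : Iso D (A.sum A')) (s : Mor A R) (s' : Mor A' R) :
    Mor D R := ((s.comp (.fst _ _)).add (s'.comp (.snd _ _))).comp i.toMor

theorem Mor.pairVia_eq_zero {R A A' D : EquivVB Y} (i : Iso D (A.sum A')) (j : Mor R A)
    (j' : Mor R A') {y : Y.Total} {e : R.fiber y} (h : pairVia i j j' y e = 0) :
    j y e = 0 ∧ j' y e = 0 := by
  have h1 : j.pair j' y e = 0 := ((i.toEquiv y).symm.map_eq_zero_iff).1 h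
  exact ⟨congrArg Prod.fst h1, congrArg Prod.snd h1⟩

theorem Mor.sumVia_pairVia {R A A' D : EquivVB Y} (i : Iso D (A.sum A')) (j : Mor R A)
    (j' : Mor R A') (s : Mor A R) (s' : Mor A' R) (y : Y.Total) (e : R.fiber y) :
    sumVia i s s' y (pairVia i j j' y e) = s y (j y e) + s' y (j' y e) :=
  congrArg (fun p : A.fiber y × A'.fiber y => s y p.1 + s' y p.2)
    (i.toMor_symm_apply y (j.pair j' y e))

open MeasureTheory in
theorem _root_.GSpace.avgFun_nonneg {a : C(Y.Total, ℝ)} (ha : ∀ y, 0 ≤ a y) (y : Y.Total) :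
    0 ≤ Y.avgFun a y := integral_nonneg fun _ => ha _

open MeasureTheory in
theorem _root_.GSpace.avgFun_pos {a : C(Y.Total, ℝ)} (ha : ∀ y, 0 ≤ a y) {y : Y.Total}
    (hy : 0 < a y) : 0 < Y.avgFun a y := by
  have hc : Continuous fun g : 𝒢.fiber y.base => a ⟨y.base, g • y.pt⟩ := by
    refine a.continuous.comp (Y.continuous_smul_tot ?_ continuous_const)
    exact continuous_induced_dom
  refine (integral_pos_iff_support_of_nonneg (fun g => ha _)
    ((BoundedContinuousFunction.mkOfCompact ⟨_, hc⟩).integrable _)).2 ?_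
  refine hc.isOpen_support.measure_pos _ ⟨1, ?_⟩
  have h : (⟨y.base, (1 : 𝒢.fiber y.base) • y.pt⟩ : Y.Total) = y :=
    congrArg (Tot.mk y.base) (one_smul _ y.pt)
  simp only [Function.mem_support]
  rw [h]
  exact hy.ne'

/-- A morphism that is injective at a point is split near the orbit of the point. -/
theorem Mor.exists_local_split [T2Space Y.Total] [CompactSpace Y.Total] {E E' : EquivVB Y}
    (j : Mor E E') {y : Y.Total} (hj : Function.Injective (j y)) :
    ∃ (s : Mor E' E) (a : Y.InvFun), (∀ y, 0 ≤ a y) ∧ (∀ y e, s y (j y e) = (a y : ℂ) • e) ∧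
      0 < a y := by
  obtain ⟨R, hR⟩ := VBundle.ContAt.exists_leftInverse (Filter.Eventually.of_forall j.contAt) hj
  obtain ⟨N, hN, hNo, hyN⟩ := mem_nhds_iff.1 hR
  obtain ⟨θ, h1, h0, hθ⟩ := exists_bump hNo hyN
  have hL : Continuous (VBundle.totMap fun y => (θ y : ℂ) • R y) :=
    VBundle.continuous_totMap_iff.2 (VBundle.contAt_smul_of_tsupport
      (Complex.continuous_ofReal.comp θ.continuous) fun y hy =>
        (hN (hθ (tsupport_ofReal θ hy))).1)
  refine ⟨average _ hL, Y.avgFun θ, GSpace.avgFun_nonneg h0, ?_,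
    GSpace.avgFun_pos h0 (h1 ▸ one_pos)⟩
  rintro ⟨b, y⟩ e
  refine average_apply _ hL fun g => ?_
  rw [← j.equivariant]
  by_cases hg : (⟨b, g • y⟩ : Y.Total) ∈ N
  · exact congrArg _ (LinearMap.congr_fun (hN hg).2 _)
  · have : θ ⟨b, g • y⟩ = 0 := image_eq_zero_of_notMem_tsupport fun h => hg (hθ h)
    simp [this]

end

variable {𝒢 : GroupBundle.{u, v} B} {ℋ : GroupBundle.{u, v'} B}
  {Z : GSpace.{u, max v v', w} (𝒢.prod ℋ)}

/-- The points with trivial `ℋ`-stabilizer. -/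
def _root_.GSpace.rightFree (Z : GSpace.{u, max v v', w} (𝒢.prod ℋ)) : Set Z.Total :=
  {z | ∀ h : ℋ.fiber z.base, GroupBundle.pair (𝒢 := 𝒢) 1 h • z.pt = z.pt → h = 1}

variable [T2Space B] [CompactSpace B] [T2Space Z.Total] [CompactSpace Z.Total]

theorem exists_mor_injective (h𝒢 : 𝒢.FiniteHolonomy) (R : EquivVB Z) {z : Z.Total}
    (hz : z ∈ Z.rightFree) : ∃ (W : EquivVB (GSpace.base 𝒢))
      (J : Mor R (W.pull (Z.toBase (GroupBundle.fst 𝒢 ℋ)))), Function.Injective (J z) := by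
  suffices h : ∀ (n : ℕ) (W : EquivVB (GSpace.base 𝒢))
      (J : Mor R (W.pull (Z.toBase (GroupBundle.fst 𝒢 ℋ)))),
      Module.finrank ℂ (LinearMap.ker (J z)) = n → ∃ (W : EquivVB (GSpace.base 𝒢))
        (J : Mor R (W.pull (Z.toBase (GroupBundle.fst 𝒢 ℋ)))), Function.Injective (J z) from
    h _ (zero _) (Mor.zero _ _) rfl
  intro n
  induction n using Nat.strong_induction_on with
  | _ n ih =>
    intro W J hn
    by_cases hJ : Function.Injective (J z)
    · exact ⟨W, J, hJ⟩
    rw [← LinearMap.ker_eq_bot] at hJ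
    obtain ⟨e, he, he0⟩ := (Submodule.ne_bot_iff _).1 hJ
    obtain ⟨W', J', hJ'⟩ := exists_mor_ne_zero h𝒢 R (b := z.base) (y := z.pt) hz he0
    let J'' := Mor.pairVia (pullSum (Z.toBase (GroupBundle.fst 𝒢 ℋ)) W W') J J'
    have hk : LinearMap.ker (J'' z) < LinearMap.ker (J z) := by
      refine lt_of_le_of_ne (fun x hx => ?_) fun h => hJ' ?_
      · exact (Mor.pairVia_eq_zero _ J J' hx).1
      · rw [← h] at he
        exact (Mor.pairVia_eq_zero _ J J' he).2
    exact ih _ (hn ▸ Submodule.finrank_lt_finrank_of_lt hk) (W.sum W') J'' rfl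

/-- Over a closed set of points with trivial `ℋ`-stabilizer each bundle is a direct summand of the
pull-back of a bundle over `B`. -/
theorem exists_split_over (h𝒢 : 𝒢.FiniteHolonomy) (R : EquivVB Z) {C : Set Z.Total}
    (hC : IsClosed C) (hCf : C ⊆ Z.rightFree) : ∃ (W : EquivVB (GSpace.base 𝒢))
      (j : Mor R (W.pull (Z.toBase (GroupBundle.fst 𝒢 ℋ))))
      (s : Mor (W.pull (Z.toBase (GroupBundle.fst 𝒢 ℋ))) R), ∀ z ∈ C, ∀ e, s z (j z e) = e := by
  let q := Z.toBase (GroupBundle.fst 𝒢 ℋ)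
  have key : ∃ (W : EquivVB (GSpace.base 𝒢)) (j : Mor R (W.pull q)) (s : Mor (W.pull q) R)
      (a : Z.InvFun), (∀ z, 0 ≤ a z) ∧ (∀ z e, s z (j z e) = (a z : ℂ) • e) ∧
        ∀ z ∈ C, 0 < a z := by
    refine hC.isCompact.induction_on (p := fun C => ∃ (W : EquivVB (GSpace.base 𝒢))
      (j : Mor R (W.pull q)) (s : Mor (W.pull q) R) (a : Z.InvFun), (∀ z, 0 ≤ a z) ∧
        (∀ z e, s z (j z e) = (a z : ℂ) • e) ∧ ∀ z ∈ C, 0 < a z) ?_ ?_ ?_ ?_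
    · exact ⟨zero _, .zero _ _, .zero _ _, ⟨fun _ => 0, continuous_const, fun _ _ => rfl⟩,
        fun _ => le_rfl, fun z e =>
          (by rw [Complex.ofReal_zero, zero_smul] : (((0 : ℝ) : ℂ)) • e = 0).symm, fun z hz => hz.elim⟩
    · rintro S S' hS ⟨W, j, s, a, h0, h1, h2⟩
      exact ⟨W, j, s, a, h0, h1, fun z hz => h2 z (hS hz)⟩
    · rintro S S' ⟨W, j, s, a, h0, h1, h2⟩ ⟨W', j', s', a', h0', h1', h2'⟩
      refine ⟨W.sum W', .pairVia (pullSum q W W') j j', .sumVia (pullSum q W W') s s',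
        ⟨fun z => a z + a' z, a.continuous.add a'.continuous, fun g y => by
          rw [a.smul, a'.smul]⟩, fun z => add_nonneg (h0 z) (h0' z), fun z e => ?_, ?_⟩
      · rw [Mor.sumVia_pairVia, h1, h1', Complex.ofReal_add, add_smul]
      · rintro z (hz | hz)
        · exact add_pos_of_pos_of_nonneg (h2 z hz) (h0' z)
        · exact add_pos_of_nonneg_of_pos (h0 z) (h2' z hz)
    · intro z hz
      obtain ⟨W, j, hj⟩ := exists_mor_injective h𝒢 R (hCf hz)
      obtain ⟨s, a, h0, h1, h2⟩ := j.exists_local_split hj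
      exact ⟨{z | 0 < a z}, mem_nhdsWithin_of_mem_nhds
        ((isOpen_lt continuous_const a.continuous).mem_nhds h2), W, j, s, a, h0, h1, fun z h => h⟩
  obtain ⟨W, j, s, a, h0, h1, h2⟩ := key
  obtain ⟨ε, hε, hεa⟩ := hC.isCompact.exists_forall_le' a.continuous.continuousOn h2
  refine ⟨W, j, .smul (a.comp (fun t => (max t ε)⁻¹) ((continuous_id.max continuous_const).inv₀
    fun t => (lt_max_of_lt_right hε).ne')) s, fun z hz e => ?_⟩
  have h3 : max (a z) ε = a z := max_eq_left (hεa z hz)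
  change (((max (a z) ε)⁻¹ : ℝ) : ℂ) • s z (j z e) = e
  rw [h1, h3, smul_smul, ← Complex.ofReal_mul, inv_mul_cancel₀ (h2 z hz).ne', Complex.ofReal_one,
    one_smul]

end EquivVB

/-! ### Bundles on the quotient -/

namespace EquivVB

variable {B : Type u} [TopologicalSpace B]

section

variable {𝒢 : GroupBundle.{u, v} B} {𝒢' : GroupBundle.{u, v'} B} {γ : 𝒢.Hom 𝒢'}
  {X : GSpace.{u, v, w} 𝒢} {Y : GSpace.{u, v', w'} 𝒢'}

/-- Pull-backs from `B` are compatible with maps over `B`. -/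
def pullToBase (f : GSpace.Hom γ X Y) (W : EquivVB (GSpace.base 𝒢')) :
    Iso (W.pull (X.toBase γ)) ((W.pull (Y.toBase (.id 𝒢'))).pull f) where
  toEquiv x := LinearEquiv.refl ℂ (W.fiber ⟨x.base, ()⟩)
  continuous := Tot.continuous_to_pull (f := f.tot)
    (E := PullFam (Y.toBase (.id 𝒢')).tot W.fiber)
    (Tot.continuous_pull_base (f := (X.toBase γ).tot) (E := W.fiber))
    (Tot.continuous_to_pull (f := (Y.toBase (.id 𝒢')).tot) (E := W.fiber)
      (Continuous.comp (g := f.tot) f.continuous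
        (Tot.continuous_pull_base (f := (X.toBase γ).tot) (E := W.fiber)))
      (Tot.continuous_pull_pt (f := (X.toBase γ).tot) (E := W.fiber)))
  continuous_symm := Tot.continuous_to_pull (f := (X.toBase γ).tot) (E := W.fiber)
    (Tot.continuous_pull_base (f := f.tot) (E := PullFam (Y.toBase (.id 𝒢')).tot W.fiber))
    ((Tot.continuous_pull_pt (f := (Y.toBase (.id 𝒢')).tot) (E := W.fiber)).comp
      (Tot.continuous_pull_pt (f := f.tot) (E := PullFam (Y.toBase (.id 𝒢')).tot W.fiber)))
  equivariant {b} g x e := by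
    have h1 := mk_pull_act (X.toBase γ) W g x e
    have h2 := congrArg (fun z : Tot (PullFam (Y.toBase (.id 𝒢')).tot W.fiber) =>
      (⟨(Y.toBase (.id 𝒢')).tot z.base, z.pt⟩ : Tot W.fiber))
      (mk_pull_act f (W.pull (Y.toBase (.id 𝒢'))) g x e)
    have h3 := mk_pull_act (Y.toBase (.id 𝒢')) W (γ.toFun b g) (f.toFun b x) e
    exact eq_of_heq (Tot.mk.inj (h1.trans (h2.trans h3).symm)).2

/-- A direct summand of a pulled back bundle is itself pulled back: the idempotent descends. -/
theorem exists_descend {f : GSpace.Hom γ X Y} (hf : f.IsKerQuot) {A : EquivVB Y} {F : EquivVB X}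
    (j : Mor F (A.pull f)) (s : Mor (A.pull f) F) (h : ∀ x e, s x (j x e) = e) :
    ∃ E : EquivVB Y, Nonempty (Iso F (E.pull f)) := by
  have hs : ∀ x (a : A.fiber (f.tot x)), (j.comp s).descend hf (f.tot x) a = j x (s x a) :=
    fun x a => Mor.descend_apply _ hf x a
  have hP : ∀ y e, (j.comp s).descend hf y ((j.comp s).descend hf y e) =
      (j.comp s).descend hf y e := by
    intro y e
    obtain ⟨x, rfl⟩ := hf.surjective y
    rw [hs, hs, h]
  refine ⟨Mor.image _ hP, ⟨(((Mor.proj _ hP).pull f).comp j).toIso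
    (s.comp ((Mor.incl _ hP).pull f)) (fun x e => ?_) fun x e => ?_⟩⟩
  · exact (congrArg (s x) (hs x (j x e))).trans ((h x _).trans (h x e))
  · exact (congrArg (Mor.proj _ hP (f.tot x)) ((hs x _).symm.trans (Mor.apply_incl _ hP _ _))).trans
      (Mor.proj_incl _ hP _ e)

theorem _root_.KVect.exists_addEquiv (f : GSpace.Hom γ X Y)
    (hf : Function.Bijective (Classes.map f)) :
    ∃ Φ : KVect Y ≃+ KVect X, ∀ a, Φ a = KVect.map f a := by
  let e : Classes Y ≃+ Classes X := AddEquiv.ofBijective _ hf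
  let g : KVect X →+ KVect Y := Algebra.GrothendieckAddGroup.lift
    (Algebra.GrothendieckAddGroup.of.comp e.symm.toAddMonoidHom)
  have hg : ∀ c, g (Algebra.GrothendieckAddGroup.of c) =
      Algebra.GrothendieckAddGroup.of (e.symm c) := fun c =>
    DFunLike.congr_fun (Algebra.GrothendieckAddGroup.lift.symm_apply_apply
      (Algebra.GrothendieckAddGroup.of.comp e.symm.toAddMonoidHom)) c
  have hm : ∀ c, KVect.map f (Algebra.GrothendieckAddGroup.of c) =
      Algebra.GrothendieckAddGroup.of (e c) := fun c =>
    DFunLike.congr_fun (Algebra.GrothendieckAddGroup.lift.symm_apply_apply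
      (Algebra.GrothendieckAddGroup.of.comp (Classes.map f))) c
  refine ⟨AddMonoidHom.toAddEquiv (KVect.map f) g (KVect.hom_ext fun E => ?_)
    (KVect.hom_ext fun E => ?_), fun _ => rfl⟩
  · change g (KVect.map f (Algebra.GrothendieckAddGroup.of E.toClass)) = _
    rw [hm, hg, AddEquiv.symm_apply_apply]
    rfl
  · change KVect.map f (g (Algebra.GrothendieckAddGroup.of E.toClass)) = _
    rw [hg, hm, AddEquiv.apply_symm_apply]
    rfl

end

section

variable {𝒢 : GroupBundle.{u, v} B} {ℋ : GroupBundle.{u, v'} B}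
  {X : GSpace.{u, max v v', w} (𝒢.prod ℋ)}

/-- A bundle with pull-back isomorphic to `F` is the orbit bundle of `F`. -/
def orbitBundleOfIso {F : EquivVB X} {E : EquivVB X.quot} (i : Iso F (E.pull X.quotMap)) :
    OrbitBundle F E :=
  have heq : ∀ {b : B} (g : 𝒢.fiber b) (h : ℋ.fiber b) (x : X.fiber b) (e : F.fiber ⟨b, x⟩),
      (⟨X.quotMap.tot ⟨b, GroupBundle.pair g h • x⟩,
        i.toEquiv _ (F.act (GroupBundle.pair g h) x e)⟩ : Tot E.fiber) =
      ⟨_, E.act g (X.quotMk b x) (i.toEquiv _ e)⟩ := fun {b} g h x e => by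
    rw [i.equivariant]
    exact mk_pull_act X.quotMap E (GroupBundle.pair g h) x (i.toEquiv _ e)
  { q := fun x => i.toEquiv x
    equivariant := heq
    orbits := fun {b} x x' e e' => by
      constructor
      · intro h
        obtain ⟨h1, -⟩ := Tot.mk.inj h
        have h3 : X.quotMk b x' = X.quotMk b x := (eq_of_heq (Tot.mk.inj h1).2).symm
        obtain ⟨k, rfl⟩ := X.quotMk_eq.1 h3
        refine ⟨k, congrArg (Tot.mk _) ((i.toEquiv _).injective ?_)⟩
        have h2 := (heq 1 k x e).trans ((E.act_one _ _).trans h)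
        exact eq_of_heq (Tot.mk.inj h2).2
      · rintro ⟨k, hk⟩
        have h1 := congrArg (fun z : Tot F.fiber =>
          (⟨X.quotMap.tot z.base, i.toEquiv _ z.pt⟩ : Tot E.fiber)) hk
        exact ((E.act_one _ _).symm.trans (heq 1 k x e).symm).trans h1
    isQuotientMap := by
      let o : Tot F.fiber ≃ₜ Tot (E.pull X.quotMap).fiber :=
        { toFun := fun e => ⟨e.base, i.toEquiv _ e.pt⟩
          invFun := fun e => ⟨e.base, (i.toEquiv _).symm e.pt⟩
          left_inv := fun e => congrArg (Tot.mk e.base) ((i.toEquiv _).symm_apply_apply e.pt)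
          right_inv := fun e => congrArg (Tot.mk e.base) ((i.toEquiv _).apply_symm_apply e.pt)
          continuous_toFun := i.continuous
          continuous_invFun := i.continuous_symm }
      exact (isQuotientMap_pullTot X.quotMap_isKerQuot E).comp o.isQuotientMap }

/-- A bundle is the pull-back of its orbit bundle: a continuous equivariant family of linear
isomorphisms of the fibres is an isomorphism of bundles. -/
theorem _root_.OrbitBundle.nonempty_iso {F : EquivVB X} {E : EquivVB X.quot}
    (o : OrbitBundle F E) : Nonempty (Iso F (E.pull X.quotMap)) := by
  let m : Mor F (E.pull X.quotMap) :=
    { toFun := fun x => (o.q x).toLinearMap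
      continuous := Tot.continuous_to_pull (f := X.quotMap.tot) (E := E.fiber) F.continuous_base
        o.isQuotientMap.continuous
      equivariant := fun {b} g x e => by
        have h := (o.equivariant g.1 g.2 x e).trans (mk_pull_act X.quotMap E g x (o.q _ e)).symm
        exact eq_of_heq (Tot.mk.inj h).2 }
  exact ⟨m.isoOfBijective fun x => (o.q x).bijective⟩

theorem exists_iso_pull_quotMap [T2Space B] [CompactSpace B] (h𝒢 : 𝒢.FiniteHolonomy)
    [T2Space X.Total] [CompactSpace X.Total] (hX : X.resRight.IsFree) (F : EquivVB X) :
    ∃ E : EquivVB X.quot, Nonempty (Iso F (E.pull X.quotMap)) := by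
  obtain ⟨W, j, s, h⟩ := exists_split_over h𝒢 F (C := univ) isClosed_univ
    fun z _ h hh => hX z.base h z.pt hh
  let i := pullToBase X.quotMap W
  refine exists_descend X.quotMap_isKerQuot (i.toMor.comp j) (s.comp i.symm.toMor) fun x e => ?_
  exact (congrArg (s x) (i.symm_toMor_apply x (j x e))).trans (h x trivial e)

/-- Over a compact space every bundle is the pull-back of its orbit bundle, and isomorphisms
descend. -/
theorem bijective_classesMap_quotMap [T2Space B] [CompactSpace B] (h𝒢 : 𝒢.FiniteHolonomy)
    [T2Space X.Total] [CompactSpace X.Total] (hX : X.resRight.IsFree) :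
    Function.Bijective (Classes.map X.quotMap) := by
  constructor
  · rintro ⟨E⟩ ⟨E'⟩ h
    obtain ⟨i⟩ : Nonempty (Iso (E.pull X.quotMap) (E'.pull X.quotMap)) := Quotient.exact h
    exact Quotient.sound (Iso.descend X.quotMap_isKerQuot i)
  · rintro ⟨F⟩
    obtain ⟨E, ⟨i⟩⟩ := exists_iso_pull_quotMap h𝒢 hX F
    exact ⟨E.toClass, Quotient.sound ⟨i.symm⟩⟩

end

end EquivVB

/-! ### Classes in the K-groups -/

namespace KVect

variable {B : Type u} [TopologicalSpace B] {𝒢 : GroupBundle.{u, v} B} {Y : GSpace.{u, v, w} 𝒢}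

theorem mk_sum (E F : EquivVB Y) : mk (E.sum F) = mk E + mk F :=
  map_add Algebra.GrothendieckAddGroup.of E.toClass F.toClass

theorem mk_congr {E F : EquivVB Y} (i : EquivVB.Iso E F) : mk E = mk F :=
  congrArg Algebra.GrothendieckAddGroup.of (Quotient.sound ⟨i⟩)

theorem exists_eq_sub (a : KVect Y) : ∃ E F : EquivVB Y, a = mk E - mk F := by
  obtain ⟨⟨c, d⟩, h⟩ := (AddLocalization.addMonoidOf ⊤).surj a
  obtain ⟨E⟩ := c
  obtain ⟨⟨F⟩, hd⟩ := d
  exact ⟨E, F, eq_sub_of_add_eq h⟩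

theorem mk_eq_mk_iff {E F : EquivVB Y} :
    mk E = mk F ↔ ∃ R, Nonempty (EquivVB.Iso (E.sum R) (F.sum R)) := by
  constructor
  · intro h
    obtain ⟨⟨⟨R⟩, _⟩, hR⟩ := ((AddLocalization.addMonoidOf
      (⊤ : AddSubmonoid (EquivVB.Classes Y))).eq_iff_exists (x := E.toClass) (y := F.toClass)).1 h
    obtain ⟨i⟩ : Nonempty (EquivVB.Iso (R.sum E) (R.sum F)) := Quotient.exact hR
    exact ⟨R, ⟨((EquivVB.sumComm E R).trans i).trans (EquivVB.sumComm R F)⟩⟩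
  · rintro ⟨R, ⟨i⟩⟩
    have h := mk_congr i
    rwa [mk_sum, mk_sum, add_left_inj] at h

end KVect

namespace EquivVB

variable {B : Type u} [TopologicalSpace B]

section

variable {𝒢 : GroupBundle.{u, v} B} {𝒢' : GroupBundle.{u, v'} B} {γ : 𝒢.Hom 𝒢'} {γ' : 𝒢'.Hom 𝒢}
  {X : GSpace.{u, v, w} 𝒢} {Y : GSpace.{u, v', w'} 𝒢'}

/-- The pull-back along a retraction, restricted along a section of it. -/
def pullSection (f : GSpace.Hom γ X Y) (g : GSpace.Hom γ' Y X)
    (hγ : ∀ b k, γ'.toFun b (γ.toFun b k) = k) (h : ∀ x, g.tot (f.tot x) = x) (E : EquivVB X) :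
    Iso E ((E.pull g).pull f) where
  toEquiv x := E.cast (h x).symm
  continuous := by
    refine Tot.continuous_to_pull (f := f.tot) (E := PullFam g.tot E.fiber) E.continuous_base
      (Tot.continuous_to_pull (f := g.tot) (E := E.fiber)
        (Continuous.comp (g := f.tot) f.continuous E.continuous_base) ?_)
    exact continuous_id.congr fun e => (E.mk_cast (h e.base).symm _).symm
  continuous_symm := by
    refine ((Tot.continuous_pull_pt (f := g.tot) (E := E.fiber)).comp
      (Tot.continuous_pull_pt (f := f.tot) (E := PullFam g.tot E.fiber)) : Continuous
      fun e : Tot (PullFam f.tot (PullFam g.tot E.fiber)) =>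
        (⟨g.tot (f.tot e.base), e.pt⟩ : Tot E.fiber)).congr fun e => ?_
    exact (E.mk_cast_symm (h e.base).symm _).symm
  equivariant {b} k x e := by
    have h2 : (⟨g.tot (f.tot ⟨b, k • x⟩),
        ((E.pull g).pull f).act k x (E.cast (h ⟨b, x⟩).symm e)⟩ : Tot E.fiber) =
        ⟨_, E.act (γ'.toFun b (γ.toFun b k)) (g.toFun b (f.toFun b x))
          (E.cast (h ⟨b, x⟩).symm e)⟩ := by
      refine Eq.trans ?_ (mk_pull_act g E (γ.toFun b k) (f.toFun b x) _)
      exact congrArg (fun z : Tot (PullFam g.tot E.fiber) => (⟨g.tot z.base, z.pt⟩ : Tot E.fiber))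
        (mk_pull_act f (E.pull g) k x _)
    have h3 := E.act_congr (hγ b k) (E.mk_cast (h ⟨b, x⟩).symm e)
    have h4 := (E.mk_cast (h ⟨b, k • x⟩).symm (E.act k x e)).trans (h3.symm.trans h2.symm)
    exact eq_of_heq (Tot.mk.inj h4).2

end

section

variable [CompactSpace B] [T2Space B] {𝒢 : GroupBundle.{u, v} B} {X : GSpace.{u, v, w} 𝒢}

/-- Each class that vanishes at infinity is the difference of two bundles that are isomorphic
at infinity. A stable isomorphism at infinity becomes an isomorphism after adding a bundle that is
pulled back from `B`. -/
theorem _root_.K0.exists_eq_sub (a : K0 X) : ∃ E F : EquivVB X.plus,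
    (a : KVect X.plus) = KVect.mk E - KVect.mk F ∧
      Nonempty (Iso (E.pull X.infty) (F.pull X.infty)) := by
  obtain ⟨a, ha⟩ := a
  obtain ⟨E, F, rfl⟩ := KVect.exists_eq_sub a
  have h : KVect.map X.infty (KVect.mk E - KVect.mk F) = 0 := ha
  rw [map_sub, KVect.map_mk, KVect.map_mk, sub_eq_zero, KVect.mk_eq_mk_iff] at h
  obtain ⟨R, ⟨i⟩⟩ := h
  let r := X.plus.toBase (.id 𝒢)
  have hR : ∀ E : EquivVB X.plus, Nonempty (Iso ((E.sum (R.pull r)).pull X.infty)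
      ((E.pull X.infty).sum R)) := fun E =>
    ⟨(pullSum X.infty E (R.pull r)).trans ((Iso.refl _).sum
      (pullSection X.infty r (fun _ _ => rfl) (fun _ => rfl) R).symm)⟩
  obtain ⟨i₁⟩ := hR E
  obtain ⟨i₂⟩ := hR F
  refine ⟨E.sum (R.pull r), F.sum (R.pull r), ?_, ⟨(i₁.trans i).trans i₂.symm⟩⟩
  rw [KVect.mk_sum, KVect.mk_sum, add_sub_add_right_eq_sub]

end

section

variable {𝒢 : GroupBundle.{u, v} B} {Y : GSpace.{u, v, w} 𝒢}

/-- Near a point where a continuous family `L` of endomorphisms vanishes, all `1 + t L` with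
`0 ≤ t ≤ 1` are invertible. -/
theorem _root_.VBundle.ContAt.eventually_bijective_add_smul {T : Type*} [TopologicalSpace T]
    {A : VBundle T} {L : ∀ t, A.fiber t →ₗ[ℂ] A.fiber t} {t : T} (hL : VBundle.ContAt L t)
    (h : L t = 0) : ∀ᶠ s in 𝓝 t, ∀ a : ℝ, 0 ≤ a → a ≤ 1 →
      Function.Bijective (LinearMap.id + (a : ℂ) • L s : A.fiber s →ₗ[ℂ] A.fiber s) := by
  obtain ⟨c, hc⟩ := A.exists_chart t
  have h1 := ((VBundle.contAt_iff_mat c c hc hc).1 hL).norm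
  have h0 : VBundle.mat L c c t = 0 := by
    ext x
    simp [VBundle.mat, h]
  have h2 : ∀ᶠ s in 𝓝 t, ‖VBundle.mat L c c s‖ < 1 :=
    h1.eventually_lt_const (by
      change ‖VBundle.mat L c c t‖ < 1
      rw [h0, norm_zero]
      exact one_pos)
  filter_upwards [h2, c.isOpen.mem_nhds hc] with s hs hcs a ha0 ha1
  have h3 : VBundle.mat (fun s => LinearMap.id + (a : ℂ) • L s) c c s =
      1 - (-(a : ℂ)) • VBundle.mat L c c s := by
    ext x
    simp [VBundle.mat, c.co_sec hcs]
  have h4 : ‖(-(a : ℂ)) • VBundle.mat L c c s‖ < 1 := by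
    rw [norm_smul, norm_neg, Complex.norm_of_nonneg ha0]
    exact (mul_le_of_le_one_left (norm_nonneg _) ha1).trans_lt hs
  have h5 := isUnit_one_sub_of_norm_lt_one h4
  rw [← h3] at h5
  have h6 := (VBundle.mat_bijective_iff (L := fun s => LinearMap.id + (a : ℂ) • L s) c c hcs
    hcs).1
  refine h6 ?_
  obtain ⟨u, hu⟩ := h5
  rw [← hu]
  exact Function.bijective_iff_has_inverse.2 ⟨u.inv,
    fun x => congrArg (fun f : (Fin c.n → ℂ) →L[ℂ] (Fin c.n → ℂ) => f x) u.inv_val,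
    fun x => congrArg (fun f : (Fin c.n → ℂ) →L[ℂ] (Fin c.n → ℂ) => f x) u.val_inv⟩

/-- An isomorphism that agrees with a morphism `m` on a closed invariant set can be modified to
agree with `m` near this set: with `n = i⁻¹ m - 1` and a cut-off function `ρ` the automorphism
`1 + ρ n` agrees with `i⁻¹ m` where `ρ = 1`. -/
theorem Iso.exists_modify [NormalSpace Y.Total] {E E' : EquivVB Y} (i : Iso E E') (m : Mor E E')
    {C : Set Y.Total} (hC : IsClosed C) (hCi : Y.IsInvariant C)
    (h : ∀ y ∈ C, ∀ e, i.toMor y e = m y e) :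
    ∃ (i' : Iso E E') (N : Set Y.Total), IsOpen N ∧ C ⊆ N ∧ ∀ y ∈ N, ∀ e, i'.toMor y e = m y e := by
  let n : Mor E E := (i.symm.toMor.comp m).add (Mor.id E).neg
  have hn : ∀ y e, n y e = i.symm.toMor y (m y e) - e := fun y e => by
    simp [n, sub_eq_add_neg]
  let O : Set Y.Total := interior {y | ∀ a : ℝ, 0 ≤ a → a ≤ 1 →
    Function.Bijective (LinearMap.id + (a : ℂ) • n y : E.fiber y →ₗ[ℂ] E.fiber y)}
  have hCO : C ⊆ O := fun y hy => mem_interior_iff_mem_nhds.2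
    ((n.contAt y).eventually_bijective_add_smul (LinearMap.ext fun e => by
      rw [hn, ← h y hy, Iso.symm_toMor_apply, sub_self, LinearMap.zero_apply]))
  obtain ⟨ρ, h0, h1, ⟨N, hN, hCN, hNρ⟩, hρ⟩ := Y.exists_invFun hC hCi isOpen_interior hCO
  let k : Mor E E := (Mor.id E).add (.smul ρ n)
  have hk : ∀ y, Function.Bijective (k y) := by
    intro y
    by_cases hy : y ∈ O
    · exact interior_subset hy (ρ y) (h0 y) (h1 y)
    · have h2 : ρ y = 0 := image_eq_zero_of_notMem_tsupport fun h => hy (hρ h)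
      have h3 : k y = LinearMap.id := LinearMap.ext fun e => by simp [k, h2]
      rw [h3]
      exact Function.bijective_id
  refine ⟨(k.isoOfBijective hk).trans i, N, hN, hCN, fun y hy e => ?_⟩
  have h2 : k y e = i.symm.toMor y (m y e) := by
    simp [k, hn, hNρ y hy]
  exact (congrArg (i.toMor y) h2).trans (i.toMor_symm_apply y _)

end

end EquivVB

/-! ### Clutching -/

namespace EquivVB

variable {B : Type u} [TopologicalSpace B] {𝒢 : GroupBundle.{u, v} B} {Y : GSpace.{u, v, w} 𝒢}

/-- The linear combination `m - c² m' + c m''` of morphisms, where `c` is an invariant function. -/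
def Mor.comb (c : Y.InvFun) {E E' : EquivVB Y} (m m' m'' : Mor E E') : Mor E E' :=
  (m.add (Mor.smul (c.comp (fun t => t ^ 2) (continuous_pow 2)) m').neg).add (.smul c m'')

theorem Mor.comb_apply (c : Y.InvFun) {E E' : EquivVB Y} (m m' m'' : Mor E E') (y : Y.Total)
    (e : E.fiber y) :
    comb c m m' m'' y e = m y e - (c y : ℂ) ^ 2 • m' y e + (c y : ℂ) • m'' y e := by
  simp [comb, GSpace.InvFun.comp, sub_eq_add_neg]

/-- If `U : S ⊕ F → T` has a right inverse `V` such that `V U` is the identity on `F` and preserves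
`S`, then `T` is the sum of `F` and the image of the idempotent endomorphism `V U` of `S`. -/
theorem exists_summand {S F T : EquivVB Y} (U : Mor (S.sum F) T) (V : Mor T (S.sum F))
    (hUV : ∀ y x, U y (V y x) = x)
    (hr : ∀ y (f : F.fiber y), V y (U y (0, f)) = ((0, f) : S.fiber y × F.fiber y))
    (hl : ∀ y (w : S.fiber y), (V y (U y (w, 0)) : S.fiber y × F.fiber y).2 = 0) :
    ∃ (R : EquivVB Y) (j : Mor R S) (s : Mor S R),
      (∀ y e, s y (j y e) = e) ∧ Nonempty (Iso (R.sum F) T) := by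
  let P : Mor S S := (Mor.fst _ _).comp (V.comp (U.comp ((Mor.id _).pair (.zero _ _))))
  have hVU0 : ∀ y (w : S.fiber y), V y (U y (w, 0)) = ((P y w, 0) : S.fiber y × F.fiber y) :=
    fun y w => Prod.ext rfl (hl y w)
  have hVU : ∀ y (w : S.fiber y) (f : F.fiber y),
      V y (U y (w, f)) = ((P y w, f) : S.fiber y × F.fiber y) := by
    intro y w f
    have h : ((w, f) : S.fiber y × F.fiber y) = (w, 0) + (0, f) :=
      Prod.ext (add_zero w).symm (zero_add f).symm
    have h1 : V y (U y ((w, 0) + (0, f) : S.fiber y × F.fiber y)) =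
        V y (U y (w, 0)) + V y (U y (0, f)) :=
      (congrArg (V y) ((U y).map_add (w, 0) (0, f))).trans ((V y).map_add _ _)
    refine (congrArg (fun x => V y (U y x)) h).trans (h1.trans ?_)
    refine (congrArg₂ (fun a b : S.fiber y × F.fiber y => a + b) (hVU0 y w) (hr y f)).trans ?_
    exact Prod.ext (add_zero (P y w)) (zero_add f)
  have hP : ∀ y w, P y (P y w) = P y w := by
    intro y w
    have h1 := congrArg (V y) (hUV y (U y (w, 0)))
    have h2 := (congrArg (fun x => V y (U y x)) (hVU0 y w)).symm.trans h1
    exact congrArg Prod.fst h2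
  refine ⟨P.image hP, P.incl hP, P.proj hP, fun y e => P.proj_incl hP y e, ⟨Mor.toIso
    (U.comp (((P.incl hP).comp (.fst _ _)).pair (.snd _ _)))
    ((((P.proj hP).comp (.fst _ _)).pair (.snd _ _)).comp V) (fun y x => ?_) fun y x => ?_⟩⟩
  · have h := hVU y (P.incl hP y x.1) x.2
    refine Prod.ext ?_ ?_
    · refine (congrArg (fun z : S.fiber y × F.fiber y => P.proj hP y z.1) h).trans ?_
      exact (congrArg (P.proj hP y) (P.apply_incl hP y x.1)).trans (P.proj_incl hP y x.1)
    · exact congrArg (fun z : S.fiber y × F.fiber y => z.2) h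
  · have h : V y x = ((P y (V y x).1, (V y x).2) : S.fiber y × F.fiber y) :=
      (congrArg (V y) (hUV y x)).symm.trans (hVU y _ _)
    have h2 : ((P.incl hP y (P.proj hP y (V y x).1), (V y x).2) : S.fiber y × F.fiber y) =
        V y x := h.symm
    exact (congrArg (U y) h2).trans (hUV y x)

section linear

variable {E F D₁ D₂ : Type*} [AddCommGroup E] [AddCommGroup F] [AddCommGroup D₁] [AddCommGroup D₂]
  [Module ℂ E] [Module ℂ F] [Module ℂ D₁] [Module ℂ D₂] {φ : E →ₗ[ℂ] F} {χ : F →ₗ[ℂ] E} {c : ℂ}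
  {j₁ : E →ₗ[ℂ] D₁} {s₁ : D₁ →ₗ[ℂ] E} {j₂ : F →ₗ[ℂ] D₂} {s₂ : D₂ →ₗ[ℂ] F}

variable (φ χ c s₁ j₂ s₂) in
/-- The effect of `clutch` on one fibre. -/
def linClutch (w₁ : D₁) (w₂ : D₂) (f : F) : D₂ × E :=
  (w₂ - c ^ 2 • j₂ (s₂ w₂) + c • j₂ (f + φ (s₁ w₁)), - χ f - c ^ 2 • (-s₁ w₁) + c • χ (s₂ w₂))

variable (φ χ c j₁ j₂ s₂) in
/-- The effect of `clutchInv` on one fibre. -/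
def linClutchInv (w₂ : D₂) (e : E) : (D₁ × D₂) × F :=
  ((0 - c ^ 2 • (-j₁ e) + c • j₁ (χ (s₂ w₂)), w₂ - c ^ 2 • j₂ (s₂ w₂) + c • j₂ (φ e)),
    -φ e - c ^ 2 • 0 + c • s₂ w₂)

theorem linClutch_linClutchInv (hχφ : ∀ e, χ (φ e) = (1 - c ^ 2) • e)
    (hφχ : ∀ f, φ (χ f) = (1 - c ^ 2) • f) (h₁ : c ≠ 0 → ∀ e, s₁ (j₁ e) = e)
    (h₂ : c ≠ 0 → ∀ f, s₂ (j₂ f) = f) (w₂ : D₂) (e : E) :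
    linClutch φ χ c s₁ j₂ s₂ (linClutchInv φ χ c j₁ j₂ s₂ w₂ e).1.1
      (linClutchInv φ χ c j₁ j₂ s₂ w₂ e).1.2 (linClutchInv φ χ c j₁ j₂ s₂ w₂ e).2 = (w₂, e) := by
  by_cases hc : c = 0
  · subst hc
    simp [linClutch, linClutchInv, hχφ]
  · refine Prod.ext ?_ ?_ <;>
    · simp only [linClutch, linClutchInv, map_add, map_sub, map_neg, map_smul, map_zero, h₁ hc,
        h₂ hc, hφχ, hχφ]
      module

theorem linClutchInv_linClutch (hφχ : ∀ f, φ (χ f) = (1 - c ^ 2) • f)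
    (h₂ : c ≠ 0 → ∀ f, s₂ (j₂ f) = f) (f : F) :
    linClutchInv φ χ c j₁ j₂ s₂ (linClutch φ χ c s₁ j₂ s₂ 0 0 f).1
      (linClutch φ χ c s₁ j₂ s₂ 0 0 f).2 = ((0, 0), f) := by
  by_cases hc : c = 0
  · subst hc
    simp [linClutch, linClutchInv, hφχ]
  · refine Prod.ext (Prod.ext ?_ ?_) ?_ <;>
    · simp only [linClutch, linClutchInv, map_add, map_sub, map_neg, map_smul, map_zero,
        h₂ hc, hφχ]
      module

theorem linClutchInv_linClutch_snd (hφχ : ∀ f, φ (χ f) = (1 - c ^ 2) • f)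
    (h₂ : c ≠ 0 → ∀ f, s₂ (j₂ f) = f) (w₁ : D₁) (w₂ : D₂) :
    (linClutchInv φ χ c j₁ j₂ s₂ (linClutch φ χ c s₁ j₂ s₂ w₁ w₂ 0).1
      (linClutch φ χ c s₁ j₂ s₂ w₁ w₂ 0).2).2 = 0 := by
  by_cases hc : c = 0
  · subst hc
    simp [linClutch, linClutchInv]
  · simp only [linClutch, linClutchInv, map_add, map_sub, map_neg, map_smul, map_zero,
      h₂ hc, hφχ]
    module

end linear

section

variable {E F D₁ D₂ : EquivVB Y} (φ : Mor E F) (χ : Mor F E) (c : Y.InvFun) (j₁ : Mor E D₁)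
  (s₁ : Mor D₁ E) (j₂ : Mor F D₂) (s₂ : Mor D₂ F)

/-- The morphism `(w₁, w₂, f) ↦ (w₂ - c² j₂ s₂ w₂ + c j₂ (f + φ s₁ w₁),
- χ f + c² s₁ w₁ + c χ s₂ w₂)`, see `exists_clutch`. -/
def clutch : Mor ((D₁.sum D₂).sum F) (D₂.sum E) :=
  let p₁ : Mor ((D₁.sum D₂).sum F) D₁ := (Mor.fst _ _).comp (Mor.fst _ _)
  let p₂ : Mor ((D₁.sum D₂).sum F) D₂ := (Mor.snd _ _).comp (Mor.fst _ _)
  let p₃ : Mor ((D₁.sum D₂).sum F) F := Mor.snd _ _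
  (Mor.comb c p₂ (j₂.comp (s₂.comp p₂)) (j₂.comp (p₃.add (φ.comp (s₁.comp p₁))))).pair
    (Mor.comb c (χ.comp p₃).neg (s₁.comp p₁).neg (χ.comp (s₂.comp p₂)))

/-- The morphism `(w₂, e) ↦ (c² j₁ e + c j₁ χ s₂ w₂, w₂ - c² j₂ s₂ w₂ + c j₂ φ e,
- φ e + c s₂ w₂)`, a right inverse of `clutch`. -/
def clutchInv : Mor (D₂.sum E) ((D₁.sum D₂).sum F) :=
  let p₂ : Mor (D₂.sum E) D₂ := Mor.fst _ _
  let p : Mor (D₂.sum E) E := Mor.snd _ _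
  ((Mor.comb c (.zero _ _) (j₁.comp p).neg (j₁.comp (χ.comp (s₂.comp p₂)))).pair
    (Mor.comb c p₂ (j₂.comp (s₂.comp p₂)) (j₂.comp (φ.comp p)))).pair
  (Mor.comb c (φ.comp p).neg (.zero _ _) (s₂.comp p₂))

theorem clutch_apply (y : Y.Total) (w₁ : D₁.fiber y) (w₂ : D₂.fiber y) (f : F.fiber y) :
    clutch φ χ c s₁ j₂ s₂ y ((w₁, w₂), f) =
      linClutch (φ y) (χ y) (c y) (s₁ y) (j₂ y) (s₂ y) w₁ w₂ f := by
  refine Prod.ext (Mor.comb_apply ..) ((Mor.comb_apply ..).trans ?_)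
  exact congrArg₂ (fun a b => a - (c y : ℂ) ^ 2 • b + (c y : ℂ) • χ y (s₂ y w₂))
    (Mor.neg_apply _ y _) (Mor.neg_apply _ y _)

theorem clutchInv_apply (y : Y.Total) (w₂ : D₂.fiber y) (e : E.fiber y) :
    clutchInv φ χ c j₁ j₂ s₂ y (w₂, e) =
      linClutchInv (φ y) (χ y) (c y) (j₁ y) (j₂ y) (s₂ y) w₂ e := by
  refine Prod.ext (Prod.ext ((Mor.comb_apply ..).trans ?_) (Mor.comb_apply ..))
    ((Mor.comb_apply ..).trans ?_)
  · exact congrArg (fun b => 0 - (c y : ℂ) ^ 2 • b + (c y : ℂ) • j₁ y (χ y (s₂ y w₂)))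
      (Mor.neg_apply _ y _)
  · exact congrArg (fun a => a - (c y : ℂ) ^ 2 • 0 + (c y : ℂ) • s₂ y w₂) (Mor.neg_apply _ y _)

/-- Let `φ : E → F` be invertible, with inverse `χ`, where `c = 0`, and let `E` and `F` be direct
summands of `D₁` and `D₂` where `c ≠ 0`. Then the formal difference of `E` and `F` is the
difference of a direct summand `R` of `D₁ ⊕ D₂` and `D₂`. The bundle `R` arises from `E` plus the
complement of `F` in `D₂`, over `c ≠ 0`, and `D₂`, near `c = 0`, by clutching along `φ`. -/
theorem exists_clutch
    (hχφ : ∀ y e, χ y (φ y e) = (1 - (c y : ℂ) ^ 2) • e)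
    (hφχ : ∀ y f, φ y (χ y f) = (1 - (c y : ℂ) ^ 2) • f)
    (h₁ : ∀ y, c y ≠ 0 → ∀ e, s₁ y (j₁ y e) = e) (h₂ : ∀ y, c y ≠ 0 → ∀ f, s₂ y (j₂ y f) = f) :
    ∃ (R : EquivVB Y) (j : Mor R (D₁.sum D₂)) (s : Mor (D₁.sum D₂) R),
      (∀ y e, s y (j y e) = e) ∧ Nonempty (Iso (R.sum F) (D₂.sum E)) := by
  let U := clutch φ χ c s₁ j₂ s₂
  let V := clutchInv φ χ c j₁ j₂ s₂
  have h₁' : ∀ y, (c y : ℂ) ≠ 0 → ∀ e, s₁ y (j₁ y e) = e := fun y hy =>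
    h₁ y fun h => hy (h ▸ Complex.ofReal_zero)
  have h₂' : ∀ y, (c y : ℂ) ≠ 0 → ∀ e, s₂ y (j₂ y e) = e := fun y hy =>
    h₂ y fun h => hy (h ▸ Complex.ofReal_zero)
  have hUV : ∀ y (x : D₂.fiber y × E.fiber y), U y (V y x) = x := by
    rintro y ⟨w₂, e⟩
    refine (congrArg (U y) (clutchInv_apply φ χ c j₁ j₂ s₂ y w₂ e)).trans
      ((clutch_apply ..).trans ?_)
    exact linClutch_linClutchInv (hχφ y) (hφχ y) (h₁' y) (h₂' y) w₂ e
  have hVUr : ∀ y (f : F.fiber y), V y (U y ((0, 0), f)) =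
      (((0, 0), f) : (D₁.fiber y × D₂.fiber y) × F.fiber y) := by
    intro y f
    refine (congrArg (V y) (clutch_apply φ χ c s₁ j₂ s₂ y 0 0 f)).trans
      ((clutchInv_apply ..).trans ?_)
    exact linClutchInv_linClutch (hφχ y) (h₂' y) f
  have hVUl : ∀ y (w : D₁.fiber y × D₂.fiber y),
      (V y (U y (w, 0)) : (D₁.fiber y × D₂.fiber y) × F.fiber y).2 = 0 := by
    rintro y ⟨w₁, w₂⟩
    refine (congrArg Prod.snd ((congrArg (V y) (clutch_apply φ χ c s₁ j₂ s₂ y w₁ w₂ 0)).trans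
      (clutchInv_apply ..))).trans ?_
    exact linClutchInv_linClutch_snd (hφχ y) (h₂' y) w₁ w₂
  exact exists_summand U V hUV hVUr hVUl

end

end EquivVB

/-! ### Stable isomorphisms -/

namespace EquivVB

variable {B : Type u} [TopologicalSpace B]

section

variable {𝒢 : GroupBundle.{u, v} B} {Y : GSpace.{u, v, w} 𝒢}

/-- The elementary automorphism `(a, q) ↦ (a + x q, q)`. -/
def elemUpper {A Q : EquivVB Y} (x : Mor Q A) : Iso (A.sum Q) (A.sum Q) :=
  Mor.toIso (((Mor.fst A Q).add (x.comp (.snd A Q))).pair (.snd A Q))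
    (((Mor.fst A Q).add (x.neg.comp (.snd A Q))).pair (.snd A Q))
    (fun y e => Prod.ext ((congrArg (fun a => (e.1 + x y e.2) + a) (x.neg_apply y e.2)).trans
      (add_neg_cancel_right _ _)) rfl)
    (fun y e => Prod.ext ((congrArg (fun a => (e.1 + a) + x y e.2) (x.neg_apply y e.2)).trans
      (neg_add_cancel_right _ _)) rfl)

/-- The elementary automorphism `(a, q) ↦ (a, q + x a)`. -/
def elemLower {A Q : EquivVB Y} (x : Mor A Q) : Iso (A.sum Q) (A.sum Q) :=
  ((sumComm A Q).trans (elemUpper x)).trans (sumComm Q A)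

theorem elemUpper_symm_apply {A Q : EquivVB Y} (x : Mor Q A) (y : Y.Total) (a : A.fiber y)
    (q : Q.fiber y) :
    (elemUpper x).symm.toMor y (a, q) = ((a - x y q, q) : A.fiber y × Q.fiber y) :=
  Prod.ext ((congrArg (fun b => a + b) (x.neg_apply y q)).trans (sub_eq_add_neg _ _).symm) rfl

theorem elemLower_symm_apply {A Q : EquivVB Y} (x : Mor A Q) (y : Y.Total) (a : A.fiber y)
    (q : Q.fiber y) :
    (elemLower x).symm.toMor y (a, q) = ((a, q - x y a) : A.fiber y × Q.fiber y) :=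
  Prod.ext rfl ((congrArg (fun b => q + b) (x.neg_apply y a)).trans (sub_eq_add_neg _ _).symm)

/-- The Whitehead lemma: where `t` is invertible with inverse `t'`, the automorphism
`t' b⁻¹ t ⊕ b` is a product of elementary automorphisms, and such a product is defined
everywhere. -/
theorem exists_whitehead {A Q : EquivVB Y} (t : Mor A Q) (t' : Mor Q A) (b : Iso Q Q) :
    ∃ w : Iso (A.sum Q) (A.sum Q), ∀ y, (∀ e, t' y (t y e) = e) → (∀ e, t y (t' y e) = e) →
      ∀ (a : A.fiber y) (q : Q.fiber y), w.toMor y (a, q) =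
        ((t' y (b.symm.toMor y (t y a)), b.toMor y q) : A.fiber y × Q.fiber y) := by
  let x : Mor Q A := t'.comp b.symm.toMor
  let z : Mor A Q := b.toMor.comp t
  refine ⟨(elemUpper t').symm.trans ((elemLower t).trans ((elemUpper t').symm.trans
    ((elemUpper x).trans ((elemLower z).symm.trans (elemUpper x))))), fun y h h' a q => ?_⟩
  let up : A.fiber y × Q.fiber y → A.fiber y × Q.fiber y := (elemUpper t').symm.toMor y
  let lo : A.fiber y × Q.fiber y → A.fiber y × Q.fiber y := (elemLower z).symm.toMor y
  have hup : ∀ a q, up (a, q) = (a - t' y q, q) := elemUpper_symm_apply t' y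
  have hlo : ∀ a q, lo (a, q) = (a, q - b.toMor y (t y a)) := elemLower_symm_apply z y
  let p₁ : A.fiber y × Q.fiber y → A.fiber y × Q.fiber y := fun p => (p.1, p.2 + t y p.1)
  let p₂ : A.fiber y × Q.fiber y → A.fiber y × Q.fiber y := fun p =>
    (p.1 + t' y (b.symm.toMor y p.2), p.2)
  change p₂ (lo (p₂ (up (p₁ (up (a, q)))))) = _
  have h1 : up (p₁ (up (a, q))) = (-t' y q, t y a) := by
    simp only [hup, p₁, map_sub, h, h', add_sub_cancel, sub_sub_cancel_left]
  rw [h1]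
  simp only [p₂, hlo, map_add, map_neg, h', b.toMor_symm_apply]
  refine Prod.ext ?_ ?_
  · simp
  · simp

/-- The morphism `E ⊕ D → E' ⊕ D` defined by a morphism `m : E ⊕ R → E' ⊕ R`, with
`j : R → D` and `s : D → R`. Where `s j = 1` it is `m` plus the identity of the complement of `R`
in `D`. -/
def absorb {E E' R D : EquivVB Y} (m : Mor (E.sum R) (E'.sum R)) (j : Mor R D) (s : Mor D R) :
    Mor (E.sum D) (E'.sum D) :=
  let k : Mor (E.sum D) (E'.sum R) := m.comp ((Mor.fst E D).pair (s.comp (.snd E D)))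
  ((Mor.fst E' R).comp k).pair
    ((Mor.snd E D).add (j.comp (((Mor.snd E' R).comp k).add (s.comp (.snd E D)).neg)))

theorem absorb_apply {E E' R D : EquivVB Y} (m : Mor (E.sum R) (E'.sum R)) (j : Mor R D)
    (s : Mor D R) (y : Y.Total) (e : E.fiber y) (d : D.fiber y) {e' : E'.fiber y} {r : R.fiber y}
    (h : m y (e, s y d) = ((e', r) : E'.fiber y × R.fiber y)) :
    absorb m j s y (e, d) = ((e', d + j y (r - s y d)) : E'.fiber y × D.fiber y) := by
  refine Prod.ext (congrArg (fun p : E'.fiber y × R.fiber y => p.1) h) ?_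
  refine congrArg (fun r => d + j y r) ?_
  refine (congrArg₂ (fun a b : R.fiber y => a + b)
    (congrArg (fun p : E'.fiber y × R.fiber y => p.2) h)
    ((s.comp (.snd E D)).neg_apply y (e, d))).trans (sub_eq_add_neg _ _).symm

/-- Passing from `m` to `absorb m j s` preserves inverses where `R` is a direct summand of `D`, and
also where `m` does not change the component in `R`, so that the deviation of `s j` from `1` does not
matter. -/
theorem absorb_absorb {E E' R D : EquivVB Y} {m : Mor (E.sum R) (E'.sum R)}
    {m' : Mor (E'.sum R) (E.sum R)} {j : Mor R D} {s : Mor D R} {y : Y.Total}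
    (hm : ∀ x, m' y (m y x) = x)
    (h : (∀ r, s y (j y r) = r) ∨ ∀ (e : E.fiber y) (r : R.fiber y),
      (m y (e, r) : E'.fiber y × R.fiber y).2 = r) (x) :
    absorb m' j s y (absorb m j s y x) = x := by
  obtain ⟨e, d⟩ : E.fiber y × D.fiber y := x
  obtain ⟨e', r, h1⟩ : ∃ e' r, m y (e, s y d) = ((e', r) : E'.fiber y × R.fiber y) :=
    ⟨_, _, rfl⟩
  have h2 : m' y (e', r) = ((e, s y d) : E.fiber y × R.fiber y) :=
    (congrArg (m' y) h1).symm.trans (hm _)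
  refine (congrArg (absorb m' j s y) (absorb_apply m j s y e d h1)).trans ?_
  have h3 : s y (d + j y (r - s y d)) = r := by
    rcases h with h | h
    · rw [map_add, h, add_sub_cancel]
    · have h4 : r = s y d := (congrArg (fun p : E'.fiber y × R.fiber y => p.2) h1).symm.trans
        (h e (s y d))
      rw [h4, sub_self, map_zero, add_zero]
  refine (absorb_apply m' j s y e' (d + j y (r - s y d)) (e' := e) (r := s y d)
    ((congrArg (fun r => m' y (e', r)) h3).trans h2)).trans ?_
  rw [h3]
  refine Prod.ext rfl ?_
  change d + j y (r - s y d) + j y (s y d - r) = d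
  rw [map_sub, map_sub]
  abel

/-- If `E ⊕ R` and `E' ⊕ R` are isomorphic and `R` is a direct summand of `D` where the isomorphism
does not preserve the component in `R`, then `E ⊕ D` and `E' ⊕ D` are isomorphic. -/
def absorbIso {E E' R D : EquivVB Y} (i : Iso (E.sum R) (E'.sum R)) (j : Mor R D) (s : Mor D R)
    (h : ∀ y, (∀ r, s y (j y r) = r) ∨ ∀ (e : E.fiber y) (r : R.fiber y),
      (i.toMor y (e, r) : E'.fiber y × R.fiber y).2 = r) : Iso (E.sum D) (E'.sum D) :=
  Mor.toIso (absorb i.toMor j s) (absorb i.symm.toMor j s)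
    (fun y => absorb_absorb (i.symm_toMor_apply y) (h y))
    (fun y => absorb_absorb (i.toMor_symm_apply y) ((h y).imp_right fun hy e r => by
      have h1 := congrArg (fun p : E'.fiber y × R.fiber y => p.2) (i.toMor_symm_apply y (e, r))
      exact (hy _ _).symm.trans h1))

end

section

variable [CompactSpace B] [T2Space B] {𝒢 : GroupBundle.{u, v} B} {X : GSpace.{u, v, w} 𝒢}
  [T2Space X.plus.Total]

/-- A morphism between isomorphic bundles that is invertible at infinity can, after adding a bundle
`Q`, be extended from the section at infinity to an isomorphism. At infinity `u = ψ⁻¹ m` is an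
automorphism of `A`. For the pull-back `Q` of its restriction along the retraction to the section at
infinity, `u⁻¹` extends to an automorphism of `Q`, and by the Whitehead lemma `u ⊕ u⁻¹` extends to
an automorphism of `A ⊕ Q`. -/
theorem exists_iso_extending {A A' : EquivVB X.plus} (ψ : Iso A A') (m : Mor A A')
    (hm : ∀ z ∈ X.atInfty, Function.Bijective (m z)) :
    ∃ (Q : EquivVB X.plus) (i : Iso (A.sum Q) (A'.sum Q)), ∀ z ∈ X.atInfty, ∀ (a : A.fiber z)
      (q : Q.fiber z), i.toMor z (a, q) = ((m z a, q) : A'.fiber z × Q.fiber z) := by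
  have := X.compactSpace_plus
  let r := X.plus.toBase (.id 𝒢)
  let n : Mor A A := ψ.symm.toMor.comp m
  let n' : Iso (A.pull X.infty) (A.pull X.infty) := (n.pull X.infty).isoOfBijective fun b =>
    (ψ.symm.toEquiv _).bijective.comp (hm _ rfl)
  -- the pull-back of `A` along the retraction to the section at infinity; at infinity the morphism
  -- `t : A → Q` is the identity
  let Q : EquivVB X.plus := (A.pull X.infty).pull r
  let i := pullSection X.infty r (fun _ _ => rfl) (fun _ => rfl) (A.pull X.infty)
  obtain ⟨t, ht⟩ := Mor.exists_extend (A := A) (C := Q) i.toMor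
  have ht' : ∀ b (e : A.fiber ⟨b, none⟩), t ⟨b, none⟩ e = e := fun b e => ht b e
  obtain ⟨ρ, t', -, -, ⟨N, -, hN, hρ⟩, h1, h2⟩ := t.exists_cutoff_inverse X.isClosed_atInfty
    X.isInvariant_atInfty (by
      intro z hz
      obtain ⟨b, rfl⟩ : ∃ b, z = ⟨b, none⟩ := ⟨z.base, congrArg (Tot.mk z.base) hz⟩
      exact ⟨fun e e' h => (ht' b e).symm.trans (h.trans (ht' b e')), fun e => ⟨e, ht' b e⟩⟩)
  obtain ⟨w, hw⟩ := exists_whitehead t t' (n'.pull r).symm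
  refine ⟨Q, w.trans (ψ.sum (n'.pull r)), ?_⟩
  intro z hz a q
  obtain ⟨b, rfl⟩ : ∃ b, z = ⟨b, none⟩ := ⟨z.base, congrArg (Tot.mk z.base) hz⟩
  have hρ1 : ((ρ ⟨b, none⟩ : ℝ) : ℂ) = 1 := by rw [hρ _ (hN rfl), Complex.ofReal_one]
  have h3 := hw ⟨b, none⟩ (fun e => by rw [h1, hρ1, one_smul]) (fun e => by rw [h2, hρ1, one_smul])
    a q
  refine (congrArg ((ψ.sum (n'.pull r)).toMor ⟨b, none⟩) h3).trans (Prod.ext ?_ ?_)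
  · have h4 : (n'.pull r).toMor ⟨b, none⟩ (t ⟨b, none⟩ a) = t ⟨b, none⟩ (n ⟨b, none⟩ a) :=
      (congrArg ((n'.pull r).toMor ⟨b, none⟩) (ht' b a)).trans (ht' b (n ⟨b, none⟩ a)).symm
    have h5 : t' ⟨b, none⟩ ((n'.pull r).toMor ⟨b, none⟩ (t ⟨b, none⟩ a)) = n ⟨b, none⟩ a := by
      rw [h4, h1, hρ1, one_smul]
    exact (congrArg (ψ.toMor ⟨b, none⟩) h5).trans (ψ.toMor_symm_apply _ _)
  · exact (n'.pull r).toMor_symm_apply _ q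

end

end EquivVB

/-! ### Separation of quotients and fibre products -/

theorem IsProperMap.t2Space {X Y : Type*} [TopologicalSpace X] [TopologicalSpace Y] [T2Space X]
    {f : X → Y} (hf : IsProperMap f) (hs : Function.Surjective f) : T2Space Y := by
  obtain ⟨hfc, hcl, hfib⟩ := isProperMap_iff_isClosedMap_and_compact_fibers.1 hf
  refine ⟨fun y y' hy => ?_⟩
  obtain ⟨U, U', hU, hU', h1, h2, h3⟩ := SeparatedNhds.of_isCompact_isCompact (hfib (y := y))
    (hfib (y := y')) (Disjoint.preimage f (Set.disjoint_singleton.2 hy))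
  refine ⟨(f '' Uᶜ)ᶜ, (f '' U'ᶜ)ᶜ, (hcl _ hU.isClosed_compl).isOpen_compl,
    (hcl _ hU'.isClosed_compl).isOpen_compl, ?_, ?_, ?_⟩
  · rintro ⟨x, hx, hxy⟩
    exact hx (h1 hxy)
  · rintro ⟨x, hx, hxy⟩
    exact hx (h2 hxy)
  · refine Set.disjoint_left.2 fun z hz hz' => ?_
    obtain ⟨x, rfl⟩ := hs z
    have hxU : x ∈ U := by
      by_contra h
      exact hz ⟨x, h, rfl⟩
    have hxU' : x ∈ U' := by
      by_contra h
      exact hz' ⟨x, h, rfl⟩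
    exact Set.disjoint_left.1 h3 hxU hxU'

namespace GSpace

variable {B : Type u} [TopologicalSpace B]

section

variable {𝒢 : GroupBundle.{u, v} B} {ℋ : GroupBundle.{u, v'} B}

instance (X : GSpace.{u, max v v', w} (𝒢.prod ℋ)) [T2Space X.Total] : T2Space X.quot.Total :=
  X.isProperMap_quotProj.t2Space X.quotProj_surjective

instance (X : GSpace.{u, max v v', w} (𝒢.prod ℋ)) [T2Space X.Total] [LocallyCompactSpace X.Total] :
    LocallyCompactSpace X.quot.Total := by
  have : WeaklyLocallyCompactSpace X.quot.Total := by
    refine ⟨fun y => ?_⟩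
    obtain ⟨x, rfl⟩ := X.quotProj_surjective y
    obtain ⟨K, hK, hx⟩ := exists_compact_mem_nhds x
    exact ⟨_, hK.image X.continuous_quotProj, X.isOpenMap_quotProj.image_mem_nhds hx⟩
  infer_instance

theorem isClosedEmbedding_split [T2Space B] (X : GSpace.{u, max v v', w} (𝒢.prod ℋ))
    (W : GSpace.{u, v', w'} ℋ) :
    IsClosedEmbedding (Tot.split : (X.mixedProd W).Total → X.Total × W.Total) := by
  refine ⟨⟨Tot.isInducing_split, Tot.split_injective⟩, ?_⟩
  have h : range (Tot.split : (X.mixedProd W).Total → X.Total × W.Total) =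
      {p | p.1.base = p.2.base} := by
    ext ⟨⟨b, x⟩, ⟨b', z⟩⟩
    constructor
    · rintro ⟨p, hp⟩
      rw [← hp]
      rfl
    · rintro h
      change b = b' at h
      subst h
      exact ⟨⟨b, x, z⟩, rfl⟩
  rw [h]
  exact isClosed_eq (X.continuous_base.comp continuous_fst) (W.continuous_base.comp continuous_snd)

instance [T2Space B] (X : GSpace.{u, max v v', w} (𝒢.prod ℋ)) (W : GSpace.{u, v', w'} ℋ)
    [T2Space X.Total] [T2Space W.Total] : T2Space (X.mixedProd W).Total :=
  (X.isClosedEmbedding_split W).isEmbedding.t2Space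

instance [T2Space B] (X : GSpace.{u, max v v', w} (𝒢.prod ℋ)) (W : GSpace.{u, v', w'} ℋ)
    [LocallyCompactSpace X.Total] [LocallyCompactSpace W.Total] :
    LocallyCompactSpace (X.mixedProd W).Total :=
  (X.isClosedEmbedding_split W).locallyCompactSpace

theorem isFree_mixedProd {X : GSpace.{u, max v v', w} (𝒢.prod ℋ)} (W : GSpace.{u, v', w'} ℋ)
    (hX : X.resRight.IsFree) : (X.mixedProd W).resRight.IsFree :=
  fun b h z hz => hX b h z.1 (congrArg Prod.fst hz)

end

end GSpace

/-! ### The isomorphism for locally compact spaces -/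

namespace EquivVB

variable {B : Type u} [TopologicalSpace B] [CompactSpace B] [T2Space B]

section

variable {𝒢 : GroupBundle.{u, v} B} {X : GSpace.{u, v, w} 𝒢} [T2Space X.plus.Total]

/-- If `E` and `E'` are stably isomorphic, and isomorphic at infinity, then there is a stable
isomorphism `E ⊕ R' ≅ E' ⊕ R'` that preserves the component in `R'` near infinity. -/
theorem exists_iso_near_infty {E E' R : EquivVB X.plus} (ψ : Iso (E.sum R) (E'.sum R))
    (m : Mor E E') (hm : ∀ z ∈ X.atInfty, Function.Bijective (m z)) :
    ∃ (R' : EquivVB X.plus) (i : Iso (E.sum R') (E'.sum R')) (N : Set X.plus.Total), IsOpen N ∧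
      X.atInfty ⊆ N ∧ ∀ z ∈ N, ∀ (e : E.fiber z) (r : R'.fiber z),
        (i.toMor z (e, r) : E'.fiber z × R'.fiber z).2 = r := by
  have := X.compactSpace_plus
  obtain ⟨Q, i, hi⟩ := exists_iso_extending ψ ((m.comp (.fst E R)).pair (.snd E R))
    fun z hz => (hm z hz).prodMap Function.bijective_id
  let i' : Iso (E.sum (R.sum Q)) (E'.sum (R.sum Q)) :=
    (sumAssoc E R Q).symm.trans (i.trans (sumAssoc E' R Q))
  obtain ⟨k, N, hN, hN', hk⟩ := i'.exists_modify ((m.comp (.fst E (R.sum Q))).pair (.snd _ _))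
    X.isClosed_atInfty X.isInvariant_atInfty fun z hz e => by
      exact congrArg ((sumAssoc E' R Q).toMor z) (hi z hz (e.1, e.2.1) e.2.2)
  exact ⟨_, k, N, hN, hN', fun z hz e r =>
    congrArg (fun p : E'.fiber z × (R.sum Q).fiber z => p.2) (hk z hz (e, r))⟩

end

variable {𝒢 : GroupBundle.{u, v} B} {ℋ : GroupBundle.{u, v'} B}
  {X : GSpace.{u, max v v', w} (𝒢.prod ℋ)} [T2Space X.Total] [LocallyCompactSpace X.Total]

theorem compl_atInfty_subset_rightFree (hX : X.resRight.IsFree) :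
    X.atInftyᶜ ⊆ X.plus.rightFree := by
  rintro ⟨b, z⟩ hz h hh
  cases z with
  | none => exact absurd rfl hz
  | some x => exact hX b h x (Option.some.inj hh)

/-- If the pull-backs of `E` and `F` to `X⁺` are stably isomorphic, choose a stable isomorphism that
preserves the additional summand near infinity. Away from infinity this summand lies in a bundle `W`
pulled back from `B`, so that `E ⊕ W` and `F ⊕ W` have isomorphic pull-backs, and the isomorphism
descends. -/
theorem injective_K0_map_quotMap (h𝒢 : 𝒢.FiniteHolonomy) (hX : X.resRight.IsFree) :
    Function.Injective (K0.map X.quotMap X.quotMap_proper) := by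
  have := X.compactSpace_plus
  have := X.t2Space_plus
  have := X.quot.t2Space_plus
  refine (injective_iff_map_eq_zero _).2 fun a ha => ?_
  obtain ⟨E, F, hEF, ⟨i⟩⟩ := K0.exists_eq_sub a
  have h0 : KVect.map X.quotPlus (a : KVect X.quot.plus) = 0 := congrArg Subtype.val ha
  rw [hEF, map_sub, KVect.map_mk, KVect.map_mk, sub_eq_zero, KVect.mk_eq_mk_iff] at h0
  obtain ⟨R, ⟨ψ⟩⟩ := h0
  obtain ⟨m, hm⟩ := Mor.exists_extend i.toMor
  obtain ⟨R', k, N, hN, hN', hk⟩ := exists_iso_near_infty ψ (m.pull X.quotPlus) (by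
    intro z hz
    obtain ⟨b, rfl⟩ : ∃ b, z = ⟨b, none⟩ := ⟨z.base, congrArg (Tot.mk z.base) hz⟩
    have h1 : m ⟨b, none⟩ = i.toMor ⟨b, ()⟩ := LinearMap.ext (hm b)
    change Function.Bijective (m ⟨b, none⟩)
    rw [h1]
    exact (i.toEquiv ⟨b, ()⟩).bijective)
  obtain ⟨W, j, s, hW⟩ := exists_split_over h𝒢 R' hN.isClosed_compl
    ((Set.compl_subset_compl.2 hN').trans (compl_atInfty_subset_rightFree hX))
  let k' := absorbIso k j s fun z => by
    by_cases hz : z ∈ N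
    · exact .inr (hk z hz)
    · exact .inl (hW z hz)
  let q := pullToBase X.quotPlus W
  let W' := W.pull (X.quot.plus.toBase (.id 𝒢))
  have t : ∀ E : EquivVB X.quot.plus, Iso ((E.sum W').pull X.quotPlus)
      ((E.pull X.quotPlus).sum (W.pull (X.plus.toBase (GroupBundle.fst 𝒢 ℋ)))) := fun E =>
    (pullSum X.quotPlus E W').trans ((Iso.refl _).sum q.symm)
  have h1 := Iso.descend X.quotPlus_isKerQuot (((t E).trans k').trans (t F).symm)
  refine Subtype.ext ?_
  rw [hEF, KVect.mk_eq_mk_iff.2 ⟨W', h1⟩, sub_self]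
  rfl

/-- Whether a class vanishes at infinity can be checked after pull-back to `X⁺`, since a bundle over
`B` is recovered from its pull-back along `𝒢 × ℋ → 𝒢` by restriction along `𝒢 → 𝒢 × ℋ`. -/
theorem mem_K0_of_map_mem {a : KVect X.quot.plus} (ha : KVect.map X.quotPlus a ∈ K0 X) :
    a ∈ K0 X.quot := by
  let inl : 𝒢.Hom (𝒢.prod ℋ) := ⟨fun _ => MonoidHom.inl _ _,
    Tot.isInducing_split.continuous_iff.2
      (continuous_id.prodMk (ℋ.continuous_one.comp 𝒢.continuous_base))⟩
  have h1 := KVect.map_square X.infty X.quotPlus (GSpace.baseMap (GroupBundle.fst 𝒢 ℋ))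
    X.quot.infty (fun _ _ => rfl) (fun _ => rfl) a
  have h2 : KVect.map (GSpace.baseMap (GroupBundle.fst 𝒢 ℋ)) (KVect.map X.quot.infty a) = 0 :=
    h1.symm.trans ha
  have h3 : ∀ c, KVect.map (GSpace.baseMap inl)
      (KVect.map (GSpace.baseMap (GroupBundle.fst 𝒢 ℋ)) c) = c := by
    refine DFunLike.congr_fun (f := (KVect.map (GSpace.baseMap inl)).comp
      (KVect.map (GSpace.baseMap (GroupBundle.fst 𝒢 ℋ)))) (g := AddMonoidHom.id _)
        (KVect.hom_ext fun E => ?_)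
    rw [AddMonoidHom.comp_apply, KVect.map_mk, KVect.map_mk]
    exact KVect.mk_congr (pullSection _ _ (fun _ _ => rfl) (fun _ => rfl) E).symm
  have h4 := h3 (KVect.map X.quot.infty a)
  rw [h2, map_zero] at h4
  exact h4.symm

/-- Let `E` and `F` be bundles on `X⁺` that are isomorphic at infinity. Away from infinity they are
direct summands of bundles pulled back from `B`, and clutching yields bundles with the same formal
difference that are direct summands of such bundles everywhere and therefore descend. -/
theorem surjective_K0_map_quotMap (h𝒢 : 𝒢.FiniteHolonomy) (hX : X.resRight.IsFree) :
    Function.Surjective (K0.map X.quotMap X.quotMap_proper) := by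
  have := X.compactSpace_plus
  have := X.t2Space_plus
  intro a
  obtain ⟨E, F, hEF, ⟨i⟩⟩ := K0.exists_eq_sub a
  obtain ⟨φ, hφ⟩ := Mor.exists_extend i.toMor
  obtain ⟨ρ, χ, h0, h1, ⟨N, hN, hN', hρ⟩, hχφ, hφχ⟩ := φ.exists_cutoff_inverse X.isClosed_atInfty
    X.isInvariant_atInfty (by
      intro z hz
      obtain ⟨b, rfl⟩ : ∃ b, z = ⟨b, none⟩ := ⟨z.base, congrArg (Tot.mk z.base) hz⟩
      have h1 : φ ⟨b, none⟩ = i.toMor ⟨b, ()⟩ := LinearMap.ext (hφ b)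
      rw [h1]
      exact (i.toEquiv ⟨b, ()⟩).bijective)
  -- `c` vanishes near infinity, where `χ` is the inverse of `φ`
  let c : X.plus.InvFun := ρ.comp (fun t => √(1 - t)) (by fun_prop)
  have hc : ∀ z, (ρ z : ℂ) = 1 - (c z : ℂ) ^ 2 := fun z => by
    have h2 : (c z) ^ 2 = 1 - ρ z := Real.sq_sqrt (sub_nonneg.2 (h1 z))
    rw [← Complex.ofReal_pow, h2]
    simp
  have hcN : ∀ z, c z ≠ 0 → z ∈ Nᶜ := fun z hz hzN => hz (by
    change √(1 - ρ z) = 0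
    rw [hρ z hzN, sub_self, Real.sqrt_zero])
  have hfree : Nᶜ ⊆ X.plus.rightFree :=
    (Set.compl_subset_compl.2 hN').trans (compl_atInfty_subset_rightFree hX)
  obtain ⟨W₁, j₁, s₁, hW₁⟩ := exists_split_over h𝒢 E hN.isClosed_compl hfree
  obtain ⟨W₂, j₂, s₂, hW₂⟩ := exists_split_over h𝒢 F hN.isClosed_compl hfree
  obtain ⟨R, j, s, hR, ⟨k⟩⟩ := exists_clutch φ χ c j₁ s₁ j₂ s₂ (fun z e => by rw [hχφ, hc])
    (fun z e => by rw [hφχ, hc]) (fun z hz => hW₁ z (hcN z hz)) (fun z hz => hW₂ z (hcN z hz))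
  let W' : EquivVB (GSpace.base 𝒢) → EquivVB X.quot.plus :=
    fun W => W.pull (X.quot.plus.toBase (.id 𝒢))
  let q := ((pullToBase X.quotPlus W₁).sum (pullToBase X.quotPlus W₂)).trans
    (pullSum X.quotPlus (W' W₁) (W' W₂)).symm
  obtain ⟨G, ⟨l⟩⟩ := exists_descend X.quotPlus_isKerQuot (q.toMor.comp j) (s.comp q.symm.toMor)
    fun x e => (congrArg (s x) (q.symm_toMor_apply x (j x e))).trans (hR x e)
  have h2 : KVect.map X.quotPlus (KVect.mk G - KVect.mk (W' W₂)) = a := by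
    have h3 := KVect.mk_congr k
    rw [KVect.mk_sum, KVect.mk_sum, KVect.mk_congr l,
      KVect.mk_congr (pullToBase X.quotPlus W₂)] at h3
    rw [map_sub, KVect.map_mk, KVect.map_mk, hEF, sub_eq_sub_iff_add_eq_add, h3, add_comm]
  exact ⟨⟨_, mem_K0_of_map_mem (h2 ▸ a.2)⟩, Subtype.ext h2⟩

/-- Pull-back along the quotient map is an isomorphism of the groups `K⁰` of locally compact
spaces. -/
theorem exists_K0_addEquiv (h𝒢 : 𝒢.FiniteHolonomy) (hX : X.resRight.IsFree) :
    ∃ Φ : K0 X.quot ≃+ K0 X, ∀ a, Φ a = K0.map X.quotMap X.quotMap_proper a :=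
  ⟨AddEquiv.ofBijective _ ⟨injective_K0_map_quotMap h𝒢 hX, surjective_K0_map_quotMap h𝒢 hX⟩,
    fun _ => rfl⟩

end EquivVB

/-! ### The isomorphism for compact spaces -/

namespace EquivVB

variable {B : Type u} [TopologicalSpace B] [CompactSpace B] [T2Space B]
  {𝒢 : GroupBundle.{u, v} B} {ℋ : GroupBundle.{u, v'} B}
  {X : GSpace.{u, max v v', w} (𝒢.prod ℋ)} [T2Space X.Total] [CompactSpace X.Total]

/-- Pull-back along the quotient map of a compact space is an isomorphism of the group completions,
with inverse `[F] ↦ [F/ℋ]`. -/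
theorem exists_KVect_addEquiv (h𝒢 : 𝒢.FiniteHolonomy) (hX : X.resRight.IsFree) :
    ∃ Φ : KVect X.quot ≃+ KVect X,
      (∀ E : EquivVB X.quot, Φ (KVect.mk E) = KVect.mk (E.pull X.quotMap)) ∧
      ∀ (F : EquivVB X) (E : EquivVB X.quot), Nonempty (OrbitBundle F E) →
        Φ.symm (KVect.mk F) = KVect.mk E := by
  obtain ⟨Φ, hΦ⟩ := KVect.exists_addEquiv X.quotMap (bijective_classesMap_quotMap h𝒢 hX)
  have h : ∀ E : EquivVB X.quot, Φ (KVect.mk E) = KVect.mk (E.pull X.quotMap) := fun E =>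
    (hΦ _).trans (KVect.map_mk _ E)
  refine ⟨Φ, h, fun F E ⟨o⟩ => ?_⟩
  obtain ⟨i⟩ := o.nonempty_iso
  rw [AddEquiv.symm_apply_eq, h, KVect.mk_congr i]

end EquivVB

theorem mainTheorem9 {B : Type u} [TopologicalSpace B] [CompactSpace B] [T2Space B]
    (𝒢 : GroupBundle.{u, v} B) (ℋ : GroupBundle.{u, v'} B)
    (h𝒢 : 𝒢.FiniteHolonomy) (hℋ : ℋ.FiniteHolonomy)
    (X : GSpace.{u, max v v', w} (𝒢.prod ℋ)) [T2Space X.Total] [LocallyCompactSpace X.Total]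
    (hX : X.IsLocallyTrivial) (hfree : X.resRight.IsFree) :
    -- the isomorphism for locally compact `X`
    (∃ Φ : K0 X.quot ≃+ K0 X, ∀ a, Φ a = K0.map X.quotMap X.quotMap_proper a) ∧
    -- the isomorphism for compact `X`, with its inverse `[F] ↦ [F/ℋ]`
    (CompactSpace X.Total →
      (∀ F : EquivVB X, ∃ E : EquivVB X.quot, Nonempty (OrbitBundle F E)) ∧
      ∃ Φ : KVect X.quot ≃+ KVect X,
        (∀ E : EquivVB X.quot, Φ (KVect.mk E) = KVect.mk (E.pull X.quotMap)) ∧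
        ∀ (F : EquivVB X) (E : EquivVB X.quot), Nonempty (OrbitBundle F E) →
          Φ.symm (KVect.mk F) = KVect.mk E) ∧
    -- naturality
    (∀ (𝒢' : GroupBundle.{u, v} B) (ℋ' : GroupBundle.{u, v'} B) (α : 𝒢'.Hom 𝒢) (β : ℋ'.Hom ℋ)
      (X' : GSpace.{u, max v v', w} (𝒢'.prod ℋ')) (f : GSpace.Hom (α.prodMap β) X' X),
      (∀ a : KVect X.quot, KVect.map f (KVect.map X.quotMap a) =
        KVect.map X'.quotMap (KVect.map f.quot a)) ∧
      ∀ (hf : f.Proper) (a : K0 X.quot), K0.map f hf (K0.map X.quotMap X.quotMap_proper a) =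
        K0.map X'.quotMap X'.quotMap_proper (K0.map f.quot (GSpace.Hom.quot_proper hf) a)) ∧
    -- the case of `X ×_B W`, whose quotient is `X ×_ℋ W`
    (∀ (W : GSpace.{u, v', w} ℋ) [T2Space W.Total] [LocallyCompactSpace W.Total],
      W.IsLocallyTrivial →
      (∃ Φ : K0 (X.mixedProd W).quot ≃+ K0 (X.mixedProd W),
        ∀ a, Φ a = K0.map (X.mixedProd W).quotMap (X.mixedProd W).quotMap_proper a) ∧
      (CompactSpace (X.mixedProd W).Total →
        ∃ Φ : KVect (X.mixedProd W).quot ≃+ KVect (X.mixedProd W),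
          ∀ E : EquivVB (X.mixedProd W).quot,
            Φ (KVect.mk E) = KVect.mk (E.pull (X.mixedProd W).quotMap))) := by
  refine ⟨EquivVB.exists_K0_addEquiv h𝒢 hfree, fun _ => ⟨fun F => ?_,
    EquivVB.exists_KVect_addEquiv h𝒢 hfree⟩, fun 𝒢' ℋ' α β X' f => ⟨fun a => ?_, fun hf a => ?_⟩,
    fun W _ _ _ => ⟨EquivVB.exists_K0_addEquiv h𝒢 (GSpace.isFree_mixedProd W hfree), fun _ => ?_⟩⟩
  · obtain ⟨E, ⟨i⟩⟩ := EquivVB.exists_iso_pull_quotMap h𝒢 hfree F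
    exact ⟨E, ⟨EquivVB.orbitBundleOfIso i⟩⟩
  · exact KVect.map_square f X.quotMap X'.quotMap f.quot (fun _ _ => rfl) (fun _ => rfl) a
  · refine Subtype.ext (KVect.map_square (f.plus hf) X.quotPlus X'.quotPlus
      (f.quot.plus (GSpace.Hom.quot_proper hf)) (fun _ _ => rfl) ?_ a.1)
    rintro ⟨b, _ | x⟩
    · rfl
    · rfl
  · obtain ⟨Φ, hΦ, -⟩ := EquivVB.exists_KVect_addEquiv h𝒢 (GSpace.isFree_mixedProd W hfree)
    exact ⟨Φ, hΦ⟩
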